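/- **Setting.** Let $\mathcal N=\mathcal N(s,r,t)$ be an interaction (possibly complex valued) and let $\phi\in C([0,\infty);H^1(\mathbb R^3))$ be a global spherically symmetric solution, in the sense of distributions, of $$i\partial_t\phi+\Delta\phi=\mathcal N(|\phi|,|x|,t)\,\phi,\qquad \phi(0)=\phi_0\in H^1_{rad}(\mathbb R^3)\cap L^2_{rad}(\mathbb R^3,|x|^{1/2}dx),$$ with $\sup_{t\ge 0}\|\phi(t)\|_{H^1}<\infty$. A *smooth characteristic function of $[1,\infty)$* is a smooth nondecreasing $F:\mathbb R\to[0,1]$ with $F(\lambda)=0$ for $\lambda\le\frac12$ and $F(\lambda)=1$ for $\lambda\ge1$; $F(\lambda\ge 1)$ stands for $F(\lambda)$. Let $\langle x\rangle=\beta(|x|)$ be a smoothed norm, where $\beta(r)=C+\int_1^r\int_1^s a(u)\,du\,ds$ for a smooth $a\ge0$ that is positive exactly on $(1,2)$ and has integral one, with $C$ chosen such that $\beta(r)=r$ for $r\ge2$ ($\beta=C$ on $[0,1]$). Let $\alpha_0\in(\frac12,1)$ and assume that the interaction decays in the exterior region: for every smooth characteristic function $G$ of $[1,\infty)$ there are $\beta_0>1$,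 $C$ and $T\ge 1$ such that, for all $t\ge T$ and almost every $x$, $$\Big|G\Big(\tfrac{|x|}{t^{\alpha_0}}\ge1\Big)\,\mathcal N(|\phi(t,x)|,|x|,t)\Big|\le C\,t^{-\beta_0}.$$ **Theorem (free channel wave operator).** For every smooth characteristic function $F$ of $[1,\infty)$ the limit $$\Omega_F^*\phi_0=\lim_{t\to+\infty}e^{-i\Delta t}F\Big(\tfrac{\langle x\rangle}{t^{\alpha_0}}\ge1\Big)\phi(t)$$ exists in $L^2(\mathbb R^3)$ and belongs to $H^1(\mathbb R^3)$. If moreover the interaction is regular in the exterior region, that is, if for all large $t$ the function $(s,r)\mapsto\mathcal N(s,r,t)$ is $C^1$ on $\{s>0,\ r>t^{\alpha_0}/2\}$ and for every smooth characteristic function $G$ of $[1,\infty)$ there are $\beta_0>1$, $C$ and $T\ge1$ such that, for all $t\ge T$ and almost every $x$, $$G\Big(\tfrac{|x|}{t^{\alpha_0}}\ge1\Big)\Big(|\phi|\,|\partial_s\mathcal N(|\phi|,|x|,t)|+|\partial_r\mathcal N(|\phi|,|x|,t)|\Big)\le C\,t^{-\beta_0},$$ then the limit exists in $H^1(\mathbb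 R^3)$, i.e. the convergence holds in the $H^1$ norm. -/

import Mathlib

open MeasureTheory Filter Set
open scoped Topology ENNReal ContDiff FourierTransform

noncomputable section

/-- The space `ℝ³`. -/
abbrev E3 : Type := EuclideanSpace ℝ (Fin 3)

/-- The complex Hilbert space `L²(ℝ³)`. -/
abbrev L2 : Type := Lp ℂ 2 (volume : Measure E3)

/-- The `H¹(ℝ³)` norm `(‖f‖² + ‖∇f‖²)^{1/2}` of an `L²` function, computed on the Fourier side by
Plancherel; it takes the value `⊤` exactly when `f ∉ H¹`.  Mathlib's Fourier transform has the
kernel `exp (-2πi ⟨x, ξ⟩)`, so that `∇` corresponds to multiplication by `2πi ξ`. -/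
def h1Norm (f : L2) : ℝ≥0∞ :=
  eLpNorm (fun ξ : E3 => (Real.sqrt (1 + (2 * Real.pi * ‖ξ‖) ^ 2) : ℂ) * (𝓕 f : L2) ξ) 2 volume

/-- The Fourier symbol `exp (-i t |2πξ|²)` of `e^{itΔ}`. -/
def freeSymbol (t : ℝ) (ξ : E3) : ℂ :=
  Complex.exp (-(Complex.I * ((t * (2 * Real.pi * ‖ξ‖) ^ 2 : ℝ) : ℂ)))

theorem memLp_freeSymbol (t : ℝ) : MemLp (freeSymbol t) ∞ (volume : Measure E3) := by
  refine memLp_top_of_bound (C := 1) ?_ ?_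
  · have : Continuous (freeSymbol t) := by unfold freeSymbol; fun_prop
    exact this.aestronglyMeasurable
  · refine Eventually.of_forall fun ξ => ?_
    rw [freeSymbol, Complex.norm_exp, Complex.neg_re, Complex.I_mul_re, Complex.ofReal_im]
    simp

/-- The free Schrödinger group `e^{itΔ}` on `L²(ℝ³)`. -/
def freeEvol (t : ℝ) (f : L2) : L2 :=
  𝓕⁻ ((memLp_freeSymbol t).toLp (freeSymbol t) • (𝓕 f : L2) : L2)

/-- Smooth characteristic functions of `[1, ∞)`: smooth increasing functions vanishing on
`(-∞, 1/2]` and equal to `1` on `[1, ∞)`. -/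
structure SmoothCharFun where
  toFun : ℝ → ℝ
  smooth : ContDiff ℝ ∞ toFun
  monotone : Monotone toFun
  eq_zero : ∀ l ≤ 1 / 2, toFun l = 0
  eq_one : ∀ l, 1 ≤ l → toFun l = 1

instance : CoeFun SmoothCharFun (fun _ => ℝ → ℝ) := ⟨SmoothCharFun.toFun⟩

/-- The data of a smoothed norm `⟨x⟩`: a smooth nonnegative bump supported in `(1,2)` with
integral one. -/
structure SmoothedNorm where
  bump : ℝ → ℝ
  smooth : ContDiff ℝ ∞ bump
  nonneg : ∀ r, 0 ≤ bump r
  support_eq : Function.support bump = Ioo 1 2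
  integral_eq : ∫ r in (1 : ℝ)..2, bump r = 1

/-- The profile `β`: it is `∫₁ʳ∫₁ˢ bump + C` where `C` is the constant for which `β r = r` when
`r ≥ 2`; it is equal to `C` when `r ≤ 1`. -/
def SmoothedNorm.profile (ρ : SmoothedNorm) (r : ℝ) : ℝ :=
  (∫ s in (1 : ℝ)..r, ∫ u in (1 : ℝ)..s, ρ.bump u) +
    (2 - ∫ s in (1 : ℝ)..2, ∫ u in (1 : ℝ)..s, ρ.bump u)

/-- The smoothed norm `⟨x⟩ = β(|x|)`. -/
def SmoothedNorm.japanese (ρ : SmoothedNorm) (x : E3) : ℝ := ρ.profile ‖x‖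

/-- The multiplier `F(⟨x⟩ / t^α ≥ 1)`. -/
def cutoff (F : SmoothCharFun) (ρ : SmoothedNorm) (α t : ℝ) (x : E3) : ℂ :=
  (F (ρ.japanese x / t ^ α) : ℂ)

theorem memLp_cutoff (F : SmoothCharFun) (ρ : SmoothedNorm) (α t : ℝ) :
    MemLp (cutoff F ρ α t) ∞ (volume : Measure E3) := by
  have hb : Continuous ρ.bump := ρ.smooth.continuous
  have h1 : Continuous fun s : ℝ => ∫ u in (1 : ℝ)..s, ρ.bump u :=
    intervalIntegral.continuous_primitive (fun a b => hb.intervalIntegrable a b) 1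
  have h2 : Continuous ρ.profile :=
    (intervalIntegral.continuous_primitive (fun a b => h1.intervalIntegrable a b) 1).add
      continuous_const
  have hF : Continuous F.toFun := F.smooth.continuous
  refine memLp_top_of_bound (C := 1) ?_ ?_
  · have : Continuous (cutoff F ρ α t) :=
      Complex.continuous_ofReal.comp
        (hF.comp ((h2.comp continuous_norm).div_const _))
    exact this.aestronglyMeasurable
  · refine Eventually.of_forall fun x => ?_
    have h0 : ∀ l, 0 ≤ F l := fun l => by
      rcases le_total l (1 / 2) with h | h
      · exact (F.eq_zero l h).ge
      · exact (F.eq_zero (1 / 2) le_rfl).ge.trans (F.monotone h)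
    have h3 : ∀ l, F l ≤ 1 := fun l => by
      rcases le_total l 1 with h | h
      · exact (F.monotone h).trans (F.eq_one 1 le_rfl).le
      · exact (F.eq_one l h).le
    rw [cutoff, Complex.norm_real, Real.norm_of_nonneg (h0 _)]
    exact h3 _

/-- `e^{-itΔ} F(⟨x⟩ / t^α ≥ 1) φ(t)`. -/
def channelState (F : SmoothCharFun) (ρ : SmoothedNorm) (α : ℝ) (φ : ℝ → L2) (t : ℝ) : L2 :=
  freeEvol (-t) ((memLp_cutoff F ρ α t).toLp (cutoff F ρ α t) • φ t)

/-- Radial (rotation invariant) `L²` functions. -/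
def IsRadial (f : L2) : Prop :=
  ∀ R : E3 ≃ₗᵢ[ℝ] E3, (fun x => f (R x)) =ᵐ[volume] f

/-- Initial data in `H¹_rad(ℝ³) ∩ L²_rad(ℝ³, |x|^{1/2} dx)`. -/
structure IsAdmissibleDatum (f : L2) : Prop where
  memH1 : h1Norm f < ⊤
  radial : IsRadial f
  weighted : ∫⁻ x : E3, ‖f x‖ₑ ^ 2 * ENNReal.ofReal (‖x‖ ^ (1 / 2 : ℝ)) < ⊤

/-- The interaction term `𝒩(|φ|, |x|, t) φ`. -/
def interaction (N : ℝ → ℝ → ℝ → ℂ) (φ : ℝ → L2) (t : ℝ) (x : E3) : ℂ :=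
  N ‖φ t x‖ ‖x‖ t * φ t x

/-- `φ ∈ C([0, ∞); H¹)` is a global spherically symmetric solution of
`i ∂ₜφ + Δφ = 𝒩(|φ|, |x|, t) φ`, `φ(0) = φ₀`, where the equation is understood in the sense of
distributions, integrated in time against test functions of `x`. -/
structure IsGlobalRadialSolution (N : ℝ → ℝ → ℝ → ℂ) (φ₀ : L2) (φ : ℝ → L2) : Prop where
  initial : φ 0 = φ₀
  radial : ∀ t, 0 ≤ t → IsRadial (φ t)
  memH1 : ∀ t, 0 ≤ t → h1Norm (φ t) < ⊤
  continuous : ∀ t, 0 ≤ t → Tendsto (fun s => h1Norm (φ s - φ t)) (𝓝[Ici 0] t) (𝓝 0)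
  locallyIntegrable : ∀ᵐ s ∂((volume : Measure ℝ).restrict (Ici 0)),
    LocallyIntegrable (interaction N φ s) (volume : Measure E3)
  integrable : ∀ η : E3 → ℂ, ContDiff ℝ ∞ η → HasCompactSupport η → ∀ t, 0 ≤ t →
    IntervalIntegrable (fun s => ∫ x, interaction N φ s x * η x) volume 0 t
  equation : ∀ η : E3 → ℂ, ContDiff ℝ ∞ η → HasCompactSupport η → ∀ t, 0 ≤ t →
    (∫ x, φ t x * η x) - (∫ x, φ₀ x * η x) =
      Complex.I * (∫ s in (0 : ℝ)..t, ∫ x, φ s x * Laplacian.laplacian η x) -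
        Complex.I * (∫ s in (0 : ℝ)..t, ∫ x, interaction N φ s x * η x)

/-- The global bound `sup_{t ≥ 0} ‖φ(t)‖_{H¹} < ∞`. -/
def GlobalH1Bound (φ : ℝ → L2) : Prop :=
  ∃ M : ℝ, ∀ t, 0 ≤ t → h1Norm (φ t) ≤ ENNReal.ofReal M

/-- Decay of the interaction along `φ` in the region `|x| ≳ t^α`: for every smooth characteristic
function `G` of `[1, ∞)` there are `β₀ > 1` and `C` with
`|G(|x| / t^α ≥ 1) 𝒩(|φ|, |x|, t)| ≤ C t^{-β₀}` for all large `t`. -/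
def ExteriorDecay (N : ℝ → ℝ → ℝ → ℂ) (φ : ℝ → L2) (α : ℝ) : Prop :=
  ∀ G : SmoothCharFun, ∃ β₀ : ℝ, 1 < β₀ ∧ ∃ C T : ℝ, 1 ≤ T ∧ ∀ t, T ≤ t → ∀ᵐ x : E3,
    |G (‖x‖ / t ^ α)| * ‖N ‖φ t x‖ ‖x‖ t‖ ≤ C * t ^ (-β₀)

/-- Regularity of the interaction in the region `|x| ≳ t^α`: for large `t` the function
`(s, r) ↦ 𝒩(s, r, t)` is `C¹` for `s > 0`, `r > t^α / 2`, and along `φ` the quantities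
`|φ| ∂ₛ𝒩` and `∂ᵣ𝒩` decay in the same manner as `𝒩` does in `ExteriorDecay`. -/
def ExteriorRegularity (N : ℝ → ℝ → ℝ → ℂ) (φ : ℝ → L2) (α : ℝ) : Prop :=
  (∃ T : ℝ, 1 ≤ T ∧ ∀ t, T ≤ t →
    ContDiffOn ℝ 1 (fun p : ℝ × ℝ => N p.1 p.2 t) (Ioi 0 ×ˢ Ioi (t ^ α / 2))) ∧
  ∀ G : SmoothCharFun, ∃ β₀ : ℝ, 1 < β₀ ∧ ∃ C T : ℝ, 1 ≤ T ∧ ∀ t, T ≤ t → ∀ᵐ x : E3,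
    |G (‖x‖ / t ^ α)| * (‖φ t x‖ * ‖deriv (fun s => N s ‖x‖ t) ‖φ t x‖‖ +
      ‖deriv (fun r => N ‖φ t x‖ r t) ‖x‖‖) ≤ C * t ^ (-β₀)

end

/-! The proof fixes a unit vector `e` and studies cutoffs `Q(⟪e, x⟫ / t^α)`. The natural variables
are `y = ⟪e, x⟫ / t^α` and the rescaled momentum `κ = t^{1-α} p`, where `p = -i∂_e`. Along the free
flow `t dy/dt = 2κ - αy` and `t dκ/dt = (1 - α)κ`. The commutator of `y` and `κ` has size
`t^{1-2α}`. After division by `t` every quantum correction is therefore `O(t^{-2α})`, which is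
integrable because `α > 1/2`. The interaction enters only as a source `O(t^{-β})` with `β > 1` in
the exterior region, so it is integrable too.

The heart is `propagation_estimate`: for `χ` supported in a compact set of `y > 1/2`, the integral
of `t⁻¹ ⟪χv, (|κ| + 1/8) χv⟫` over time is finite. The bounded observable is `g(y) κw - B(y) w` with
`w = 1 / (|κ| + 1/8)` and `B' = (α/2) y g'`. Its derivative is `t⁻¹` times `2 g' w (κ - αy/2)²`,
plus the terms `(1 - α)(g κw²/8 + B |κ| w²)` produced by the dilation of `κ`. The square can vanish
only on `κ = αy/2`. There `κ ≠ 0`, since `y` stays away from `0`, and the second group is positive,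
since `B` exceeds `g/8`. `exists_commutator_lower_bound` turns this pointwise positivity into an
operator inequality by completing squares and using a Gårding inequality for Lipschitz symbols. The
latter rests on `StepLike.commBound`, which expands a cutoff in plane waves. A factor `(1 - ε²Δ)⁻¹`
on both sides makes all operators bounded, and every estimate is uniform in `ε`.

Free waves satisfy the same propagation estimate. Pairing a free wave with the localized solution
`f(y) v` and applying Cauchy–Schwarz gives Cook's method in weak form: `e^{-itΔ} f(y) v(t)` is
Cauchy, uniformly over unit test vectors (`ExtSol.exists_limit`). For compactly supported `χ` the
limit must be zero, because a nonzero limit would make `∫ dt/t` finite (`ExtSol.tendsto_shell`).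
Hence all shells `|x| ~ t^α` are asymptotically empty. Combining finitely many half-space cutoffs
gives a cutoff which differs from `F(|x| / t^α)` only by shells and by an arbitrarily small multiple
of the identity. This proves convergence for the radial cutoff
(`ExteriorSolution.exists_limit_radCut`).

The limit lies in `H¹` because the channel states are bounded in `H¹` and the norm is lower
semicontinuous. For `H¹` convergence the same machine is run on the weak derivatives of the
solution. They solve the exterior equation with source `∂_e(𝒩 φ)`, and regularity of the interaction
makes this source `O(t^{-β})` in `L²` by a weak chain rule (`exists_norm_integral_nonlinearity_le`,
`exteriorSolution_grad`). Derivatives falling on the cutoff are `O(t^{-α})` and disappear. -/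

noncomputable section

open scoped InnerProductSpace ComplexConjugate SchwartzMap
open scoped LineDeriv Laplacian

/-! ### Bounded multipliers on `L²` -/

/-- Bounded measurable functions, the admissible multipliers on `L²`. -/
def IsBdd (q : E3 → ℂ) : Prop := Measurable q ∧ ∃ C : ℝ, ∀ x, ‖q x‖ ≤ C

namespace IsBdd

variable {p q : E3 → ℂ}

theorem memLp (hq : IsBdd q) : MemLp q ∞ (volume : Measure E3) := by
  obtain ⟨h1, C, hC⟩ := hq
  exact memLp_top_of_bound h1.aestronglyMeasurable C (Eventually.of_forall hC)

theorem of_continuous (hq : Continuous q) {C : ℝ} (h : ∀ x, ‖q x‖ ≤ C) : IsBdd q :=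
  ⟨hq.measurable, C, h⟩

theorem add (hp : IsBdd p) (hq : IsBdd q) : IsBdd (fun x => p x + q x) := by
  obtain ⟨h1, C, hC⟩ := hp
  obtain ⟨h2, D, hD⟩ := hq
  exact ⟨h1.add h2, C + D, fun x => (norm_add_le _ _).trans (add_le_add (hC x) (hD x))⟩

theorem sub (hp : IsBdd p) (hq : IsBdd q) : IsBdd (fun x => p x - q x) := by
  obtain ⟨h1, C, hC⟩ := hp
  obtain ⟨h2, D, hD⟩ := hq
  exact ⟨h1.sub h2, C + D, fun x => (norm_sub_le _ _).trans (add_le_add (hC x) (hD x))⟩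

theorem mul (hp : IsBdd p) (hq : IsBdd q) : IsBdd (fun x => p x * q x) := by
  obtain ⟨h1, C, hC⟩ := hp
  obtain ⟨h2, D, hD⟩ := hq
  refine ⟨h1.mul h2, C * D, fun x => ?_⟩
  rw [norm_mul]
  exact mul_le_mul (hC x) (hD x) (norm_nonneg _) ((norm_nonneg _).trans (hC x))

theorem const (c : ℂ) : IsBdd (fun _ => c) := ⟨measurable_const, ‖c‖, fun _ => le_rfl⟩

theorem star (hq : IsBdd q) : IsBdd (fun x => conj (q x)) := by
  obtain ⟨h1, C, hC⟩ := hq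
  exact ⟨Complex.continuous_conj.measurable.comp h1, C, fun x => by simpa using hC x⟩

end IsBdd

/-- Multiplication by `q` on `L²`. -/
def mulOp (q : E3 → ℂ) : L2 →L[ℂ] L2 :=
  open Classical in
  if h : MemLp q ∞ (volume : Measure E3) then
    LinearMap.mkContinuous
      { toFun := fun f => ((h.toLp q • f : L2) : L2)
        map_add' := fun f g => Lp.add_smul _ _ _
        map_smul' := fun c f => by
          ext1
          filter_upwards [Lp.coeFn_lpSMul (r := 2) (h.toLp q) (c • f),
            Lp.coeFn_smul c f, Lp.coeFn_smul c (h.toLp q • f : L2),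
            Lp.coeFn_lpSMul (r := 2) (h.toLp q) f] with x h1 h2 h3 h4
          rw [h1, RingHom.id_apply, h3, Pi.smul_apply', Pi.smul_apply, h2, Pi.smul_apply, h4,
            Pi.smul_apply', smul_comm] }
      ‖h.toLp q‖ (fun f => Lp.norm_smul_le _ _)
  else 0

theorem mulOp_apply {q : E3 → ℂ} (h : MemLp q ∞ (volume : Measure E3)) (f : L2) :
    mulOp q f = (h.toLp q • f : L2) := by
  rw [mulOp, dif_pos h]; rfl

theorem mulOp_coe {q : E3 → ℂ} (h : IsBdd q) (f : L2) :
    (mulOp q f : E3 → ℂ) =ᵐ[volume] fun x => q x * f x := by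
  rw [mulOp_apply h.memLp]
  filter_upwards [Lp.coeFn_lpSMul (r := 2) (h.memLp.toLp q) f, h.memLp.coeFn_toLp] with x h1 h2
  rw [h1, Pi.smul_apply', h2, smul_eq_mul]

theorem norm_mulOp_le {q : E3 → ℂ} (h : IsBdd q) {C : ℝ} (hC : ∀ x, ‖q x‖ ≤ C) (f : L2) :
    ‖mulOp q f‖ ≤ C * ‖f‖ := by
  apply Lp.norm_le_mul_norm_of_ae_le_mul
  filter_upwards [mulOp_coe h f] with x hx
  rw [hx, norm_mul]
  exact mul_le_mul_of_nonneg_right (hC x) (norm_nonneg _)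

theorem mulOp_mul {p q : E3 → ℂ} (hp : IsBdd p) (hq : IsBdd q) (f : L2) :
    mulOp (fun x => p x * q x) f = mulOp p (mulOp q f) := by
  ext1
  filter_upwards [mulOp_coe (hp.mul hq) f, mulOp_coe hp (mulOp q f), mulOp_coe hq f] with x a b c
  rw [a, b, c, mul_assoc]

theorem mulOp_comm {p q : E3 → ℂ} (hp : IsBdd p) (hq : IsBdd q) (f : L2) :
    mulOp p (mulOp q f) = mulOp q (mulOp p f) := by
  rw [← mulOp_mul hp hq, ← mulOp_mul hq hp]; simp_rw [mul_comm]

theorem mulOp_add {p q : E3 → ℂ} (hp : IsBdd p) (hq : IsBdd q) (f : L2) :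
    mulOp (fun x => p x + q x) f = mulOp p f + mulOp q f := by
  ext1
  filter_upwards [mulOp_coe (hp.add hq) f, mulOp_coe hp f, mulOp_coe hq f,
    Lp.coeFn_add (mulOp p f) (mulOp q f)] with x a b c d
  rw [a, d, Pi.add_apply, b, c, add_mul]

theorem mulOp_sub {p q : E3 → ℂ} (hp : IsBdd p) (hq : IsBdd q) (f : L2) :
    mulOp (fun x => p x - q x) f = mulOp p f - mulOp q f := by
  ext1
  filter_upwards [mulOp_coe (hp.sub hq) f, mulOp_coe hp f, mulOp_coe hq f,
    Lp.coeFn_sub (mulOp p f) (mulOp q f)] with x a b c d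
  rw [a, d, Pi.sub_apply, b, c, sub_mul]

theorem mulOp_const (c : ℂ) (f : L2) : mulOp (fun _ => c) f = c • f := by
  ext1
  filter_upwards [mulOp_coe (IsBdd.const c) f, Lp.coeFn_smul c f] with x a b
  rw [a, b, Pi.smul_apply, smul_eq_mul]

theorem mulOp_const_mul {q : E3 → ℂ} (c : ℂ) (hq : IsBdd q) (f : L2) :
    mulOp (fun x => c * q x) f = c • mulOp q f := by
  rw [mulOp_mul (IsBdd.const c) hq, mulOp_const]

theorem L2_inner_def (f g : L2) : ⟪f, g⟫_ℂ = ∫ x, conj (f x) * g x := by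
  rw [L2.inner_def]
  exact integral_congr_ae (Eventually.of_forall fun x => by simp [mul_comm])

theorem integrable_conj_mul (f g : L2) : Integrable (fun x => conj (f x) * g x) volume := by
  refine (L2.integrable_inner (𝕜 := ℂ) f g).congr (Eventually.of_forall fun x => by simp [mul_comm])

theorem integrable_norm_mul (f g : L2) : Integrable (fun x => ‖f x‖ * ‖g x‖) volume := by
  refine (integrable_conj_mul f g).norm.congr (Eventually.of_forall fun x => by simp)

theorem integral_norm_mul_le (f g : L2) : ∫ x, ‖f x‖ * ‖g x‖ ≤ ‖f‖ * ‖g‖ := by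
  have hF : MemLp (fun x => ((‖f x‖ : ℝ) : ℂ)) 2 (volume : Measure E3) := by
    refine (Lp.memLp f).norm.ofReal
  have hG : MemLp (fun x => ((‖g x‖ : ℝ) : ℂ)) 2 (volume : Measure E3) := by
    refine (Lp.memLp g).norm.ofReal
  have h1 : ‖hF.toLp _‖ = ‖f‖ := by
    rw [Lp.norm_toLp, Lp.norm_def]
    congr 1
    exact eLpNorm_congr_norm_ae (Eventually.of_forall fun x => by simp)
  have h2 : ‖hG.toLp _‖ = ‖g‖ := by
    rw [Lp.norm_toLp, Lp.norm_def]
    congr 1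
    exact eLpNorm_congr_norm_ae (Eventually.of_forall fun x => by simp)
  have h3 := norm_inner_le_norm (𝕜 := ℂ) (hF.toLp _) (hG.toLp _)
  rw [L2_inner_def, h1, h2] at h3
  have h4 : ∫ x, conj ((hF.toLp _ : L2) x) * (hG.toLp _ : L2) x
      = ((∫ x, ‖f x‖ * ‖g x‖ : ℝ) : ℂ) := by
    rw [← integral_complex_ofReal]
    refine integral_congr_ae ?_
    filter_upwards [hF.coeFn_toLp, hG.coeFn_toLp] with x a b
    rw [a, b]; simp
  rw [h4, Complex.norm_real] at h3
  exact (le_abs_self _).trans h3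

theorem inner_mulOp_right {q : E3 → ℂ} (hq : IsBdd q) (f g : L2) :
    ⟪f, mulOp q g⟫_ℂ = ∫ x, q x * (conj (f x) * g x) := by
  rw [L2_inner_def]
  refine integral_congr_ae ?_
  filter_upwards [mulOp_coe hq g] with x a
  rw [a]; ring

theorem inner_mulOp_left {q : E3 → ℂ} (hq : IsBdd q) (f g : L2) :
    ⟪mulOp q f, g⟫_ℂ = ⟪f, mulOp (fun x => conj (q x)) g⟫_ℂ := by
  rw [inner_mulOp_right hq.star, L2_inner_def]
  refine integral_congr_ae ?_
  filter_upwards [mulOp_coe hq f] with x a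
  rw [a, map_mul]; ring

theorem inner_mulOp_comm {r : E3 → ℝ} (hq : IsBdd (fun x => (r x : ℂ))) (f g : L2) :
    ⟪mulOp (fun x => (r x : ℂ)) f, g⟫_ℂ = ⟪f, mulOp (fun x => (r x : ℂ)) g⟫_ℂ := by
  rw [inner_mulOp_left hq]; simp_rw [Complex.conj_ofReal]

theorem norm_sq_eq_integral (f : L2) : ‖f‖ ^ 2 = ∫ x, ‖f x‖ ^ 2 := by
  have h := inner_self_eq_norm_sq_to_K (𝕜 := ℂ) f
  rw [L2_inner_def] at h
  have h4 : ∫ x, conj (f x) * f x = ((∫ x, ‖f x‖ ^ 2 : ℝ) : ℂ) := by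
    rw [← integral_complex_ofReal]
    refine integral_congr_ae (Eventually.of_forall fun x => ?_)
    simp only [Complex.conj_mul', Complex.ofReal_pow]
  rw [h4] at h
  have h5 : ((‖f‖ ^ 2 : ℝ) : ℂ) = ((∫ x, ‖f x‖ ^ 2 : ℝ) : ℂ) := by
    rw [h]; push_cast; rfl
  exact Complex.ofReal_injective h5

theorem integrable_norm_sq (f : L2) : Integrable (fun x => ‖f x‖ ^ 2) volume := by
  refine (integrable_norm_mul f f).congr (Eventually.of_forall fun x => by simp [sq])

/-- Strong continuity of multiplication operators under bounded pointwise convergence. -/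
theorem tendsto_mulOp {ι : Type*} {l : Filter ι} [l.IsCountablyGenerated] {q : ι → E3 → ℂ}
    {p : E3 → ℂ} {C : ℝ} (hq : ∀ᶠ i in l, Measurable (q i)) (hp : Measurable p)
    (hb : ∀ᶠ i in l, ∀ x, ‖q i x‖ ≤ C) (hpb : ∀ x, ‖p x‖ ≤ C)
    (hlim : ∀ x, Tendsto (fun i => q i x) l (𝓝 (p x))) (f : L2) :
    Tendsto (fun i => mulOp (q i) f) l (𝓝 (mulOp p f)) := by
  have hpB : IsBdd p := ⟨hp, C, hpb⟩
  rw [tendsto_iff_norm_sub_tendsto_zero]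
  have key : Tendsto (fun i => ∫ x, ‖(q i x - p x) * f x‖ ^ 2) l (𝓝 (∫ _ : E3, (0 : ℝ))) := by
    refine tendsto_integral_filter_of_dominated_convergence (fun x => (2 * C) ^ 2 * ‖f x‖ ^ 2)
      ?_ ?_ ((integrable_norm_sq f).const_mul _) ?_
    · filter_upwards [hq] with i hi
      exact ((((hi.sub hp).aestronglyMeasurable).mul (Lp.aestronglyMeasurable f)).norm.pow 2)
    · filter_upwards [hb] with i hi
      refine Eventually.of_forall fun x => ?_
      rw [Real.norm_of_nonneg (by positivity), norm_mul, mul_pow]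
      gcongr
      linarith [norm_sub_le (q i x) (p x), hi x, hpb x]
    · refine Eventually.of_forall fun x => ?_
      have h1 : Tendsto (fun i => ‖(q i x - p x) * f x‖ ^ 2) l (𝓝 (‖(p x - p x) * f x‖ ^ 2)) :=
        ((((hlim x).sub tendsto_const_nhds).mul tendsto_const_nhds).norm).pow 2
      simpa using h1
  rw [integral_zero] at key
  have h2 : Tendsto (fun i => Real.sqrt (∫ x, ‖(q i x - p x) * f x‖ ^ 2)) l (𝓝 0) := by
    have h3 := (Real.continuous_sqrt.tendsto 0).comp key
    rw [Real.sqrt_zero] at h3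
    exact h3
  refine h2.congr' ?_
  filter_upwards [hq, hb] with i hi hbi
  have hqB : IsBdd (q i) := ⟨hi, C, hbi⟩
  rw [← mulOp_sub hqB hpB, ← Real.sqrt_sq (norm_nonneg (mulOp (fun x => q i x - p x) f)),
    norm_sq_eq_integral]
  congr 1
  refine integral_congr_ae ?_
  filter_upwards [mulOp_coe (hqB.sub hpB) f] with x hx
  rw [hx]

/-! ### Fourier multipliers on `L²` -/

/-- The Fourier multiplier with symbol `m` on `L²`. -/
def fourierMul (m : E3 → ℂ) : L2 →L[ℂ] L2 :=
  ((Lp.fourierTransformₗᵢ E3 ℂ).symm.toContinuousLinearEquiv : L2 →L[ℂ] L2) ∘L mulOp m ∘L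
    ((Lp.fourierTransformₗᵢ E3 ℂ).toContinuousLinearEquiv : L2 →L[ℂ] L2)

theorem fourierMul_apply (m : E3 → ℂ) (f : L2) :
    fourierMul m f = (𝓕⁻ (mulOp m (𝓕 f : L2)) : L2) := rfl

theorem fourier_fourierMul (m : E3 → ℂ) (f : L2) :
    (𝓕 (fourierMul m f) : L2) = mulOp m (𝓕 f : L2) := by
  rw [fourierMul_apply, FourierTransform.fourier_fourierInv_eq]

theorem fourier_injective {f g : L2} (h : (𝓕 f : L2) = 𝓕 g) : f = g :=
  (Lp.fourierTransformₗᵢ E3 ℂ).injective h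

theorem norm_fourierMul_le {q : E3 → ℂ} (h : IsBdd q) {C : ℝ} (hC : ∀ x, ‖q x‖ ≤ C) (f : L2) :
    ‖fourierMul q f‖ ≤ C * ‖f‖ := by
  rw [← Lp.norm_fourier_eq, fourier_fourierMul]
  exact (norm_mulOp_le h hC _).trans_eq (by rw [Lp.norm_fourier_eq])

theorem fourierMul_mul {p q : E3 → ℂ} (hp : IsBdd p) (hq : IsBdd q) (f : L2) :
    fourierMul (fun x => p x * q x) f = fourierMul p (fourierMul q f) := by
  apply fourier_injective; simp only [fourier_fourierMul]; exact mulOp_mul hp hq _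

theorem fourierMul_comm {p q : E3 → ℂ} (hp : IsBdd p) (hq : IsBdd q) (f : L2) :
    fourierMul p (fourierMul q f) = fourierMul q (fourierMul p f) := by
  apply fourier_injective; simp only [fourier_fourierMul]; exact mulOp_comm hp hq _

theorem fourierMul_add {p q : E3 → ℂ} (hp : IsBdd p) (hq : IsBdd q) (f : L2) :
    fourierMul (fun x => p x + q x) f = fourierMul p f + fourierMul q f := by
  simp only [fourierMul_apply, mulOp_add hp hq]
  exact (Lp.fourierTransformₗᵢ E3 ℂ).symm.map_add _ _

theorem fourierMul_sub {p q : E3 → ℂ} (hp : IsBdd p) (hq : IsBdd q) (f : L2) :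
    fourierMul (fun x => p x - q x) f = fourierMul p f - fourierMul q f := by
  simp only [fourierMul_apply, mulOp_sub hp hq]
  exact (Lp.fourierTransformₗᵢ E3 ℂ).symm.map_sub _ _

theorem fourierMul_const (c : ℂ) (f : L2) : fourierMul (fun _ => c) f = c • f := by
  apply fourier_injective
  rw [fourier_fourierMul, mulOp_const]
  exact ((Lp.fourierTransformₗᵢ E3 ℂ).map_smul c f).symm

theorem fourierMul_const_mul {q : E3 → ℂ} (c : ℂ) (hq : IsBdd q) (f : L2) :
    fourierMul (fun x => c * q x) f = c • fourierMul q f := by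
  rw [fourierMul_mul (IsBdd.const c) hq, fourierMul_const]

theorem inner_fourierMul_left {q : E3 → ℂ} (hq : IsBdd q) (f g : L2) :
    ⟪fourierMul q f, g⟫_ℂ = ⟪f, fourierMul (fun x => conj (q x)) g⟫_ℂ := by
  rw [← Lp.inner_fourier_eq, ← Lp.inner_fourier_eq f, fourier_fourierMul, fourier_fourierMul,
    inner_mulOp_left hq]

theorem inner_fourierMul_comm {r : E3 → ℝ} (hq : IsBdd (fun x => (r x : ℂ))) (f g : L2) :
    ⟪fourierMul (fun x => (r x : ℂ)) f, g⟫_ℂ = ⟪f, fourierMul (fun x => (r x : ℂ)) g⟫_ℂ := by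
  rw [inner_fourierMul_left hq]; simp_rw [Complex.conj_ofReal]

theorem tendsto_fourierMul {ι : Type*} {l : Filter ι} [l.IsCountablyGenerated] {q : ι → E3 → ℂ}
    {p : E3 → ℂ} {C : ℝ} (hq : ∀ᶠ i in l, Measurable (q i)) (hp : Measurable p)
    (hb : ∀ᶠ i in l, ∀ x, ‖q i x‖ ≤ C) (hpb : ∀ x, ‖p x‖ ≤ C)
    (hlim : ∀ x, Tendsto (fun i => q i x) l (𝓝 (p x))) (f : L2) :
    Tendsto (fun i => fourierMul (q i) f) l (𝓝 (fourierMul p f)) :=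
  ((Lp.fourierTransformₗᵢ E3 ℂ).symm.continuous.tendsto _).comp
    (tendsto_mulOp hq hp hb hpb hlim (𝓕 f : L2))

/-! ### Modulations and translations -/

/-- The plane wave `exp (2πi ⟪a, x⟫)`. -/
def planeWave (a x : E3) : ℂ := Complex.exp (2 * Real.pi * Complex.I * ((inner ℝ a x : ℝ) : ℂ))

theorem norm_planeWave (a x : E3) : ‖planeWave a x‖ = 1 := by
  rw [planeWave, Complex.norm_exp]
  simp

theorem isBdd_planeWave (a : E3) : IsBdd (planeWave a) := by
  refine IsBdd.of_continuous (C := 1) ?_ fun x => (norm_planeWave a x).le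
  unfold planeWave; fun_prop

/-- Translation by `a` on `L²`. -/
def shiftOp (a : E3) : L2 →ₗᵢ[ℂ] L2 :=
  Lp.compMeasurePreservingₗᵢ ℂ (fun x : E3 => x - a) (measurePreserving_sub_right volume a)

theorem shiftOp_coe (a : E3) (f : L2) : (shiftOp a f : E3 → ℂ) =ᵐ[volume] fun x => f (x - a) :=
  Lp.coeFn_compMeasurePreserving f (measurePreserving_sub_right volume a)

theorem fourierInv_shiftOp (a : E3) (g : L2) :
    (𝓕⁻ (shiftOp a g) : L2) = mulOp (planeWave a) (𝓕⁻ g : L2) := by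
  have hd : DenseRange (SchwartzMap.toLpCLM ℂ (E := E3) ℂ 2 volume) :=
    SchwartzMap.denseRange_toLpCLM ENNReal.ofNat_ne_top
  refine DenseRange.induction_on (p := fun g : L2 =>
    (𝓕⁻ (shiftOp a g) : L2) = mulOp (planeWave a) (𝓕⁻ g : L2)) hd g ?_ ?_
  · refine isClosed_eq ?_ ?_
    · exact (Lp.fourierTransformₗᵢ E3 ℂ).symm.continuous.comp (shiftOp a).continuous
    · exact (mulOp (planeWave a)).continuous.comp (Lp.fourierTransformₗᵢ E3 ℂ).symm.continuous
  · intro f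
    rw [SchwartzMap.toLpCLM_apply]
    have h1 : shiftOp a (f.toLp 2) = (SchwartzMap.compSubConstCLM ℂ a f).toLp 2 := by
      ext1
      have h2 := (measurePreserving_sub_right (volume : Measure E3) a).quasiMeasurePreserving.ae
        (f.coeFn_toLp 2 volume)
      filter_upwards [shiftOp_coe a (f.toLp 2),
        (SchwartzMap.compSubConstCLM ℂ a f).coeFn_toLp 2 volume, h2] with x a1 a2 a3
      rw [a1, a2, a3, SchwartzMap.compSubConstCLM_apply]
    rw [h1, SchwartzMap.toLp_fourierInv_eq, SchwartzMap.toLp_fourierInv_eq]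
    ext1
    filter_upwards [mulOp_coe (isBdd_planeWave a) ((𝓕⁻ f).toLp 2), (𝓕⁻ f).coeFn_toLp 2 volume,
      (𝓕⁻ (SchwartzMap.compSubConstCLM ℂ a f)).coeFn_toLp 2 volume] with x a1 a2 a3
    rw [a1, a2, a3, SchwartzMap.fourierInv_coe, SchwartzMap.fourierInv_coe,
      Real.fourierInv_eq', Real.fourierInv_eq', ← integral_const_mul,
      ← integral_add_right_eq_self _ a]
    congr 1
    ext v
    rw [SchwartzMap.compSubConstCLM_apply, add_sub_cancel_right, smul_eq_mul, smul_eq_mul,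
      ← mul_assoc, planeWave, ← Complex.exp_add]
    congr 2
    rw [inner_add_left]
    push_cast
    ring

theorem fourier_mulOp_planeWave (a : E3) (f : L2) :
    (𝓕 (mulOp (planeWave a) f) : L2) = shiftOp a (𝓕 f : L2) := by
  have := fourierInv_shiftOp a (𝓕 f : L2)
  rw [FourierTransform.fourierInv_fourier_eq] at this
  rw [← this, FourierTransform.fourier_fourierInv_eq]

/-! ### One-dimensional cutoffs and their commutators with Fourier multipliers -/

/-- Smooth functions on the line which are constant near `-∞` and near `+∞`. -/
structure StepLike (Q : ℝ → ℝ) : Prop where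
  smooth : ContDiff ℝ ∞ Q
  compact : HasCompactSupport (deriv Q)

theorem StepLike.eventually_const {Q : ℝ → ℝ} (hQ : StepLike Q) :
    ∃ A : ℝ, 0 < A ∧ (∀ y ≤ -A, Q y = Q (-A)) ∧ ∀ y, A ≤ y → Q y = Q A := by
  obtain ⟨A, hA⟩ := hQ.compact.isCompact.isBounded.subset_closedBall 0
  have h0 : ∀ y, |A| + 1 ≤ |y| → deriv Q y = 0 := fun y hy => by
    apply image_eq_zero_of_notMem_tsupport
    intro h
    have := hA h
    rw [Metric.mem_closedBall, dist_zero_right, Real.norm_eq_abs] at this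
    linarith [le_abs_self A]
  have hd : Differentiable ℝ Q := hQ.smooth.differentiable (by simp)
  refine ⟨|A| + 1, by positivity, fun y hy => ?_, fun y hy => ?_⟩
  · have := (convex_Iic (-(|A| + 1))).norm_image_sub_le_of_norm_deriv_le (f := Q) (C := 0)
      (fun x _ => hd x) (fun x hx => by
        rw [h0 x (by rw [mem_Iic] at hx; linarith [neg_abs_le x])]
        simp) (mem_Iic.2 le_rfl) (mem_Iic.2 hy)
    rw [zero_mul, norm_le_zero_iff, sub_eq_zero] at this
    exact this
  · have := (convex_Ici (|A| + 1)).norm_image_sub_le_of_norm_deriv_le (f := Q) (C := 0)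
      (fun x _ => hd x) (fun x hx => by
        rw [h0 x (by rw [mem_Ici] at hx; exact hx.trans (le_abs_self x))]
        simp) (mem_Ici.2 le_rfl) (mem_Ici.2 hy)
    rw [zero_mul, norm_le_zero_iff, sub_eq_zero] at this
    exact this

theorem StepLike.bounded {Q : ℝ → ℝ} (hQ : StepLike Q) : ∃ C : ℝ, 0 ≤ C ∧ ∀ y, |Q y| ≤ C := by
  obtain ⟨A, hA, h1, h2⟩ := hQ.eventually_const
  obtain ⟨C, hC⟩ := (isCompact_Icc (a := -A) (b := A)).exists_bound_of_continuousOn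
    hQ.smooth.continuous.continuousOn
  have hC0 : 0 ≤ C := (norm_nonneg _).trans (hC A ⟨by linarith, le_rfl⟩)
  refine ⟨C, hC0, fun y => ?_⟩
  rcases le_total y (-A) with h | h
  · rw [h1 y h]; exact hC _ ⟨le_rfl, by linarith⟩
  rcases le_total A y with h' | h'
  · rw [h2 y h']; exact hC _ ⟨by linarith, le_rfl⟩
  · exact hC _ ⟨h, h'⟩

/-- The function `Q(⟪e, x⟫ / R)`. -/
def cut (e : E3) (R : ℝ) (Q : ℝ → ℝ) (x : E3) : ℂ := (Q (inner ℝ e x / R) : ℂ)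

theorem StepLike.isBdd {Q : ℝ → ℝ} (hQ : StepLike Q) (e : E3) (R : ℝ) : IsBdd (cut e R Q) := by
  obtain ⟨C, -, hC⟩ := hQ.bounded
  refine IsBdd.of_continuous (C := C) ?_ fun x => ?_
  · have := hQ.smooth.continuous
    unfold cut; fun_prop
  · rw [cut, Complex.norm_real]; exact hC _

theorem StepLike.norm_cut_le {Q : ℝ → ℝ} (hQ : StepLike Q) : ∃ C : ℝ, 0 ≤ C ∧
    ∀ e R f, ‖mulOp (cut e R Q) f‖ ≤ C * ‖f‖ := by
  obtain ⟨C, h0, hC⟩ := hQ.bounded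
  exact ⟨C, h0, fun e R f => norm_mulOp_le (hQ.isBdd e R)
    (fun x => by rw [cut, Complex.norm_real]; exact hC _) f⟩

/-- Fourier inversion on the line writes the cutoff as a superposition of plane waves in direction
`e`, and Fubini takes it out of the pairing. Plane waves act as frequency translations, so
commutators with Fourier multipliers become differences of symbols. -/
theorem inner_cut_eq_integral (q : 𝓢(ℝ, ℂ)) {Q : ℝ → ℝ} (hq : ∀ y, q y = Q y) (hQ : StepLike Q)
    (e : E3) (R : ℝ) (F G : L2) :
    ⟪F, mulOp (cut e R Q) G⟫_ℂ =
      ∫ s, (𝓕 q : 𝓢(ℝ, ℂ)) s * ⟪F, mulOp (planeWave ((s / R) • e)) G⟫_ℂ := by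
  have h1 : ∀ x, cut e R Q x = ∫ s, (𝓕 q : 𝓢(ℝ, ℂ)) s * planeWave ((s / R) • e) x := by
    intro x
    have h2 : q = 𝓕⁻ (𝓕 q) := (FourierTransform.fourierInv_fourier_eq q).symm
    rw [cut, ← hq]
    conv_lhs => rw [h2]
    rw [SchwartzMap.fourierInv_coe, Real.fourierInv_eq']
    refine integral_congr_ae (Eventually.of_forall fun s => ?_)
    simp only [planeWave, smul_eq_mul, inner_smul_left, RCLike.inner_apply, conj_trivial]
    rw [mul_comm]
    congr 2
    push_cast
    ring
  rw [inner_mulOp_right (hQ.isBdd e R)]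
  simp_rw [inner_mulOp_right (isBdd_planeWave _), h1]
  simp_rw [← integral_mul_const, ← integral_const_mul]
  rw [integral_integral_swap]
  · simp_rw [mul_assoc]
  · have h3 : Integrable (fun z : E3 × ℝ => (conj (F z.1) * G z.1) * (𝓕 q : 𝓢(ℝ, ℂ)) z.2)
        (volume.prod volume) :=
      (integrable_conj_mul F G).mul_prod (𝓕 q : 𝓢(ℝ, ℂ)).integrable
    have h4 : Continuous fun z : E3 × ℝ => planeWave ((z.2 / R) • e) z.1 := by
      unfold planeWave; fun_prop
    have h5 := h3.bdd_mul (c := 1) h4.aestronglyMeasurable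
      (Eventually.of_forall fun z => (norm_planeWave _ _).le)
    refine h5.congr (Eventually.of_forall fun z => ?_)
    simp only [Function.uncurry]
    ring

/-- On the Fourier side the whole sum is one integral of the transforms of `f` and of the shifted
`g` against a single kernel. Keeping the sum together lets cancellations between the terms be seen
in the supremum of that kernel; the individual terms need not be small. -/
theorem norm_sum_inner_planeWave_le {ι : Type*} [Fintype ι] {m n : ι → E3 → ℂ}
    (hm : ∀ i, IsBdd (m i)) (hn : ∀ i, IsBdd (n i)) (a : E3) {B : ℝ}
    (hB : ∀ ξ, ‖∑ i, conj (m i ξ) * n i (ξ - a)‖ ≤ B) (f g : L2) :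
    ‖∑ i, ⟪fourierMul (m i) f, mulOp (planeWave a) (fourierMul (n i) g)⟫_ℂ‖ ≤
      B * (‖f‖ * ‖g‖) := by
  have h1 : ∀ i, ⟪fourierMul (m i) f, mulOp (planeWave a) (fourierMul (n i) g)⟫_ℂ =
      ∫ ξ, (conj (m i ξ) * n i (ξ - a)) *
        (conj ((𝓕 f : L2) ξ) * (shiftOp a (𝓕 g : L2) : L2) ξ) := by
    intro i
    rw [← Lp.inner_fourier_eq, fourier_mulOp_planeWave, fourier_fourierMul, fourier_fourierMul,
      L2_inner_def]
    refine integral_congr_ae ?_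
    have h2 := (measurePreserving_sub_right (volume : Measure E3) a).quasiMeasurePreserving.ae
      (mulOp_coe (hn i) (𝓕 g : L2))
    filter_upwards [mulOp_coe (hm i) (𝓕 f : L2), shiftOp_coe a (mulOp (n i) (𝓕 g : L2)), h2,
      shiftOp_coe a (𝓕 g : L2)] with ξ a1 a2 a3 a4
    rw [a1, a2, a3, a4, map_mul]
    ring
  have h3 : ∀ i, Integrable (fun ξ => (conj (m i ξ) * n i (ξ - a)) *
        (conj ((𝓕 f : L2) ξ) * (shiftOp a (𝓕 g : L2) : L2) ξ)) volume := by
    intro i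
    obtain ⟨h4, C, hC⟩ := (hm i).star
    obtain ⟨h5, D, hD⟩ := hn i
    refine (integrable_conj_mul _ _).bdd_mul (c := C * D)
      (h4.mul (h5.comp (measurable_id.sub_const a))).aestronglyMeasurable
      (Eventually.of_forall fun ξ => ?_)
    rw [norm_mul]
    exact mul_le_mul (hC ξ) (hD _) (norm_nonneg _) ((norm_nonneg _).trans (hC ξ))
  simp_rw [h1]
  rw [← integral_finsetSum _ fun i _ => h3 i]
  simp_rw [← Finset.sum_mul]
  have hB0 : 0 ≤ B := (norm_nonneg _).trans (hB 0)
  calc _ ≤ ∫ ξ, B * (‖(𝓕 f : L2) ξ‖ * ‖(shiftOp a (𝓕 g : L2) : L2) ξ‖) := by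
        refine norm_integral_le_of_norm_le ((integrable_norm_mul _ _).const_mul _)
          (Eventually.of_forall fun ξ => ?_)
        rw [norm_mul, norm_mul, RCLike.norm_conj]
        exact mul_le_mul_of_nonneg_right (hB ξ) (by positivity)
    _ ≤ B * (‖f‖ * ‖g‖) := by
        rw [integral_const_mul]
        refine mul_le_mul_of_nonneg_left ((integral_norm_mul_le _ _).trans_eq ?_) hB0
        rw [LinearIsometry.norm_map, Lp.norm_fourier_eq, Lp.norm_fourier_eq]

/-- `C` controls the commutators of `Q(⟪e, x⟫ / R)` with Fourier multipliers. -/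
def CommBound (Q : ℝ → ℝ) (C : ℝ) : Prop :=
  ∀ (ι : Type) [Fintype ι] (m n : ι → E3 → ℂ), (∀ i, IsBdd (m i)) → (∀ i, IsBdd (n i)) →
    ∀ (e : E3) (R L : ℝ), 0 < R →
    (∀ ξ (s : ℝ), ‖∑ i, conj (m i ξ) * n i (ξ - s • e)‖ ≤ L * |s|) → ∀ f g : L2,
    ‖∑ i, ⟪fourierMul (m i) f, mulOp (cut e R Q) (fourierMul (n i) g)⟫_ℂ‖ ≤
      C * (L / R) * (‖f‖ * ‖g‖)

/-- Frequency `s` of the profile translates by `(s / R) e`, where the kernel is at most `L |s| / R`.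
Integrating against the Fourier transform of the profile leaves its first absolute moment as the
constant. -/
theorem commBound_of_schwartz (q : 𝓢(ℝ, ℂ)) {Q : ℝ → ℝ} (hq : ∀ y, q y = Q y) (hQ : StepLike Q)
    {C : ℝ} (hC : ∫ s : ℝ, |s| * ‖(𝓕 q : 𝓢(ℝ, ℂ)) s‖ ≤ C) : CommBound Q C := by
  intro ι _ m n hm hn e R L hR hL f g
  have hL0 : 0 ≤ L := by
    have := (norm_nonneg _).trans (hL 0 1)
    simpa using this
  simp_rw [inner_cut_eq_integral q hq hQ]
  have hint : Integrable (fun s : ℝ => |s| * ‖(𝓕 q : 𝓢(ℝ, ℂ)) s‖) volume := by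
    have := (𝓕 q : 𝓢(ℝ, ℂ)).integrable_pow_mul (μ := volume) 1
    simpa using this
  have hcont : ∀ F G : L2, AEStronglyMeasurable
      (fun s : ℝ => ⟪F, mulOp (planeWave ((s / R) • e)) G⟫_ℂ) volume := by
    intro F G
    refine Continuous.aestronglyMeasurable ?_
    refine continuous_const.inner ?_
    rw [continuous_iff_continuousAt]
    intro s
    refine tendsto_mulOp (C := 1) (Eventually.of_forall fun i => (isBdd_planeWave _).1)
      (isBdd_planeWave _).1 (Eventually.of_forall fun i x => (norm_planeWave _ _).le)
      (fun x => (norm_planeWave _ _).le) (fun x => ?_) G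
    have : Continuous fun s : ℝ => planeWave ((s / R) • e) x := by unfold planeWave; fun_prop
    exact this.tendsto s
  have hI : ∀ i, Integrable (fun s => (𝓕 q : 𝓢(ℝ, ℂ)) s * ⟪fourierMul (m i) f,
      mulOp (planeWave ((s / R) • e)) (fourierMul (n i) g)⟫_ℂ) volume := by
    intro i
    refine (𝓕 q : 𝓢(ℝ, ℂ)).integrable.mul_bdd (c := ‖fourierMul (m i) f‖ * ‖fourierMul (n i) g‖)
      (hcont _ _) (Eventually.of_forall fun s => ?_)
    refine (norm_inner_le_norm _ _).trans (mul_le_mul_of_nonneg_left ?_ (norm_nonneg _))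
    exact (norm_mulOp_le (isBdd_planeWave _) (fun x => (norm_planeWave _ _).le) _).trans_eq
      (one_mul _)
  rw [← integral_finsetSum _ fun i _ => hI i]
  simp_rw [← Finset.mul_sum]
  calc _ ≤ ∫ s : ℝ, (L / R) * (‖f‖ * ‖g‖) * (|s| * ‖(𝓕 q : 𝓢(ℝ, ℂ)) s‖) := by
        refine norm_integral_le_of_norm_le (hint.const_mul _) (Eventually.of_forall fun s => ?_)
        rw [norm_mul]
        have h1 := norm_sum_inner_planeWave_le hm hn ((s / R) • e) (fun ξ => hL ξ (s / R)) f g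
        rw [abs_div, abs_of_pos hR] at h1
        calc _ ≤ ‖(𝓕 q : 𝓢(ℝ, ℂ)) s‖ * (L * (|s| / R) * (‖f‖ * ‖g‖)) :=
              mul_le_mul_of_nonneg_left h1 (norm_nonneg _)
          _ = _ := by ring
    _ ≤ _ := by
        rw [integral_const_mul]
        have : 0 ≤ (L / R) * (‖f‖ * ‖g‖) := by positivity
        nlinarith [mul_le_mul_of_nonneg_left hC this]

theorem StepLike.sub_comp {Q : ℝ → ℝ} (hQ : StepLike Q) {a : ℝ} (ha : 0 ≤ a) :
    HasCompactSupport (fun y => Q y - Q (y - a)) := by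
  obtain ⟨A, hA, h1, h2⟩ := hQ.eventually_const
  refine HasCompactSupport.of_support_subset_isCompact (isCompact_Icc (a := -A) (b := A + a)) ?_
  intro y hy
  by_contra hcon
  apply hy
  rw [mem_Icc, not_and_or, not_le, not_le] at hcon
  rcases hcon with h | h
  · simp only [h1 y h.le, h1 (y - a) (by linarith), sub_self]
  · simp only [h2 y (by linarith), h2 (y - a) (by linarith), sub_self]

theorem StepLike.of_compact {Q : ℝ → ℝ} (h : ContDiff ℝ ∞ Q) (hc : HasCompactSupport Q) :
    StepLike Q := ⟨h, hc.deriv⟩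

theorem StepLike.deriv_contDiff {Q : ℝ → ℝ} (hQ : StepLike Q) : ContDiff ℝ ∞ (deriv Q) := by
  exact (contDiff_infty_iff_deriv.1 hQ.smooth).2

theorem StepLike.deriv {Q : ℝ → ℝ} (hQ : StepLike Q) : StepLike (deriv Q) :=
  StepLike.of_compact hQ.deriv_contDiff hQ.compact

theorem contDiff_ofReal_comp {Q : ℝ → ℝ} (h : ContDiff ℝ ∞ Q) :
    ContDiff ℝ ∞ (fun y => (Q y : ℂ)) := Complex.ofRealCLM.contDiff.comp h

theorem hasCompactSupport_ofReal_comp {Q : ℝ → ℝ} (h : HasCompactSupport Q) :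
    HasCompactSupport (fun y => (Q y : ℂ)) :=
  h.comp_left (g := fun r : ℝ => (r : ℂ)) Complex.ofReal_zero

/-- A step is not Schwartz, but the difference of the step and a far translate is. The constant for
that difference depends only on `Q'`, so the translate can be sent to infinity. -/
theorem StepLike.commBound {Q : ℝ → ℝ} (hQ : StepLike Q) : ∃ C : ℝ, 0 ≤ C ∧ CommBound Q C := by
  obtain ⟨A, hA, hl, hr⟩ := hQ.eventually_const
  obtain ⟨D, hD0, hD⟩ := hQ.bounded
  set q' : 𝓢(ℝ, ℂ) := (hasCompactSupport_ofReal_comp hQ.compact).toSchwartzMap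
    (contDiff_ofReal_comp hQ.deriv_contDiff) with hq'
  have hq'c : ∀ y, q' y = ((_root_.deriv Q y : ℝ) : ℂ) := fun y => rfl
  set C : ℝ := (1 / Real.pi) * ∫ s : ℝ, ‖(𝓕 q' : 𝓢(ℝ, ℂ)) s‖ with hCdef
  have hC0 : 0 ≤ C := by
    have : 0 ≤ ∫ s : ℝ, ‖(𝓕 q' : 𝓢(ℝ, ℂ)) s‖ := integral_nonneg fun s => norm_nonneg _
    have := Real.pi_pos
    positivity
  have hdQ : Differentiable ℝ Q := hQ.smooth.differentiable (by simp)
  -- The derivative of the difference is `Q' - Q'(· - a)`, and a translate has a Fourier transform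
  -- of the same modulus. Hence `2π |s| |q̂(s)| ≤ 2 |𝓕 Q'(s)|` for all `a`, which is where the
  -- `a`-independent constant with `1 / π` comes from.
  have step : ∀ a : ℝ, 0 ≤ a → CommBound (fun y => Q y - Q (y - a)) C := by
    intro a ha
    have hsm : ContDiff ℝ ∞ (fun y => Q y - Q (y - a)) :=
      hQ.smooth.sub (hQ.smooth.comp (contDiff_id.sub contDiff_const))
    have hcs := hQ.sub_comp ha
    set q : 𝓢(ℝ, ℂ) := (hasCompactSupport_ofReal_comp hcs).toSchwartzMap
      (contDiff_ofReal_comp hsm) with hq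
    have hqc : ∀ y, q y = ((Q y - Q (y - a) : ℝ) : ℂ) := fun y => rfl
    refine commBound_of_schwartz q hqc (StepLike.of_compact hsm hcs) ?_
    have hder : SchwartzMap.derivCLM ℂ ℂ q = q' - SchwartzMap.compSubConstCLM ℂ a q' := by
      ext y
      rw [SchwartzMap.derivCLM_apply, sub_apply, SchwartzMap.compSubConstCLM_apply, hq'c, hq'c]
      have e1 : HasDerivAt (fun y => Q y - Q (y - a))
          (_root_.deriv Q y - _root_.deriv Q (y - a)) y := by
        refine (hdQ y).hasDerivAt.sub ?_
        exact HasDerivAt.comp_sub_const y a (hdQ (y - a)).hasDerivAt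
      have e2 := e1.ofReal_comp.deriv
      rw [show (q : ℝ → ℂ) = fun y => ((Q y - Q (y - a) : ℝ) : ℂ) from funext hqc, e2]
      push_cast
      rfl
    have hF : ∀ s : ℝ, 2 * Real.pi * (|s| * ‖(𝓕 q : 𝓢(ℝ, ℂ)) s‖) ≤
        2 * ‖(𝓕 q' : 𝓢(ℝ, ℂ)) s‖ := by
      intro s
      have e1 : 𝓕 (SchwartzMap.derivCLM ℂ ℂ q : ℝ → ℂ) s =
          (2 * Real.pi * Complex.I * s) • 𝓕 (q : ℝ → ℂ) s := by
        have e0 : (SchwartzMap.derivCLM ℂ ℂ q : ℝ → ℂ) = _root_.deriv (q : ℝ → ℂ) :=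
          funext fun y => SchwartzMap.derivCLM_apply ℂ q y
        have := Real.fourier_deriv (f := (q : ℝ → ℂ)) q.integrable q.differentiable
          (by rw [← e0]; exact (SchwartzMap.derivCLM ℂ ℂ q).integrable)
        rw [e0, this]
      have e2 : ‖𝓕 (SchwartzMap.compSubConstCLM ℂ a q' : ℝ → ℂ) s‖ = ‖𝓕 (q' : ℝ → ℂ) s‖ := by
        have e3 : (SchwartzMap.compSubConstCLM ℂ a q' : ℝ → ℂ) = fun y => q' (y + -a) := by
          funext y; rw [SchwartzMap.compSubConstCLM_apply, sub_eq_add_neg]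
        rw [e3]
        simp only [Real.fourier_eq', smul_eq_mul]
        have e4 : ∀ v : ℝ, Complex.exp (((-2 * Real.pi * inner ℝ v s : ℝ) : ℂ) * Complex.I) *
            q' (v + -a) = Complex.exp (((-2 * Real.pi * inner ℝ a s : ℝ) : ℂ) * Complex.I) *
            (Complex.exp (((-2 * Real.pi * inner ℝ (v + -a) s : ℝ) : ℂ) * Complex.I) *
            q' (v + -a)) := by
          intro v
          rw [← mul_assoc, ← Complex.exp_add]
          congr 2
          rw [inner_add_left, inner_neg_left]
          push_cast
          ring
        simp_rw [e4]
        rw [integral_const_mul, integral_add_right_eq_self (fun v : ℝ =>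
          Complex.exp (((-2 * Real.pi * inner ℝ v s : ℝ) : ℂ) * Complex.I) * q' v), norm_mul,
          Complex.norm_exp_ofReal_mul_I, one_mul]
      rw [hder] at e1
      have e5 : 𝓕 ((q' - SchwartzMap.compSubConstCLM ℂ a q' : 𝓢(ℝ, ℂ)) : ℝ → ℂ) s =
          𝓕 (q' : ℝ → ℂ) s - 𝓕 (SchwartzMap.compSubConstCLM ℂ a q' : ℝ → ℂ) s := by
        have := congrArg (fun F : 𝓢(ℝ, ℂ) => F s) ((SchwartzMap.fourierTransformCLM ℂ
          (V := ℝ) (E := ℂ)).map_sub q' (SchwartzMap.compSubConstCLM ℂ a q'))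
        exact this
      rw [e5] at e1
      have e6 := congrArg norm e1
      rw [norm_smul] at e6
      have e7 : ‖(2 * Real.pi * Complex.I * s : ℂ)‖ = 2 * Real.pi * |s| := by
        simp [abs_of_pos Real.pi_pos]
      rw [e7] at e6
      have e8 := norm_sub_le (𝓕 (q' : ℝ → ℂ) s)
        (𝓕 (SchwartzMap.compSubConstCLM ℂ a q' : ℝ → ℂ) s)
      rw [e6, e2] at e8
      rw [SchwartzMap.fourier_coe, SchwartzMap.fourier_coe]
      linarith
    have hint : Integrable (fun s : ℝ => |s| * ‖(𝓕 q : 𝓢(ℝ, ℂ)) s‖) volume := by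
      have := (𝓕 q : 𝓢(ℝ, ℂ)).integrable_pow_mul (μ := volume) 1
      simpa using this
    have := integral_mono (hint.const_mul (2 * Real.pi))
      ((𝓕 q' : 𝓢(ℝ, ℂ)).integrable.norm.const_mul 2) hF
    rw [integral_const_mul, integral_const_mul] at this
    rw [hCdef, one_div, inv_mul_eq_div, le_div_iff₀ Real.pi_pos]
    linarith
  refine ⟨C, hC0, ?_⟩
  intro ι _ m n hm hn e R L hR hL f g
  -- At `s = 0` the kernel hypothesis says that the symbols cancel on the diagonal, so a constant
  -- cutoff contributes nothing and the limiting value `Q (-A)` may be added back.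
  have hzero : ∑ i, ⟪fourierMul (m i) f, fourierMul (n i) g⟫_ℂ = 0 := by
    have h1 := norm_sum_inner_planeWave_le hm hn 0 (B := 0) (fun ξ => by
      have := hL ξ 0; simpa using this) f g
    have h2 : ∀ G : L2, mulOp (planeWave 0) G = G := fun G => by
      have : planeWave 0 = fun _ => (1 : ℂ) := by funext x; simp [planeWave]
      rw [this, mulOp_const, one_smul]
    simp_rw [h2] at h1
    rw [zero_mul] at h1
    exact norm_le_zero_iff.1 h1
  have hlim : ∀ G : L2, Tendsto (fun N : ℕ => mulOp (cut e R fun y => Q y - Q (y - N)) G) atTop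
      (𝓝 (mulOp (cut e R fun y => Q y - Q (-A)) G)) := by
    intro G
    have hc := hQ.smooth.continuous
    refine tendsto_mulOp (C := D + D) (Eventually.of_forall fun N => ?_) ?_
      (Eventually.of_forall fun N x => ?_) (fun x => ?_) (fun x => ?_) G
    · refine Continuous.measurable ?_; unfold cut; fun_prop
    · refine Continuous.measurable ?_; unfold cut; fun_prop
    · rw [cut, Complex.norm_real]
      exact (abs_sub _ _).trans (add_le_add (hD _) (hD _))
    · rw [cut, Complex.norm_real]
      exact (abs_sub _ _).trans (add_le_add (hD _) (hD _))
    · refine tendsto_const_nhds.congr' ?_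
      filter_upwards [eventually_ge_atTop ⌈A + inner ℝ e x / R⌉₊] with N hN
      have : A + inner ℝ e x / R ≤ N := (Nat.le_ceil _).trans (by exact_mod_cast hN)
      rw [cut, cut, hl (inner ℝ e x / R - N) (by linarith)]
  have hbd : ‖∑ i, ⟪fourierMul (m i) f,
      mulOp (cut e R fun y => Q y - Q (-A)) (fourierMul (n i) g)⟫_ℂ‖ ≤
      C * (L / R) * (‖f‖ * ‖g‖) := by
    have hT := (tendsto_finsetSum Finset.univ fun i _ =>
      ((tendsto_const_nhds (x := fourierMul (m i) f)).inner (𝕜 := ℂ)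
        (hlim (fourierMul (n i) g)))).norm
    exact le_of_tendsto hT
      (Eventually.of_forall fun N : ℕ => step N N.cast_nonneg ι m n hm hn e R L hR hL f g)
  have hsplit : ∀ G : L2, mulOp (cut e R fun y => Q y - Q (-A)) G =
      mulOp (cut e R Q) G - (Q (-A) : ℂ) • G := by
    intro G
    rw [← mulOp_const, ← mulOp_sub (hQ.isBdd e R) (IsBdd.const _)]
    congr 2
    funext x
    simp [cut]
  simp_rw [hsplit, inner_sub_right, inner_smul_right, Finset.sum_sub_distrib, ← Finset.mul_sum,
    hzero, mul_zero, sub_zero] at hbd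
  exact hbd

theorem fourierMul_one (f : L2) : fourierMul (fun _ => 1) f = f := by
  rw [fourierMul_const, one_smul]

/-- The pairs of symbols `(A, 1)` and `(-1, A)` produce exactly the kernel `A(ξ) - A(ξ - s e)`. -/
theorem CommBound.commutator {Q : ℝ → ℝ} {C : ℝ} (h : CommBound Q C) {A : E3 → ℝ}
    (hA : IsBdd fun ξ => (A ξ : ℂ)) {e : E3} {R L : ℝ} (hR : 0 < R)
    (hL : ∀ ξ (s : ℝ), |A ξ - A (ξ - s • e)| ≤ L * |s|) (f g : L2) :
    ‖⟪f, fourierMul (fun ξ => (A ξ : ℂ)) (mulOp (cut e R Q) g)⟫_ℂ -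
      ⟪f, mulOp (cut e R Q) (fourierMul (fun ξ => (A ξ : ℂ)) g)⟫_ℂ‖ ≤
      C * (L / R) * (‖f‖ * ‖g‖) := by
  have := h (Fin 2) ![fun ξ => (A ξ : ℂ), fun _ => -1] ![fun _ => 1, fun ξ => (A ξ : ℂ)]
    (by intro i; fin_cases i; exacts [hA, IsBdd.const _])
    (by intro i; fin_cases i; exacts [IsBdd.const _, hA]) e R L hR (by
      intro ξ s
      refine le_trans (le_of_eq ?_) (hL ξ s)
      simp only [Fin.sum_univ_two, Matrix.cons_val_zero, Matrix.cons_val_one,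
        Complex.conj_ofReal]
      rw [show ((A ξ : ℂ) * 1 + conj (-1) * (A (ξ - s • e) : ℂ)) =
        ((A ξ - A (ξ - s • e) : ℝ) : ℂ) by simp; ring, Complex.norm_real, Real.norm_eq_abs]) f g
  simp only [Fin.sum_univ_two, Matrix.cons_val_zero, Matrix.cons_val_one, fourierMul_one,
    inner_fourierMul_comm hA] at this
  rw [fourierMul_const, neg_one_smul, inner_neg_left, ← sub_eq_add_neg] at this
  exact this

/-- Compare the symmetrized product of `A` and `Q` with `√A Q √A ≥ 0`. The kernel of the difference
is `(√A(ξ) - √A(ξ'))² / 2`, which is at most `|A(ξ) - A(ξ')|`. A Lipschitz bound on `A` itself is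
therefore enough, although `√A` need not be Lipschitz. -/
theorem CommBound.garding {Q : ℝ → ℝ} {C : ℝ} (h : CommBound Q C) (hQ : StepLike Q)
    (hQ0 : ∀ y, 0 ≤ Q y) {A : E3 → ℝ}
    (hA : IsBdd fun ξ => (A ξ : ℂ)) (hA0 : ∀ ξ, 0 ≤ A ξ) {e : E3} {R L : ℝ} (hR : 0 < R)
    (hL : ∀ ξ (s : ℝ), |A ξ - A (ξ - s • e)| ≤ L * |s|) (f : L2) :
    -(C * (L / R) * ‖f‖ ^ 2) ≤
      (⟪mulOp (cut e R Q) f, fourierMul (fun ξ => (A ξ : ℂ)) f⟫_ℂ).re := by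
  have hs : IsBdd fun ξ => ((Real.sqrt (A ξ) : ℝ) : ℂ) := by
    obtain ⟨h1, D, hD⟩ := hA
    have h1' : Measurable A := by
      have := Complex.measurable_re.comp h1
      exact this
    refine ⟨Complex.measurable_ofReal.comp h1'.sqrt, Real.sqrt D, fun ξ => ?_⟩
    rw [Complex.norm_real, Real.norm_of_nonneg (Real.sqrt_nonneg _)]
    refine Real.sqrt_le_sqrt ?_
    have := hD ξ
    rw [Complex.norm_real] at this
    exact (le_abs_self _).trans this
  have hh : IsBdd fun ξ => ((A ξ / 2 : ℝ) : ℂ) := by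
    have := (IsBdd.const (1 / 2)).mul hA
    convert this using 2
    push_cast; ring
  have := h (Fin 3) ![fun ξ => ((A ξ / 2 : ℝ) : ℂ), fun _ => 1, fun ξ => ((Real.sqrt (A ξ) : ℝ) : ℂ)]
    ![fun _ => 1, fun ξ => ((A ξ / 2 : ℝ) : ℂ), fun ξ => -1 * ((Real.sqrt (A ξ) : ℝ) : ℂ)]
    (by intro i; fin_cases i; exacts [hh, IsBdd.const _, hs])
    (by intro i; fin_cases i; exacts [IsBdd.const _, hh, (IsBdd.const _).mul hs]) e R L hR (by
      intro ξ s
      refine le_trans (le_of_eq ?_) ((?_ : |(Real.sqrt (A ξ) - Real.sqrt (A (ξ - s • e))) ^ 2 / 2|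
        ≤ |A ξ - A (ξ - s • e)|).trans (hL ξ s))
      · simp only [Fin.sum_univ_three, Matrix.cons_val_zero, Matrix.cons_val_one,
          Matrix.cons_val_two, Matrix.head_cons, Matrix.tail_cons,
          Complex.conj_ofReal]
        rw [← Real.norm_eq_abs, ← Complex.norm_real]
        congr 1
        have e1 := Real.sq_sqrt (hA0 ξ)
        have e2 := Real.sq_sqrt (hA0 (ξ - s • e))
        have e3 : (Real.sqrt (A ξ) - Real.sqrt (A (ξ - s • e))) ^ 2 / 2 =
            A ξ / 2 + A (ξ - s • e) / 2 - Real.sqrt (A ξ) * Real.sqrt (A (ξ - s • e)) := by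
          rw [← e1, ← e2, Real.sqrt_sq (Real.sqrt_nonneg _), Real.sqrt_sq (Real.sqrt_nonneg _)]
          ring
        rw [e3]
        simp only [map_one]
        push_cast
        ring
      · set x := Real.sqrt (A ξ)
        set y := Real.sqrt (A (ξ - s • e))
        have hx : 0 ≤ x := Real.sqrt_nonneg _
        have hy : 0 ≤ y := Real.sqrt_nonneg _
        rw [← Real.sq_sqrt (hA0 ξ), ← Real.sq_sqrt (hA0 (ξ - s • e))]
        change |(x - y) ^ 2 / 2| ≤ |x ^ 2 - y ^ 2|
        rw [abs_of_nonneg (by positivity), sq_sub_sq, abs_mul, abs_of_nonneg (add_nonneg hx hy),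
          ← sq_abs]
        have : |x - y| ≤ x + y := by
          rw [abs_le]; constructor <;> linarith
        nlinarith [abs_nonneg (x - y)]) f f
  simp only [Fin.sum_univ_three, Matrix.cons_val_zero, Matrix.cons_val_one,
          Matrix.cons_val_two, Matrix.head_cons, Matrix.tail_cons,
          fourierMul_one] at this
  have h2 : ∀ F : L2, fourierMul (fun ξ => ((A ξ / 2 : ℝ) : ℂ)) F =
      (1 / 2 : ℂ) • fourierMul (fun ξ => (A ξ : ℂ)) F := by
    intro F
    rw [← fourierMul_const_mul _ hA]
    congr 2
    funext ξ; push_cast; ring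
  rw [h2, fourierMul_const_mul _ hs, neg_one_smul, map_neg, map_smul, inner_neg_right,
    inner_smul_left, inner_smul_right] at this
  have hcut : ∀ F G : L2, ⟪mulOp (cut e R Q) F, G⟫_ℂ = ⟪F, mulOp (cut e R Q) G⟫_ℂ :=
    fun F G => inner_mulOp_comm (hQ.isBdd e R) F G
  have hpos : 0 ≤ (⟪fourierMul (fun ξ => ((Real.sqrt (A ξ) : ℝ) : ℂ)) f,
      mulOp (cut e R Q) (fourierMul (fun ξ => ((Real.sqrt (A ξ) : ℝ) : ℂ)) f)⟫_ℂ).re := by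
    set G := fourierMul (fun ξ => ((Real.sqrt (A ξ) : ℝ) : ℂ)) f
    rw [inner_mulOp_right (hQ.isBdd e R)]
    have : ∫ x, cut e R Q x * (conj (G x) * G x) =
        ((∫ x, Q (inner ℝ e x / R) * ‖G x‖ ^ 2 : ℝ) : ℂ) := by
      rw [← integral_complex_ofReal]
      refine integral_congr_ae (Eventually.of_forall fun x => ?_)
      simp only [cut, Complex.conj_mul']
      push_cast
      ring
    rw [this, Complex.ofReal_re]
    exact integral_nonneg fun x => mul_nonneg (hQ0 _) (by positivity)
  have h3 := (abs_le.1 ((Complex.abs_re_le_norm _).trans this)).1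
  have h4 : (⟪fourierMul (fun ξ => (A ξ : ℂ)) f, mulOp (cut e R Q) f⟫_ℂ).re =
      (⟪mulOp (cut e R Q) f, fourierMul (fun ξ => (A ξ : ℂ)) f⟫_ℂ).re :=
    inner_re_symm (𝕜 := ℂ) _ _
  rw [← hcut f] at h3
  have e1 : conj (1 / 2 : ℂ) = ((1 / 2 : ℝ) : ℂ) := by
    rw [show (1 / 2 : ℂ) = ((1 / 2 : ℝ) : ℂ) by push_cast; rfl, Complex.conj_ofReal]
  rw [e1, show (1 / 2 : ℂ) = ((1 / 2 : ℝ) : ℂ) by push_cast; rfl, Complex.add_re, Complex.add_re,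
    Complex.neg_re, Complex.re_ofReal_mul, Complex.re_ofReal_mul, h4, ← sq] at h3
  linarith

/-! ### Lipschitz symbols -/

/-- Lipschitz symbols on the line. -/
def LipSym (a : ℝ → ℝ) : Prop :=
  ∃ L : ℝ, 0 ≤ L ∧ (∀ k k', |a k - a k'| ≤ L * |k - k'|) ∧ ∀ k, |a k| ≤ L * (1 + |k|)

/-- Bounded Lipschitz symbols on the line. -/
def BLipSym (a : ℝ → ℝ) : Prop :=
  ∃ L : ℝ, 0 ≤ L ∧ (∀ k k', |a k - a k'| ≤ L * |k - k'|) ∧ ∀ k, |a k| ≤ L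

theorem BLipSym.lipSym {a : ℝ → ℝ} (h : BLipSym a) : LipSym a := by
  obtain ⟨L, h0, h1, h2⟩ := h
  exact ⟨L, h0, h1, fun k => (h2 k).trans (by nlinarith [abs_nonneg k])⟩

theorem BLipSym.mul {a b : ℝ → ℝ} (ha : BLipSym a) (hb : BLipSym b) :
    BLipSym (fun k => a k * b k) := by
  obtain ⟨L, h0, h1, h2⟩ := ha
  obtain ⟨M, g0, g1, g2⟩ := hb
  refine ⟨2 * (L * M) + L * M, by positivity, fun k k' => ?_, fun k => ?_⟩
  · have e : a k * b k - a k' * b k' = (a k - a k') * b k + a k' * (b k - b k') := by ring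
    rw [e]
    refine (abs_add_le _ _).trans ?_
    rw [abs_mul, abs_mul]
    have := mul_le_mul (h1 k k') (g2 k) (abs_nonneg _) (by positivity)
    have := mul_le_mul (h2 k') (g1 k k') (abs_nonneg _) h0
    nlinarith [mul_nonneg (mul_nonneg h0 g0) (abs_nonneg (k - k'))]
  · rw [abs_mul]
    have := mul_le_mul (h2 k) (g2 k) (abs_nonneg _) h0
    nlinarith [mul_nonneg h0 g0]

theorem LipSym.add {a b : ℝ → ℝ} (ha : LipSym a) (hb : LipSym b) :
    LipSym (fun k => a k + b k) := by
  obtain ⟨L, h0, h1, h2⟩ := ha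
  obtain ⟨M, g0, g1, g2⟩ := hb
  refine ⟨L + M, by positivity, fun k k' => ?_, fun k => ?_⟩
  · have e : a k + b k - (a k' + b k') = (a k - a k') + (b k - b k') := by ring
    rw [e]
    linarith [abs_add_le (a k - a k') (b k - b k'), h1 k k', g1 k k']
  · linarith [abs_add_le (a k) (b k), h2 k, g2 k]

theorem LipSym.const_mul {a : ℝ → ℝ} (ha : LipSym a) (c : ℝ) : LipSym (fun k => c * a k) := by
  obtain ⟨L, h0, h1, h2⟩ := ha
  refine ⟨|c| * L, by positivity, fun k k' => ?_, fun k => ?_⟩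
  · rw [← mul_sub, abs_mul, mul_assoc]; gcongr; exact h1 k k'
  · rw [abs_mul, mul_assoc]; gcongr; exact h2 k

theorem BLipSym.const (c : ℝ) : BLipSym (fun _ => c) :=
  ⟨|c|, abs_nonneg c, fun k k' => by simp; positivity, fun _ => le_rfl⟩

theorem LipSym.abs : LipSym (fun k => |k|) :=
  ⟨1, zero_le_one, fun k k' => by rw [one_mul]; exact abs_abs_sub_abs_le k k',
    fun k => by rw [abs_abs]; linarith⟩

theorem LipSym.id : LipSym (fun k => k) :=
  ⟨1, zero_le_one, fun k k' => by rw [one_mul], fun k => by linarith⟩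

theorem LipSym.congr {a b : ℝ → ℝ} (ha : LipSym a) (h : ∀ k, b k = a k) : LipSym b := by
  rwa [funext h]

theorem BLipSym.congr {a b : ℝ → ℝ} (ha : BLipSym a) (h : ∀ k, b k = a k) : BLipSym b := by
  rwa [funext h]

theorem LipSym.continuous {a : ℝ → ℝ} (ha : LipSym a) : Continuous a := by
  obtain ⟨L, h0, h1, -⟩ := ha
  have : LipschitzWith L.toNNReal a := LipschitzWith.of_dist_le_mul fun x y => by
    rw [Real.dist_eq, Real.dist_eq, Real.coe_toNNReal _ h0]; exact h1 x y
  exact this.continuous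

/-- The weight `1 / (|k| + 1/8)`. -/
def wt (k : ℝ) : ℝ := 1 / (|k| + 1 / 8)

theorem wt_pos (k : ℝ) : 0 < wt k := by unfold wt; positivity

theorem wt_mul (k : ℝ) : (|k| + 1 / 8) * wt k = 1 := by
  unfold wt; field_simp

theorem wt_le (k : ℝ) : wt k ≤ 8 := by
  have h1 := wt_mul k
  have h2 := wt_pos k
  nlinarith [abs_nonneg k]

theorem abs_mul_wt_le (k : ℝ) : |k| * wt k ≤ 1 := by
  have h1 := wt_mul k
  have h2 := wt_pos k
  nlinarith

theorem wt_sub (k k' : ℝ) : |wt k - wt k'| ≤ wt k * wt k' * |k - k'| := by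
  have h1 := wt_mul k
  have h2 := wt_mul k'
  have e : wt k - wt k' = wt k * wt k' * (|k'| - |k|) := by
    linear_combination wt k' * h1 - wt k * h2
  rw [e, abs_mul, abs_of_pos (mul_pos (wt_pos k) (wt_pos k')), abs_sub_comm k k']
  exact mul_le_mul_of_nonneg_left (abs_abs_sub_abs_le _ _) (mul_pos (wt_pos k) (wt_pos k')).le

theorem bLipSym_wt : BLipSym wt := by
  refine ⟨64, by norm_num, fun k k' => (wt_sub k k').trans ?_, fun k => ?_⟩
  · gcongr
    nlinarith [wt_le k, wt_le k', wt_pos k, wt_pos k']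
  · rw [abs_of_pos (wt_pos k)]; linarith [wt_le k]

theorem bLipSym_mul_wt : BLipSym (fun k => k * wt k) := by
  refine ⟨16, by norm_num, fun k k' => ?_, fun k => ?_⟩
  · have e : k * wt k - k' * wt k' = (k - k') * wt k + k' * (wt k - wt k') := by ring
    rw [e]
    refine (abs_add_le _ _).trans ?_
    rw [abs_mul, abs_mul, abs_of_pos (wt_pos k)]
    have h1 := mul_le_mul_of_nonneg_left (wt_sub k k') (abs_nonneg k')
    have h2 := abs_mul_wt_le k'
    have h3 : |k'| * (wt k * wt k' * |k - k'|) ≤ 8 * |k - k'| := by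
      have : |k'| * (wt k * wt k' * |k - k'|) = (|k'| * wt k') * wt k * |k - k'| := by ring
      rw [this]
      gcongr
      nlinarith [wt_le k, wt_pos k, wt_pos k', abs_nonneg k']
    nlinarith [wt_le k, abs_nonneg (k - k')]
  · rw [abs_mul, abs_of_pos (wt_pos k)]; linarith [abs_mul_wt_le k]

theorem bLipSym_abs_mul_wt : BLipSym (fun k => |k| * wt k) := by
  obtain ⟨L, h0, h1, h2⟩ := bLipSym_mul_wt
  have e : ∀ k, |k| * wt k = |k * wt k| := fun k => by rw [abs_mul, abs_of_pos (wt_pos k)]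
  refine ⟨L, h0, fun k k' => ?_, fun k => ?_⟩
  · simp only [e]
    exact (abs_abs_sub_abs_le _ _).trans (h1 k k')
  · simp only [e]
    rw [abs_abs]
    exact h2 k

/-- Division with remainder by `|k| + 1/8`. It shows that `k² wt k` is Lipschitz with linear growth;
this is the reason for admitting unbounded symbols and a regularization. -/
theorem sq_mul_wt (k : ℝ) : k ^ 2 * wt k = |k| + (-(1 / 8) + 1 / 64 * wt k) := by
  have h1 := wt_mul k
  rw [← sq_abs]
  linear_combination (|k| - 1 / 8) * h1

theorem lipSym_sq_mul_wt : LipSym (fun k => k ^ 2 * wt k) :=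
  (LipSym.abs.add ((BLipSym.const (-(1 / 8))).lipSym.add (bLipSym_wt.lipSym.const_mul (1 / 64)))).congr
    sq_mul_wt

/-- The rescaled frequency `2π t^{1-α} ⟪e, ξ⟫`. -/
def kap (e : E3) (α t : ℝ) (ξ : E3) : ℝ := 2 * Real.pi * t ^ (1 - α) * inner ℝ e ξ

/-- The symbol of the regularization `(1 - ε²Δ)⁻¹`. -/
def reg (ε : ℝ) (ξ : E3) : ℝ := 1 / (1 + ε ^ 2 * (2 * Real.pi * ‖ξ‖) ^ 2)

theorem reg_pos (ε : ℝ) (ξ : E3) : 0 < reg ε ξ := by unfold reg; positivity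

theorem reg_le_one (ε : ℝ) (ξ : E3) : reg ε ξ ≤ 1 := by
  unfold reg
  rw [div_le_one (by positivity)]
  nlinarith [sq_nonneg (ε * (2 * Real.pi * ‖ξ‖))]

theorem continuous_reg (ε : ℝ) : Continuous (reg ε) := by
  unfold reg
  exact continuous_const.div (by fun_prop) fun x => by positivity

theorem isBdd_reg (ε : ℝ) : IsBdd (fun ξ => (reg ε ξ : ℂ)) := by
  refine IsBdd.of_continuous (C := 1) (Complex.continuous_ofReal.comp (continuous_reg ε)) fun x => ?_
  rw [Complex.norm_real, Real.norm_of_nonneg (reg_pos _ _).le]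
  exact reg_le_one _ _

/-- The admissible parameters. -/
structure Adm (e : E3) (α ε t : ℝ) : Prop where
  norm_e : ‖e‖ = 1
  half_lt : 1 / 2 < α
  lt_one : α < 1
  pos : 0 < ε
  le_one : ε ≤ 1
  one_le : 1 ≤ t

/-- The symbol `a(κ) (1 + ε² |2πξ|²)⁻²`. -/
def sym (a : ℝ → ℝ) (e : E3) (α ε t : ℝ) (ξ : E3) : ℝ := a (kap e α t ξ) * reg ε ξ ^ 2

/-! ### Lipschitz bounds for regularized symbols, uniform in the regularization. -/

theorem mul_regularized_le {N δ k : ℝ} (hN : 1 ≤ N) :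
    δ * |k| * (1 / (N + δ ^ 2 * k ^ 2)) ≤ 1 / 2 := by
  have hp : 0 < N + δ ^ 2 * k ^ 2 := by positivity
  rw [mul_one_div, div_le_iff₀ hp]
  nlinarith [sq_nonneg (δ * |k| - 1), sq_abs k]

theorem sq_mul_regularized_le {N δ k : ℝ} (hN : 1 ≤ N) :
    (δ * |k|) ^ 2 * (1 / (N + δ ^ 2 * k ^ 2)) ≤ 1 := by
  have hp : 0 < N + δ ^ 2 * k ^ 2 := by positivity
  rw [mul_one_div, div_le_one hp, mul_pow, sq_abs]
  linarith

theorem regularized_le {N δ k : ℝ} (hN : 1 ≤ N) : 1 / (N + δ ^ 2 * k ^ 2) ≤ 1 := by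
  have hp : 0 < N + δ ^ 2 * k ^ 2 := by positivity
  rw [div_le_one hp]
  nlinarith [sq_nonneg (δ * k)]

/-- The weight `1 + |k'|` is there to absorb a symbol of linear growth. The difference of the two
fractions carries `δ²` and both fractions, which pays for two powers of the frequency; `δ ≤ 1`
handles the remaining terms. -/
theorem regularized_sub {N δ k k' : ℝ} (hN : 1 ≤ N) (hδ0 : 0 ≤ δ) (hδ : δ ≤ 1) :
    |1 / (N + δ ^ 2 * k ^ 2) - 1 / (N + δ ^ 2 * k' ^ 2)| * (1 + |k'|) ≤ |k - k'| * 3 := by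
  have d1 := mul_regularized_le (N := N) (δ := δ) (k := k) hN
  have d1' := mul_regularized_le (N := N) (δ := δ) (k := k') hN
  have d2' := sq_mul_regularized_le (N := N) (δ := δ) (k := k') hN
  have hS1 := regularized_le (N := N) (δ := δ) (k := k) hN
  have hS1' := regularized_le (N := N) (δ := δ) (k := k') hN
  have hp : 0 < N + δ ^ 2 * k ^ 2 := by positivity
  have hp' : 0 < N + δ ^ 2 * k' ^ 2 := by positivity
  have e1 : (N + δ ^ 2 * k ^ 2) * (1 / (N + δ ^ 2 * k ^ 2)) = 1 := by field_simp
  have e2 : (N + δ ^ 2 * k' ^ 2) * (1 / (N + δ ^ 2 * k' ^ 2)) = 1 := by field_simp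
  have hS0 : 0 < 1 / (N + δ ^ 2 * k ^ 2) := by positivity
  have hS0' : 0 < 1 / (N + δ ^ 2 * k' ^ 2) := by positivity
  generalize 1 / (N + δ ^ 2 * k ^ 2) = S at *
  generalize 1 / (N + δ ^ 2 * k' ^ 2) = S' at *
  have hdiff : S - S' = (k' - k) * (k' + k) * δ ^ 2 * (S * S') := by
    linear_combination S' * e1 - S * e2
  rw [hdiff, abs_mul, abs_mul, abs_mul, abs_sub_comm k' k, abs_of_pos (mul_pos hS0 hS0'),
    abs_of_nonneg (sq_nonneg δ)]
  have h3 : |k' + k| ≤ |k'| + |k| := abs_add_le _ _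
  have y1 : δ * S ≤ 1 := mul_le_one₀ hδ hS0.le hS1
  have y2 : δ * S' ≤ 1 := mul_le_one₀ hδ hS0'.le hS1'
  have t1 : (δ * |k'| * S') * (δ * S) ≤ 1 / 2 * 1 := by gcongr
  have t2 : (δ * |k| * S) * (δ * S') ≤ 1 / 2 * 1 := by gcongr
  have t3 : ((δ * |k'|) ^ 2 * S') * S ≤ 1 * 1 := by gcongr
  have t4 : (δ * |k| * S) * (δ * |k'| * S') ≤ 1 / 2 * (1 / 2) := by gcongr
  have h4 : (|k'| + |k|) * δ ^ 2 * (S * S') * (1 + |k'|) ≤ 3 := by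
    have : (|k'| + |k|) * δ ^ 2 * (S * S') * (1 + |k'|) =
      (δ * |k'| * S') * (δ * S) + (δ * |k| * S) * (δ * S') + ((δ * |k'|) ^ 2 * S') * S +
      (δ * |k| * S) * (δ * |k'| * S') := by ring
    rw [this]; linarith
  calc _ ≤ |k - k'| * (|k'| + |k|) * δ ^ 2 * (S * S') * (1 + |k'|) := by gcongr
    _ = |k - k'| * ((|k'| + |k|) * δ ^ 2 * (S * S') * (1 + |k'|)) := by ring
    _ ≤ _ := by gcongr

theorem regularized_lip {N δ k k' L a a' : ℝ} (hN : 1 ≤ N) (hδ0 : 0 ≤ δ) (hδ : δ ≤ 1)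
    (hL : 0 ≤ L) (h1 : |a - a'| ≤ L * |k - k'|) (h2 : |a'| ≤ L * (1 + |k'|)) :
    |a * (1 / (N + δ ^ 2 * k ^ 2)) ^ 2 - a' * (1 / (N + δ ^ 2 * k' ^ 2)) ^ 2| ≤
      7 * L * |k - k'| := by
  have hS1 := regularized_le (N := N) (δ := δ) (k := k) hN
  have hS1' := regularized_le (N := N) (δ := δ) (k := k') hN
  have hk3 := regularized_sub (k := k) (k' := k') hN hδ0 hδ
  have hS0 : 0 < 1 / (N + δ ^ 2 * k ^ 2) := by positivity
  have hS0' : 0 < 1 / (N + δ ^ 2 * k' ^ 2) := by positivity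
  generalize 1 / (N + δ ^ 2 * k ^ 2) = S at *
  generalize 1 / (N + δ ^ 2 * k' ^ 2) = S' at *
  have e : a * S ^ 2 - a' * S' ^ 2 = (a - a') * S ^ 2 + a' * ((S - S') * (S + S')) := by ring
  rw [e]
  refine (abs_add_le _ _).trans ?_
  rw [abs_mul, abs_mul, abs_mul, abs_of_nonneg (sq_nonneg S), abs_of_pos (add_pos hS0 hS0')]
  have p1 : |a - a'| * S ^ 2 ≤ L * |k - k'| * 1 := by
    have : S ^ 2 ≤ 1 := pow_le_one₀ hS0.le hS1
    gcongr
  have p2 : |a'| * (|S - S'| * (S + S')) ≤ L * (|k - k'| * 3) * 2 := by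
    calc _ ≤ (L * (1 + |k'|)) * (|S - S'| * 2) := by gcongr; linarith
      _ = L * (|S - S'| * (1 + |k'|)) * 2 := by ring
      _ ≤ _ := by gcongr
  linarith

theorem kap_shift {e : E3} (he : ‖e‖ = 1) (α t : ℝ) (ξ : E3) (s : ℝ) :
    kap e α t (ξ - s • e) = kap e α t ξ - 2 * Real.pi * t ^ (1 - α) * s := by
  unfold kap
  rw [inner_sub_right, inner_smul_right, real_inner_self_eq_norm_sq, he]
  ring

theorem reg_eq {e : E3} {α ε t : ℝ} (ht : 0 < t) (ξ : E3) :
    reg ε ξ = 1 / ((1 + ε ^ 2 * (2 * Real.pi) ^ 2 * (‖ξ‖ ^ 2 - (inner ℝ e ξ) ^ 2)) +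
      (ε * t ^ (α - 1)) ^ 2 * kap e α t ξ ^ 2) := by
  unfold reg kap
  have : t ^ (α - 1) * t ^ (1 - α) = 1 := by
    rw [← Real.rpow_add ht]; simp
  congr 1
  linear_combination -(ε ^ 2 * (2 * Real.pi) ^ 2 * (inner ℝ e ξ) ^ 2 *
    (t ^ (α - 1) * t ^ (1 - α) + 1)) * this

/-- A shift along `e` does not change the transverse frequency. In terms of `κ` the regularizer is
thus `1 / (N + δ² κ²)` with the same `N ≥ 1` at both points and `δ = ε t^{α-1} ≤ 1`. The constant is
independent of `ε`, and the factor `t^{1-α}` is the scaling of `κ`. -/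
theorem LipSym.sym_lip {a : ℝ → ℝ} (ha : LipSym a) : ∃ L : ℝ, 0 ≤ L ∧
    ∀ {e : E3} {α ε t : ℝ}, Adm e α ε t → ∀ ξ (s : ℝ),
      |sym a e α ε t ξ - sym a e α ε t (ξ - s • e)| ≤ L * t ^ (1 - α) * |s| := by
  obtain ⟨L, h0, h1, h2⟩ := ha
  refine ⟨7 * L * (2 * Real.pi), by positivity, fun {e α ε t} h ξ s => ?_⟩
  have ht : 0 < t := by linarith [h.one_le]
  unfold sym
  rw [reg_eq (e := e) (α := α) ht ξ, reg_eq (e := e) (α := α) ht (ξ - s • e)]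
  have hinv : ‖ξ - s • e‖ ^ 2 - (inner ℝ e (ξ - s • e)) ^ 2 = ‖ξ‖ ^ 2 - (inner ℝ e ξ) ^ 2 := by
    rw [norm_sub_sq_real, inner_sub_right, inner_smul_right, inner_smul_right, norm_smul,
      real_inner_self_eq_norm_sq, h.norm_e, real_inner_comm, Real.norm_eq_abs, mul_one, sq_abs]
    ring
  rw [hinv]
  have hN : 1 ≤ 1 + ε ^ 2 * (2 * Real.pi) ^ 2 * (‖ξ‖ ^ 2 - (inner ℝ e ξ) ^ 2) := by
    have : (inner ℝ e ξ) ^ 2 ≤ ‖ξ‖ ^ 2 := by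
      have := abs_real_inner_le_norm e ξ
      rw [h.norm_e, one_mul] at this
      rw [← sq_abs]; gcongr
    have : 0 ≤ ε ^ 2 * (2 * Real.pi) ^ 2 * (‖ξ‖ ^ 2 - (inner ℝ e ξ) ^ 2) :=
      mul_nonneg (by positivity) (by linarith)
    linarith
  have hpow : t ^ (α - 1) ≤ 1 := Real.rpow_le_one_of_one_le_of_nonpos h.one_le
    (by linarith [h.lt_one])
  have hp0 : 0 < t ^ (α - 1) := Real.rpow_pos_of_pos ht _
  refine (regularized_lip hN (mul_nonneg h.pos.le hp0.le) (mul_le_one₀ h.le_one hp0.le hpow) h0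
    (h1 _ _) (h2 _)).trans (le_of_eq ?_)
  rw [kap_shift h.norm_e, sub_sub_cancel, abs_mul, abs_of_pos (by positivity)]
  ring

/-- This bound degenerates as `ε → 0`. It serves only to make the operators bounded and continuous
in time, never to estimate anything uniformly. -/
theorem LipSym.norm_sym_le {a : ℝ → ℝ} (ha : LipSym a) : ∃ L : ℝ, 0 ≤ L ∧
    ∀ {e : E3} {α ε t : ℝ}, Adm e α ε t → ∀ ξ,
      ‖(sym a e α ε t ξ : ℂ)‖ ≤ L * (1 + t * (1 / (2 * ε))) := by
  obtain ⟨L, h0, -, h2⟩ := ha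
  refine ⟨L, h0, fun {e α ε t} h ξ => ?_⟩
  have ht : 0 < t := by linarith [h.one_le]
  rw [Complex.norm_real, Real.norm_eq_abs, sym, abs_mul, abs_of_nonneg (sq_nonneg (reg ε ξ))]
  have hr0 := reg_pos ε ξ
  have hr1 := reg_le_one ε ξ
  have htt : t ^ (1 - α) ≤ t := by
    have := Real.rpow_le_rpow_of_exponent_le h.one_le (by linarith [h.half_lt] : 1 - α ≤ 1)
    rwa [Real.rpow_one] at this
  have h3 : |kap e α t ξ| ≤ t * (2 * Real.pi * ‖ξ‖) := by
    unfold kap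
    rw [abs_mul, abs_of_pos (by positivity)]
    have := abs_real_inner_le_norm e ξ
    rw [h.norm_e, one_mul] at this
    calc _ ≤ 2 * Real.pi * t * ‖ξ‖ := by gcongr
      _ = _ := by ring
  have h4 : (2 * Real.pi * ‖ξ‖) * reg ε ξ ≤ 1 / (2 * ε) := by
    have hε := h.pos
    unfold reg
    rw [mul_one_div, div_le_div_iff₀ (by positivity) (by positivity)]
    nlinarith [sq_nonneg (ε * (2 * Real.pi * ‖ξ‖) - 1)]
  calc _ ≤ (L * (1 + |kap e α t ξ|)) * reg ε ξ ^ 2 := by gcongr; exact h2 _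
    _ ≤ (L * (1 + t * (2 * Real.pi * ‖ξ‖))) * (reg ε ξ ^ 2) := by gcongr
    _ = L * (reg ε ξ * reg ε ξ + t * ((2 * Real.pi * ‖ξ‖) * reg ε ξ) * reg ε ξ) := by
      ring
    _ ≤ L * (1 * 1 + t * (1 / (2 * ε)) * 1) := by
      have hε := h.pos
      have : 0 ≤ t * (1 / (2 * ε)) := by positivity
      gcongr
    _ = _ := by ring

theorem LipSym.continuous_sym {a : ℝ → ℝ} (ha : LipSym a) (e : E3) (α ε t : ℝ) :
    Continuous fun ξ => (sym a e α ε t ξ : ℂ) := by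
  have hc := ha.continuous
  have := continuous_reg ε
  unfold sym kap
  fun_prop

theorem LipSym.isBdd_sym {a : ℝ → ℝ} (ha : LipSym a) {e : E3} {α ε t : ℝ} (h : Adm e α ε t) :
    IsBdd fun ξ => (sym a e α ε t ξ : ℂ) := by
  obtain ⟨L, -, hL⟩ := ha.norm_sym_le
  exact IsBdd.of_continuous (ha.continuous_sym e α ε t) (hL h)

/-! ### Quadratic forms -/

/-- The form `Re ⟪u, a(κ) (1 - ε²Δ)⁻² z⟫`. -/
def BF (a : ℝ → ℝ) (e : E3) (α ε t : ℝ) (u z : L2) : ℝ :=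
  (⟪u, fourierMul (fun ξ => (sym a e α ε t ξ : ℂ)) z⟫_ℂ).re

/-- Multiplication by `Q(⟪e, x⟫ / t^α)`. -/
def loc (Q : ℝ → ℝ) (e : E3) (α t : ℝ) (w : L2) : L2 := mulOp (cut e (t ^ α) Q) w

/-- The form `Re ⟪Q w, a(κ) (1 - ε²Δ)⁻² w⟫` with `Q = Q(⟪e, x⟫ / t^α)`. -/
def S2 (Q a : ℝ → ℝ) (e : E3) (α ε t : ℝ) (w : L2) : ℝ := BF a e α ε t (loc Q e α t w) w

section BF

variable {a b : ℝ → ℝ} {e : E3} {α ε t : ℝ}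

theorem BF_add_left (u u' z : L2) : BF a e α ε t (u + u') z = BF a e α ε t u z + BF a e α ε t u' z := by
  simp [BF, inner_add_left]

theorem BF_add_right (u z z' : L2) : BF a e α ε t u (z + z') = BF a e α ε t u z + BF a e α ε t u z' := by
  simp [BF, inner_add_right]

theorem BF_smul_left (c : ℝ) (u z : L2) : BF a e α ε t ((c : ℂ) • u) z = c * BF a e α ε t u z := by
  simp only [BF, inner_smul_left, Complex.conj_ofReal, Complex.re_ofReal_mul]

theorem BF_smul_right (c : ℝ) (u z : L2) : BF a e α ε t u ((c : ℂ) • z) = c * BF a e α ε t u z := by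
  simp only [BF, map_smul, inner_smul_right, Complex.re_ofReal_mul]

theorem BF_comm (h : Adm e α ε t) (ha : LipSym a) (u z : L2) :
    BF a e α ε t u z = BF a e α ε t z u := by
  unfold BF
  rw [← inner_fourierMul_comm (ha.isBdd_sym h), ← inner_conj_symm, Complex.conj_re]

theorem BF_add (h : Adm e α ε t) (ha : LipSym a) (hb : LipSym b) (u z : L2) :
    BF (fun k => a k + b k) e α ε t u z = BF a e α ε t u z + BF b e α ε t u z := by
  unfold BF
  rw [← Complex.add_re, ← inner_add_right, ← fourierMul_add (ha.isBdd_sym h) (hb.isBdd_sym h)]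
  congr 4
  funext ξ
  unfold sym; push_cast; ring

theorem BF_const_mul (h : Adm e α ε t) (ha : LipSym a) (c : ℝ) (u z : L2) :
    BF (fun k => c * a k) e α ε t u z = c * BF a e α ε t u z := by
  unfold BF
  rw [← Complex.re_ofReal_mul, ← inner_smul_right, ← fourierMul_const_mul _ (ha.isBdd_sym h)]
  congr 4
  funext ξ
  unfold sym; push_cast; ring

theorem isBdd_sqrt {A : E3 → ℝ} (hA : IsBdd fun ξ => (A ξ : ℂ)) :
    IsBdd fun ξ => ((Real.sqrt (A ξ) : ℝ) : ℂ) := by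
  obtain ⟨h1, D, hD⟩ := hA
  have h1' : Measurable A := by
    have := Complex.measurable_re.comp h1
    exact this
  refine ⟨Complex.measurable_ofReal.comp h1'.sqrt, Real.sqrt D, fun ξ => ?_⟩
  rw [Complex.norm_real, Real.norm_of_nonneg (Real.sqrt_nonneg _)]
  refine Real.sqrt_le_sqrt ?_
  have := hD ξ
  rw [Complex.norm_real] at this
  exact (le_abs_self _).trans this

theorem re_inner_fourierMul_mul {p q : E3 → ℝ} (hp : IsBdd fun ξ => (p ξ : ℂ))
    (hq : IsBdd fun ξ => (q ξ : ℂ)) (u z : L2) :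
    ⟪u, fourierMul (fun ξ => ((p ξ * q ξ : ℝ) : ℂ)) z⟫_ℂ =
      ⟪fourierMul (fun ξ => (p ξ : ℂ)) u, fourierMul (fun ξ => (q ξ : ℂ)) z⟫_ℂ := by
  rw [inner_fourierMul_comm hp, ← fourierMul_mul hp hq]
  simp_rw [Complex.ofReal_mul]

theorem re_inner_fourierMul_self {p : E3 → ℝ} (hp : IsBdd fun ξ => (p ξ : ℂ)) (hp0 : ∀ ξ, 0 ≤ p ξ)
    (u : L2) : (⟪u, fourierMul (fun ξ => (p ξ : ℂ)) u⟫_ℂ).re =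
      ‖fourierMul (fun ξ => ((Real.sqrt (p ξ) : ℝ) : ℂ)) u‖ ^ 2 := by
  have := re_inner_fourierMul_mul (isBdd_sqrt hp) (isBdd_sqrt hp) u u
  simp_rw [Real.mul_self_sqrt (hp0 _)] at this
  rw [this, ← inner_self_eq_norm_sq (𝕜 := ℂ)]
  rfl

theorem BF_self_nonneg (h : Adm e α ε t) (ha : LipSym a) (ha0 : ∀ k, 0 ≤ a k) (u : L2) :
    0 ≤ BF a e α ε t u u := by
  unfold BF
  rw [re_inner_fourierMul_self (ha.isBdd_sym h) fun ξ => mul_nonneg (ha0 _) (sq_nonneg _)]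
  positivity

theorem BF_self_mono (h : Adm e α ε t) (ha : LipSym a) (hb : LipSym b) (hab : ∀ k, a k ≤ b k)
    (u : L2) : BF a e α ε t u u ≤ BF b e α ε t u u := by
  have := BF_self_nonneg h (hb.add (ha.const_mul (-1))) (fun k => by linarith [hab k]) u
  rw [BF_add h hb (ha.const_mul _), BF_const_mul h ha] at this
  linarith

/-- Cauchy–Schwarz with a free weight. The forms of `b + a` at `u + σμz` and of `b - a` at `u - σμz`
are nonnegative for `σ = ±1`; in their sum the cross terms of `b` and the diagonal terms of `a` drop
out. -/
theorem abs_BF_le (h : Adm e α ε t) (ha : LipSym a) (hb : LipSym b) (hab : ∀ k, |a k| ≤ b k)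
    {μ : ℝ} (hμ : 0 < μ) (u z : L2) :
    |BF a e α ε t u z| ≤ (μ⁻¹ * BF b e α ε t u u + μ * BF b e α ε t z z) / 2 := by
  have hb0 : ∀ k, 0 ≤ b k := fun k => (abs_nonneg _).trans (hab k)
  have key : ∀ σ : ℝ, σ ^ 2 = 1 → 0 ≤ BF b e α ε t u u + 2 * σ * μ * BF a e α ε t u z +
      μ ^ 2 * BF b e α ε t z z := by
    intro σ hσ
    have hp : LipSym fun k => b k + a k := hb.add ha
    have hm : LipSym fun k => b k + -1 * a k := hb.add (ha.const_mul _)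
    have h1 := BF_self_nonneg h hp (fun k => by linarith [neg_le_of_abs_le (hab k)])
      (u + ((σ * μ : ℝ) : ℂ) • z)
    have h2 := BF_self_nonneg h hm (fun k => by linarith [le_of_abs_le (hab k)])
      (u + ((-(σ * μ) : ℝ) : ℂ) • z)
    simp only [BF_add_left, BF_add_right, BF_smul_left, BF_smul_right, BF_add h hb ha,
      BF_add h hb (ha.const_mul _), BF_const_mul h ha, BF_comm h ha z u, BF_comm h hb z u] at h1 h2
    have e : σ * μ * (σ * μ * BF b e α ε t z z) = μ ^ 2 * BF b e α ε t z z := by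
      linear_combination μ ^ 2 * BF b e α ε t z z * hσ
    linarith
  have k1 := key 1 (by norm_num)
  have k2 := key (-1) (by norm_num)
  have e1 : (μ⁻¹ * BF b e α ε t u u + μ * BF b e α ε t z z) / 2 =
      (BF b e α ε t u u + μ ^ 2 * BF b e α ε t z z) / (2 * μ) := by field_simp
  rw [e1, abs_le]
  constructor
  · rw [neg_le, le_div_iff₀ (by positivity)]
    linarith
  · rw [le_div_iff₀ (by positivity)]
    linarith

end BF

section loc

variable {Q Q' : ℝ → ℝ} {e : E3} {α t : ℝ}

theorem loc_mul (hQ : StepLike Q) (hQ' : StepLike Q') (w : L2) :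
    loc (fun y => Q y * Q' y) e α t w = loc Q e α t (loc Q' e α t w) := by
  unfold loc
  rw [← mulOp_mul (hQ.isBdd _ _) (hQ'.isBdd _ _)]
  congr 2
  funext x
  simp [cut]

theorem loc_add (hQ : StepLike Q) (hQ' : StepLike Q') (w : L2) :
    loc (fun y => Q y + Q' y) e α t w = loc Q e α t w + loc Q' e α t w := by
  unfold loc
  rw [← mulOp_add (hQ.isBdd _ _) (hQ'.isBdd _ _)]
  congr 2
  funext x
  simp [cut]

theorem loc_const_mul (hQ : StepLike Q) (c : ℝ) (w : L2) :
    loc (fun y => c * Q y) e α t w = (c : ℂ) • loc Q e α t w := by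
  unfold loc
  rw [← mulOp_const_mul _ (hQ.isBdd _ _)]
  congr 2
  funext x
  simp [cut]

theorem inner_loc (hQ : StepLike Q) (u z : L2) :
    ⟪loc Q e α t u, z⟫_ℂ = ⟪u, loc Q e α t z⟫_ℂ :=
  inner_mulOp_comm (r := fun x => Q (inner ℝ e x / t ^ α)) (hQ.isBdd e (t ^ α)) u z

theorem norm_loc_le {D : ℝ} (hQ : StepLike Q) (hD : ∀ y, |Q y| ≤ D) (w : L2) :
    ‖loc Q e α t w‖ ≤ D * ‖w‖ :=
  norm_mulOp_le (hQ.isBdd _ _) (fun x => by rw [cut, Complex.norm_real]; exact hD _) w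

theorem loc_comm (hQ : StepLike Q) (hQ' : StepLike Q') (w : L2) :
    loc Q e α t (loc Q' e α t w) = loc Q' e α t (loc Q e α t w) :=
  mulOp_comm (hQ.isBdd _ _) (hQ'.isBdd _ _) w

end loc

theorem StepLike.mul {Q Q' : ℝ → ℝ} (hQ : StepLike Q) (hQ' : StepLike Q') :
    StepLike (fun y => Q y * Q' y) := by
  refine ⟨hQ.smooth.mul hQ'.smooth, ?_⟩
  have h1 : Differentiable ℝ Q := hQ.smooth.differentiable (by simp)
  have h2 : Differentiable ℝ Q' := hQ'.smooth.differentiable (by simp)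
  have : _root_.deriv (fun y => Q y * Q' y) =
      fun y => _root_.deriv Q y * Q' y + Q y * _root_.deriv Q' y :=
    funext fun y => deriv_fun_mul (h1 y) (h2 y)
  rw [this]
  exact (hQ.compact.mul_right).add (hQ'.compact.mul_left)

theorem StepLike.add {Q Q' : ℝ → ℝ} (hQ : StepLike Q) (hQ' : StepLike Q') :
    StepLike (fun y => Q y + Q' y) := by
  refine ⟨hQ.smooth.add hQ'.smooth, ?_⟩
  have h1 : Differentiable ℝ Q := hQ.smooth.differentiable (by simp)
  have h2 : Differentiable ℝ Q' := hQ'.smooth.differentiable (by simp)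
  have : _root_.deriv (fun y => Q y + Q' y) = fun y => _root_.deriv Q y + _root_.deriv Q' y :=
    funext fun y => deriv_fun_add (h1 y) (h2 y)
  rw [this]
  exact hQ.compact.add hQ'.compact

theorem StepLike.const (c : ℝ) : StepLike (fun _ => c) :=
  ⟨contDiff_const, by
    rw [show _root_.deriv (fun _ : ℝ => c) = 0 by funext y; simp]
    exact HasCompactSupport.zero⟩

theorem StepLike.const_mul {Q : ℝ → ℝ} (hQ : StepLike Q) (c : ℝ) : StepLike (fun y => c * Q y) :=
  (StepLike.const c).mul hQ

section LocalizedForms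

variable {Q Q' a b : ℝ → ℝ} {e : E3} {α ε t : ℝ}

theorem S2_add_left (hQ : StepLike Q) (hQ' : StepLike Q') (w : L2) :
    S2 (fun y => Q y + Q' y) a e α ε t w = S2 Q a e α ε t w + S2 Q' a e α ε t w := by
  unfold S2
  rw [loc_add hQ hQ', BF_add_left]

theorem S2_const_mul_left (hQ : StepLike Q) (c : ℝ) (w : L2) :
    S2 (fun y => c * Q y) a e α ε t w = c * S2 Q a e α ε t w := by
  unfold S2
  rw [loc_const_mul hQ, BF_smul_left]

theorem S2_add (h : Adm e α ε t) (ha : LipSym a) (hb : LipSym b) (w : L2) :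
    S2 Q (fun k => a k + b k) e α ε t w = S2 Q a e α ε t w + S2 Q b e α ε t w :=
  BF_add h ha hb _ _

theorem S2_const_mul (h : Adm e α ε t) (ha : LipSym a) (c : ℝ) (w : L2) :
    S2 Q (fun k => c * a k) e α ε t w = c * S2 Q a e α ε t w :=
  BF_const_mul h ha c _ _

theorem rpow_div_rpow_eq (ht : 0 < t) (L : ℝ) :
    L * t ^ (1 - α) / t ^ α = L * t ^ (1 - 2 * α) := by
  rw [mul_div_assoc, ← Real.rpow_sub ht]
  ring_nf

/-- Gårding at the scales of the problem: the symbol has Lipschitz constant of order `t^{1-α}` and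
the cutoff lives on scale `t^α`, so the loss is `t^{1-2α}`. -/
theorem S2_nonneg (hQ : StepLike Q) (hQ0 : ∀ y, 0 ≤ Q y) (ha : LipSym a) (ha0 : ∀ k, 0 ≤ a k) :
    ∃ C : ℝ, 0 ≤ C ∧ ∀ {e : E3} {α ε t : ℝ}, Adm e α ε t → ∀ w : L2,
      -(C * t ^ (1 - 2 * α) * ‖w‖ ^ 2) ≤ S2 Q a e α ε t w := by
  obtain ⟨C, hC0, hC⟩ := hQ.commBound
  obtain ⟨L, hL0, hL⟩ := ha.sym_lip
  refine ⟨C * L, by positivity, fun {e α ε t} h w => ?_⟩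
  have ht : 0 < t := by linarith [h.one_le]
  have := hC.garding hQ hQ0 (ha.isBdd_sym h) (fun ξ => mul_nonneg (ha0 _) (sq_nonneg _))
    (Real.rpow_pos_of_pos ht α) (hL h) w
  rw [rpow_div_rpow_eq ht, ← mul_assoc C] at this
  exact this

theorem BF_commutator (hQ : StepLike Q) (ha : LipSym a) :
    ∃ C : ℝ, 0 ≤ C ∧ ∀ {e : E3} {α ε t : ℝ}, Adm e α ε t → ∀ u z : L2,
      |BF a e α ε t u (loc Q e α t z) - BF a e α ε t (loc Q e α t u) z| ≤
        C * t ^ (1 - 2 * α) * (‖u‖ * ‖z‖) := by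
  obtain ⟨C, hC0, hC⟩ := hQ.commBound
  obtain ⟨L, hL0, hL⟩ := ha.sym_lip
  refine ⟨C * L, by positivity, fun {e α ε t} h u z => ?_⟩
  have ht : 0 < t := by linarith [h.one_le]
  have := hC.commutator (ha.isBdd_sym h) (Real.rpow_pos_of_pos ht α) (hL h) u z
  rw [rpow_div_rpow_eq ht, ← mul_assoc C] at this
  refine le_trans ?_ this
  unfold BF
  rw [inner_loc hQ, ← Complex.sub_re]
  exact Complex.abs_re_le_norm _

/-- One cutoff is commuted through the symbol and merged with the other. This passes between
genuinely two-sided localization and the one-sided forms `S2`, which are linear in the cutoff. -/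
theorem S2_split (hQ : StepLike Q) (hQ' : StepLike Q') (ha : LipSym a) :
    ∃ C : ℝ, 0 ≤ C ∧ ∀ {e : E3} {α ε t : ℝ}, Adm e α ε t → ∀ w : L2,
      |BF a e α ε t (loc Q e α t w) (loc Q' e α t w) - S2 (fun y => Q y * Q' y) a e α ε t w| ≤
        C * t ^ (1 - 2 * α) * ‖w‖ ^ 2 := by
  obtain ⟨C, hC0, hC⟩ := BF_commutator hQ' ha
  obtain ⟨D, hD0, hD⟩ := hQ.bounded
  refine ⟨C * D, by positivity, fun {e α ε t} h w => ?_⟩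
  have := hC h (loc Q e α t w) w
  have ht : 0 < t := by linarith [h.one_le]
  rw [← loc_comm hQ hQ', ← loc_mul hQ hQ'] at this
  refine this.trans ?_
  have h1 := norm_loc_le (e := e) (α := α) (t := t) hQ hD w
  calc C * t ^ (1 - 2 * α) * (‖loc Q e α t w‖ * ‖w‖) ≤ C * t ^ (1 - 2 * α) * (D * ‖w‖ * ‖w‖) := by
        gcongr
    _ = _ := by ring

/-- This is exactly `‖κ √m u - β √m z‖²`, with the regularizer included in the square root.
Boundedness of `κ √m` is read off from that of the symbol of `k² m`. -/
theorem BF_square_nonneg (h : Adm e α ε t) {m : ℝ → ℝ} (hm0 : ∀ k, 0 ≤ m k) (h0 : LipSym m)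
    (h2 : LipSym fun k => k ^ 2 * m k) (β : ℝ) (u z : L2) :
    0 ≤ BF (fun k => k ^ 2 * m k) e α ε t u u - 2 * β * BF (fun k => k * m k) e α ε t u z +
      β ^ 2 * BF m e α ε t z z := by
  set q : E3 → ℝ := fun ξ => Real.sqrt (sym m e α ε t ξ) with hq
  set p : E3 → ℝ := fun ξ => kap e α t ξ * q ξ with hp
  have hs0 : ∀ ξ, 0 ≤ sym m e α ε t ξ := fun ξ => mul_nonneg (hm0 _) (sq_nonneg _)
  have hqB : IsBdd fun ξ => (q ξ : ℂ) := isBdd_sqrt (h0.isBdd_sym h)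
  have hqq : ∀ ξ, q ξ * q ξ = sym m e α ε t ξ := fun ξ => Real.mul_self_sqrt (hs0 ξ)
  have hpB : IsBdd fun ξ => (p ξ : ℂ) := by
    obtain ⟨-, D, hD⟩ := h2.isBdd_sym h
    refine ⟨?_, Real.sqrt D, fun ξ => ?_⟩
    · have : Measurable fun ξ => (kap e α t ξ : ℂ) := by
        refine Continuous.measurable ?_
        unfold kap; fun_prop
      simp only [hp]
      push_cast
      exact this.mul hqB.1
    · rw [Complex.norm_real, Real.norm_eq_abs]
      refine Real.abs_le_sqrt ?_
      have h3 := hD ξ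
      rw [Complex.norm_real, Real.norm_eq_abs] at h3
      refine le_trans (le_of_eq ?_) ((le_abs_self _).trans h3)
      simp only [hp]
      rw [mul_pow, sq (q ξ), hqq]
      simp only [sym]; ring
  have e0 := re_inner_fourierMul_mul hqB hqB z z
  have e1 := re_inner_fourierMul_mul hpB hqB u z
  have e2 := re_inner_fourierMul_mul hpB hpB u u
  have f0 : BF m e α ε t z z = (⟪fourierMul (fun ξ => (q ξ : ℂ)) z,
      fourierMul (fun ξ => (q ξ : ℂ)) z⟫_ℂ).re := by
    rw [← e0]; unfold BF; simp_rw [hqq]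
  have f1 : BF (fun k => k * m k) e α ε t u z = (⟪fourierMul (fun ξ => (p ξ : ℂ)) u,
      fourierMul (fun ξ => (q ξ : ℂ)) z⟫_ℂ).re := by
    rw [← e1]; unfold BF; simp only [hp, mul_assoc, hqq, sym]
  have f2 : BF (fun k => k ^ 2 * m k) e α ε t u u = (⟪fourierMul (fun ξ => (p ξ : ℂ)) u,
      fourierMul (fun ξ => (p ξ : ℂ)) u⟫_ℂ).re := by
    rw [← e2]; unfold BF
    have : ∀ ξ, p ξ * p ξ = sym (fun k => k ^ 2 * m k) e α ε t ξ := fun ξ => by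
      simp only [hp, mul_mul_mul_comm, hqq, sym]; ring
    simp_rw [this]
  rw [f0, f1, f2]
  set U := fourierMul (fun ξ => (p ξ : ℂ)) u
  set Z := fourierMul (fun ξ => (q ξ : ℂ)) z
  have g := inner_self_nonneg (𝕜 := ℂ) (x := U - (β : ℂ) • Z)
  have hsym : (⟪Z, U⟫_ℂ).re = (⟪U, Z⟫_ℂ).re := inner_re_symm (𝕜 := ℂ) Z U
  simp only [inner_sub_left, inner_sub_right, inner_smul_left, inner_smul_right, Complex.conj_ofReal,
    RCLike.re_to_complex, Complex.sub_re, Complex.re_ofReal_mul, hsym] at g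
  linarith

/-- Apply the exact square to `u = θw` and `z = yθw` and merge the cutoffs. This quantizes `θ² m (κ
- βy)² ≥ 0`, the ordering of `y` and `κ` costing only `t^{1-2α}`. -/
theorem S2_square_nonneg {θ : ℝ → ℝ} (hθ : StepLike θ) (hsθ : StepLike fun y => y * θ y)
    {m : ℝ → ℝ} (hm0 : ∀ k, 0 ≤ m k) (h0 : LipSym m)
    (h1 : LipSym fun k => k * m k) (h2 : LipSym fun k => k ^ 2 * m k) (β : ℝ) :
    ∃ C : ℝ, 0 ≤ C ∧ ∀ {e : E3} {α ε t : ℝ}, Adm e α ε t → ∀ w : L2,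
      -(C * t ^ (1 - 2 * α) * ‖w‖ ^ 2) ≤
        S2 (fun y => θ y ^ 2) (fun k => k ^ 2 * m k) e α ε t w -
        2 * β * S2 (fun y => y * θ y ^ 2) (fun k => k * m k) e α ε t w +
        β ^ 2 * S2 (fun y => y ^ 2 * θ y ^ 2) m e α ε t w := by
  obtain ⟨C2, hC2, H2⟩ := S2_split hθ hθ h2
  obtain ⟨C1, hC1, H1⟩ := S2_split hθ hsθ h1
  obtain ⟨C0, hC0, H0⟩ := S2_split hsθ hsθ h0
  refine ⟨C2 + 2 * |β| * C1 + β ^ 2 * C0, by positivity, fun {e α ε t} h w => ?_⟩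
  have g := BF_square_nonneg h hm0 h0 h2 β (loc θ e α t w) (loc (fun y => y * θ y) e α t w)
  have i2 := H2 h w
  have i1 := H1 h w
  have i0 := H0 h w
  rw [show (fun y => θ y * θ y) = fun y => θ y ^ 2 by funext y; ring] at i2
  rw [show (fun y => θ y * (y * θ y)) = fun y => y * θ y ^ 2 by funext y; ring] at i1
  rw [show (fun y => y * θ y * (y * θ y)) = fun y => y ^ 2 * θ y ^ 2 by funext y; ring] at i0
  have j1 := mul_le_mul_of_nonneg_left i1 (abs_nonneg (2 * β))
  rw [← abs_mul, abs_mul 2 β, abs_two] at j1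
  have j0 := mul_le_mul_of_nonneg_left (abs_le.1 i0).2 (sq_nonneg β)
  have := (abs_le.1 i2).2
  have := (abs_le.1 j1).1
  nlinarith

end LocalizedForms

/-! ### Schwartz test functions -/

theorem HasCompactSupport.fderiv_real {Q : ℝ → ℝ} (h : HasCompactSupport (deriv Q)) :
    HasCompactSupport (fderiv ℝ Q) := by
  have : fderiv ℝ Q = fun y => ContinuousLinearMap.toSpanSingleton ℝ (deriv Q y) := by
    funext y; ext; simp
  rw [this]
  exact h.comp_left (g := fun r : ℝ => ContinuousLinearMap.toSpanSingleton ℝ r) (by simp)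

theorem StepLike.hasTemperateGrowth {Q : ℝ → ℝ} (hQ : StepLike Q) : Q.HasTemperateGrowth := by
  obtain ⟨D, -, hD⟩ := hQ.bounded
  refine Function.HasTemperateGrowth.of_fderiv (k := 0) (C := D) ?_
    (hQ.smooth.differentiable (by simp)) fun x => by simpa using hD x
  exact hQ.compact.fderiv_real.hasTemperateGrowth ((contDiff_infty_iff_fderiv.1 hQ.smooth).2)

theorem StepLike.hasTemperateGrowth_cut {Q : ℝ → ℝ} (hQ : StepLike Q) (e : E3) (R : ℝ) :
    (cut e R Q).HasTemperateGrowth := by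
  have h1 : (fun x : E3 => inner ℝ e x / R).HasTemperateGrowth := by
    simp_rw [div_eq_mul_inv]; fun_prop
  exact (Function.Complex.hasTemperateGrowth_ofReal).comp (hQ.hasTemperateGrowth.comp h1)

theorem hasTemperateGrowth_reg (ε : ℝ) : (reg ε).HasTemperateGrowth := by
  have h1 : (fun ξ : E3 => (ε * (2 * Real.pi)) • ξ).HasTemperateGrowth :=
    ((ε * (2 * Real.pi)) • ContinuousLinearMap.id ℝ E3).hasTemperateGrowth
  have h2 := (Function.hasTemperateGrowth_one_add_norm_sq_rpow E3 (-1)).comp h1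
  refine (funext fun ξ => ?_ : reg ε = _) ▸ h2
  simp only [Function.comp, reg]
  rw [norm_smul, Real.rpow_neg_one, one_div, mul_pow (‖_‖), Real.norm_eq_abs, sq_abs]
  ring

theorem toLp_smulLeftCLM {q : E3 → ℂ} (hq : q.HasTemperateGrowth) (hb : IsBdd q) (y : 𝓢(E3, ℂ)) :
    (SchwartzMap.smulLeftCLM ℂ q y).toLp 2 = mulOp q (y.toLp 2) := by
  ext1
  filter_upwards [mulOp_coe hb (y.toLp 2), y.coeFn_toLp 2 volume,
    (SchwartzMap.smulLeftCLM ℂ q y).coeFn_toLp 2 volume] with x a1 a2 a3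
  rw [a1, a2, a3, SchwartzMap.smulLeftCLM_apply_apply hq, smul_eq_mul]

theorem toLp_fourierMultiplierCLM {q : E3 → ℂ} (hq : q.HasTemperateGrowth) (hb : IsBdd q)
    (y : 𝓢(E3, ℂ)) :
    (SchwartzMap.fourierMultiplierCLM ℂ q y).toLp 2 = fourierMul q (y.toLp 2) := by
  rw [SchwartzMap.fourierMultiplierCLM_apply, ← SchwartzMap.toLp_fourierInv_eq,
    toLp_smulLeftCLM hq hb, ← SchwartzMap.toLp_fourier_eq, fourierMul_apply]

theorem isBdd_sq_mul_reg {ε : ℝ} (hε : 0 < ε) :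
    IsBdd fun ξ => (((2 * Real.pi * ‖ξ‖) ^ 2 * reg ε ξ : ℝ) : ℂ) := by
  refine IsBdd.of_continuous (C := 1 / ε ^ 2) ?_ fun ξ => ?_
  · have := continuous_reg ε
    fun_prop
  · rw [Complex.norm_real, Real.norm_of_nonneg (mul_nonneg (sq_nonneg _) (reg_pos _ _).le)]
    unfold reg
    rw [mul_one_div, div_le_div_iff₀ (by positivity) (by positivity)]
    nlinarith

theorem isBdd_inner_mul_reg {ε : ℝ} (hε : 0 < ε) (e : E3) :
    IsBdd fun ξ => ((2 * Real.pi * inner ℝ e ξ * reg ε ξ : ℝ) : ℂ) := by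
  refine IsBdd.of_continuous (C := ‖e‖ * (1 / (2 * ε))) ?_ fun ξ => ?_
  · have := continuous_reg ε
    fun_prop
  · rw [Complex.norm_real, norm_mul, norm_mul, Real.norm_of_nonneg (reg_pos _ _).le,
      Real.norm_of_nonneg (by positivity : (0 : ℝ) ≤ 2 * Real.pi)]
    have h4 : (2 * Real.pi * ‖ξ‖) * reg ε ξ ≤ 1 / (2 * ε) := by
      unfold reg
      rw [mul_one_div, div_le_div_iff₀ (by positivity) (by positivity)]
      nlinarith [sq_nonneg (ε * (2 * Real.pi * ‖ξ‖) - 1)]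
    calc _ ≤ 2 * Real.pi * (‖e‖ * ‖ξ‖) * reg ε ξ := by
          gcongr
          · exact (reg_pos _ _).le
          · exact norm_inner_le_norm e ξ
      _ = ‖e‖ * ((2 * Real.pi * ‖ξ‖) * reg ε ξ) := by ring
      _ ≤ _ := by gcongr

theorem SchwartzMap.toLp_add' (f g : 𝓢(E3, ℂ)) : ((f + g).toLp 2 volume : L2) = f.toLp 2 volume + g.toLp 2 volume :=
  map_add (SchwartzMap.toLpCLM ℂ (E := E3) ℂ 2 volume) f g

theorem SchwartzMap.toLp_smul' (c : ℂ) (f : 𝓢(E3, ℂ)) : ((c • f).toLp 2 volume : L2) = c • (f.toLp 2 volume : L2) :=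
  map_smul (SchwartzMap.toLpCLM ℂ (E := E3) ℂ 2 volume) c f

/-- The resolvent preserves Schwartz functions. Testing the equation with resolvents of `ζ` makes
one and two derivatives of the test function bounded in `L²` by `ζ`, so that the equation can be
read as an identity between `L²` vectors. -/
theorem exists_schwartz_reg {ε : ℝ} (hε : 0 < ε) (ζ : 𝓢(E3, ℂ)) : ∃ y : 𝓢(E3, ℂ),
    y.toLp 2 = fourierMul (fun ξ => (reg ε ξ : ℂ)) (ζ.toLp 2) ∧
    (Δ y).toLp 2 = (-1 : ℂ) •
      fourierMul (fun ξ => (((2 * Real.pi * ‖ξ‖) ^ 2 * reg ε ξ : ℝ) : ℂ)) (ζ.toLp 2) ∧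
    ∀ e : E3, (∂_{e} y).toLp 2 = Complex.I •
      fourierMul (fun ξ => ((2 * Real.pi * inner ℝ e ξ * reg ε ξ : ℝ) : ℂ)) (ζ.toLp 2) := by
  have hr := hasTemperateGrowth_reg ε
  have hrc : (fun ξ => (reg ε ξ : ℂ)).HasTemperateGrowth :=
    (Function.Complex.hasTemperateGrowth_ofReal).comp hr
  refine ⟨SchwartzMap.fourierMultiplierCLM ℂ (fun ξ => (reg ε ξ : ℂ)) ζ,
    toLp_fourierMultiplierCLM hrc (isBdd_reg ε) ζ, ?_, fun e => ?_⟩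
  · rw [SchwartzMap.laplacian_eq_fourierMultiplierCLM,
      ← SchwartzMap.fourierMultiplierCLM_ofReal ℂ (by fun_prop),
      SchwartzMap.fourierMultiplierCLM_fourierMultiplierCLM_apply (by fun_prop) hrc]
    have h1 : (fun ξ => (((2 * Real.pi * ‖ξ‖) ^ 2 * reg ε ξ : ℝ) : ℂ)).HasTemperateGrowth := by
      refine (Function.Complex.hasTemperateGrowth_ofReal).comp (Function.HasTemperateGrowth.mul ?_ hr)
      simp_rw [mul_pow]
      fun_prop
    rw [← toLp_fourierMultiplierCLM h1 (isBdd_sq_mul_reg hε), ← SchwartzMap.toLp_smul']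
    congr 1
    have h2 : (fun ξ : E3 => (((2 * Real.pi * ‖ξ‖) ^ 2 * reg ε ξ : ℝ) : ℂ)) =
        (((2 * Real.pi) ^ 2 : ℝ) : ℂ) • ((fun ξ : E3 => ((‖ξ‖ ^ 2 : ℝ) : ℂ)) *
          fun ξ => (reg ε ξ : ℂ)) := by
      funext ξ
      simp only [Pi.smul_apply, Pi.mul_apply, smul_eq_mul]
      push_cast; ring
    rw [h2, SchwartzMap.fourierMultiplierCLM_smul]
    · ext x
      simp only [_root_.smul_apply, smul_eq_mul,
        Complex.real_smul]
      push_cast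
      simp
    · have : (fun ξ : E3 => ((‖ξ‖ ^ 2 : ℝ) : ℂ)).HasTemperateGrowth :=
        (Function.Complex.hasTemperateGrowth_ofReal).comp (Function.hasTemperateGrowth_norm_sq E3)
      exact this.mul hrc
  · have hi : (fun ξ : E3 => (inner ℝ ξ e : ℝ)).HasTemperateGrowth := by fun_prop
    have hic : (fun ξ : E3 => ((inner ℝ ξ e : ℝ) : ℂ)).HasTemperateGrowth :=
      (Function.Complex.hasTemperateGrowth_ofReal).comp hi
    rw [SchwartzMap.lineDeriv_eq_fourierMultiplierCLM,
      ← SchwartzMap.fourierMultiplierCLM_ofReal ℂ hi]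
    have h0 := SchwartzMap.fourierMultiplierCLM_fourierMultiplierCLM_apply (F := ℂ) hic hrc ζ
    rw [show (fun ξ : E3 => (RCLike.ofReal (inner ℝ ξ e) : ℂ)) =
      fun ξ : E3 => ((inner ℝ ξ e : ℝ) : ℂ) from rfl, h0]
    have h1 : (fun ξ => ((2 * Real.pi * inner ℝ e ξ * reg ε ξ : ℝ) : ℂ)).HasTemperateGrowth := by
      refine (Function.Complex.hasTemperateGrowth_ofReal).comp (Function.HasTemperateGrowth.mul ?_ hr)
      fun_prop
    rw [← toLp_fourierMultiplierCLM h1 (isBdd_inner_mul_reg hε e), ← SchwartzMap.toLp_smul']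
    congr 1
    have h2 : (fun ξ : E3 => ((2 * Real.pi * inner ℝ e ξ * reg ε ξ : ℝ) : ℂ)) =
        ((2 * Real.pi : ℝ) : ℂ) • ((fun ξ : E3 => ((inner ℝ ξ e : ℝ) : ℂ)) *
          fun ξ => (reg ε ξ : ℂ)) := by
      funext ξ
      simp only [Pi.smul_apply, Pi.mul_apply, smul_eq_mul, real_inner_comm e ξ]
      push_cast; ring
    rw [h2, SchwartzMap.fourierMultiplierCLM_smul (hic.mul hrc)]
    ext x
    simp only [_root_.smul_apply, smul_eq_mul]
    push_cast
    ring

theorem lineDeriv_smulLeftCLM_cut {Q : ℝ → ℝ} (hQ : StepLike Q) (e : E3) (R : ℝ) (m : E3)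
    (y : 𝓢(E3, ℂ)) :
    ∂_{m} (SchwartzMap.smulLeftCLM ℂ (cut e R Q) y) =
      ((inner ℝ e m / R : ℝ) : ℂ) • SchwartzMap.smulLeftCLM ℂ (cut e R (deriv Q)) y +
        SchwartzMap.smulLeftCLM ℂ (cut e R Q) (∂_{m} y) := by
  ext x
  rw [SchwartzMap.lineDerivOp_apply_eq_fderiv, SchwartzMap.smulLeftCLM_apply
    (hQ.hasTemperateGrowth_cut e R), _root_.add_apply, _root_.smul_apply,
    SchwartzMap.smulLeftCLM_apply_apply (hQ.deriv.hasTemperateGrowth_cut e R),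
    SchwartzMap.smulLeftCLM_apply_apply (hQ.hasTemperateGrowth_cut e R),
    SchwartzMap.lineDerivOp_apply_eq_fderiv]
  have h1 : HasFDerivAt (fun x : E3 => inner ℝ e x / R) ((1 / R) • innerSL ℝ e) x := by
    have := ((innerSL ℝ e).hasFDerivAt (x := x)).const_mul (1 / R)
    refine this.congr_of_eventuallyEq (Eventually.of_forall fun z => ?_)
    simp [div_eq_inv_mul]
  have h2 : HasDerivAt (fun r : ℝ => (Q r : ℂ)) ((deriv Q (inner ℝ e x / R) : ℝ) : ℂ) (inner ℝ e x / R) :=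
    ((hQ.smooth.differentiable (by simp)) _).hasDerivAt.ofReal_comp
  have h3 := h2.hasFDerivAt.comp x h1
  have h4 := (h3.smul (y.hasFDerivAt x)).fderiv
  change fderiv ℝ (((fun r : ℝ => (Q r : ℂ)) ∘ fun x : E3 => inner ℝ e x / R) • ⇑y) x m = _
  rw [h4]
  simp [cut]
  ring

theorem laplacian_smulLeftCLM_cut {Q : ℝ → ℝ} (hQ : StepLike Q) {e : E3} (he : ‖e‖ = 1) (R : ℝ)
    (y : 𝓢(E3, ℂ)) :
    Δ (SchwartzMap.smulLeftCLM ℂ (cut e R Q) y) =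
      SchwartzMap.smulLeftCLM ℂ (cut e R Q) (Δ y) +
      (((2 / R : ℝ) : ℂ) • SchwartzMap.smulLeftCLM ℂ (cut e R (deriv Q)) (∂_{e} y) +
      ((1 / R ^ 2 : ℝ) : ℂ) • SchwartzMap.smulLeftCLM ℂ (cut e R (deriv (deriv Q))) y) := by
  set b := stdOrthonormalBasis ℝ E3
  rw [SchwartzMap.laplacian_eq_sum b, SchwartzMap.laplacian_eq_sum b]
  have h1 : ∀ i, ∂_{b i} (∂_{b i} (SchwartzMap.smulLeftCLM ℂ (cut e R Q) y)) =
      SchwartzMap.smulLeftCLM ℂ (cut e R Q) (∂_{b i} (∂_{b i} y)) +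
      (((2 / R : ℝ) : ℂ) • SchwartzMap.smulLeftCLM ℂ (cut e R (deriv Q))
        ((inner ℝ e (b i) : ℝ) • ∂_{b i} y) +
      (inner ℝ e (b i) : ℝ) ^ 2 • ((1 / R ^ 2 : ℝ) : ℂ) •
        SchwartzMap.smulLeftCLM ℂ (cut e R (deriv (deriv Q))) y) := by
    intro i
    rw [lineDeriv_smulLeftCLM_cut hQ, LineDeriv.lineDerivOp_add, LineDeriv.lineDerivOp_smul,
      lineDeriv_smulLeftCLM_cut hQ.deriv, lineDeriv_smulLeftCLM_cut hQ]
    ext x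
    simp only [_root_.add_apply, _root_.smul_apply,
      SchwartzMap.smulLeftCLM_apply_apply (hQ.hasTemperateGrowth_cut e R),
      SchwartzMap.smulLeftCLM_apply_apply (hQ.deriv.hasTemperateGrowth_cut e R),
      SchwartzMap.smulLeftCLM_apply_apply (hQ.deriv.deriv.hasTemperateGrowth_cut e R),
      smul_eq_mul, Complex.real_smul]
    push_cast
    ring
  simp_rw [h1, Finset.sum_add_distrib, ← map_sum, ← Finset.smul_sum, ← map_sum]
  rw [← Finset.sum_smul, b.sum_sq_inner_left, he, one_pow, one_smul]
  congr 4
  have : e = ∑ i, (inner ℝ e (b i) : ℝ) • b i := by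
    conv_lhs => rw [← b.sum_repr' e]
    simp_rw [real_inner_comm]
  conv_rhs => rw [this]
  ext x
  rw [SchwartzMap.lineDerivOp_apply_eq_fderiv, map_sum, _root_.sum_apply]
  simp [SchwartzMap.lineDerivOp_apply_eq_fderiv]

/-! ### Approximate right derivatives -/

/-- `V'` is a right derivative of `V` at `t` up to an error of size `b`. -/
def ApproxDeriv {E : Type*} [NormedAddCommGroup E] [NormedSpace ℝ E] (V : ℝ → E) (V' : E)
    (b t : ℝ) : Prop :=
  ∃ g : ℝ → ℝ, Tendsto g (𝓝[>] t) (𝓝 b) ∧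
    ∀ᶠ t' in 𝓝[>] t, ‖V t' - V t - (t' - t) • V'‖ ≤ g t' * (t' - t)

theorem tendsto_sub_nhdsGT (t : ℝ) : Tendsto (fun t' => t' - t) (𝓝[>] t) (𝓝 0) := by
  have : Tendsto (fun t' => t' - t) (𝓝 t) (𝓝 (t - t)) := (continuous_id.sub continuous_const).tendsto t
  rw [sub_self] at this
  exact this.mono_left nhdsWithin_le_nhds

namespace ApproxDeriv

variable {E : Type*} [NormedAddCommGroup E] [NormedSpace ℝ E] {V : ℝ → E} {V' : E} {b t : ℝ}

theorem tendsto (h : ApproxDeriv V V' b t) : Tendsto V (𝓝[>] t) (𝓝 (V t)) := by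
  obtain ⟨g, hg, h1⟩ := h
  have h2 : Tendsto (fun t' => g t' * (t' - t) + ‖(t' - t) • V'‖) (𝓝[>] t) (𝓝 (b * 0 + ‖(0 : ℝ) • V'‖)) :=
    (hg.mul (tendsto_sub_nhdsGT t)).add ((tendsto_sub_nhdsGT t).smul_const V').norm
  rw [mul_zero, zero_smul, norm_zero, add_zero] at h2
  rw [tendsto_iff_norm_sub_tendsto_zero]
  refine squeeze_zero' (Eventually.of_forall fun _ => norm_nonneg _) ?_ h2
  filter_upwards [h1] with t' h3
  have : V t' - V t = (V t' - V t - (t' - t) • V') + (t' - t) • V' := by abel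
  rw [this]
  exact (norm_add_le _ _).trans (by gcongr)

theorem mono (h : ApproxDeriv V V' b t) {b' : ℝ} (hb : b ≤ b') : ApproxDeriv V V' b' t := by
  obtain ⟨g, hg, h1⟩ := h
  refine ⟨fun t' => g t' + (b' - b), by simpa using hg.add_const (b' - b), ?_⟩
  filter_upwards [h1, self_mem_nhdsWithin] with t' h2 h3
  have : (0 : ℝ) < t' - t := sub_pos.2 h3
  exact h2.trans (by gcongr; linarith)

theorem sub (h : ApproxDeriv V V' b t) {U : ℝ → E} {U' : E} {b' : ℝ} (h' : ApproxDeriv U U' b' t) :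
    ApproxDeriv (fun t => V t - U t) (V' - U') (b + b') t := by
  obtain ⟨g, hg, h1⟩ := h
  obtain ⟨g', hg', h1'⟩ := h'
  refine ⟨fun t' => g t' + g' t', hg.add hg', ?_⟩
  filter_upwards [h1, h1'] with t' h2 h3
  have : V t' - U t' - (V t - U t) - (t' - t) • (V' - U') =
      (V t' - V t - (t' - t) • V') - (U t' - U t - (t' - t) • U') := by rw [smul_sub]; abel
  rw [this]
  refine (norm_sub_le _ _).trans ?_
  rw [add_mul]
  exact add_le_add h2 h3

end ApproxDeriv

/-- A product rule needing only strong convergence: of the operators at the single vector `V'`, and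
of their difference quotients at the single vector `V t`. Convergence in operator norm is not
required. -/
theorem ApproxDeriv.clm {V : ℝ → L2} {V' : L2} {b t : ℝ} (h : ApproxDeriv V V' b t)
    {A : ℝ → L2 →L[ℂ] L2} {B : ℝ} (hB1 : 0 ≤ B) (hB : ∀ᶠ t' in 𝓝[>] t, ∀ u, ‖A t' u‖ ≤ B * ‖u‖)
    (hA : Tendsto (fun t' => A t' V') (𝓝[>] t) (𝓝 (A t V'))) {D : L2}
    (hD : Tendsto (fun t' => (t' - t)⁻¹ • (A t' (V t) - A t (V t))) (𝓝[>] t) (𝓝 D)) :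
    ApproxDeriv (fun t' => A t' (V t')) (A t V' + D) (B * b) t := by
  obtain ⟨g, hg, h1⟩ := h
  refine ⟨fun t' => B * g t' + ‖A t' V' - A t V'‖ +
    ‖(t' - t)⁻¹ • (A t' (V t) - A t (V t)) - D‖, ?_, ?_⟩
  · have := ((hg.const_mul B).add (tendsto_iff_norm_sub_tendsto_zero.1 hA)).add
      (tendsto_iff_norm_sub_tendsto_zero.1 hD)
    simpa using this
  · filter_upwards [h1, hB, self_mem_nhdsWithin] with t' h2 h3 h4
    have hδ : (0 : ℝ) < t' - t := sub_pos.2 h4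
    have hB0 := h3 (V t' - V t - (t' - t) • V')
    have e1 : A t' (V t') - A t (V t) - (t' - t) • (A t V' + D) =
        A t' (V t' - V t - (t' - t) • V') + (t' - t) • (A t' V' - A t V') +
        (t' - t) • ((t' - t)⁻¹ • (A t' (V t) - A t (V t)) - D) := by
      rw [smul_sub (t' - t) ((t' - t)⁻¹ • _), smul_inv_smul₀ hδ.ne', map_sub, map_sub,
        ContinuousLinearMap.map_smul_of_tower, smul_add, smul_sub]
      abel
    rw [e1]
    refine (norm_add_le _ _).trans ?_
    rw [add_mul _ _ (t' - t), norm_smul, Real.norm_of_nonneg hδ.le, mul_comm (t' - t)]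
    refine add_le_add ?_ le_rfl
    refine (norm_add_le _ _).trans ?_
    rw [add_mul _ _ (t' - t), norm_smul, Real.norm_of_nonneg hδ.le, mul_comm (t' - t)]
    refine add_le_add ?_ le_rfl
    refine hB0.trans ?_
    rw [mul_assoc]
    gcongr

theorem L2.real_smul_eq (r : ℝ) (u : L2) : r • u = (r : ℂ) • u := by
  ext1
  filter_upwards [Lp.coeFn_smul r u, Lp.coeFn_smul (r : ℂ) u] with x h1 h2
  rw [h1, h2, Pi.smul_apply, Pi.smul_apply, Complex.real_smul, smul_eq_mul]

theorem ApproxDeriv.re_inner {V Y : ℝ → L2} {V' Y' : L2} {b b' t : ℝ} (h : ApproxDeriv V V' b t)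
    (h' : ApproxDeriv Y Y' b' t) :
    ApproxDeriv (fun t => (⟪V t, Y t⟫_ℂ).re) ((⟪V', Y t⟫_ℂ).re + (⟪V t, Y'⟫_ℂ).re)
      (b * ‖Y t‖ + ‖V t‖ * b') t := by
  have hY := h'.tendsto
  obtain ⟨g, hg, h1⟩ := h
  obtain ⟨g', hg', h1'⟩ := h'
  refine ⟨fun t' => g t' * ‖Y t'‖ + ‖V'‖ * ‖Y t' - Y t‖ + ‖V t‖ * g' t', ?_, ?_⟩
  · have := ((hg.mul hY.norm).add ((tendsto_iff_norm_sub_tendsto_zero.1 hY).const_mul ‖V'‖)).add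
      (hg'.const_mul ‖V t‖)
    simpa using this
  · filter_upwards [h1, h1', self_mem_nhdsWithin] with t' h2 h2' h4
    have hδ : (0 : ℝ) < t' - t := sub_pos.2 h4
    have hre : ∀ (r : ℝ) (u z : L2), (⟪r • u, z⟫_ℂ).re = r * (⟪u, z⟫_ℂ).re := fun r u z => by
      rw [L2.real_smul_eq, inner_smul_left, Complex.conj_ofReal, Complex.re_ofReal_mul]
    have hre' : ∀ (r : ℝ) (u z : L2), (⟪u, r • z⟫_ℂ).re = r * (⟪u, z⟫_ℂ).re := fun r u z => by
      rw [L2.real_smul_eq, inner_smul_right, Complex.re_ofReal_mul]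
    have e1 : (⟪V t', Y t'⟫_ℂ).re - (⟪V t, Y t⟫_ℂ).re -
        (t' - t) • ((⟪V', Y t⟫_ℂ).re + (⟪V t, Y'⟫_ℂ).re) =
        (⟪V t' - V t - (t' - t) • V', Y t'⟫_ℂ).re + (t' - t) * (⟪V', Y t' - Y t⟫_ℂ).re +
        (⟪V t, Y t' - Y t - (t' - t) • Y'⟫_ℂ).re := by
      simp only [inner_sub_left, inner_sub_right, Complex.sub_re, hre, hre', smul_eq_mul]
      ring
    rw [e1, Real.norm_eq_abs]
    refine (abs_add_three _ _ _).trans ?_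
    have i1 : ∀ u z : L2, |(⟪u, z⟫_ℂ).re| ≤ ‖u‖ * ‖z‖ := fun u z =>
      (Complex.abs_re_le_norm _).trans (norm_inner_le_norm u z)
    rw [abs_mul, abs_of_pos hδ]
    calc _ ≤ (g t' * (t' - t)) * ‖Y t'‖ + (t' - t) * (‖V'‖ * ‖Y t' - Y t‖) +
          ‖V t‖ * (g' t' * (t' - t)) := by
          refine add_le_add (add_le_add ((i1 _ _).trans ?_) ?_) ((i1 _ _).trans ?_)
          · gcongr
          · exact mul_le_mul_of_nonneg_left (i1 _ _) hδ.le
          · gcongr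
      _ = _ := by ring

/-- A function whose approximate right derivative is bounded below by `g` grows at least like the
integral of `g`. -/
theorem integral_le_sub_of_approxDeriv {r r' b g : ℝ → ℝ} {T t₁ t₂ : ℝ}
    (hr : ContinuousOn r (Ici T)) (hg : ContinuousOn g (Ici T))
    (h : ∀ t, T ≤ t → ApproxDeriv r (r' t) (b t) t) (hle : ∀ t, T ≤ t → g t ≤ r' t - b t)
    (h1 : T ≤ t₁) (h12 : t₁ ≤ t₂) : ∫ t in t₁..t₂, g t ≤ r t₂ - r t₁ := by
  have hgi : ∀ x ∈ Icc t₁ t₂, ContinuousOn g (Icc t₁ t₂) := fun x _ =>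
    hg.mono fun z hz => h1.trans hz.1
  have hgc : ContinuousOn g (Icc t₁ t₂) := hg.mono fun z hz => h1.trans hz.1
  have hint : ∀ x ∈ Icc t₁ t₂, IntervalIntegrable g volume t₁ x := fun x hx =>
    (hgc.mono (by rw [uIcc_of_le hx.1]; exact Icc_subset_Icc_right hx.2)).intervalIntegrable
  -- A comparison principle for `-r` that asks only for upper bounds on right slopes; the function
  -- `r` need not be differentiable.
  have key := image_le_of_liminf_slope_right_le_deriv_boundary (f := fun t => - r t) (a := t₁)
    (b := t₂) (B := fun t => - r t₁ - ∫ s in t₁..t, g s) (B' := fun t => - g t)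
    ((hr.mono fun z hz => h1.trans hz.1).neg) (by simp) ?_ ?_ ?_
  · have := key (right_mem_Icc.2 h12)
    linarith
  · refine continuousOn_const.sub ?_
    have := intervalIntegral.continuousOn_primitive_interval (μ := volume) (f := g) (a := t₁) (b := t₂)
      (by rw [uIcc_of_le h12]; exact hgc.integrableOn_Icc)
    rwa [uIcc_of_le h12] at this
  · intro x hx
    have h3 : HasDerivWithinAt (fun t => ∫ s in t₁..t, g s) (g x) (Ici x) x := by
      refine intervalIntegral.integral_hasDerivWithinAt_right (hint x ⟨hx.1, hx.2.le⟩) (s := Ici x) (t := Ioi x) ?_ ?_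
      · refine (hg.mono ?_).stronglyMeasurableAtFilter_nhdsWithin measurableSet_Ici x |>.filter_mono
          (nhdsWithin_mono x Ioi_subset_Ici_self)
        exact Ici_subset_Ici.2 (h1.trans hx.1)
      · exact (hg x (h1.trans hx.1)).mono fun z hz => (h1.trans hx.1).trans (le_of_lt hz)
    simpa using (h3.const_sub (-r t₁))
  · intro x hx ρ hρ
    obtain ⟨γ, hγ, h4⟩ := h x (h1.trans hx.1)
    have h5 := hle x (h1.trans hx.1)
    have h6 : ∀ᶠ t' in 𝓝[>] x, γ t' < ρ + r' x := hγ.eventually_lt_const (by linarith)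
    refine Eventually.frequently ?_
    filter_upwards [h4, h6, self_mem_nhdsWithin] with t' h7 h8 h9
    have hδ : (0 : ℝ) < t' - x := sub_pos.2 h9
    rw [slope_def_field, div_lt_iff₀ hδ]
    rw [Real.norm_eq_abs, smul_eq_mul] at h7
    have := (abs_le.1 h7).1
    nlinarith

/-! ### Solutions in the exterior region -/

/-- `v` is a bounded solution of `∂ₜv = iΔv + O(t^{-β})` in the region `‖x‖ ≥ s t^α`. -/
structure ExtSol (α s M C β T : ℝ) (v : ℝ → L2) : Prop where
  one_le : 1 ≤ T
  nonneg : 0 ≤ C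
  cont : ContinuousOn v (Ici T)
  bound : ∀ t, T ≤ t → ‖v t‖ ≤ M
  eqn : ∀ t t', T ≤ t → t ≤ t' → ∀ η : 𝓢(E3, ℂ), (∀ x, η x ≠ 0 → s * t' ^ α ≤ ‖x‖) →
    ‖⟪(η.toLp 2 volume : L2), v t' - v t⟫_ℂ -
      Complex.I * ∫ τ in t..t', ⟪((Δ η).toLp 2 volume : L2), v τ⟫_ℂ‖ ≤
      C * t ^ (-β) * (t' - t) * ‖(η.toLp 2 volume : L2)‖

theorem norm_le_of_schwartz {X : L2} {B : ℝ} (hB : 0 ≤ B)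
    (h : ∀ ζ : 𝓢(E3, ℂ), ‖⟪(ζ.toLp 2 volume : L2), X⟫_ℂ‖ ≤ B * ‖(ζ.toLp 2 volume : L2)‖) :
    ‖X‖ ≤ B := by
  have hd : DenseRange (SchwartzMap.toLpCLM ℂ (E := E3) ℂ 2 volume) :=
    SchwartzMap.denseRange_toLpCLM ENNReal.ofNat_ne_top
  have h1 : ∀ u : L2, ‖⟪u, X⟫_ℂ‖ ≤ B * ‖u‖ := fun u =>
    DenseRange.induction_on (p := fun u : L2 => ‖⟪u, X⟫_ℂ‖ ≤ B * ‖u‖) hd u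
      (isClosed_le ((continuous_id.inner continuous_const).norm) (continuous_const.mul continuous_norm)) h
  rcases eq_or_ne X 0 with rfl | hX
  · rwa [norm_zero]
  · have h2 := h1 X
    rw [inner_self_eq_norm_sq_to_K] at h2
    simp only [norm_pow, RCLike.norm_ofReal, abs_norm] at h2
    have := norm_pos_iff.2 hX
    nlinarith

/-- The symbol `κ (1 - ε²Δ)⁻¹`. -/
def kreg (e : E3) (α ε t : ℝ) (ξ : E3) : ℝ := kap e α t ξ * reg ε ξ

theorem isBdd_kreg (e : E3) (α t : ℝ) {ε : ℝ} (hε : 0 < ε) :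
    IsBdd fun ξ => (kreg e α ε t ξ : ℂ) := by
  have h := (IsBdd.const ((t ^ (1 - α) : ℝ) : ℂ)).mul (isBdd_inner_mul_reg hε e)
  refine (funext fun ξ => ?_ : (fun ξ => (kreg e α ε t ξ : ℂ)) = _) ▸ h
  rw [← Complex.ofReal_mul, kreg, kap]
  congr 1
  ring

/-- The symbol of `-Δ (1 - ε²Δ)⁻¹`. -/
def lreg (ε : ℝ) (ξ : E3) : ℝ := (2 * Real.pi * ‖ξ‖) ^ 2 * reg ε ξ

/-- The operator `(1 - ε²Δ)⁻¹`. -/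
def regOp (ε : ℝ) : L2 →L[ℂ] L2 := fourierMul fun ξ => (reg ε ξ : ℂ)

theorem norm_regOp_le (ε : ℝ) (f : L2) : ‖regOp ε f‖ ≤ ‖f‖ := by
  have := norm_fourierMul_le (isBdd_reg ε) (C := 1) (fun x => by
    rw [Complex.norm_real, Real.norm_of_nonneg (reg_pos _ _).le]
    exact reg_le_one _ _) f
  rwa [one_mul] at this

/-- The part of `i (1 - ε²Δ)⁻¹ [Q, Δ] + i Δ (1 - ε²Δ)⁻¹ Q`, `Q = Q(⟪e, x⟫ / t^α)`. -/
def evolOp (Q : ℝ → ℝ) (e : E3) (α ε t : ℝ) : L2 →L[ℂ] L2 :=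
  (-Complex.I) • (fourierMul (fun ξ => (lreg ε ξ : ℂ)) ∘L mulOp (cut e (t ^ α) Q)) +
  ((t⁻¹ : ℝ) : ℂ) • ((2 : ℂ) • (fourierMul (fun ξ => (kreg e α ε t ξ : ℂ)) ∘L
      mulOp (cut e (t ^ α) (deriv Q))) +
    (Complex.I * ((t ^ (1 - 2 * α) : ℝ) : ℂ)) •
      (regOp ε ∘L mulOp (cut e (t ^ α) (deriv (deriv Q)))))

/-- Integration by parts moves the resolvent, the cutoff and the Laplacian onto `g`. The derivatives
of the cutoff bring `t^{-α} = t⁻¹ t^{1-α}` and `t^{-2α} = t⁻¹ t^{1-2α}`; the first power joins the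
momentum to form `κ`, and the second is an error term. -/
theorem inner_laplacian_cut {Q : ℝ → ℝ} (hQ : StepLike Q) {e : E3} {α ε t : ℝ}
    (h : Adm e α ε t) {ζ y : 𝓢(E3, ℂ)}
    (h0 : y.toLp 2 = fourierMul (fun ξ => (reg ε ξ : ℂ)) (ζ.toLp 2))
    (h1 : (Δ y).toLp 2 = (-1 : ℂ) •
      fourierMul (fun ξ => (((2 * Real.pi * ‖ξ‖) ^ 2 * reg ε ξ : ℝ) : ℂ)) (ζ.toLp 2))
    (h2 : (∂_{e} y).toLp 2 = Complex.I •
      fourierMul (fun ξ => ((2 * Real.pi * inner ℝ e ξ * reg ε ξ : ℝ) : ℂ)) (ζ.toLp 2)) (g : L2) :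
    Complex.I * ⟪((Δ (SchwartzMap.smulLeftCLM ℂ (cut e (t ^ α) Q) y)).toLp 2 volume : L2), g⟫_ℂ =
      ⟪(ζ.toLp 2 volume : L2), evolOp Q e α ε t g⟫_ℂ := by
  have ht : 0 < t := by linarith [h.one_le]
  have hr : ∀ {Q : ℝ → ℝ}, StepLike Q → ∀ u z : L2, ⟪mulOp (cut e (t ^ α) Q) u, z⟫_ℂ =
      ⟪u, mulOp (cut e (t ^ α) Q) z⟫_ℂ := fun {Q} hQ u z =>
    inner_mulOp_comm (r := fun x => Q (inner ℝ e x / t ^ α)) (hQ.isBdd e (t ^ α)) u z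
  have hk : ∀ z : L2, fourierMul (fun ξ => (kreg e α ε t ξ : ℂ)) z = ((t ^ (1 - α) : ℝ) : ℂ) •
      fourierMul (fun ξ => ((2 * Real.pi * inner ℝ e ξ * reg ε ξ : ℝ) : ℂ)) z := by
    intro z
    rw [← fourierMul_const_mul _ (isBdd_inner_mul_reg h.pos e)]
    congr 2
    funext ξ
    rw [← Complex.ofReal_mul, kreg, kap]
    congr 1
    ring
  rw [laplacian_smulLeftCLM_cut hQ h.norm_e, SchwartzMap.toLp_add', SchwartzMap.toLp_add',
    SchwartzMap.toLp_smul', SchwartzMap.toLp_smul',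
    toLp_smulLeftCLM (hQ.hasTemperateGrowth_cut _ _) (hQ.isBdd _ _),
    toLp_smulLeftCLM (hQ.deriv.hasTemperateGrowth_cut _ _) (hQ.deriv.isBdd _ _),
    toLp_smulLeftCLM (hQ.deriv.deriv.hasTemperateGrowth_cut _ _) (hQ.deriv.deriv.isBdd _ _),
    h0, h1, h2]
  simp only [evolOp, _root_.add_apply, _root_.smul_apply, hk,
    ContinuousLinearMap.comp_apply, inner_add_left, inner_add_right, inner_smul_left,
    inner_smul_right, map_smul, Complex.conj_ofReal, Complex.conj_I, map_neg, map_one,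
    hr hQ, hr hQ.deriv, hr hQ.deriv.deriv, inner_fourierMul_comm (isBdd_reg ε),
    inner_fourierMul_comm (isBdd_sq_mul_reg h.pos), inner_fourierMul_comm
    (isBdd_inner_mul_reg h.pos e), lreg, regOp]
  have e1 : t⁻¹ * t ^ (1 - α) = (t ^ α)⁻¹ := by
    rw [← Real.rpow_neg_one, ← Real.rpow_add ht, ← Real.rpow_neg ht.le]; ring_nf
  have e2 : t⁻¹ * t ^ (1 - 2 * α) = ((t ^ α) ^ 2)⁻¹ := by
    rw [← Real.rpow_neg_one, ← Real.rpow_add ht, ← Real.rpow_natCast, ← Real.rpow_mul ht.le,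
      ← Real.rpow_neg ht.le]
    congr 1; push_cast; ring
  have e1' : ((t⁻¹ : ℝ) : ℂ) * ((t ^ (1 - α) : ℝ) : ℂ) = (((t ^ α)⁻¹ : ℝ) : ℂ) := by
    rw [← Complex.ofReal_mul, e1]
  have e2' : ((t⁻¹ : ℝ) : ℂ) * ((t ^ (1 - 2 * α) : ℝ) : ℂ) = ((((t ^ α) ^ 2)⁻¹ : ℝ) : ℂ) := by
    rw [← Complex.ofReal_mul, e2]
  rw [div_eq_mul_inv, one_div, Complex.ofReal_mul, ← e1', ← e2']
  generalize ⟪(ζ.toLp 2 volume : L2), _⟫_ℂ = X1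
  generalize ⟪(ζ.toLp 2 volume : L2), _⟫_ℂ = X2
  generalize ⟪(ζ.toLp 2 volume : L2), _⟫_ℂ = X3
  have hI : Complex.I ^ 2 = -1 := Complex.I_sq
  push_cast
  linear_combination (-(2 * (t : ℂ)⁻¹ * ((t ^ (1 - α) : ℝ) : ℂ) * X2)) * hI

theorem StepLike.id_mul_deriv {Q : ℝ → ℝ} (hQ : StepLike Q) : StepLike fun y => y * _root_.deriv Q y := by
  refine StepLike.of_compact (contDiff_id.mul hQ.deriv_contDiff) ?_
  exact hQ.compact.mul_left

theorem hasDerivAt_comp_div_rpow {Q : ℝ → ℝ} (hQ : Differentiable ℝ Q) (α Y : ℝ) {t : ℝ}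
    (ht : 0 < t) : HasDerivAt (fun t => Q (Y / t ^ α))
      (-(α / t) * (Y / t ^ α * deriv Q (Y / t ^ α))) t := by
  have h1 : HasDerivAt (fun t : ℝ => Y / t ^ α) (-(α / t) * (Y / t ^ α)) t := by
    have h2 := (Real.hasDerivAt_rpow_const (x := t) (p := -α) (Or.inl ht.ne')).const_mul Y
    have h3 : (fun t : ℝ => Y / t ^ α) =ᶠ[𝓝 t] fun t => Y * t ^ (-α) := by
      filter_upwards [eventually_gt_nhds ht] with z hz
      rw [Real.rpow_neg hz.le, div_eq_mul_inv]
    refine (h2.congr_of_eventuallyEq h3).congr_deriv ?_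
    rw [Real.rpow_sub ht, Real.rpow_neg ht.le, Real.rpow_one]
    field_simp
  have := (hQ (Y / t ^ α)).hasDerivAt.comp t h1
  refine this.congr_deriv ?_
  ring

/-- The slope is taken at the moving vector `v t'` because the increment of `Q v` splits as the
frozen cutoff applied to the increment of `v`, plus the increment of the cutoff applied to `v t'`.
-/
theorem tendsto_loc_slope {Q : ℝ → ℝ} (hQ : StepLike Q) (e : E3) {α t : ℝ} (hα : 0 < α)
    (ht : 0 < t) {v : ℝ → L2} (hv : Tendsto v (𝓝[>] t) (𝓝 (v t))) :
    Tendsto (fun t' => (t' - t)⁻¹ • (loc Q e α t' (v t') - loc Q e α t (v t'))) (𝓝[>] t)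
      (𝓝 ((-(α / t) : ℝ) • loc (fun y => y * deriv Q y) e α t (v t))) := by
  obtain ⟨D, hD0, hD⟩ := hQ.id_mul_deriv.bounded
  have hdQ : Differentiable ℝ Q := hQ.smooth.differentiable (by simp)
  set K : ℝ := α / t * D with hK
  have hK0 : 0 ≤ K := by positivity
  have hbd : ∀ t', t < t' → ∀ Y, |Q (Y / t' ^ α) - Q (Y / t ^ α)| ≤ K * (t' - t) := by
    intro t' ht' Y
    have := (convex_Icc t t').norm_image_sub_le_of_norm_hasDerivWithin_le
      (f := fun t => Q (Y / t ^ α)) (C := K)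
      (fun τ hτ => (hasDerivAt_comp_div_rpow hdQ α Y (ht.trans_le hτ.1)).hasDerivWithinAt)
      (fun τ hτ => by
        have hτ0 := ht.trans_le hτ.1
        rw [norm_mul, norm_neg, Real.norm_of_nonneg (by positivity)]
        exact mul_le_mul (div_le_div_of_nonneg_left hα.le ht hτ.1) (hD _) (norm_nonneg _)
          (by positivity))
      (left_mem_Icc.2 ht'.le) (right_mem_Icc.2 ht'.le)
    rwa [Real.norm_eq_abs, Real.norm_of_nonneg (by linarith)] at this
  set q : ℝ → E3 → ℂ := fun t' x => (((t' - t)⁻¹ : ℝ) : ℂ) *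
    (cut e (t' ^ α) Q x - cut e (t ^ α) Q x) with hq
  set p : E3 → ℂ := fun x => ((-(α / t) : ℝ) : ℂ) * cut e (t ^ α) (fun y => y * deriv Q y) x with hp
  have hqm : ∀ t', Measurable (q t') := fun t' =>
    (measurable_const.mul ((hQ.isBdd e (t' ^ α)).1.sub (hQ.isBdd e (t ^ α)).1))
  have hqb : ∀ t', t < t' → ∀ x, ‖q t' x‖ ≤ K := by
    intro t' ht' x
    have hδ : 0 < t' - t := sub_pos.2 ht'
    simp only [hq, cut]
    rw [← Complex.ofReal_sub, norm_mul, Complex.norm_real, Complex.norm_real,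
      Real.norm_of_nonneg (by positivity), Real.norm_eq_abs, inv_mul_le_iff₀ hδ, mul_comm (t' - t)]
    exact hbd t' ht' _
  have hpB : IsBdd p := (IsBdd.const _).mul (hQ.id_mul_deriv.isBdd _ _)
  have hpb : ∀ x, ‖p x‖ ≤ K := by
    intro x
    simp only [hp, cut]
    rw [norm_mul, Complex.norm_real, Complex.norm_real, norm_neg,
      Real.norm_of_nonneg (by positivity)]
    exact mul_le_mul_of_nonneg_left (hD _) (by positivity)
  have hlim : ∀ x, Tendsto (fun t' => q t' x) (𝓝[>] t) (𝓝 (p x)) := by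
    intro x
    have h1 := (hasDerivAt_comp_div_rpow hdQ α (inner ℝ e x) ht).tendsto_slope.mono_left
      (nhdsWithin_mono t (fun z (hz : t < z) => hz.ne'))
    have h2 := (Complex.continuous_ofReal.tendsto _).comp h1
    refine (h2.congr fun t' => ?_).trans_eq ?_
    · simp [hq, cut, slope_def_field, div_eq_inv_mul]
    · simp [hp, cut]
  have h1 := tendsto_mulOp (C := K) (l := 𝓝[>] t) (Eventually.of_forall hqm) hpB.1
    (eventually_nhdsWithin_of_forall hqb) hpb hlim (v t)
  have h2 : Tendsto (fun t' => mulOp (q t') (v t' - v t)) (𝓝[>] t) (𝓝 0) := by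
    rw [tendsto_zero_iff_norm_tendsto_zero]
    have h3 := (tendsto_iff_norm_sub_tendsto_zero.1 hv).const_mul K
    rw [mul_zero] at h3
    refine squeeze_zero' (Eventually.of_forall fun _ => norm_nonneg _) ?_ h3
    filter_upwards [self_mem_nhdsWithin] with t' ht'
    exact norm_mulOp_le ⟨hqm t', K, hqb t' ht'⟩ (hqb t' ht') _
  have h4 := h2.add h1
  rw [zero_add] at h4
  have e1 : mulOp p (v t) = (-(α / t) : ℝ) • loc (fun y => y * deriv Q y) e α t (v t) := by
    rw [L2.real_smul_eq, loc, ← mulOp_const_mul _ (hQ.id_mul_deriv.isBdd _ _)]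
  rw [e1] at h4
  refine h4.congr' ?_
  filter_upwards [self_mem_nhdsWithin] with t' ht'
  rw [← map_add, sub_add_cancel, L2.real_smul_eq, loc, loc, ← mulOp_sub (hQ.isBdd _ _)
    (hQ.isBdd _ _), ← mulOp_const_mul _ ((hQ.isBdd _ _).sub (hQ.isBdd _ _))]

/-- The regularized, localized solution. -/
def rloc (Q : ℝ → ℝ) (e : E3) (α ε : ℝ) (v : ℝ → L2) (t : ℝ) : L2 := regOp ε (loc Q e α t (v t))

/-- The derivative of `rloc` up to the source. -/
def rlocDeriv (Q : ℝ → ℝ) (e : E3) (α ε t : ℝ) (w : L2) : L2 :=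
  evolOp Q e α ε t w + (-(α / t) : ℝ) • regOp ε (loc (fun y => y * deriv Q y) e α t w)

/-- The source has a bound but no continuity in time, so it is carried as an error in the right
derivative. Everything else, the commutator with `Δ` and the motion of the cutoff, is differentiated
exactly. -/
theorem ExtSol.approxDeriv {α s M C β T : ℝ} {v : ℝ → L2} (hv : ExtSol α s M C β T v)
    {Q : ℝ → ℝ} (hQ : StepLike Q) {s₀ : ℝ} (hs : s < s₀) (hQs : ∀ y, Q y ≠ 0 → s₀ ≤ |y|)
    {D : ℝ} (hD : ∀ y, |Q y| ≤ D) {e : E3} {ε t : ℝ} (h : Adm e α ε t) (ht : T ≤ t) :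
    ApproxDeriv (rloc Q e α ε v) (rlocDeriv Q e α ε t (v t)) (D * (C * t ^ (-β))) t := by
  have ht0 : 0 < t := by linarith [h.one_le]
  have hD0 : 0 ≤ D := (abs_nonneg _).trans (hD 0)
  have hα : 0 < α := by linarith [h.half_lt]
  have hvt : Tendsto v (𝓝[>] t) (𝓝 (v t)) :=
    ((hv.cont t ht).mono fun z hz => ht.trans (le_of_lt hz))
  have hcont : ∀ t', t ≤ t' → ContinuousOn (fun τ => evolOp Q e α ε t (v τ)) (Icc t t') :=
    fun t' _ => (evolOp Q e α ε t).continuous.comp_continuousOn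
      (hv.cont.mono fun z hz => ht.trans hz.1)
  have hint : ∀ t', t ≤ t' → IntervalIntegrable (fun τ => evolOp Q e α ε t (v τ)) volume t t' :=
    fun t' ht' => by
      have := hcont t' ht'
      rw [← uIcc_of_le ht'] at this
      exact this.intervalIntegrable
  -- the equation tested against all of `L²`
  have main : ∀ᶠ t' in 𝓝[>] t, ‖rloc Q e α ε v t' - rloc Q e α ε v t -
      (∫ τ in t..t', evolOp Q e α ε t (v τ)) -
      regOp ε (loc Q e α t' (v t') - loc Q e α t (v t'))‖ ≤ D * (C * t ^ (-β)) * (t' - t) := by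
    -- The cutoff is frozen at time `t`, whereas the equation on `[t, t']` tolerates only supports
    -- beyond `s t'^α`. The strict gap `s < s₀` leaves room for `t'` slightly larger than `t`.
    have hev : ∀ᶠ t' in 𝓝[>] t, s * t' ^ α < s₀ * t ^ α := by
      have : Tendsto (fun t' : ℝ => s * t' ^ α) (𝓝[>] t) (𝓝 (s * t ^ α)) :=
        ((Real.continuousAt_rpow_const t α (Or.inl ht0.ne')).const_mul s).mono_left
          nhdsWithin_le_nhds
      exact this.eventually_lt_const (mul_lt_mul_of_pos_right hs (Real.rpow_pos_of_pos ht0 _))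
    filter_upwards [hev, self_mem_nhdsWithin] with t' hst htt
    have htt' : t ≤ t' := le_of_lt htt
    have hnn : 0 ≤ D * (C * t ^ (-β)) * (t' - t) := by
      have := hv.nonneg
      have : 0 ≤ t' - t := by linarith
      positivity
    refine norm_le_of_schwartz hnn fun ζ => ?_
    -- The resolvent destroys supports, so the cutoff is applied after it; the resulting test
    -- function is again supported in the exterior region.
    obtain ⟨y, y0, y1, y2⟩ := exists_schwartz_reg h.pos ζ
    have key := inner_laplacian_cut hQ h y0 y1 (y2 e)
    set η := SchwartzMap.smulLeftCLM ℂ (cut e (t ^ α) Q) y with hη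
    have hsupp : ∀ x, η x ≠ 0 → s * t' ^ α ≤ ‖x‖ := by
      intro x hx
      rw [hη, SchwartzMap.smulLeftCLM_apply_apply (hQ.hasTemperateGrowth_cut _ _), smul_eq_mul] at hx
      have h1 : Q (inner ℝ e x / t ^ α) ≠ 0 := fun h0 => left_ne_zero_of_mul hx (by simp [cut, h0])
      have h2 := hQs _ h1
      have hp := Real.rpow_pos_of_pos ht0 α
      rw [abs_div, abs_of_pos hp, le_div_iff₀ hp] at h2
      have h3 := abs_real_inner_le_norm e x
      rw [h.norm_e, one_mul] at h3
      linarith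
    have h1 := hv.eqn t t' ht htt' η hsupp
    rw [← intervalIntegral.integral_const_mul] at h1
    simp_rw [key] at h1
    have h2 : ∫ τ in t..t', ⟪(ζ.toLp 2 volume : L2), evolOp Q e α ε t (v τ)⟫_ℂ =
        ⟪(ζ.toLp 2 volume : L2), ∫ τ in t..t', evolOp Q e α ε t (v τ)⟫_ℂ :=
      ((innerSL ℂ (ζ.toLp 2 volume : L2)).intervalIntegral_comp_comm (hint t' htt'))
    have h3 : ⟪(η.toLp 2 volume : L2), v t' - v t⟫_ℂ =
        ⟪(ζ.toLp 2 volume : L2), regOp ε (loc Q e α t (v t' - v t))⟫_ℂ := by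
      rw [hη, toLp_smulLeftCLM (hQ.hasTemperateGrowth_cut _ _) (hQ.isBdd _ _), y0, regOp,
        ← inner_fourierMul_comm (isBdd_reg ε), ← inner_loc hQ]
      rfl
    rw [h2, h3, ← inner_sub_right] at h1
    have h4 : rloc Q e α ε v t' - rloc Q e α ε v t - (∫ τ in t..t', evolOp Q e α ε t (v τ)) -
        regOp ε (loc Q e α t' (v t') - loc Q e α t (v t')) =
        regOp ε (loc Q e α t (v t' - v t)) - ∫ τ in t..t', evolOp Q e α ε t (v τ) := by
      simp only [rloc, loc, map_sub]
      abel
    rw [h4]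
    refine h1.trans ?_
    have h5 : ‖(η.toLp 2 volume : L2)‖ ≤ D * ‖(ζ.toLp 2 volume : L2)‖ := by
      rw [hη, toLp_smulLeftCLM (hQ.hasTemperateGrowth_cut _ _) (hQ.isBdd _ _), y0]
      refine (norm_loc_le hQ hD _).trans (mul_le_mul_of_nonneg_left (norm_regOp_le ε _) hD0)
    have : 0 ≤ C * t ^ (-β) * (t' - t) := by
      have := hv.nonneg
      have : 0 ≤ t' - t := by linarith
      positivity
    calc _ ≤ C * t ^ (-β) * (t' - t) * (D * ‖(ζ.toLp 2 volume : L2)‖) := by gcongr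
      _ = _ := by ring
  have lim1 : Tendsto (fun t' => (t' - t)⁻¹ • ∫ τ in t..t', evolOp Q e α ε t (v τ)) (𝓝[>] t)
      (𝓝 (evolOp Q e α ε t (v t))) := by
    have hc : ContinuousOn (fun τ => evolOp Q e α ε t (v τ)) (Ici t) :=
      (evolOp Q e α ε t).continuous.comp_continuousOn (hv.cont.mono (Ici_subset_Ici.2 ht))
    have h3 : HasDerivWithinAt (fun t' => ∫ τ in t..t', evolOp Q e α ε t (v τ))
        (evolOp Q e α ε t (v t)) (Ici t) t := by
      refine intervalIntegral.integral_hasDerivWithinAt_right (hint t le_rfl) (s := Ici t)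
        (t := Ioi t) ?_ ?_
      · exact (hc.stronglyMeasurableAtFilter_nhdsWithin measurableSet_Ici t).filter_mono
          (nhdsWithin_mono t Ioi_subset_Ici_self)
      · exact (hc t self_mem_Ici).mono Ioi_subset_Ici_self
    have h4 := (hasDerivWithinAt_iff_tendsto_slope.1 h3)
    have h5 : Ici t \ {t} = Ioi t := Ici_sdiff_left
    rw [h5] at h4
    refine h4.congr fun t' => ?_
    rw [slope_def_module, intervalIntegral.integral_same, sub_zero]
  have lim2 : Tendsto (fun t' => regOp ε ((t' - t)⁻¹ • (loc Q e α t' (v t') - loc Q e α t (v t'))))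
      (𝓝[>] t) (𝓝 (regOp ε ((-(α / t) : ℝ) • loc (fun y => y * deriv Q y) e α t (v t)))) :=
    ((regOp ε).continuous.tendsto _).comp (tendsto_loc_slope hQ e hα ht0 hvt)
  refine ⟨fun t' => D * (C * t ^ (-β)) +
    ‖(t' - t)⁻¹ • (∫ τ in t..t', evolOp Q e α ε t (v τ)) - evolOp Q e α ε t (v t)‖ +
    ‖regOp ε ((t' - t)⁻¹ • (loc Q e α t' (v t') - loc Q e α t (v t'))) -
      regOp ε ((-(α / t) : ℝ) • loc (fun y => y * deriv Q y) e α t (v t))‖, ?_, ?_⟩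
  · have := ((tendsto_const_nhds (x := D * (C * t ^ (-β)))).add
      (tendsto_iff_norm_sub_tendsto_zero.1 lim1)).add (tendsto_iff_norm_sub_tendsto_zero.1 lim2)
    simpa using this
  · filter_upwards [main, self_mem_nhdsWithin] with t' h1 htt
    have hδ : (0 : ℝ) < t' - t := sub_pos.2 htt
    have hsm : ∀ (r : ℝ) (u : L2), regOp ε (r • u) = r • regOp ε u := fun r u =>
      ContinuousLinearMap.map_smul_of_tower _ r u
    have e1 : rloc Q e α ε v t' - rloc Q e α ε v t - (t' - t) • rlocDeriv Q e α ε t (v t) =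
        (rloc Q e α ε v t' - rloc Q e α ε v t - (∫ τ in t..t', evolOp Q e α ε t (v τ)) -
          regOp ε (loc Q e α t' (v t') - loc Q e α t (v t'))) +
        (t' - t) • ((t' - t)⁻¹ • (∫ τ in t..t', evolOp Q e α ε t (v τ)) -
          evolOp Q e α ε t (v t)) +
        (t' - t) • (regOp ε ((t' - t)⁻¹ • (loc Q e α t' (v t') - loc Q e α t (v t'))) -
          regOp ε ((-(α / t) : ℝ) • loc (fun y => y * deriv Q y) e α t (v t))) := by
      simp only [rlocDeriv, hsm]
      rw [smul_sub (t' - t) ((t' - t)⁻¹ • _), smul_sub (t' - t) ((t' - t)⁻¹ • _),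
        smul_inv_smul₀ hδ.ne', smul_inv_smul₀ hδ.ne', smul_add]
      abel
    rw [e1]
    refine (norm_add_le _ _).trans ?_
    rw [add_mul _ _ (t' - t), norm_smul, Real.norm_of_nonneg hδ.le, mul_comm (t' - t)]
    refine add_le_add ?_ le_rfl
    refine (norm_add_le _ _).trans ?_
    rw [add_mul _ _ (t' - t), norm_smul, Real.norm_of_nonneg hδ.le, mul_comm (t' - t)]
    exact add_le_add h1 le_rfl

/-! ### Positivity of the commutator -/

/-- The pointwise inequality behind the lower bound, with `x = |κ|`. The term `d p` gives positivity
near `x = 0`, the quartic term gives it for large `x`, and the `c₂` term pays for the negative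
quadratic terms in between. The weights are chosen in the order `d`, `δ`, `c₀`. -/
theorem exists_weights {p q c₂ : ℝ} (hp : 0 < p) (hq : 0 < q) (hc₂ : 0 < c₂) :
    ∃ δ d c₀ : ℝ, 0 < δ ∧ 0 < d ∧ 0 < c₀ ∧ δ + 64 * d ≤ 1 ∧ ∀ x : ℝ, 0 ≤ x →
      c₀ * (x + 1 / 8) ^ 4 ≤ δ * ((x ^ 2 - q) * (x + 1 / 8) ^ 2) + d * (p - 2 * x ^ 2) +
        c₂ * (x * (x + 1 / 8)) := by
  set d : ℝ := min (c₂ / 4) (1 / 128) with hd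
  have hd0 : 0 < d := by positivity
  have hd1 : d ≤ c₂ / 4 := min_le_left _ _
  have hd2 : d ≤ 1 / 128 := min_le_right _ _
  set δ : ℝ := min (min (c₂ / (8 * q)) (d * p / q)) (1 / 2) with hδ
  have hδ0 : 0 < δ := by positivity
  have h1 : δ * q ≤ c₂ / 8 := by
    have : δ ≤ c₂ / (8 * q) := (min_le_left _ _).trans (min_le_left _ _)
    rw [le_div_iff₀ (by positivity)] at this
    linarith
  have h2 : δ * q ≤ d * p := by
    have : δ ≤ d * p / q := (min_le_left _ _).trans (min_le_right _ _)
    rwa [le_div_iff₀ hq] at this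
  have h3 : δ ≤ 1 / 2 := min_le_right _ _
  set c₀ : ℝ := min (δ / 8) (d * p) with hc₀
  have hc0 : 0 < c₀ := by positivity
  refine ⟨δ, d, c₀, hδ0, hd0, hc0, by linarith, fun x hx => ?_⟩
  have h4 : c₀ ≤ δ / 8 := min_le_left _ _
  have h5 : c₀ ≤ d * p := min_le_right _ _
  have i1 : (x + 1 / 8) ^ 2 ≤ 2 * x ^ 2 + 1 / 32 := by nlinarith [sq_nonneg (x - 1 / 8)]
  have i2 : (x + 1 / 8) ^ 4 ≤ 8 * x ^ 4 + 1 / 512 := by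
    have : (x + 1 / 8) ^ 4 = ((x + 1 / 8) ^ 2) ^ 2 := by ring
    rw [this]
    have h6 : ((x + 1 / 8) ^ 2) ^ 2 ≤ (2 * x ^ 2 + 1 / 32) ^ 2 := by gcongr
    nlinarith [sq_nonneg (x ^ 2 - 1 / 64)]
  have i3 : x ^ 4 ≤ x ^ 2 * (x + 1 / 8) ^ 2 := by
    have : x ^ 4 = x ^ 2 * x ^ 2 := by ring
    rw [this]; gcongr; linarith
  have j1 : c₀ * (x + 1 / 8) ^ 4 ≤ δ * x ^ 4 + d * p / 512 := by
    have a1 := mul_le_mul_of_nonneg_left i2 hc0.le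
    have a2 := mul_le_mul_of_nonneg_right h4 (by positivity : 0 ≤ x ^ 4)
    linarith
  have j2 := mul_le_mul_of_nonneg_left i3 hδ0.le
  have j3 := mul_le_mul_of_nonneg_left i1 (by positivity : 0 ≤ δ * q)
  have j4 := mul_le_mul_of_nonneg_right h1 (sq_nonneg x)
  have j5 := mul_le_mul_of_nonneg_right hd1 (sq_nonneg x)
  have j6 : 0 ≤ c₂ * x := by positivity
  have j7 : 0 ≤ d * p := by positivity
  nlinarith

theorem bLipSym_wt_pow_three : BLipSym fun k => wt k ^ 3 :=
  ((bLipSym_wt.mul bLipSym_wt).mul bLipSym_wt).congr fun k => by ring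

theorem bLipSym_mul_wt_pow_three : BLipSym fun k => k * wt k ^ 3 :=
  ((bLipSym_mul_wt.mul bLipSym_wt).mul bLipSym_wt).congr fun k => by ring

theorem bLipSym_sq_mul_wt_pow_three : BLipSym fun k => k ^ 2 * wt k ^ 3 :=
  ((bLipSym_mul_wt.mul bLipSym_mul_wt).mul bLipSym_wt).congr fun k => by ring

theorem bLipSym_mul_wt_sq : BLipSym fun k => k * wt k ^ 2 :=
  (bLipSym_mul_wt.mul bLipSym_wt).congr fun k => by ring

theorem bLipSym_abs_mul_wt_sq : BLipSym fun k => |k| * wt k ^ 2 :=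
  (bLipSym_abs_mul_wt.mul bLipSym_wt).congr fun k => by ring

theorem lipSym_abs_add : LipSym fun k => |k| + 1 / 8 :=
  LipSym.abs.add (BLipSym.const _).lipSym

/-- The first three terms quantize `2 (χ² + γ²) wt (κ - αy/2)²` and the last bracket comes from the
dilation of `κ`. The square degenerates on `κ = αy/2`, where `y ≥ s₀` keeps `|κ|` away from `0` and
the bracket is positive. Conversely the bracket degenerates at `κ = 0`, where the square is
positive. All steps are squares or nonnegative symbols, so each costs one error of size `t^{1-2α}`.
-/
theorem exists_commutator_lower_bound {α : ℝ} (hα : 1 / 2 < α) (hα1 : α < 1) {χ γ g B : ℝ → ℝ}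
    (hχ : ContDiff ℝ ∞ χ) (hχc : HasCompactSupport χ) (hγ : ContDiff ℝ ∞ γ)
    (hγc : HasCompactSupport γ) (hg : StepLike g) (hB : StepLike B) {s₀ s₁ c₁ : ℝ} (hs₀ : 0 < s₀)
    (hχs : ∀ y, χ y ≠ 0 → s₀ ≤ y ∧ y ≤ s₁) (hs₁ : 0 < s₁) (hc₁ : 0 < c₁) (hg0 : ∀ y, 0 ≤ g y)
    (hBg : ∀ y, c₁ * χ y ^ 2 ≤ B y - 1 / 8 * g y) :
    ∃ c₀ C : ℝ, 0 < c₀ ∧ 0 ≤ C ∧ ∀ {e : E3} {ε t : ℝ}, Adm e α ε t → ∀ w : L2,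
      c₀ * S2 (fun y => χ y ^ 2) (fun k => |k| + 1 / 8) e α ε t w -
        C * t ^ (1 - 2 * α) * ‖w‖ ^ 2 ≤
      2 * S2 (fun y => χ y ^ 2 + γ y ^ 2) (fun k => k ^ 2 * wt k) e α ε t w -
      2 * α * S2 (fun y => y * χ y ^ 2 + y * γ y ^ 2) (fun k => k * wt k) e α ε t w +
      α ^ 2 / 2 * S2 (fun y => y ^ 2 * χ y ^ 2 + y ^ 2 * γ y ^ 2) wt e α ε t w +
      (1 - α) * (1 / 8 * S2 g (fun k => k * wt k ^ 2) e α ε t w +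
        S2 B (fun k => |k| * wt k ^ 2) e α ε t w) := by
  have hα0 : 0 < α := by linarith
  obtain ⟨δ, d, c₀, hδ, hd, hc₀, hsum, hxx⟩ := exists_weights (p := α ^ 2 / 4 * s₀ ^ 2)
    (q := α ^ 2 / 2 * s₁ ^ 2) (c₂ := (1 - α) * c₁) (by positivity) (by positivity)
    (mul_pos (by linarith) hc₁)
  have P : ∀ (p θ : ℝ → ℝ), ContDiff ℝ ∞ p → ContDiff ℝ ∞ θ → HasCompactSupport θ →
      StepLike fun y => p y * θ y ^ 2 := fun p θ hp h1 h2 => by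
    refine StepLike.of_compact (hp.mul (h1.pow 2)) ?_
    simp_rw [sq]
    exact (h2.mul_left).mul_left
  have P1 : ∀ (p θ : ℝ → ℝ), ContDiff ℝ ∞ p → ContDiff ℝ ∞ θ → HasCompactSupport θ →
      StepLike fun y => p y * θ y := fun p θ hp h1 h2 => by
    refine StepLike.of_compact (hp.mul h1) h2.mul_left
  have q2 : ∀ θ : ℝ → ℝ, ContDiff ℝ ∞ θ → HasCompactSupport θ → StepLike fun y => θ y ^ 2 :=
    fun θ h1 h2 => by simpa using P (fun _ => 1) θ contDiff_const h1 h2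
  have hid : ContDiff ℝ ∞ (fun y : ℝ => y) := contDiff_id
  have hid2 : ContDiff ℝ ∞ (fun y : ℝ => y ^ 2) := contDiff_id.pow 2
  have L0 := bLipSym_wt.lipSym
  have L1 := bLipSym_mul_wt.lipSym
  have L2' := lipSym_sq_mul_wt
  have M0 := bLipSym_wt_pow_three.lipSym
  have M1 := bLipSym_mul_wt_pow_three.lipSym
  have M2 := bLipSym_sq_mul_wt_pow_three.lipSym
  -- The portion of the square that is thrown away must keep a nonnegative weight; `δ + 64 d ≤ 1`
  -- suffices because `wt² ≤ 64`.
  have hrest : ∀ k, 0 ≤ (1 - δ) * wt k + -d * wt k ^ 3 := fun k => by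
    have h1 := wt_pos k
    have h2 := wt_le k
    have h3 : wt k ^ 2 ≤ 64 := by nlinarith
    have : (1 - δ) * wt k + -d * wt k ^ 3 = wt k * (1 - δ - d * wt k ^ 2) := by ring
    rw [this]
    refine mul_nonneg h1.le ?_
    nlinarith
  have r0 : LipSym fun k => (1 - δ) * wt k + -d * wt k ^ 3 := (L0.const_mul _).add (M0.const_mul _)
  have e1 : (fun k => k * ((1 - δ) * wt k + -d * wt k ^ 3)) =
      fun k => (1 - δ) * (k * wt k) + -d * (k * wt k ^ 3) := by funext k; ring
  have e2 : (fun k => k ^ 2 * ((1 - δ) * wt k + -d * wt k ^ 3)) =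
      fun k => (1 - δ) * (k ^ 2 * wt k) + -d * (k ^ 2 * wt k ^ 3) := by funext k; ring
  have r1 : LipSym fun k => k * ((1 - δ) * wt k + -d * wt k ^ 3) := by
    rw [e1]; exact (L1.const_mul _).add (M1.const_mul _)
  have r2 : LipSym fun k => k ^ 2 * ((1 - δ) * wt k + -d * wt k ^ 3) := by
    rw [e2]; exact (L2'.const_mul _).add (M2.const_mul _)
  have sχ := StepLike.of_compact hχ hχc
  have sγ := StepLike.of_compact hγ hγc
  -- The values of `β` come from two completions of the square: `2 (κ - αy/2)² = (κ - αy)² + κ² - α²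
  -- y² / 2`, used with weight `δ wt`, and `2 (κ - αy/2)² = 4 (κ - αy/4)² + α² y² / 4 - 2κ²`, used
  -- with weight `d wt³`. The first is good for large `κ`, the second for small `κ`.
  obtain ⟨C1, hC1, H1⟩ := S2_square_nonneg sχ (P1 _ χ hid hχ hχc) hrest r0 r1 r2 (α / 2)
  obtain ⟨C2, hC2, H2⟩ := S2_square_nonneg sχ (P1 _ χ hid hχ hχc) (fun k => (wt_pos k).le)
    L0 L1 L2' α
  obtain ⟨C3, hC3, H3⟩ := S2_square_nonneg sχ (P1 _ χ hid hχ hχc)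
    (fun k => pow_nonneg (wt_pos k).le 3) M0 M1 M2 (α / 4)
  obtain ⟨C4, hC4, H4⟩ := S2_square_nonneg sγ (P1 _ γ hid hγ hγc) (fun k => (wt_pos k).le)
    L0 L1 L2' (α / 2)
  have b5 : ∀ y, 0 ≤ s₁ ^ 2 * χ y ^ 2 + -1 * (y ^ 2 * χ y ^ 2) := fun y => by
    rcases eq_or_ne (χ y) 0 with h | h
    · simp [h]
    · obtain ⟨h1, h2⟩ := hχs y h
      have : y ^ 2 ≤ s₁ ^ 2 := pow_le_pow_left₀ (by linarith) h2 2
      nlinarith [sq_nonneg (χ y)]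
  have b6 : ∀ y, 0 ≤ y ^ 2 * χ y ^ 2 + -s₀ ^ 2 * χ y ^ 2 := fun y => by
    rcases eq_or_ne (χ y) 0 with h | h
    · simp [h]
    · obtain ⟨h1, h2⟩ := hχs y h
      have : s₀ ^ 2 ≤ y ^ 2 := pow_le_pow_left₀ (by linarith) h1 2
      nlinarith [sq_nonneg (χ y)]
  have q0χ := q2 χ hχ hχc
  have q2χ := P _ χ hid2 hχ hχc
  obtain ⟨C5, hC5, H5⟩ := S2_nonneg ((q0χ.const_mul (s₁ ^ 2)).add (q2χ.const_mul (-1))) b5 L0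
    (fun k => (wt_pos k).le)
  obtain ⟨C6, hC6, H6⟩ := S2_nonneg (q2χ.add (q0χ.const_mul (-s₀ ^ 2))) b6 M0
    (fun k => pow_nonneg (wt_pos k).le 3)
  -- The term in `g` has the sign of `κ`. It is absorbed by writing `κ g / 8 + B |κ| = (B - g/8) |κ|
  -- + (|κ| + κ) g / 8`, in which both summands are nonnegative.
  have sBg : StepLike fun y => B y + (-(1 / 8) * g y + -c₁ * χ y ^ 2) :=
    hB.add ((hg.const_mul _).add (q0χ.const_mul _))
  have La := bLipSym_abs_mul_wt_sq.lipSym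
  have Lk := bLipSym_mul_wt_sq.lipSym
  have hw2 : ∀ k, 0 ≤ wt k ^ 2 := fun k => sq_nonneg _
  obtain ⟨C7, hC7, H7⟩ := S2_nonneg sBg (fun y => by linarith [hBg y]) La
    (fun k => mul_nonneg (abs_nonneg k) (hw2 k))
  obtain ⟨C8, hC8, H8⟩ := S2_nonneg hg hg0 (La.add Lk) (fun k => by
    rw [← add_mul]; exact mul_nonneg (by linarith [neg_abs_le k]) (hw2 k))
  have LA : LipSym fun k => δ * (k ^ 2 * wt k) + (-(δ * (α ^ 2 / 2 * s₁ ^ 2)) * wt k +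
      (d * (α ^ 2 / 4 * s₀ ^ 2) * wt k ^ 3 + (-(2 * d) * (k ^ 2 * wt k ^ 3) +
      ((1 - α) * c₁ * (|k| * wt k ^ 2) + -c₀ * (|k| + 1 / 8))))) :=
    (L2'.const_mul _).add ((L0.const_mul _).add ((M0.const_mul _).add ((M2.const_mul _).add
      ((La.const_mul _).add (lipSym_abs_add.const_mul _)))))
  obtain ⟨C9, hC9, H9⟩ := S2_nonneg q0χ (fun y => sq_nonneg _) LA (fun k => by
    have h1 := hxx |k| (abs_nonneg k)
    have h2 := wt_mul k
    have h3 := wt_pos k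
    have h4 := mul_le_mul_of_nonneg_right h1 (pow_pos h3 3).le
    have g1 : c₀ * (|k| + 1 / 8) ^ 4 * wt k ^ 3 = c₀ * (|k| + 1 / 8) := by
      have : c₀ * (|k| + 1 / 8) ^ 4 * wt k ^ 3 = c₀ * (|k| + 1 / 8) * ((|k| + 1 / 8) * wt k) ^ 3 := by
        ring
      rw [this, h2]; ring
    have g2 : (δ * ((|k| ^ 2 - α ^ 2 / 2 * s₁ ^ 2) * (|k| + 1 / 8) ^ 2) +
        d * (α ^ 2 / 4 * s₀ ^ 2 - 2 * |k| ^ 2) + (1 - α) * c₁ * (|k| * (|k| + 1 / 8))) * wt k ^ 3 =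
        δ * (k ^ 2 * wt k) + (-(δ * (α ^ 2 / 2 * s₁ ^ 2)) * wt k +
      (d * (α ^ 2 / 4 * s₀ ^ 2) * wt k ^ 3 + (-(2 * d) * (k ^ 2 * wt k ^ 3) +
      ((1 - α) * c₁ * (|k| * wt k ^ 2))))) := by
      rw [sq_abs]
      have : ((|k| + 1 / 8) * wt k) ^ 2 = 1 := by rw [h2, one_pow]
      linear_combination δ * (k ^ 2 - α ^ 2 / 2 * s₁ ^ 2) * wt k * this +
        (1 - α) * c₁ * |k| * wt k ^ 2 * h2
    rw [g1, g2] at h4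
    linarith)
  set K : ℝ := 2 * C1 + δ * C2 + 4 * d * C3 + 2 * C4 + δ * (α ^ 2 / 2) * C5 +
    d * (α ^ 2 / 4) * C6 + (1 - α) * (C7 + 1 / 8 * C8) + C9 with hK
  have h1α : 0 < 1 - α := by linarith
  refine ⟨c₀, K, hc₀, by positivity, fun {e ε t} h w => ?_⟩
  have I1 := H1 h w
  have I2 := H2 h w
  have I3 := H3 h w
  have I4 := H4 h w
  have I5 := H5 h w
  have I6 := H6 h w
  have I7 := H7 h w
  have I8 := H8 h w
  have I9 := H9 h w
  rw [e1, e2] at I1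
  have t0 := L0.const_mul (1 - δ)
  have t1 := L1.const_mul (1 - δ)
  have t2 := L2'.const_mul (1 - δ)
  rw [S2_add h t0 (M0.const_mul _), S2_add h t1 (M1.const_mul _), S2_add h t2 (M2.const_mul _),
    S2_const_mul h L0, S2_const_mul h L1, S2_const_mul h L2', S2_const_mul h M0,
    S2_const_mul h M1, S2_const_mul h M2] at I1
  rw [S2_add_left (q0χ.const_mul _) (q2χ.const_mul _), S2_const_mul_left q0χ,
    S2_const_mul_left q2χ] at I5
  rw [S2_add_left q2χ (q0χ.const_mul _), S2_const_mul_left q0χ] at I6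
  rw [S2_add_left hB ((hg.const_mul _).add (q0χ.const_mul _)),
    S2_add_left (hg.const_mul _) (q0χ.const_mul _), S2_const_mul_left q0χ,
    S2_const_mul_left hg] at I7
  rw [S2_add h La Lk] at I8
  rw [S2_add h (L2'.const_mul _) ((L0.const_mul _).add ((M0.const_mul _).add ((M2.const_mul _).add
      ((La.const_mul _).add (lipSym_abs_add.const_mul _))))),
    S2_add h (L0.const_mul _) ((M0.const_mul _).add ((M2.const_mul _).add
      ((La.const_mul _).add (lipSym_abs_add.const_mul _)))),
    S2_add h (M0.const_mul _) ((M2.const_mul _).add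
      ((La.const_mul _).add (lipSym_abs_add.const_mul _))),
    S2_add h (M2.const_mul _) ((La.const_mul _).add (lipSym_abs_add.const_mul _)),
    S2_add h (La.const_mul _) (lipSym_abs_add.const_mul _),
    S2_const_mul h L0, S2_const_mul h L2', S2_const_mul h M0, S2_const_mul h M2,
    S2_const_mul h La, S2_const_mul h lipSym_abs_add] at I9
  rw [S2_add_left (q2 χ hχ hχc) (q2 γ hγ hγc),
    S2_add_left (P _ χ hid hχ hχc) (P _ γ hid hγ hγc),
    S2_add_left (P _ χ hid2 hχ hχc) (P _ γ hid2 hγ hγc)]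
  have J2 := mul_le_mul_of_nonneg_left I2 hδ.le
  have J3 := mul_le_mul_of_nonneg_left I3 hd.le
  have J5 := mul_le_mul_of_nonneg_left I5 (by positivity : 0 ≤ δ * (α ^ 2 / 2))
  have J6 := mul_le_mul_of_nonneg_left I6 (by positivity : 0 ≤ d * (α ^ 2 / 4))
  have J7 := mul_le_mul_of_nonneg_left I7 h1α.le
  have J8 := mul_le_mul_of_nonneg_left I8 h1α.le
  rw [hK]
  linarith

/-! ### Derivatives of the propagation observables -/

/-- `k b'(k) = b'` in the sense of dilations. -/
structure SymDeriv (b b' : ℝ → ℝ) : Prop where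
  lip : ∃ L : ℝ, 0 ≤ L ∧ ∀ k l : ℝ, 1 ≤ l → |b (l * k) - b k| ≤ L * (l - 1)
  deriv : ∀ k, HasDerivAt (fun l => b (l * k)) (b' k) 1

theorem symDeriv_wt : SymDeriv wt fun k => -(|k| * wt k ^ 2) := by
  refine ⟨⟨8, by norm_num, fun k l hl => ?_⟩, fun k => ?_⟩
  · refine (wt_sub _ _).trans ?_
    have : l * k - k = (l - 1) * k := by ring
    rw [this, abs_mul, abs_of_nonneg (by linarith)]
    have h1 := wt_le (l * k)
    have h2 := abs_mul_wt_le k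
    have h3 := wt_pos k
    calc wt (l * k) * wt k * ((l - 1) * |k|) = (wt (l * k) * (|k| * wt k)) * (l - 1) := by ring
      _ ≤ (8 * 1) * (l - 1) := by
        gcongr
      _ = _ := by ring
  · have h1 : HasDerivAt (fun l : ℝ => 1 / (l * |k| + 1 / 8)) (-(|k| * wt k ^ 2)) 1 := by
      have h2 : HasDerivAt (fun l : ℝ => l * |k| + 1 / 8) |k| 1 := by
        simpa using ((hasDerivAt_id (1 : ℝ)).mul_const |k|).add_const (1 / 8)
      have h3 : (1 : ℝ) * |k| + 1 / 8 ≠ 0 := by positivity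
      refine (h2.inv h3).congr_deriv ?_ |>.congr_of_eventuallyEq
        (Eventually.of_forall fun l => one_div _)
      unfold wt
      rw [one_mul, one_div_pow]
      ring
    refine h1.congr_of_eventuallyEq ?_
    filter_upwards [eventually_gt_nhds (zero_lt_one (α := ℝ))] with l hl
    simp only [wt, abs_mul, abs_of_pos hl]

/-- The product rule gives `k wt - k |k| wt²`, which collapses by `(|k| + 1/8) wt = 1`. The
surviving factor `1/8` makes this term, whose sign is that of `k`, small enough to be dominated by
the `B` term. -/
theorem symDeriv_mul_wt : SymDeriv (fun k => k * wt k) fun k => 1 / 8 * (k * wt k ^ 2) := by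
  refine ⟨⟨2, by norm_num, fun k l hl => ?_⟩, fun k => ?_⟩
  · have e : l * k * wt (l * k) - k * wt k = (l - 1) * (k * wt (l * k)) +
        k * (wt (l * k) - wt k) := by ring
    rw [e]
    refine (abs_add_le _ _).trans ?_
    have h1 := abs_mul_wt_le (l * k)
    have h2 := abs_mul_wt_le k
    have h3 := wt_pos k
    have h4 := wt_pos (l * k)
    have h5 : |k| * wt (l * k) ≤ 1 := by
      refine le_trans (mul_le_mul_of_nonneg_right ?_ h4.le) h1
      rw [abs_mul, abs_of_pos (by linarith : 0 < l)]
      nlinarith [abs_nonneg k]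
    have h6 := wt_sub (l * k) k
    have e2 : l * k - k = (l - 1) * k := by ring
    rw [e2, abs_mul (l - 1), abs_of_nonneg (by linarith : 0 ≤ l - 1)] at h6
    rw [abs_mul, abs_mul, abs_mul, abs_of_nonneg (by linarith : 0 ≤ l - 1), abs_of_pos h4]
    have h7 : |k| * |wt (l * k) - wt k| ≤ l - 1 := by
      calc _ ≤ |k| * (wt (l * k) * wt k * ((l - 1) * |k|)) := by gcongr
        _ = (|k| * wt (l * k)) * (|k| * wt k) * (l - 1) := by ring
        _ ≤ 1 * 1 * (l - 1) := by
          have : 0 ≤ l - 1 := by linarith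
          gcongr
        _ = _ := by ring
    nlinarith
  · have h1 := ((hasDerivAt_id (1 : ℝ)).mul_const k).mul (symDeriv_wt.deriv k)
    refine h1.congr_deriv ?_
    have := wt_mul k
    simp only [id, one_mul]
    linear_combination (-k * wt k) * this

/-- The operator `b(κ)`. -/
def symOp (b : ℝ → ℝ) (e : E3) (α t : ℝ) : L2 →L[ℂ] L2 :=
  fourierMul fun ξ => (b (kap e α t ξ) : ℂ)

theorem continuous_kap (e : E3) (α t : ℝ) : Continuous (kap e α t) := by
  unfold kap; fun_prop

theorem BLipSym.isBdd {b : ℝ → ℝ} (hb : BLipSym b) (e : E3) (α t : ℝ) :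
    IsBdd fun ξ => (b (kap e α t ξ) : ℂ) := by
  have hc := hb.lipSym.continuous.comp (continuous_kap e α t)
  obtain ⟨L, h0, -, h2⟩ := hb
  refine IsBdd.of_continuous (C := L) (Complex.continuous_ofReal.comp hc) fun ξ => ?_
  rw [Complex.norm_real]
  exact h2 _

theorem norm_symOp_le {b : ℝ → ℝ} (hb : BLipSym b) {D : ℝ} (hD : ∀ k, |b k| ≤ D) (e : E3)
    (α t : ℝ) (u : L2) : ‖symOp b e α t u‖ ≤ D * ‖u‖ :=
  norm_fourierMul_le (hb.isBdd e α t) (fun ξ => by rw [Complex.norm_real]; exact hD _) u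

theorem tendsto_symOp {b : ℝ → ℝ} (hb : BLipSym b) (e : E3) {α t : ℝ} (ht : 0 < t) (u : L2) :
    Tendsto (fun t' => symOp b e α t' u) (𝓝 t) (𝓝 (symOp b e α t u)) := by
  have hb' := hb
  obtain ⟨L, h0, -, h2⟩ := hb'
  refine tendsto_fourierMul (C := L) (Eventually.of_forall fun t' => (hb.isBdd e α t').1)
    (hb.isBdd e α t).1 (Eventually.of_forall fun t' ξ => by rw [Complex.norm_real]; exact h2 _)
    (fun ξ => by rw [Complex.norm_real]; exact h2 _) (fun ξ => ?_) u
  have h3 : ContinuousAt (fun t' => kap e α t' ξ) t := by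
    unfold kap
    exact ((Real.continuousAt_rpow_const t _ (Or.inl ht.ne')).const_mul _).mul_const _
  exact (Complex.continuous_ofReal.comp hb.lipSym.continuous).continuousAt.tendsto.comp h3

/-- The variable `κ` at time `t'` is its value at time `t` dilated by `(t' / t)^{1-α}`, so only the
derivative of the symbol along dilations matters. The dilation Lipschitz bound dominates the
difference quotients. -/
theorem tendsto_symOp_slope {b b' : ℝ → ℝ} (hb : BLipSym b) (hb' : BLipSym b') (hd : SymDeriv b b')
    (e : E3) {α t : ℝ} (hα : 0 < α) (hα1 : α < 1) (ht : 0 < t) (u : L2) :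
    Tendsto (fun t' => (t' - t)⁻¹ • (symOp b e α t' u - symOp b e α t u)) (𝓝[>] t)
      (𝓝 (((1 - α) / t : ℝ) • symOp b' e α t u)) := by
  obtain ⟨L, hL0, hL⟩ := hd.lip
  obtain ⟨D, hD0, -, hD⟩ := id hb'
  set q : ℝ → E3 → ℂ := fun t' ξ => (((t' - t)⁻¹ : ℝ) : ℂ) *
    ((b (kap e α t' ξ) : ℂ) - (b (kap e α t ξ) : ℂ)) with hq
  set p : E3 → ℂ := fun ξ => (((1 - α) / t : ℝ) : ℂ) * (b' (kap e α t ξ) : ℂ) with hp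
  have hqB : ∀ t', IsBdd (q t') := fun t' => (IsBdd.const _).mul ((hb.isBdd _ _ _).sub (hb.isBdd _ _ _))
  have hpB : IsBdd p := (IsBdd.const _).mul (hb'.isBdd _ _ _)
  have hscale : ∀ t', 0 < t' → ∀ ξ, kap e α t' ξ = (t' / t) ^ (1 - α) * kap e α t ξ := by
    intro t' ht' ξ
    unfold kap
    rw [Real.div_rpow ht'.le ht.le]
    have := (Real.rpow_pos_of_pos ht (1 - α)).ne'
    field_simp
  have hlam : ∀ t', t < t' → 1 ≤ (t' / t) ^ (1 - α) ∧ (t' / t) ^ (1 - α) - 1 ≤ (t' - t) / t := by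
    intro t' ht'
    have h1 : 1 ≤ t' / t := (one_le_div ht).2 ht'.le
    refine ⟨Real.one_le_rpow h1 (by linarith), ?_⟩
    have h2 := Real.rpow_le_rpow_of_exponent_le h1 (by linarith : 1 - α ≤ 1)
    rw [Real.rpow_one] at h2
    rw [sub_div, div_self ht.ne']
    linarith
  have hqb : ∀ t', t < t' → ∀ ξ, ‖q t' ξ‖ ≤ L / t + (1 - α) / t * D := by
    intro t' ht' ξ
    have hδ : 0 < t' - t := sub_pos.2 ht'
    obtain ⟨l1, l2⟩ := hlam t' ht'
    have h1 := hL (kap e α t ξ) _ l1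
    rw [← hscale t' (ht.trans ht')] at h1
    have h2 : ‖q t' ξ‖ ≤ L / t := by
      simp only [hq]
      rw [← Complex.ofReal_sub, norm_mul, Complex.norm_real, Complex.norm_real,
        Real.norm_of_nonneg (by positivity), Real.norm_eq_abs, inv_mul_le_iff₀ hδ]
      refine h1.trans ((mul_le_mul_of_nonneg_left l2 hL0).trans_eq ?_)
      ring
    have : 0 ≤ (1 - α) / t * D := mul_nonneg (div_nonneg (by linarith) ht.le) hD0
    linarith
  have hpb : ∀ ξ, ‖p ξ‖ ≤ L / t + (1 - α) / t * D := by
    intro ξ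
    have h0 : 0 ≤ (1 - α) / t := div_nonneg (by linarith) ht.le
    simp only [hp]
    rw [norm_mul, Complex.norm_real, Complex.norm_real, Real.norm_of_nonneg h0]
    have := mul_le_mul_of_nonneg_left (hD (kap e α t ξ)) h0
    have : 0 ≤ L / t := by positivity
    rw [Real.norm_eq_abs]
    linarith
  have hlim : ∀ ξ, Tendsto (fun t' => q t' ξ) (𝓝[>] t) (𝓝 (p ξ)) := by
    intro ξ
    have h1 : HasDerivAt (fun t' : ℝ => (t' / t) ^ (1 - α)) ((1 - α) / t) t := by
      have h2 : HasDerivAt (fun t' : ℝ => t' / t) (1 / t) t := (hasDerivAt_id t).div_const t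
      refine (h2.rpow_const (p := 1 - α) (Or.inl (by rw [div_self ht.ne']; norm_num))).congr_deriv ?_
      rw [div_self ht.ne', Real.one_rpow]
      ring
    have h3 : HasDerivAt (fun t' : ℝ => b ((t' / t) ^ (1 - α) * kap e α t ξ))
        (b' (kap e α t ξ) * ((1 - α) / t)) t := by
      have h4 := hd.deriv (kap e α t ξ)
      refine HasDerivAt.comp t (h₂ := fun l => b (l * kap e α t ξ)) ?_ h1
      rwa [div_self ht.ne', Real.one_rpow]
    have h5 : HasDerivAt (fun t' : ℝ => b (kap e α t' ξ)) (b' (kap e α t ξ) * ((1 - α) / t)) t := by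
      refine h3.congr_of_eventuallyEq ?_
      filter_upwards [eventually_gt_nhds ht] with t' ht'
      rw [hscale t' ht']
    have h6 := h5.tendsto_slope.mono_left (nhdsWithin_mono t (fun z (hz : t < z) => hz.ne'))
    have h7 := (Complex.continuous_ofReal.tendsto _).comp h6
    refine (h7.congr fun t' => ?_).trans_eq ?_
    · simp [hq, slope_def_field, div_eq_inv_mul]
    · simp only [hp]; congr 1; push_cast; ring
  have h1 := tendsto_fourierMul (C := L / t + (1 - α) / t * D) (l := 𝓝[>] t)
    (Eventually.of_forall fun t' => (hqB t').1) hpB.1 (eventually_nhdsWithin_of_forall hqb) hpb hlim u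
  have e1 : fourierMul p u = ((1 - α) / t : ℝ) • symOp b' e α t u := by
    rw [L2.real_smul_eq, symOp, ← fourierMul_const_mul _ (hb'.isBdd _ _ _)]
  rw [e1] at h1
  refine h1.congr fun t' => ?_
  rw [L2.real_smul_eq, symOp, symOp, ← fourierMul_sub (hb.isBdd _ _ _) (hb.isBdd _ _ _),
    ← fourierMul_const_mul _ ((hb.isBdd _ _ _).sub (hb.isBdd _ _ _))]

theorem inner_fourierMul_three {p q r : E3 → ℝ} (hp : IsBdd fun ξ => (p ξ : ℂ))
    (hq : IsBdd fun ξ => (q ξ : ℂ)) (hr : IsBdd fun ξ => (r ξ : ℂ)) (u z : L2) :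
    ⟪fourierMul (fun ξ => (p ξ : ℂ)) u,
      fourierMul (fun ξ => (q ξ : ℂ)) (fourierMul (fun ξ => (r ξ : ℂ)) z)⟫_ℂ =
    ⟪u, fourierMul (fun ξ => ((p ξ * (q ξ * r ξ) : ℝ) : ℂ)) z⟫_ℂ := by
  rw [inner_fourierMul_comm hp, ← fourierMul_mul hq hr, ← fourierMul_mul hp (hq.mul hr)]
  simp_rw [Complex.ofReal_mul]

/-! ### Regularized pairings expressed through quadratic forms. -/

section identities

variable {b : ℝ → ℝ} {e : E3} {α ε t : ℝ}

theorem inner_kreg_symOp_reg (h : Adm e α ε t) (hb : BLipSym b) (u z : L2) :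
    (⟪fourierMul (fun ξ => (kreg e α ε t ξ : ℂ)) u, symOp b e α t (regOp ε z)⟫_ℂ).re =
      BF (fun k => k * b k) e α ε t u z := by
  rw [symOp, regOp, inner_fourierMul_three (isBdd_kreg e α t h.pos) (hb.isBdd _ _ _) (isBdd_reg ε),
    BF]
  congr 4
  funext ξ
  simp only [kreg, sym]
  congr 1; ring

theorem inner_reg_symOp_kreg (h : Adm e α ε t) (hb : BLipSym b) (u z : L2) :
    (⟪regOp ε u, symOp b e α t (fourierMul (fun ξ => (kreg e α ε t ξ : ℂ)) z)⟫_ℂ).re =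
      BF (fun k => k * b k) e α ε t u z := by
  rw [symOp, regOp, inner_fourierMul_three (isBdd_reg ε) (hb.isBdd _ _ _) (isBdd_kreg e α t h.pos),
    BF]
  congr 4
  funext ξ
  simp only [kreg, sym]
  congr 1; ring

theorem inner_reg_symOp_reg (hb : BLipSym b) (u z : L2) :
    (⟪regOp ε u, symOp b e α t (regOp ε z)⟫_ℂ).re = BF b e α ε t u z := by
  rw [symOp, regOp, inner_fourierMul_three (isBdd_reg ε) (hb.isBdd _ _ _) (isBdd_reg ε), BF]
  congr 4
  funext ξ
  simp only [sym]
  congr 1; ring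

/-- The free Hamiltonian commutes with `b(κ)` and the resolvent, and it enters antisymmetrically.
The only contributions left in the derivative of an observable come from the motion of cutoffs and
symbols. -/
theorem inner_lreg_cancel (h : Adm e α ε t) (hb : BLipSym b) (u z : L2) :
    (⟪(-Complex.I) • fourierMul (fun ξ => (lreg ε ξ : ℂ)) u, symOp b e α t (regOp ε z)⟫_ℂ).re +
    (⟪regOp ε u, symOp b e α t ((-Complex.I) • fourierMul (fun ξ => (lreg ε ξ : ℂ)) z)⟫_ℂ).re = 0 := by
  rw [map_smul, inner_smul_left, inner_smul_right, symOp, regOp,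
    inner_fourierMul_three (r := lreg ε) (isBdd_reg ε) (hb.isBdd _ _ _) (isBdd_sq_mul_reg h.pos),
    inner_fourierMul_three (p := lreg ε) (isBdd_sq_mul_reg h.pos) (hb.isBdd _ _ _) (isBdd_reg ε)]
  have e1 : (fun ξ => ((reg ε ξ * (b (kap e α t ξ) * lreg ε ξ) : ℝ) : ℂ)) =
      fun ξ => ((lreg ε ξ * (b (kap e α t ξ) * reg ε ξ) : ℝ) : ℂ) := by
    funext ξ; congr 1; ring
  rw [e1]
  simp

end identities

theorem S2_zero (a : ℝ → ℝ) (e : E3) (α ε t : ℝ) (w : L2) : S2 (fun _ => 0) a e α ε t w = 0 := by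
  have := S2_const_mul_left (a := a) (e := e) (α := α) (ε := ε) (t := t) (StepLike.const 0) 0 w
  simpa using this

theorem rlocDeriv_apply (Q : ℝ → ℝ) (e : E3) (α ε t : ℝ) (w : L2) :
    rlocDeriv Q e α ε t w =
      (-Complex.I) • fourierMul (fun ξ => (lreg ε ξ : ℂ)) (loc Q e α t w) +
      (((t⁻¹ : ℝ) : ℂ) • ((2 : ℝ) : ℂ) • fourierMul (fun ξ => (kreg e α ε t ξ : ℂ)) (loc (deriv Q) e α t w) +
      (((t⁻¹ : ℝ) : ℂ) • (Complex.I * ((t ^ (1 - 2 * α) : ℝ) : ℂ)) •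
        regOp ε (loc (deriv (deriv Q)) e α t w) +
      ((-(α / t) : ℝ) : ℂ) • regOp ε (loc (fun y => y * deriv Q y) e α t w))) := by
  simp only [rlocDeriv, evolOp, _root_.add_apply, _root_.smul_apply, ContinuousLinearMap.comp_apply,
    smul_add, L2.real_smul_eq, loc]
  push_cast
  abel

/-- The Heisenberg derivative, with `t dy/dt = 2κ - αy` and `t dκ/dt = (1 - α)κ`. The auxiliary
cutoff `E` is needed because the equation is available only in the exterior region on both sides of
the pairing. It equals one where `g` lives, so after commuting it drops out, and all its derivatives
are annihilated by `g`. -/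
theorem exists_observable_deriv {g E b b' : ℝ → ℝ} (hg : StepLike g) (hE : StepLike E)
    (h1 : ∀ y, g y * E y = g y) (h2 : ∀ y, deriv g y * E y = deriv g y)
    (h3 : ∀ y, g y * deriv E y = 0) (hb : BLipSym b) (hb' : BLipSym b')
    (hkb : LipSym fun k => k * b k) :
    ∃ K : ℝ, 0 ≤ K ∧ ∀ {e : E3} {α ε t : ℝ}, Adm e α ε t → ∀ w : L2,
      |t * ((⟪rlocDeriv g e α ε t w, symOp b e α t (regOp ε (loc E e α t w))⟫_ℂ).re +
        (⟪regOp ε (loc g e α t w), symOp b e α t (rlocDeriv E e α ε t w) +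
          ((1 - α) / t : ℝ) • symOp b' e α t (regOp ε (loc E e α t w))⟫_ℂ).re) -
        (2 * S2 (deriv g) (fun k => k * b k) e α ε t w -
          α * S2 (fun y => y * deriv g y) b e α ε t w + (1 - α) * S2 g b' e α ε t w)| ≤
        K * t ^ (1 - 2 * α) * ‖w‖ ^ 2 := by
  obtain ⟨C1, hC1, H1⟩ := S2_split hg.deriv hE hkb
  obtain ⟨C2, hC2, H2⟩ := S2_split hg.id_mul_deriv hE hb.lipSym
  obtain ⟨C3, hC3, H3⟩ := S2_split hg hE.deriv hkb
  obtain ⟨C4, hC4, H4⟩ := S2_split hg hE.id_mul_deriv hb.lipSym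
  obtain ⟨C5, hC5, H5⟩ := S2_split hg hE hb'.lipSym
  obtain ⟨G0, hG0, G0b⟩ := hg.bounded
  obtain ⟨G2, hG2, G2b⟩ := hg.deriv.deriv.bounded
  obtain ⟨E0, hE0, E0b⟩ := hE.bounded
  obtain ⟨E2, hE2, E2b⟩ := hE.deriv.deriv.bounded
  obtain ⟨D, hD0, -, hD⟩ := id hb
  refine ⟨2 * C1 + C2 + 2 * C3 + C4 + C5 + G2 * (D * E0) + G0 * (D * E2), by positivity,
    fun {e α ε t} h w => ?_⟩
  have ht : 0 < t := by linarith [h.one_le]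
  have hα0 : 0 < α := by linarith [h.half_lt]
  have hα1 := h.lt_one
  have I1 := H1 h w
  have I2 := H2 h w
  have I3 := H3 h w
  have I4 := H4 h w
  have I5 := H5 h w
  rw [show (fun y => deriv g y * E y) = deriv g from funext h2] at I1
  rw [show (fun y => y * deriv g y * E y) = fun y => y * deriv g y by
    funext y; rw [mul_assoc, h2]] at I2
  rw [show (fun y => g y * deriv E y) = fun _ => (0 : ℝ) from funext h3, S2_zero, sub_zero] at I3
  rw [show (fun y => g y * (y * deriv E y)) = fun _ => (0 : ℝ) by
    funext y; rw [mul_left_comm, h3, mul_zero], S2_zero, sub_zero] at I4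
  rw [show (fun y => g y * E y) = g from funext h1] at I5
  have hbd : ∀ u z : L2, |(⟪regOp ε u, symOp b e α t (regOp ε z)⟫_ℂ).im| ≤ D * (‖u‖ * ‖z‖) := by
    intro u z
    refine (Complex.abs_im_le_norm _).trans ((norm_inner_le_norm _ _).trans ?_)
    calc _ ≤ ‖u‖ * (D * ‖z‖) := by
          gcongr
          · exact norm_regOp_le ε u
          · exact (norm_symOp_le hb hD _ _ _ _).trans
              (mul_le_mul_of_nonneg_left (norm_regOp_le ε z) hD0)
      _ = _ := by ring
  set hh := t ^ (1 - 2 * α) with hhdef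
  have hh0 : 0 < hh := Real.rpow_pos_of_pos ht _
  have I6 : |hh * (⟪regOp ε (loc (deriv (deriv g)) e α t w),
      symOp b e α t (regOp ε (loc E e α t w))⟫_ℂ).im| ≤ hh * (G2 * (D * E0) * ‖w‖ ^ 2) := by
    rw [abs_mul, abs_of_pos hh0]
    refine mul_le_mul_of_nonneg_left ((hbd _ _).trans ?_) hh0.le
    calc _ ≤ D * ((G2 * ‖w‖) * (E0 * ‖w‖)) := by
          gcongr
          · exact norm_loc_le hg.deriv.deriv G2b w
          · exact norm_loc_le hE E0b w
      _ = _ := by ring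
  have I7 : |hh * (⟪regOp ε (loc g e α t w),
      symOp b e α t (regOp ε (loc (deriv (deriv E)) e α t w))⟫_ℂ).im| ≤
      hh * (G0 * (D * E2) * ‖w‖ ^ 2) := by
    rw [abs_mul, abs_of_pos hh0]
    refine mul_le_mul_of_nonneg_left ((hbd _ _).trans ?_) hh0.le
    calc _ ≤ D * ((G0 * ‖w‖) * (E2 * ‖w‖)) := by
          gcongr
          · exact norm_loc_le hg G0b w
          · exact norm_loc_le hE.deriv.deriv E2b w
      _ = _ := by ring
  have cancel := inner_lreg_cancel h hb (loc g e α t w) (loc E e α t w)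
  have expand : t * ((⟪rlocDeriv g e α ε t w, symOp b e α t (regOp ε (loc E e α t w))⟫_ℂ).re +
        (⟪regOp ε (loc g e α t w), symOp b e α t (rlocDeriv E e α ε t w) +
          ((1 - α) / t : ℝ) • symOp b' e α t (regOp ε (loc E e α t w))⟫_ℂ).re) =
      2 * BF (fun k => k * b k) e α ε t (loc (deriv g) e α t w) (loc E e α t w) +
      hh * (⟪regOp ε (loc (deriv (deriv g)) e α t w),
        symOp b e α t (regOp ε (loc E e α t w))⟫_ℂ).im -
      α * BF b e α ε t (loc (fun y => y * deriv g y) e α t w) (loc E e α t w) +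
      2 * BF (fun k => k * b k) e α ε t (loc g e α t w) (loc (deriv E) e α t w) -
      hh * (⟪regOp ε (loc g e α t w),
        symOp b e α t (regOp ε (loc (deriv (deriv E)) e α t w))⟫_ℂ).im -
      α * BF b e α ε t (loc g e α t w) (loc (fun y => y * deriv E y) e α t w) +
      (1 - α) * BF b' e α ε t (loc g e α t w) (loc E e α t w) := by
    rw [rlocDeriv_apply, rlocDeriv_apply, L2.real_smul_eq]
    simp only [map_add, inner_add_left, inner_add_right, Complex.add_re]
    rw [map_smul, map_smul (symOp b e α t) ((t⁻¹ : ℝ) : ℂ), map_smul (symOp b e α t) ((2 : ℝ) : ℂ),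
      map_smul (symOp b e α t) ((t⁻¹ : ℝ) : ℂ), map_smul (symOp b e α t) (Complex.I * _),
      map_smul (symOp b e α t) ((-(α / t) : ℝ) : ℂ)]
    rw [map_smul, inner_smul_left, inner_smul_right] at cancel
    simp only [inner_smul_left, inner_smul_right, Complex.conj_ofReal, Complex.re_ofReal_mul,
      map_mul, Complex.conj_I, mul_assoc, Complex.I_mul_re, neg_mul, Complex.neg_re,
      Complex.im_ofReal_mul, inner_kreg_symOp_reg h hb, inner_reg_symOp_kreg h hb,
      inner_reg_symOp_reg hb, inner_reg_symOp_reg hb', map_neg] at cancel ⊢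
    field_simp
    linear_combination t * cancel
  rw [expand]
  have J1 := abs_le.1 I1
  have J2 := abs_le.1 I2
  have J3 := abs_le.1 I3
  have J4 := abs_le.1 I4
  have J5 := abs_le.1 I5
  have J6 := abs_le.1 I6
  have J7 := abs_le.1 I7
  have k2 : |α * (BF b e α ε t (loc (fun y => y * deriv g y) e α t w) (loc E e α t w) -
      S2 (fun y => y * deriv g y) b e α ε t w)| ≤ C2 * hh * ‖w‖ ^ 2 := by
    rw [abs_mul, abs_of_pos hα0]
    exact (mul_le_of_le_one_left (abs_nonneg _) hα1.le).trans I2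
  have k4 : |α * BF b e α ε t (loc g e α t w) (loc (fun y => y * deriv E y) e α t w)| ≤
      C4 * hh * ‖w‖ ^ 2 := by
    rw [abs_mul, abs_of_pos hα0]
    exact (mul_le_of_le_one_left (abs_nonneg _) hα1.le).trans I4
  have k5 : |(1 - α) * (BF b' e α ε t (loc g e α t w) (loc E e α t w) - S2 g b' e α ε t w)| ≤
      C5 * hh * ‖w‖ ^ 2 := by
    rw [abs_mul, abs_of_pos (by linarith)]
    exact (mul_le_of_le_one_left (abs_nonneg _) (by linarith)).trans I5
  have K2 := abs_le.1 k2
  have K4 := abs_le.1 k4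
  have K5 := abs_le.1 k5
  rw [abs_le]
  constructor <;> linarith [J1.1, J1.2, J3.1, J3.2, J6.1, J6.2, J7.1, J7.2, K2.1, K2.2, K4.1, K4.2,
    K5.1, K5.2]

/-! ### Continuity in time -/

/-- Uniform boundedness upgrades strong convergence at the limit vector to joint convergence. -/
theorem tendsto_clm_apply {ι : Type*} {l : Filter ι} {A : ι → L2 →L[ℂ] L2} {B : ℝ} {u : ι → L2}
    {u₀ y₀ : L2} (hB : ∀ᶠ i in l, ∀ x, ‖A i x‖ ≤ B * ‖x‖)
    (hA : Tendsto (fun i => A i u₀) l (𝓝 y₀)) (hu : Tendsto u l (𝓝 u₀)) :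
    Tendsto (fun i => A i (u i)) l (𝓝 y₀) := by
  have h1 : Tendsto (fun i => A i (u i - u₀)) l (𝓝 0) := by
    rw [tendsto_zero_iff_norm_tendsto_zero]
    have h3 := (tendsto_iff_norm_sub_tendsto_zero.1 hu).const_mul B
    rw [mul_zero] at h3
    refine squeeze_zero' (Eventually.of_forall fun _ => norm_nonneg _) ?_ h3
    filter_upwards [hB] with i hi using hi _
  have h2 := h1.add hA
  rw [zero_add] at h2
  refine h2.congr fun i => ?_
  rw [← map_add, sub_add_cancel]

theorem continuousOn_loc {Q : ℝ → ℝ} (hQ : StepLike Q) (e : E3) (α : ℝ) {T : ℝ} (hT : 0 < T)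
    {v : ℝ → L2} (hv : ContinuousOn v (Ici T)) :
    ContinuousOn (fun t => loc Q e α t (v t)) (Ici T) := by
  intro t ht
  obtain ⟨D, hD0, hD⟩ := hQ.bounded
  have ht0 : 0 < t := hT.trans_le ht
  refine tendsto_clm_apply (A := fun t => mulOp (cut e (t ^ α) Q)) (B := D)
    (Eventually.of_forall fun t x => norm_loc_le hQ hD x) ?_ (hv t ht)
  refine Tendsto.mono_left ?_ nhdsWithin_le_nhds
  refine tendsto_mulOp (C := D) (Eventually.of_forall fun t' => (hQ.isBdd _ _).1)
    (hQ.isBdd _ _).1 (Eventually.of_forall fun t' x => ?_) (fun x => ?_) (fun x => ?_) (v t)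
  · rw [cut, Complex.norm_real]; exact hD _
  · rw [cut, Complex.norm_real]; exact hD _
  · have : ContinuousAt (fun t' : ℝ => inner ℝ e x / t' ^ α) t :=
      continuousAt_const.div (Real.continuousAt_rpow_const t α (Or.inl ht0.ne'))
        (Real.rpow_pos_of_pos ht0 α).ne'
    exact (Complex.continuous_ofReal.comp hQ.smooth.continuous).continuousAt.tendsto.comp this

theorem continuousOn_symOp {b : ℝ → ℝ} (hb : BLipSym b) (e : E3) (α : ℝ) {T : ℝ} (hT : 0 < T)
    {u : ℝ → L2} (hu : ContinuousOn u (Ici T)) :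
    ContinuousOn (fun t => symOp b e α t (u t)) (Ici T) := by
  intro t ht
  obtain ⟨D, hD0, -, hD⟩ := id hb
  exact tendsto_clm_apply (A := fun t => symOp b e α t) (B := D)
    (Eventually.of_forall fun t x => norm_symOp_le hb hD _ _ _ x)
    ((tendsto_symOp hb e (hT.trans_le ht) _).mono_left nhdsWithin_le_nhds) (hu t ht)

theorem continuousOn_BF {a : ℝ → ℝ} (ha : LipSym a) {e : E3} {α ε T : ℝ}
    (h : ∀ t, T ≤ t → Adm e α ε t) {u z : ℝ → L2} (hu : ContinuousOn u (Ici T))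
    (hz : ContinuousOn z (Ici T)) : ContinuousOn (fun t => BF a e α ε t (u t) (z t)) (Ici T) := by
  obtain ⟨L, hL0, hL⟩ := ha.norm_sym_le
  have hε := (h T le_rfl).pos
  have key : ContinuousOn (fun t => fourierMul (fun ξ => (sym a e α ε t ξ : ℂ)) (z t)) (Ici T) := by
    intro t ht
    have ht0 : 0 < t := by linarith [(h t ht).one_le]
    have hev : ∀ᶠ t' in 𝓝[Ici T] t, ∀ ξ, ‖(sym a e α ε t' ξ : ℂ)‖ ≤
        L * (1 + (t + 1) * (1 / (2 * ε))) := by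
      have : ∀ᶠ t' in 𝓝[Ici T] t, t' < t + 1 :=
        (eventually_lt_nhds (by linarith)).filter_mono nhdsWithin_le_nhds
      filter_upwards [this, self_mem_nhdsWithin] with t' h1 h2 ξ
      refine (hL (h t' h2) ξ).trans ?_
      gcongr
    refine tendsto_clm_apply (A := fun t => fourierMul (fun ξ => (sym a e α ε t ξ : ℂ)))
      (B := L * (1 + (t + 1) * (1 / (2 * ε)))) ?_ ?_ (hz t ht)
    · filter_upwards [hev, self_mem_nhdsWithin] with t' h1 h2 x
      exact norm_fourierMul_le (ha.isBdd_sym (h t' h2)) h1 x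
    · refine tendsto_fourierMul (C := L * (1 + (t + 1) * (1 / (2 * ε)))) ?_
        (ha.isBdd_sym (h t ht)).1 hev ?_ ?_ (z t)
      · exact Eventually.of_forall fun t' => (ha.continuous_sym _ _ _ _).measurable
      · intro ξ
        refine (hL (h t ht) ξ).trans ?_
        gcongr
        linarith
      · intro ξ
        have h3 : ContinuousAt (fun t' => kap e α t' ξ) t := by
          unfold kap
          exact ((Real.continuousAt_rpow_const t _ (Or.inl ht0.ne')).const_mul _).mul_const _
        have h4 : ContinuousAt (fun t' => (sym a e α ε t' ξ : ℂ)) t := by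
          unfold sym
          exact Complex.continuous_ofReal.continuousAt.comp
            ((ha.continuous.continuousAt.comp h3).mul_const _)
        exact h4.tendsto.mono_left nhdsWithin_le_nhds
  exact Complex.continuous_re.comp_continuousOn (hu.inner key)

theorem integral_rpow_neg_le {p t₁ t₂ : ℝ} (hp : 1 < p) (h1 : 1 ≤ t₁) (h12 : t₁ ≤ t₂) :
    ∫ t in t₁..t₂, t ^ (-p) ≤ t₁ ^ (1 - p) / (p - 1) := by
  have h0 : 0 < t₁ := by linarith
  rw [integral_rpow (Or.inr ⟨by linarith, by rw [uIcc_of_le h12]; exact fun h => by linarith [h.1]⟩)]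
  have e1 : -p + 1 = 1 - p := by ring
  rw [e1, ← neg_sub p 1, div_neg, ← neg_div, neg_sub]
  have := Real.rpow_pos_of_pos (h0.trans_le h12) (-(p - 1))
  gcongr
  linarith [Real.rpow_pos_of_pos (h0.trans_le h12) (1 - p)]

theorem continuousOn_rpow_Ici {T : ℝ} (hT : 0 < T) (p : ℝ) :
    ContinuousOn (fun t : ℝ => t ^ p) (Ici T) := fun t ht =>
  (Real.continuousAt_rpow_const t p (Or.inl (hT.trans_le ht).ne')).continuousWithinAt

/-! ### Profiles -/

theorem StepLike.of_eventually_const {Q : ℝ → ℝ} (h : ContDiff ℝ ∞ Q) {a b c d : ℝ}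
    (ha : ∀ y ≤ a, Q y = c) (hb : ∀ y, b ≤ y → Q y = d) : StepLike Q := by
  refine ⟨h, HasCompactSupport.of_support_subset_isCompact (isCompact_Icc (a := a) (b := b)) ?_⟩
  intro y hy
  by_contra hcon
  apply hy
  rw [mem_Icc, not_and_or, not_le, not_le] at hcon
  rcases hcon with h1 | h1
  · have : Q =ᶠ[𝓝 y] fun _ => c := by
      filter_upwards [eventually_lt_nhds h1] with z hz using ha z hz.le
    rw [this.deriv_eq]; simp
  · have : Q =ᶠ[𝓝 y] fun _ => d := by
      filter_upwards [eventually_gt_nhds h1] with z hz using hb z hz.le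
    rw [this.deriv_eq]; simp

theorem exists_step {a b : ℝ} (hab : a < b) : ∃ E : ℝ → ℝ, StepLike E ∧ (∀ y ≤ a, E y = 0) ∧
    (∀ y, b ≤ y → E y = 1) ∧ (∀ y, 0 ≤ E y) ∧ ∀ y, E y ≤ 1 := by
  have h0 : 0 < b - a := sub_pos.2 hab
  have h1 : ∀ y ≤ a, Real.smoothTransition ((y - a) / (b - a)) = 0 := fun y hy =>
    Real.smoothTransition.zero_of_nonpos (div_nonpos_of_nonpos_of_nonneg (by linarith) h0.le)
  have h2 : ∀ y, b ≤ y → Real.smoothTransition ((y - a) / (b - a)) = 1 := fun y hy =>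
    Real.smoothTransition.one_of_one_le (by rw [one_le_div h0]; linarith)
  refine ⟨fun y => Real.smoothTransition ((y - a) / (b - a)),
    StepLike.of_eventually_const ?_ h1 h2, h1, h2, fun y => Real.smoothTransition.nonneg _,
    fun y => Real.smoothTransition.le_one _⟩
  exact Real.smoothTransition.contDiff.comp ((contDiff_id.sub contDiff_const).div_const _)

theorem stepLike_primitive {ρ : ℝ → ℝ} (h : ContDiff ℝ ∞ ρ) (hc : HasCompactSupport ρ) (a : ℝ) :
    StepLike (fun y => ∫ z in a..y, ρ z) ∧ deriv (fun y => ∫ z in a..y, ρ z) = ρ := by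
  have h1 : ∀ y, HasDerivAt (fun y => ∫ z in a..y, ρ z) (ρ y) y := fun y =>
    h.continuous.integral_hasStrictDerivAt a y |>.hasDerivAt
  have h2 : deriv (fun y => ∫ z in a..y, ρ z) = ρ := funext fun y => (h1 y).deriv
  refine ⟨⟨contDiff_infty_iff_deriv.2 ⟨fun y => (h1 y).differentiableAt, by rw [h2]; exact h⟩,
    by rw [h2]; exact hc⟩, h2⟩

theorem exists_bump {a b : ℝ} (hab : a < b) : ∃ γ : ℝ → ℝ, ContDiff ℝ ∞ γ ∧ HasCompactSupport γ ∧
    (∀ y, γ y ≠ 0 → a < y ∧ y < b) ∧ γ ((a + b) / 2) = 1 := by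
  let f : ContDiffBump ((a + b) / 2) := ⟨(b - a) / 4, (b - a) / 2, by linarith, by linarith⟩
  refine ⟨f, f.contDiff, f.hasCompactSupport, fun y hy => ?_, ?_⟩
  · have : y ∈ Function.support f := hy
    rw [f.support_eq, Metric.mem_ball, Real.dist_eq, abs_lt] at this
    have h1 : f.rOut = (b - a) / 2 := rfl
    rw [h1] at this
    constructor <;> linarith [this.1, this.2]
  · exact f.one_of_mem_closedBall (by simp [f.rIn_pos.le])

/-- Profiles of the propagation observable. -/
theorem exists_profiles {α s s₀ : ℝ} (hα : 1 / 2 < α) (hs : 1 / 2 ≤ s) (hs₀ : s < s₀) {χ : ℝ → ℝ}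
    (hχ : ContDiff ℝ ∞ χ) (hχc : HasCompactSupport χ) (hχs : ∀ y, χ y ≠ 0 → s₀ ≤ y) :
    ∃ γ g B E : ℝ → ℝ, ∃ c₁ : ℝ, 0 < c₁ ∧ ContDiff ℝ ∞ γ ∧ HasCompactSupport γ ∧ StepLike g ∧
      StepLike B ∧ StepLike E ∧ (∀ y, 0 ≤ g y) ∧ (∀ y, c₁ * χ y ^ 2 ≤ B y - 1 / 8 * g y) ∧
      deriv g = (fun y => χ y ^ 2 + γ y ^ 2) ∧
      deriv B = (fun y => α / 2 * (y * (χ y ^ 2 + γ y ^ 2))) ∧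
      (∃ s₁, s < s₁ ∧ ∀ y, (g y ≠ 0 → s₁ ≤ y) ∧ (B y ≠ 0 → s₁ ≤ y) ∧ (E y ≠ 0 → s₁ ≤ y)) ∧
      ∀ y, (g y * E y = g y ∧ deriv g y * E y = deriv g y ∧ g y * deriv E y = 0) ∧
        (B y * E y = B y ∧ deriv B y * E y = deriv B y ∧ B y * deriv E y = 0) := by
  -- The gap between `s` and `s₀` is divided into five slots: `E` rises in the second, `γ` lives in
  -- the fourth, and `χ` begins after the fifth. So `E` is already one when `g` and `B` become
  -- nonzero.
  set d := (s₀ - s) / 5 with hd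
  have hd0 : 0 < d := by rw [hd]; linarith
  -- The bump `γ` places mass strictly before `s₀`. Without it `B - g/8` would vanish at the left
  -- edge of the support of `χ`; with it the difference has reached a positive value `m` there.
  obtain ⟨γ, hγ, hγc, hγs, hγ1⟩ := exists_bump (a := s + 3 * d) (b := s + 4 * d) (by linarith)
  obtain ⟨E, hE, hE0, hE1, -, -⟩ := exists_step (a := s + d) (b := s + 2 * d) (by linarith)
  set ρ : ℝ → ℝ := fun y => χ y ^ 2 + γ y ^ 2 with hρ
  have sq_c : ∀ θ : ℝ → ℝ, HasCompactSupport θ → HasCompactSupport fun y => θ y ^ 2 := fun θ h => by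
    simp_rw [sq]; exact h.mul_left
  have hρd : ContDiff ℝ ∞ ρ := (hχ.pow 2).add (hγ.pow 2)
  have hρc : HasCompactSupport ρ := (sq_c χ hχc).add (sq_c γ hγc)
  have hρ0 : ∀ y, y < s + 3 * d → ρ y = 0 := fun y hy => by
    have h1 : χ y = 0 := by
      by_contra h
      have := hχs y h
      linarith
    have h2 : γ y = 0 := by
      by_contra h
      linarith [(hγs y h).1]
    simp [hρ, h1, h2]
  have hρn : ∀ y, 0 ≤ ρ y := fun y => by positivity
  have hBd : ContDiff ℝ ∞ (fun y => α / 2 * (y * ρ y)) := contDiff_const.mul (contDiff_id.mul hρd)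
  have hBc : HasCompactSupport (fun y => α / 2 * (y * ρ y)) := (hρc.mul_left).mul_left
  obtain ⟨sg, dg⟩ := stepLike_primitive hρd hρc s
  obtain ⟨sB, dB⟩ := stepLike_primitive hBd hBc s
  set g : ℝ → ℝ := fun y => ∫ z in s..y, ρ z with hg
  set B : ℝ → ℝ := fun y => ∫ z in s..y, α / 2 * (z * ρ z) with hB
  have vanish : ∀ f : ℝ → ℝ, (∀ y, y < s + 3 * d → f y = 0) → ∀ y, y ≤ s + 3 * d →
      ∫ z in s..y, f z = 0 := by
    intro f hf y hy
    refine intervalIntegral.integral_zero_ae ?_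
    have hae : ∀ᵐ z : ℝ, z ≠ s + 3 * d := by
      rw [ae_iff]; simp
    filter_upwards [hae] with z hz1 hz
    refine hf z (lt_of_le_of_ne ?_ hz1)
    rcases le_total s y with h | h
    · rw [uIoc_of_le h] at hz; exact hz.2.trans hy
    · rw [uIoc_of_ge h] at hz; exact hz.2.trans (by linarith)
  have hg0 : ∀ y, y ≤ s + 3 * d → g y = 0 := vanish ρ hρ0
  have hB0 : ∀ y, y ≤ s + 3 * d → B y = 0 := vanish _ fun y hy => by rw [hρ0 y hy]; ring
  have hdE : ∀ y, s + 2 * d < y → deriv E y = 0 := fun y hy => by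
    have : E =ᶠ[𝓝 y] fun _ => 1 := by
      filter_upwards [eventually_gt_nhds hy] with z hz using hE1 z hz.le
    rw [this.deriv_eq]; simp
  have hint : ∀ f : ℝ → ℝ, Continuous f → ∀ a b, IntervalIntegrable f volume a b :=
    fun f hf a b => hf.intervalIntegrable a b
  have hgnn : ∀ y, 0 ≤ g y := fun y => by
    rcases le_total y s with h | h
    · exact (hg0 y (by linarith)).ge
    · exact intervalIntegral.integral_nonneg h fun z _ => hρn z
  set κ : ℝ → ℝ := fun z => (α / 2 * z - 1 / 8) * ρ z with hκ
  have hκc : Continuous κ := by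
    have := hρd.continuous
    fun_prop
  -- Here the constant `1/8` is explained: `α > 1/2` and `z ≥ s ≥ 1/2` give `α z / 2 > 1/8`.
  have hκn : ∀ z, 0 ≤ κ z := fun z => by
    rcases lt_or_ge z (s + 3 * d) with h | h
    · simp [hκ, hρ0 z h]
    · refine mul_nonneg ?_ (hρn z)
      nlinarith
  have hdiff : ∀ y, B y - 1 / 8 * g y = ∫ z in s..y, κ z := fun y => by
    have e : ∫ z in s..y, κ z = ∫ z in s..y, (α / 2 * (z * ρ z) - 1 / 8 * ρ z) := by
      refine intervalIntegral.integral_congr fun z _ => ?_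
      simp only [hκ]; ring
    refine Eq.trans ?_ (e.trans (intervalIntegral.integral_sub (hint _ hBd.continuous _ _)
      (hint (fun z => 1 / 8 * ρ z) (continuous_const.mul hρd.continuous) _ _))).symm
    rw [intervalIntegral.integral_const_mul (1 / 8) ρ]
  set m : ℝ := ∫ z in s..s₀, κ z with hm
  have hm0 : 0 < m := by
    refine intervalIntegral.integral_pos hs₀ hκc.continuousOn (fun z _ => hκn z)
      ⟨(s + 3 * d + (s + 4 * d)) / 2, ⟨by linarith, by linarith⟩, ?_⟩
    refine mul_pos (by nlinarith) ?_
    simp only [hρ, hγ1]; positivity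
  obtain ⟨X, hX0, hX⟩ := (StepLike.of_compact hχ hχc).bounded
  refine ⟨γ, g, B, E, m / (X ^ 2 + 1), by positivity, hγ, hγc, sg, sB, hE, hgnn, fun y => ?_, dg,
    dB, ⟨s + d, by linarith, fun y => ⟨fun h => ?_, fun h => ?_, fun h => ?_⟩⟩, fun y => ?_⟩
  · rw [hdiff]
    rcases eq_or_ne (χ y) 0 with h | h
    · rw [h, zero_pow two_ne_zero, mul_zero]
      rcases le_total y s with h1 | h1
      · rw [vanish κ (fun z hz => by simp [hκ, hρ0 z hz]) y (by linarith)]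
      · exact intervalIntegral.integral_nonneg h1 fun z _ => hκn z
    · have h1 := hχs y h
      rw [← intervalIntegral.integral_add_adjacent_intervals (hint κ hκc s s₀) (hint κ hκc s₀ y)]
      have h2 : 0 ≤ ∫ z in s₀..y, κ z := intervalIntegral.integral_nonneg h1 fun z _ => hκn z
      have h3 : χ y ^ 2 ≤ X ^ 2 := by rw [← sq_abs]; exact pow_le_pow_left₀ (abs_nonneg _) (hX y) 2
      have h4 : m / (X ^ 2 + 1) * χ y ^ 2 ≤ m := by
        rw [div_mul_eq_mul_div, div_le_iff₀ (by positivity)]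
        nlinarith
      linarith
  · by_contra hcon
    exact h (hg0 y (by linarith))
  · by_contra hcon
    exact h (hB0 y (by linarith))
  · by_contra hcon
    exact h (hE0 y (by linarith))
  · rcases le_total y (s + 2 * d) with h | h
    · have h1 := hρ0 y (by linarith)
      have h2 := hg0 y (by linarith)
      have h3 := hB0 y (by linarith)
      have h4 : deriv g y = 0 := by rw [dg]; exact h1
      have h5 : deriv B y = 0 := by rw [dB]; simp only [h1, mul_zero]
      simp [h2, h3, h4, h5]
    · have h1 := hE1 y h
      rcases h.eq_or_lt with h' | h'
      · have h2 := hg0 y (by linarith)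
        have h3 := hB0 y (by linarith)
        simp [h1, h2, h3]
      · simp [h1, hdE y h']

/-! ### The propagation estimate -/

/-- The local energy `⟪χ v, (|κ| + 1/8) (1 - ε²Δ)⁻² χ v⟫`. -/
def nrg (χ : ℝ → ℝ) (e : E3) (α ε t : ℝ) (w : L2) : ℝ :=
  BF (fun k => |k| + 1 / 8) e α ε t (loc χ e α t w) (loc χ e α t w)

theorem nrg_nonneg {χ : ℝ → ℝ} {e : E3} {α ε t : ℝ} (h : Adm e α ε t) (w : L2) :
    0 ≤ nrg χ e α ε t w :=
  BF_self_nonneg h lipSym_abs_add (fun k => by positivity) _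

/-- The observable `⟪g v, b(κ) (1 - ε²Δ)⁻² E v⟫`. -/
def obs (g E b : ℝ → ℝ) (e : E3) (α ε : ℝ) (v : ℝ → L2) (t : ℝ) : ℝ :=
  (⟪rloc g e α ε v t, symOp b e α t (rloc E e α ε v t)⟫_ℂ).re

theorem continuousOn_rloc {Q : ℝ → ℝ} (hQ : StepLike Q) (e : E3) (α ε : ℝ) {T : ℝ} (hT : 0 < T)
    {v : ℝ → L2} (hv : ContinuousOn v (Ici T)) : ContinuousOn (rloc Q e α ε v) (Ici T) :=
  (regOp ε).continuous.comp_continuousOn (continuousOn_loc hQ e α hT hv)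

theorem continuousOn_obs {g E b : ℝ → ℝ} (hg : StepLike g) (hE : StepLike E) (hb : BLipSym b)
    (e : E3) (α ε : ℝ) {T : ℝ} (hT : 0 < T) {v : ℝ → L2} (hv : ContinuousOn v (Ici T)) :
    ContinuousOn (obs g E b e α ε v) (Ici T) :=
  Complex.continuous_re.comp_continuousOn ((continuousOn_rloc hg e α ε hT hv).inner
    (continuousOn_symOp hb e α hT (continuousOn_rloc hE e α ε hT hv)))

theorem norm_rloc_le {Q : ℝ → ℝ} (hQ : StepLike Q) {D : ℝ} (hD : ∀ y, |Q y| ≤ D) (e : E3)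
    (α ε : ℝ) (v : ℝ → L2) (t : ℝ) : ‖rloc Q e α ε v t‖ ≤ D * ‖v t‖ :=
  (norm_regOp_le ε _).trans (norm_loc_le hQ hD _)

theorem exists_obs_bound {g E b : ℝ → ℝ} (hg : StepLike g) (hE : StepLike E) (hb : BLipSym b) :
    ∃ K : ℝ, 0 ≤ K ∧ ∀ (e : E3) (α ε : ℝ) (v : ℝ → L2) (t : ℝ),
      |obs g E b e α ε v t| ≤ K * ‖v t‖ ^ 2 := by
  obtain ⟨G, hG0, hG⟩ := hg.bounded
  obtain ⟨D, hD0, hD⟩ := hE.bounded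
  obtain ⟨L, hL0, -, hL⟩ := id hb
  refine ⟨G * (L * D), by positivity, fun e α ε v t => ?_⟩
  refine (Complex.abs_re_le_norm _).trans ((norm_inner_le_norm _ _).trans ?_)
  calc _ ≤ (G * ‖v t‖) * (L * (D * ‖v t‖)) := by
        gcongr
        · exact norm_rloc_le hg hG e α ε v t
        · exact (norm_symOp_le hb hL _ _ _ _).trans
            (mul_le_mul_of_nonneg_left (norm_rloc_le hE hD e α ε v t) hL0)
    _ = _ := by ring

theorem exists_obs_approxDeriv {α s M C β s₁ : ℝ} (hs : s < s₁) {g E b b' : ℝ → ℝ}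
    (hg : StepLike g) (hE : StepLike E) (h1 : ∀ y, g y * E y = g y)
    (h2 : ∀ y, deriv g y * E y = deriv g y) (h3 : ∀ y, g y * deriv E y = 0)
    (hgs : ∀ y, g y ≠ 0 → s₁ ≤ |y|) (hEs : ∀ y, E y ≠ 0 → s₁ ≤ |y|) (hb : BLipSym b)
    (hb' : BLipSym b') (hd : SymDeriv b b') (hkb : LipSym fun k => k * b k) :
    ∃ K K' : ℝ, 0 ≤ K ∧ 0 ≤ K' ∧ ∀ {T : ℝ} {v : ℝ → L2}, ExtSol α s M C β T v →
      ∀ {e : E3} {ε t : ℝ}, Adm e α ε t → T ≤ t →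
        ∃ r, ApproxDeriv (obs g E b e α ε v) r (K' * t ^ (-β)) t ∧
          |t * r - (2 * S2 (deriv g) (fun k => k * b k) e α ε t (v t) -
          α * S2 (fun y => y * deriv g y) b e α ε t (v t) + (1 - α) * S2 g b' e α ε t (v t))| ≤
        K * t ^ (1 - 2 * α) * ‖v t‖ ^ 2 := by
  obtain ⟨K, hK0, hK⟩ := exists_observable_deriv hg hE h1 h2 h3 hb hb' hkb
  obtain ⟨G, hG0, hG⟩ := hg.bounded
  obtain ⟨D, hD0, hD⟩ := hE.bounded
  obtain ⟨L, hL0, -, hL⟩ := id hb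
  refine ⟨K, |2 * G * D * L * C * M|, hK0, abs_nonneg _, fun {T v} hv {e ε t} h ht => ?_⟩
  have ht0 : 0 < t := by linarith [h.one_le]
  have hα0 : 0 < α := by linarith [h.half_lt]
  have a1 := hv.approxDeriv hg hs hgs hG h ht
  have a2 := hv.approxDeriv hE hs hEs hD h ht
  have a3 := a2.clm (A := fun t => symOp b e α t) hL0
    (Eventually.of_forall fun t' u => norm_symOp_le hb hL _ _ _ u)
    ((tendsto_symOp hb e ht0 _).mono_left nhdsWithin_le_nhds)
    (tendsto_symOp_slope hb hb' hd e hα0 h.lt_one ht0 _)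
  have a4 := a1.re_inner a3
  refine ⟨_, a4.mono ?_, hK h (v t)⟩
  have hM := hv.bound t ht
  have hC := hv.nonneg
  have hp := Real.rpow_pos_of_pos ht0 (-β)
  have n1 : ‖rloc g e α ε v t‖ ≤ G * M :=
    (norm_rloc_le hg hG e α ε v t).trans (mul_le_mul_of_nonneg_left hM hG0)
  have n2 : ‖symOp b e α t (rloc E e α ε v t)‖ ≤ L * (D * M) :=
    (norm_symOp_le hb hL _ _ _ _).trans (mul_le_mul_of_nonneg_left
      ((norm_rloc_le hE hD e α ε v t).trans (mul_le_mul_of_nonneg_left hM hD0)) hL0)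
  calc _ ≤ G * (C * t ^ (-β)) * (L * (D * M)) + G * M * (L * (D * (C * t ^ (-β)))) := by gcongr
    _ = (2 * G * D * L * C * M) * t ^ (-β) := by ring
    _ ≤ _ := by gcongr; exact le_abs_self _

/-- A bounded observable whose derivative dominates the local energy, up to integrable errors,
forces the energy to be integrable with respect to `dt / t`. The constant precedes `v`, `T`, `e` and
`ε` in the quantifiers: the uniformity over solutions lets it apply to all normalized free waves at
once, and that in `ε` allows the regularization to be removed. -/
theorem propagation_estimate {α s s₀ M C β : ℝ} (hα : 1 / 2 < α) (hα1 : α < 1) (hs : 1 / 2 ≤ s)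
    (hs₀ : s < s₀) (hβ : 1 < β) {χ : ℝ → ℝ} (hχ : ContDiff ℝ ∞ χ) (hχc : HasCompactSupport χ)
    (hχs : ∀ y, χ y ≠ 0 → s₀ ≤ y) :
    ∃ K : ℝ, 0 ≤ K ∧ ∀ {T : ℝ} {v : ℝ → L2}, ExtSol α s M C β T v → ∀ {e : E3} {ε : ℝ}, ‖e‖ = 1 →
      0 < ε → ε ≤ 1 → ∀ t₁ t₂, T ≤ t₁ → t₁ ≤ t₂ →
        ∫ t in t₁..t₂, t⁻¹ * nrg χ e α ε t (v t) ≤ K := by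
  obtain ⟨γ, g, B, E, c₁, hc₁, hγ, hγc, hg, hB, hE, hg0, hBg, dg, dB, ⟨s₁, hs₁, hsupp⟩, hrel⟩ :=
    exists_profiles hα hs hs₀ hχ hχc hχs
  have hs₁0 : 0 < s₁ := by linarith
  obtain ⟨R, hR⟩ : ∃ R, ∀ y, χ y ≠ 0 → y ≤ R := by
    obtain ⟨R, hR⟩ := hχc.isCompact.bddAbove
    exact ⟨R, fun y hy => hR (subset_tsupport χ hy)⟩
  obtain ⟨c₀, C₀, hc₀, hC₀, H₀⟩ := exists_commutator_lower_bound hα hα1 hχ hχc hγ hγc hg hB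
    (s₀ := s₀) (s₁ := max R 1) (by linarith) (fun y hy => ⟨hχs y hy, (hR y hy).trans (le_max_left _ _)⟩)
    (by positivity) hc₁ hg0 hBg
  have hgs : ∀ y, g y ≠ 0 → s₁ ≤ |y| := fun y hy => ((hsupp y).1 hy).trans (le_abs_self y)
  have hBs : ∀ y, B y ≠ 0 → s₁ ≤ |y| := fun y hy => ((hsupp y).2.1 hy).trans (le_abs_self y)
  have hEs : ∀ y, E y ≠ 0 → s₁ ≤ |y| := fun y hy => ((hsupp y).2.2 hy).trans (le_abs_self y)
  have L1 : LipSym fun k => k * (k * wt k) := lipSym_sq_mul_wt.congr fun k => by ring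
  have b1 : BLipSym fun k => 1 / 8 * (k * wt k ^ 2) :=
    (BLipSym.const (1 / 8)).mul bLipSym_mul_wt_sq
  have b2 : BLipSym fun k => -(|k| * wt k ^ 2) :=
    ((BLipSym.const (-1)).mul bLipSym_abs_mul_wt_sq).congr fun k => by ring
  obtain ⟨K1, K1', hK1, hK1', H1⟩ := exists_obs_approxDeriv (α := α) (M := M) (C := C) (β := β) hs₁
    hg hE (fun y => (hrel y).1.1) (fun y => (hrel y).1.2.1) (fun y => (hrel y).1.2.2) hgs hEs
    bLipSym_mul_wt b1 symDeriv_mul_wt L1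
  obtain ⟨K2, K2', hK2, hK2', H2⟩ := exists_obs_approxDeriv (α := α) (M := M) (C := C) (β := β) hs₁
    hB hE (fun y => (hrel y).2.1) (fun y => (hrel y).2.2.1) (fun y => (hrel y).2.2.2) hBs hEs
    bLipSym_wt b2 symDeriv_wt bLipSym_mul_wt.lipSym
  obtain ⟨K3, hK3, H3⟩ := S2_split (StepLike.of_compact hχ hχc) (StepLike.of_compact hχ hχc)
    lipSym_abs_add
  obtain ⟨K4, hK4, H4⟩ := exists_obs_bound hg hE bLipSym_mul_wt
  obtain ⟨K5, hK5, H5⟩ := exists_obs_bound hB hE bLipSym_wt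
  set K6 : ℝ := (C₀ + K1 + K2 + c₀ * K3) * M ^ 2 with hK6
  have hK60 : 0 ≤ K6 := by positivity
  refine ⟨c₀⁻¹ * (2 * (K4 + K5) * M ^ 2 + K6 * (1 / (2 * α - 1)) + (K1' + K2') * (1 / (β - 1))),
    ?_, fun {T v} hv {e ε} he hε hε1 t₁ t₂ ht₁ ht₁₂ => ?_⟩
  · have : 0 < 2 * α - 1 := by linarith
    have : 0 < β - 1 := by linarith
    positivity
  have hT := hv.one_le
  have hT0 : 0 < T := by linarith
  have adm : ∀ t, T ≤ t → Adm e α ε t := fun t ht => ⟨he, hα, hα1, hε, hε1, hT.trans ht⟩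
  -- The combination is chosen so that, with `deriv B = (α/2) y deriv g`, the main parts of the two
  -- derivatives assemble to the square `2 g' wt (κ - αy/2)²`.
  set O : ℝ → ℝ := fun t => obs g E (fun k => k * wt k) e α ε v t - obs B E wt e α ε v t with hO
  have hOc : ContinuousOn O (Ici T) := (continuousOn_obs hg hE bLipSym_mul_wt e α ε hT0 hv.cont).sub
    (continuousOn_obs hB hE bLipSym_wt e α ε hT0 hv.cont)
  have hnc : ContinuousOn (fun t => nrg χ e α ε t (v t)) (Ici T) :=
    continuousOn_BF lipSym_abs_add adm
      (continuousOn_loc (StepLike.of_compact hχ hχc) e α hT0 hv.cont)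
      (continuousOn_loc (StepLike.of_compact hχ hχc) e α hT0 hv.cont)
  have hinv : ContinuousOn (fun t : ℝ => t⁻¹) (Ici T) := fun t ht =>
    (continuousAt_inv₀ (hT0.trans_le ht).ne').continuousWithinAt
  have hN : ContinuousOn (fun t => t⁻¹ * nrg χ e α ε t (v t)) (Ici T) := hinv.mul hnc
  choose! r1 hr1 hr1' using fun t (ht : T ≤ t) => H1 hv (adm t ht) ht
  choose! r2 hr2 hr2' using fun t (ht : T ≤ t) => H2 hv (adm t ht) ht
  have key := integral_le_sub_of_approxDeriv (r := O) (r' := fun t => r1 t - r2 t)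
    (b := fun t => K1' * t ^ (-β) + K2' * t ^ (-β))
    (g := fun t => c₀ * (t⁻¹ * nrg χ e α ε t (v t)) - K6 * t ^ (-(2 * α)) - (K1' + K2') * t ^ (-β))
    hOc (((hN.const_smul c₀).sub ((continuousOn_rpow_Ici hT0 _).const_smul K6)).sub
      ((continuousOn_rpow_Ici hT0 _).const_smul (K1' + K2')))
    (fun t ht => (hr1 t ht).sub (hr2 t ht)) (fun t ht => ?_) ht₁ ht₁₂
  · have hint : ∀ f : ℝ → ℝ, ContinuousOn f (Ici T) → IntervalIntegrable f volume t₁ t₂ :=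
      fun f hf => (hf.mono (by rw [uIcc_of_le ht₁₂]; exact fun z hz => ht₁.trans hz.1)).intervalIntegrable
    have i1 := hint _ hN
    have i2 := hint _ (continuousOn_rpow_Ici hT0 (-(2 * α)))
    have i3 := hint _ (continuousOn_rpow_Ici hT0 (-β))
    rw [intervalIntegral.integral_sub ((i1.const_mul _).sub (i2.const_mul _)) (i3.const_mul _),
      intervalIntegral.integral_sub (i1.const_mul _) (i2.const_mul _),
      intervalIntegral.integral_const_mul, intervalIntegral.integral_const_mul,
      intervalIntegral.integral_const_mul] at key
    have h1t : 1 ≤ t₁ := hT.trans ht₁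
    have p1 : ∫ t in t₁..t₂, t ^ (-(2 * α)) ≤ 1 / (2 * α - 1) := by
      refine (integral_rpow_neg_le (by linarith) h1t ht₁₂).trans ?_
      gcongr
      · linarith
      · exact Real.rpow_le_one_of_one_le_of_nonpos h1t (by linarith)
    have p2 : ∫ t in t₁..t₂, t ^ (-β) ≤ 1 / (β - 1) := by
      refine (integral_rpow_neg_le hβ h1t ht₁₂).trans ?_
      gcongr
      exact Real.rpow_le_one_of_one_le_of_nonpos h1t (by linarith)
    have hOb : ∀ t, T ≤ t → |O t| ≤ (K4 + K5) * M ^ 2 := fun t ht => by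
      have hM : ‖v t‖ ^ 2 ≤ M ^ 2 := pow_le_pow_left₀ (norm_nonneg _) (hv.bound t ht) 2
      calc |O t| ≤ K4 * ‖v t‖ ^ 2 + K5 * ‖v t‖ ^ 2 :=
            (abs_sub _ _).trans (add_le_add (H4 _ _ _ _ _) (H5 _ _ _ _ _))
        _ = (K4 + K5) * ‖v t‖ ^ 2 := by ring
        _ ≤ _ := by gcongr
    have o1 := abs_le.1 (hOb t₁ ht₁)
    have o2 := abs_le.1 (hOb t₂ (ht₁.trans ht₁₂))
    have q1 := mul_le_mul_of_nonneg_left p1 hK60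
    have q2 := mul_le_mul_of_nonneg_left p2 (add_nonneg hK1' hK2')
    rw [le_inv_mul_iff₀ hc₀]
    linarith [o1.1, o2.2]
  · have ht0 : 0 < t := hT0.trans_le ht
    have h := adm t ht
    set w := v t with hw
    have hM : ‖w‖ ^ 2 ≤ M ^ 2 := pow_le_pow_left₀ (norm_nonneg _) (hv.bound t ht) 2
    have I0 := H₀ h w
    have I1 := (abs_le.1 (hr1' t ht)).1
    have I2 := (abs_le.1 (hr2' t ht)).2
    have I3 := (abs_le.1 (H3 h w)).2
    have hχsq : (fun y => χ y * χ y) = fun y => χ y ^ 2 := by funext y; ring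
    rw [hχsq] at I3
    change nrg χ e α ε t w - _ ≤ _ at I3
    have hdg : StepLike fun y => χ y ^ 2 + γ y ^ 2 := by rw [← dg]; exact hg.deriv
    have hydg : StepLike fun y => y * (χ y ^ 2 + γ y ^ 2) := by
      have := hg.id_mul_deriv
      rwa [dg] at this
    have hyydg : StepLike fun y => y * (y * (χ y ^ 2 + γ y ^ 2)) := by
      refine StepLike.of_compact (contDiff_id.mul hydg.smooth) ?_
      have := hg.compact
      rw [dg] at this
      exact (this.mul_left).mul_left
    rw [dg, S2_const_mul h bLipSym_mul_wt_sq.lipSym] at I1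
    have e1 : (fun k : ℝ => k * (k * wt k)) = fun k => k ^ 2 * wt k := by funext k; ring
    have e2 : (fun k : ℝ => -(|k| * wt k ^ 2)) = fun k => -1 * (|k| * wt k ^ 2) := by funext k; ring
    have e3 : (fun y => y * (α / 2 * (y * (χ y ^ 2 + γ y ^ 2)))) =
        fun y => α / 2 * (y * (y * (χ y ^ 2 + γ y ^ 2))) := by funext y; ring
    rw [e1] at I1
    rw [dB, e2, e3, S2_const_mul h bLipSym_abs_mul_wt_sq.lipSym, S2_const_mul_left hydg,
      S2_const_mul_left hyydg] at I2
    have e4 : (fun y => y * χ y ^ 2 + y * γ y ^ 2) = fun y => y * (χ y ^ 2 + γ y ^ 2) := by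
      funext y; ring
    have e5 : (fun y => y ^ 2 * χ y ^ 2 + y ^ 2 * γ y ^ 2) =
        fun y => y * (y * (χ y ^ 2 + γ y ^ 2)) := by funext y; ring
    rw [e4, e5] at I0
    set hh := t ^ (1 - 2 * α) with hhdef
    have hh0 : 0 < hh := Real.rpow_pos_of_pos ht0 _
    have J3 := mul_le_mul_of_nonneg_left I3 hc₀.le
    -- The derivatives of the two observables, the lower bound for the commutator and the passage
    -- from the one-sided form to `nrg` are added; each has an error of order `t^{1-2α}`.
    have hfin : c₀ * nrg χ e α ε t w - (C₀ + K1 + K2 + c₀ * K3) * ‖w‖ ^ 2 * hh ≤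
        t * (r1 t - r2 t) := by linarith
    have hfin2 : c₀ * nrg χ e α ε t w - K6 * hh ≤ t * (r1 t - r2 t) := by
      refine le_trans ?_ hfin
      rw [hK6]
      have : (C₀ + K1 + K2 + c₀ * K3) * ‖w‖ ^ 2 * hh ≤ (C₀ + K1 + K2 + c₀ * K3) * M ^ 2 * hh := by
        gcongr
      linarith
    have hpow : t⁻¹ * hh = t ^ (-(2 * α)) := by
      rw [hhdef, ← Real.rpow_neg_one, ← Real.rpow_add ht0]; ring_nf
    have := mul_le_mul_of_nonneg_left hfin2 (inv_nonneg.2 ht0.le)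
    rw [inv_mul_cancel_left₀ ht0.ne'] at this
    have e7 : t⁻¹ * (c₀ * nrg χ e α ε t w - K6 * hh) =
        c₀ * (t⁻¹ * nrg χ e α ε t w) - K6 * t ^ (-(2 * α)) := by rw [← hpow]; ring
    rw [e7] at this
    linarith

/-! ### The free evolution -/

theorem freeEvol_eq (t : ℝ) (f : L2) : freeEvol t f = fourierMul (freeSymbol t) f := by
  rw [fourierMul_apply, mulOp_apply (memLp_freeSymbol t)]
  rfl

theorem norm_freeSymbol (t : ℝ) (ξ : E3) : ‖freeSymbol t ξ‖ = 1 := by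
  rw [freeSymbol, Complex.norm_exp, Complex.neg_re, Complex.I_mul_re, Complex.ofReal_im]
  simp

theorem continuous_freeSymbol (t : ℝ) : Continuous (freeSymbol t) := by
  unfold freeSymbol; fun_prop

theorem isBdd_freeSymbol (t : ℝ) : IsBdd (freeSymbol t) :=
  IsBdd.of_continuous (continuous_freeSymbol t) fun ξ => (norm_freeSymbol t ξ).le

theorem freeEvol_add (s t : ℝ) (f : L2) : freeEvol s (freeEvol t f) = freeEvol (s + t) f := by
  simp_rw [freeEvol_eq]
  rw [← fourierMul_mul (isBdd_freeSymbol s) (isBdd_freeSymbol t)]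
  congr 2
  funext ξ
  rw [freeSymbol, freeSymbol, freeSymbol, ← Complex.exp_add]
  congr 1
  push_cast; ring

theorem freeEvol_zero (f : L2) : freeEvol 0 f = f := by
  rw [freeEvol_eq]
  have : freeSymbol 0 = fun _ => 1 := by funext ξ; simp [freeSymbol]
  rw [this, fourierMul_one]

theorem norm_freeEvol (t : ℝ) (f : L2) : ‖freeEvol t f‖ = ‖f‖ := by
  have h : ∀ s g, ‖freeEvol s g‖ ≤ ‖g‖ := fun s g => by
    rw [freeEvol_eq]
    simpa using norm_fourierMul_le (isBdd_freeSymbol s) (fun ξ => (norm_freeSymbol s ξ).le) g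
  refine le_antisymm (h t f) ?_
  have := h (-t) (freeEvol t f)
  rwa [freeEvol_add, neg_add_cancel, freeEvol_zero] at this

theorem freeEvol_sub_map (t : ℝ) (f g : L2) : freeEvol t (f - g) = freeEvol t f - freeEvol t g := by
  simp_rw [freeEvol_eq, map_sub]

theorem freeEvol_add_map (t : ℝ) (f g : L2) : freeEvol t (f + g) = freeEvol t f + freeEvol t g := by
  simp_rw [freeEvol_eq, map_add]

theorem inner_freeEvol (t : ℝ) (f g : L2) : ⟪freeEvol t f, g⟫_ℂ = ⟪f, freeEvol (-t) g⟫_ℂ := by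
  rw [freeEvol_eq, freeEvol_eq, inner_fourierMul_left (isBdd_freeSymbol t)]
  congr 3
  funext ξ
  rw [freeSymbol, freeSymbol, ← Complex.exp_conj]
  congr 1
  simp only [map_neg, map_mul, Complex.conj_I, Complex.conj_ofReal]
  push_cast; ring

theorem continuous_freeEvol (f : L2) : Continuous fun t => freeEvol t f := by
  refine continuous_iff_continuousAt.2 fun t => ?_
  simp_rw [ContinuousAt, freeEvol_eq]
  refine tendsto_fourierMul (C := 1) (Eventually.of_forall fun i => (isBdd_freeSymbol i).1)
    (isBdd_freeSymbol t).1 (Eventually.of_forall fun i ξ => (norm_freeSymbol i ξ).le)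
    (fun ξ => (norm_freeSymbol t ξ).le) (fun ξ => ?_) f
  have : Continuous fun i => freeSymbol i ξ := by unfold freeSymbol; fun_prop
  exact this.tendsto t

theorem fourier_laplacian_toLp (η : 𝓢(E3, ℂ)) :
    ((𝓕 ((Δ η).toLp 2 volume : L2) : L2) : E3 → ℂ) =ᵐ[volume]
      fun ξ => -(((2 * Real.pi * ‖ξ‖) ^ 2 : ℝ) : ℂ) * (𝓕 (η.toLp 2 volume : L2) : L2) ξ := by
  rw [SchwartzMap.toLp_fourier_eq, SchwartzMap.toLp_fourier_eq]
  filter_upwards [(𝓕 (Δ η)).coeFn_toLp 2 volume, (𝓕 η).coeFn_toLp 2 volume] with ξ h1 h2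
  rw [h1, h2]
  have hg : (fun ξ : E3 => ‖ξ‖ ^ 2).HasTemperateGrowth := Function.hasTemperateGrowth_norm_sq E3
  have hgc : (fun ξ : E3 => ((‖ξ‖ ^ 2 : ℝ) : ℂ)).HasTemperateGrowth :=
    (Function.Complex.hasTemperateGrowth_ofReal).comp hg
  rw [SchwartzMap.laplacian_eq_fourierMultiplierCLM, ← SchwartzMap.fourierMultiplierCLM_ofReal ℂ hg,
    FourierTransform.fourier_smul, _root_.smul_apply, SchwartzMap.fourierMultiplierCLM_apply,
    FourierTransform.fourier_fourierInv_eq,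
    show (fun ξ : E3 => (RCLike.ofReal (‖ξ‖ ^ 2) : ℂ)) = fun ξ : E3 => ((‖ξ‖ ^ 2 : ℝ) : ℂ) from rfl,
    SchwartzMap.smulLeftCLM_apply_apply hgc]
  simp only [Complex.real_smul, smul_eq_mul]
  push_cast; ring

theorem hasDerivAt_inner_freeEvol (η : 𝓢(E3, ℂ)) (u : L2) (t : ℝ) :
    HasDerivAt (fun τ => ⟪(η.toLp 2 volume : L2), freeEvol τ u⟫_ℂ)
      (Complex.I * ⟪((Δ η).toLp 2 volume : L2), freeEvol t u⟫_ℂ) t := by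
  set lam : E3 → ℝ := fun ξ => (2 * Real.pi * ‖ξ‖) ^ 2 with hlam
  set a : E3 → ℂ := fun ξ => conj ((𝓕 (η.toLp 2 volume : L2) : L2) ξ) * (𝓕 u : L2) ξ with ha
  have hL := fourier_laplacian_toLp η
  have h1 : ∀ f : L2, ∀ τ, ⟪f, freeEvol τ u⟫_ℂ =
      ∫ ξ, freeSymbol τ ξ * (conj ((𝓕 f : L2) ξ) * (𝓕 u : L2) ξ) := fun f τ => by
    rw [← Lp.inner_fourier_eq, freeEvol_eq, fourier_fourierMul, inner_mulOp_right (isBdd_freeSymbol τ)]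
  have h2 : ∀ τ ξ, HasDerivAt (fun τ => freeSymbol τ ξ) (-(Complex.I * lam ξ) * freeSymbol τ ξ) τ := by
    intro τ ξ
    have h3 : HasDerivAt (fun τ : ℝ => -(Complex.I * ((τ * lam ξ : ℝ) : ℂ))) (-(Complex.I * lam ξ)) τ := by
      have := (((hasDerivAt_id τ).mul_const (lam ξ)).ofReal_comp.const_mul Complex.I).fun_neg
      exact this.congr_deriv (by simp)
    have := h3.cexp
    rw [mul_comm] at this
    exact this
  have hconj : ∀ᵐ ξ, -(Complex.I * lam ξ) * freeSymbol t ξ * a ξ =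
      Complex.I * (freeSymbol t ξ *
        (conj ((𝓕 ((Δ η).toLp 2 volume : L2) : L2) ξ) * (𝓕 u : L2) ξ)) := by
    filter_upwards [hL] with ξ hξ
    rw [hξ, map_mul, map_neg, Complex.conj_ofReal]
    simp only [ha, hlam]
    ring
  have hint := integrable_conj_mul (𝓕 ((Δ η).toLp 2 volume : L2) : L2) (𝓕 u : L2)
  have hbint : Integrable (fun ξ => lam ξ * ‖a ξ‖) volume := by
    refine hint.norm.congr ?_
    filter_upwards [hL] with ξ hξ
    rw [hξ, norm_mul, map_mul, map_neg, Complex.conj_ofReal, norm_mul, norm_neg, Complex.norm_real,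
      Real.norm_of_nonneg (sq_nonneg _)]
    simp only [ha, hlam, norm_mul]
    ring
  have hai : Integrable a volume := integrable_conj_mul _ _
  have key := (hasDerivAt_integral_of_dominated_loc_of_deriv_le (μ := volume)
    (F := fun τ ξ => freeSymbol τ ξ * a ξ)
    (F' := fun τ ξ => -(Complex.I * lam ξ) * freeSymbol τ ξ * a ξ) (x₀ := t) (s := univ)
    (bound := fun ξ => lam ξ * ‖a ξ‖) univ_mem ?_ ?_ ?_ ?_ hbint ?_).2
  · simp_rw [h1]
    refine key.congr_deriv ?_
    rw [integral_congr_ae hconj, integral_const_mul]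
  · exact Eventually.of_forall fun τ =>
      ((continuous_freeSymbol τ).aestronglyMeasurable).mul hai.aestronglyMeasurable
  · refine hai.norm.mono' (((continuous_freeSymbol t).aestronglyMeasurable).mul
      hai.aestronglyMeasurable) (Eventually.of_forall fun ξ => ?_)
    rw [norm_mul, norm_freeSymbol, one_mul]
  · refine AEStronglyMeasurable.mul (Continuous.aestronglyMeasurable ?_) hai.aestronglyMeasurable
    have := continuous_freeSymbol t
    simp only [hlam]
    fun_prop
  · refine Eventually.of_forall fun ξ τ _ => ?_
    rw [norm_mul, norm_mul, norm_freeSymbol, norm_neg, norm_mul, Complex.norm_I, Complex.norm_real,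
      Real.norm_of_nonneg (sq_nonneg _), one_mul, mul_one]
  · exact Eventually.of_forall fun ξ τ _ => (h2 τ ξ).mul_const _

/-- A free wave solves the equation everywhere and without source, so `s` and `β` are arbitrary and
`C = 0`. The propagation estimate thus holds for free waves with a constant depending only on the
bound for the norm. -/
theorem extSol_freeEvol (α s β : ℝ) {M : ℝ} {u : L2} (hu : ‖u‖ ≤ M) :
    ExtSol α s M 0 β 1 fun t => freeEvol t u where
  one_le := le_rfl
  nonneg := le_rfl
  cont := (continuous_freeEvol u).continuousOn
  bound t _ := by rwa [norm_freeEvol]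
  eqn t t' _ _ η _ := by
    have hc : Continuous fun τ => Complex.I * ⟪((Δ η).toLp 2 volume : L2), freeEvol τ u⟫_ℂ :=
      continuous_const.mul (continuous_const.inner (continuous_freeEvol u))
    have := intervalIntegral.integral_eq_sub_of_hasDerivAt
      (fun τ _ => hasDerivAt_inner_freeEvol η u τ) (hc.intervalIntegrable t t')
    rw [← intervalIntegral.integral_const_mul, this, inner_sub_right, sub_self, norm_zero]
    simp

/-! ### Cook's method -/

theorem continuousOn_inv_mul_nrg {χ : ℝ → ℝ} (hχ : StepLike χ) {e : E3} {α ε T : ℝ} (hT : 0 < T)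
    (h : ∀ t, T ≤ t → Adm e α ε t) {v : ℝ → L2} (hv : ContinuousOn v (Ici T)) :
    ContinuousOn (fun t => t⁻¹ * nrg χ e α ε t (v t)) (Ici T) :=
  ContinuousOn.mul (fun _ ht => (continuousAt_inv₀ (hT.trans_le ht).ne').continuousWithinAt)
    (continuousOn_BF lipSym_abs_add h (continuousOn_loc hχ e α hT hv) (continuousOn_loc hχ e α hT hv))

theorem ContinuousOn.intervalIntegrable_Ici {f : ℝ → ℝ} {T t₁ t₂ : ℝ} (hf : ContinuousOn f (Ici T))
    (h1 : T ≤ t₁) (h2 : T ≤ t₂) : IntervalIntegrable f volume t₁ t₂ :=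
  (hf.mono fun _ hz => (le_min h1 h2).trans hz.1).intervalIntegrable

/-- The regularizer increases as `ε` decreases; this monotonicity makes tails uniform in `ε`. -/
theorem BF_self_antitone {a : ℝ → ℝ} (ha : LipSym a) (ha0 : ∀ k, 0 ≤ a k) {e : E3} {α ε ε' t : ℝ}
    (h : Adm e α ε t) (h' : Adm e α ε' t) (hε : ε ≤ ε') (u : L2) :
    BF a e α ε' t u u ≤ BF a e α ε t u u := by
  have hb := ha.isBdd_sym h
  have hb' := ha.isBdd_sym h'
  have hd : IsBdd fun ξ => ((sym a e α ε t ξ - sym a e α ε' t ξ : ℝ) : ℂ) := by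
    simpa using hb.sub hb'
  have := re_inner_fourierMul_self hd (fun ξ => ?_) u
  · have h3 : fourierMul (fun ξ => ((sym a e α ε t ξ - sym a e α ε' t ξ : ℝ) : ℂ)) u =
        fourierMul (fun ξ => (sym a e α ε t ξ : ℂ)) u - fourierMul (fun ξ => (sym a e α ε' t ξ : ℂ)) u := by
      rw [← fourierMul_sub hb hb']
      simp
    rw [h3, inner_sub_right, Complex.sub_re] at this
    have h4 : (0 : ℝ) ≤ ‖fourierMul (fun ξ =>
      ((Real.sqrt (sym a e α ε t ξ - sym a e α ε' t ξ) : ℝ) : ℂ)) u‖ ^ 2 := sq_nonneg _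
    unfold BF
    linarith
  · have h5 : reg ε' ξ ≤ reg ε ξ := by
      unfold reg
      have := h.pos
      gcongr
    have h6 := (reg_pos ε' ξ).le
    have h7 : reg ε' ξ ^ 2 ≤ reg ε ξ ^ 2 := by gcongr
    have := mul_le_mul_of_nonneg_left h7 (ha0 (kap e α t ξ))
    unfold sym
    linarith

/-- For fixed `ε` the tail of a convergent integral is small, but smallness is needed for all small
`ε` together. The energies are nonnegative and increase as `ε` decreases. Hence a pair `(ε₀, T₀)`
that almost attains the supremum over both parameters leaves less than `δ` beyond `T₀`, for each `ε
≤ ε₀`. -/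
theorem ExtSol.exists_tail_small {α s s₀ M C β T : ℝ} (hα : 1 / 2 < α) (hα1 : α < 1) (hs : 1 / 2 ≤ s)
    (hs₀ : s < s₀) (hβ : 1 < β) {v : ℝ → L2} (hv : ExtSol α s M C β T v) {χ : ℝ → ℝ}
    (hχ : ContDiff ℝ ∞ χ) (hχc : HasCompactSupport χ)
    (hχs : ∀ y, χ y ≠ 0 → s₀ ≤ y) {e : E3} (he : ‖e‖ = 1) {δ : ℝ} (hδ : 0 < δ) :
    ∃ T₀ ε₀ : ℝ, T ≤ T₀ ∧ 0 < ε₀ ∧ ε₀ ≤ 1 ∧ ∀ ε, 0 < ε → ε ≤ ε₀ → ∀ t₁ t₂, T₀ ≤ t₁ → t₁ ≤ t₂ →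
      ∫ t in t₁..t₂, t⁻¹ * nrg χ e α ε t (v t) ≤ δ := by
  obtain ⟨K, hK, H⟩ := propagation_estimate (M := M) (C := C) hα hα1 hs hs₀ hβ hχ hχc hχs
  have hT := hv.one_le
  have hT0 : 0 < T := by linarith
  have adm : ∀ ε, 0 < ε → ε ≤ 1 → ∀ t, T ≤ t → Adm e α ε t := fun ε h1 h2 t ht =>
    ⟨he, hα, hα1, h1, h2, hT.trans ht⟩
  have hc : ∀ ε, 0 < ε → ε ≤ 1 → ContinuousOn (fun t => t⁻¹ * nrg χ e α ε t (v t)) (Ici T) :=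
    fun ε h1 h2 => continuousOn_inv_mul_nrg (StepLike.of_compact hχ hχc) hT0 (adm ε h1 h2) hv.cont
  set A : Set ℝ := {I | ∃ ε t, 0 < ε ∧ ε ≤ 1 ∧ T ≤ t ∧ I = ∫ τ in T..t, τ⁻¹ * nrg χ e α ε τ (v τ)}
    with hA
  have hbdd : BddAbove A := ⟨K, by
    rintro I ⟨ε, t, h1, h2, h3, rfl⟩
    exact H hv he h1 h2 T t le_rfl h3⟩
  have hne : A.Nonempty := ⟨_, 1, T, one_pos, le_rfl, le_rfl, rfl⟩
  obtain ⟨_, ⟨ε₀, T₀, h1, h2, h3, rfl⟩, h4⟩ := exists_lt_of_lt_csSup hne (sub_lt_self (sSup A) hδ)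
  refine ⟨T₀, ε₀, h3, h1, h2, fun ε hε hεε t₁ t₂ ht₁ ht₁₂ => ?_⟩
  have hε1 := hεε.trans h2
  have hTt₁ := h3.trans ht₁
  have h5 : ∫ τ in T..t₂, τ⁻¹ * nrg χ e α ε τ (v τ) ≤ sSup A :=
    le_csSup hbdd ⟨ε, t₂, hε, hε1, hTt₁.trans ht₁₂, rfl⟩
  have i0 := (hc ε hε hε1).intervalIntegrable_Ici (le_refl T) h3
  have i1 := (hc ε hε hε1).intervalIntegrable_Ici h3 hTt₁
  have i2 := (hc ε hε hε1).intervalIntegrable_Ici hTt₁ (hTt₁.trans ht₁₂)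
  have i3 := (hc ε₀ h1 h2).intervalIntegrable_Ici (le_refl T) h3
  rw [← intervalIntegral.integral_add_adjacent_intervals (i0.trans i1) i2,
    ← intervalIntegral.integral_add_adjacent_intervals i0 i1] at h5
  have h6 : ∫ τ in T..T₀, τ⁻¹ * nrg χ e α ε₀ τ (v τ) ≤ ∫ τ in T..T₀, τ⁻¹ * nrg χ e α ε τ (v τ) := by
    refine intervalIntegral.integral_mono_on h3 i3 i0 fun τ hτ => ?_
    refine mul_le_mul_of_nonneg_left ?_ (inv_nonneg.2 (hT0.le.trans hτ.1))
    exact BF_self_antitone lipSym_abs_add (fun k => by positivity) (adm ε hε hε1 τ hτ.1)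
      (adm ε₀ h1 h2 τ hτ.1) hεε _
  have h7 : 0 ≤ ∫ τ in T₀..t₁, τ⁻¹ * nrg χ e α ε τ (v τ) := by
    refine intervalIntegral.integral_nonneg ht₁ fun τ hτ => ?_
    have hTτ := h3.trans hτ.1
    exact mul_nonneg (inv_nonneg.2 (hT0.le.trans hTτ)) (nrg_nonneg (adm ε hε hε1 τ hTτ) _)
  linarith

/-! ### Pairing a free wave with a localized solution. -/

theorem symOp_one (e : E3) (α t : ℝ) (u : L2) : symOp (fun _ => 1) e α t u = u := by
  simp [symOp, fourierMul_one]

theorem loc_one (e : E3) (α t : ℝ) (u : L2) : loc (fun _ => 1) e α t u = u := by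
  have : cut e (t ^ α) (fun _ => 1) = fun _ => 1 := by funext x; simp [cut]
  rw [loc, this, mulOp_const, one_smul]

theorem loc_zero (e : E3) (α t : ℝ) (u : L2) : loc (fun _ => 0) e α t u = 0 := by
  have : cut e (t ^ α) (fun _ => 0) = fun _ => 0 := by funext x; simp [cut]
  rw [loc, this, mulOp_const, zero_smul]

/-- In the derivative of `⟪u, f w⟫` along the two flows the Hamiltonians cancel and only terms
containing `f'`, `y f'` or `f''` survive. On their support `χ = 1`, so `u` may be localized as well.
Cauchy–Schwarz then bounds them by local energies of `u` and `w`, with a weight `μ` at disposal. -/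
theorem exists_pairing_bound {f χ : ℝ → ℝ} (hf : StepLike f) (hχ : StepLike χ)
    (hχf : ∀ y, χ y * deriv f y = deriv f y) :
    ∃ K : ℝ, 0 ≤ K ∧ ∀ {e : E3} {α ε t : ℝ}, Adm e α ε t → ∀ (u w : L2) {μ : ℝ}, 0 < μ →
      |t * ((⟪rlocDeriv (fun _ => 1) e α ε t u, regOp ε (loc f e α t w)⟫_ℂ).re +
        (⟪regOp ε u, rlocDeriv f e α ε t w⟫_ℂ).re)| ≤
      K * (μ⁻¹ * nrg χ e α ε t u + μ * (nrg (deriv f) e α ε t w +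
        nrg (fun y => y * deriv f y) e α ε t w) + t ^ (1 - 2 * α) * (‖u‖ * ‖w‖)) := by
  have L1 : LipSym fun _ : ℝ => (1 : ℝ) := (BLipSym.const 1).lipSym
  have L2' : LipSym fun k : ℝ => k := LipSym.id
  obtain ⟨D1, hD1, hD1b⟩ := hf.deriv.bounded
  obtain ⟨D2, hD2, hD2b⟩ := hf.id_mul_deriv.bounded
  obtain ⟨D3, hD3, hD3b⟩ := hf.deriv.deriv.bounded
  obtain ⟨C1, hC1, H1⟩ := BF_commutator hχ L2'
  obtain ⟨C2, hC2, H2⟩ := BF_commutator hχ L1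
  refine ⟨10 + 2 * C1 * D1 + C2 * D2 + D3, by positivity, fun {e α ε t} h u w {μ} hμ => ?_⟩
  have ht : 0 < t := by linarith [h.one_le]
  have hα0 : 0 < α := by linarith [h.half_lt]
  set hh := t ^ (1 - 2 * α) with hhdef
  have hh0 : 0 < hh := Real.rpow_pos_of_pos ht _
  set w1 := loc (deriv f) e α t w with hw1
  set w2 := loc (fun y => y * deriv f y) e α t w with hw2
  set w3 := loc (deriv (deriv f)) e α t w with hw3
  have e1 : loc χ e α t w1 = w1 := by
    rw [hw1, ← loc_mul hχ hf.deriv]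
    congr 1
    exact funext hχf
  have e2 : loc χ e α t w2 = w2 := by
    rw [hw2, ← loc_mul hχ hf.id_mul_deriv]
    congr 1
    funext y
    rw [mul_left_comm, hχf]
  have I1 := H1 h u w1
  have I2 := H2 h u w2
  rw [e1] at I1
  rw [e2] at I2
  have J1 := abs_BF_le h L2' lipSym_abs_add (fun k => by linarith) hμ (loc χ e α t u) w1
  -- The term `α y f'` carries no `κ`; it is controlled by the energy through `1 ≤ 8 (|k| + 1/8)`.
  -- The offset `1/8` in the energy serves this purpose as well.
  have J2 := abs_BF_le h L1 (lipSym_abs_add.const_mul 8) (fun k => by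
    rw [abs_one]; linarith [abs_nonneg k]) hμ (loc χ e α t u) w2
  rw [BF_const_mul h lipSym_abs_add, BF_const_mul h lipSym_abs_add] at J2
  have n1 : ‖w1‖ ≤ D1 * ‖w‖ := norm_loc_le hf.deriv hD1b w
  have n2 : ‖w2‖ ≤ D2 * ‖w‖ := norm_loc_le hf.id_mul_deriv hD2b w
  have n3 : ‖w3‖ ≤ D3 * ‖w‖ := norm_loc_le hf.deriv.deriv hD3b w
  have I3 : |(⟪regOp ε u, regOp ε w3⟫_ℂ).im| ≤ D3 * (‖u‖ * ‖w‖) := by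
    refine (Complex.abs_im_le_norm _).trans ((norm_inner_le_norm _ _).trans ?_)
    calc _ ≤ ‖u‖ * (D3 * ‖w‖) := by
          gcongr
          · exact norm_regOp_le ε u
          · exact (norm_regOp_le ε w3).trans n3
      _ = _ := by ring
  have cancel := inner_lreg_cancel h (BLipSym.const 1) u (loc f e α t w)
  simp only [symOp_one] at cancel
  have k1 := inner_reg_symOp_kreg h (BLipSym.const 1) u w1
  have k2 := inner_reg_symOp_reg (e := e) (α := α) (ε := ε) (t := t) (BLipSym.const 1) u w2
  simp only [symOp_one, mul_one] at k1 k2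
  have expand : t * ((⟪rlocDeriv (fun _ => 1) e α ε t u, regOp ε (loc f e α t w)⟫_ℂ).re +
        (⟪regOp ε u, rlocDeriv f e α ε t w⟫_ℂ).re) =
      2 * BF (fun k => k) e α ε t u w1 - hh * (⟪regOp ε u, regOp ε w3⟫_ℂ).im -
        α * BF (fun _ => 1) e α ε t u w2 := by
    rw [rlocDeriv_apply, rlocDeriv_apply]
    simp only [deriv_const', mul_zero, loc_zero, map_zero, smul_zero, add_zero, loc_one]
    simp only [inner_add_right, Complex.add_re, inner_smul_right (𝕜 := ℂ) (E := L2) _ _ (_ : ℂ),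
      Complex.re_ofReal_mul]
    rw [← hw1, ← hw2, ← hw3, ← k1, ← k2]
    have : (Complex.I * ((hh : ℝ) : ℂ) * ⟪regOp ε u, regOp ε w3⟫_ℂ).re =
        -(hh * (⟪regOp ε u, regOp ε w3⟫_ℂ).im) := by
      rw [mul_assoc, Complex.I_mul_re, Complex.im_ofReal_mul]
    rw [← hhdef, this]
    rw [inner_smul_right, neg_mul] at cancel
    field_simp
    linear_combination t * cancel
  rw [expand]
  have p1 : C1 * hh * (‖u‖ * ‖w1‖) ≤ C1 * hh * (‖u‖ * (D1 * ‖w‖)) := by gcongr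
  have p2 : C2 * hh * (‖u‖ * ‖w2‖) ≤ C2 * hh * (‖u‖ * (D2 * ‖w‖)) := by gcongr
  have N0 := nrg_nonneg (χ := χ) h u
  have N1 := nrg_nonneg (χ := deriv f) h w
  have N2 := nrg_nonneg (χ := fun y => y * deriv f y) h w
  have b1 : |BF (fun k => k) e α ε t u w1| ≤
      (μ⁻¹ * nrg χ e α ε t u + μ * nrg (deriv f) e α ε t w) / 2 + C1 * hh * (‖u‖ * (D1 * ‖w‖)) := by
    have q1 := abs_le.1 I1
    have q2 := abs_le.1 J1
    change -((μ⁻¹ * nrg χ e α ε t u + μ * nrg (deriv f) e α ε t w) / 2) ≤ _ ∧ _ ≤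
      (μ⁻¹ * nrg χ e α ε t u + μ * nrg (deriv f) e α ε t w) / 2 at q2
    rw [abs_le]
    constructor <;> linarith [q1.1, q1.2, q2.1, q2.2]
  have b2 : |BF (fun _ => 1) e α ε t u w2| ≤
      4 * (μ⁻¹ * nrg χ e α ε t u + μ * nrg (fun y => y * deriv f y) e α ε t w) +
        C2 * hh * (‖u‖ * (D2 * ‖w‖)) := by
    have q1 := abs_le.1 I2
    have q2 := abs_le.1 J2
    change -((μ⁻¹ * (8 * nrg χ e α ε t u) + μ * (8 * nrg (fun y => y * deriv f y) e α ε t w)) / 2) ≤ _ ∧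
      _ ≤ (μ⁻¹ * (8 * nrg χ e α ε t u) + μ * (8 * nrg (fun y => y * deriv f y) e α ε t w)) / 2 at q2
    rw [abs_le]
    constructor <;> linarith [q1.1, q1.2, q2.1, q2.2]
  have b3 : |hh * (⟪regOp ε u, regOp ε w3⟫_ℂ).im| ≤ hh * (D3 * (‖u‖ * ‖w‖)) := by
    rw [abs_mul, abs_of_pos hh0]
    exact mul_le_mul_of_nonneg_left I3 hh0.le
  have b4 : |α * BF (fun _ => 1) e α ε t u w2| ≤ |BF (fun _ => 1) e α ε t u w2| := by
    rw [abs_mul, abs_of_pos hα0]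
    exact mul_le_of_le_one_left (abs_nonneg _) h.lt_one.le
  have tri : |2 * BF (fun k => k) e α ε t u w1 - hh * (⟪regOp ε u, regOp ε w3⟫_ℂ).im -
        α * BF (fun _ => 1) e α ε t u w2| ≤ 2 * |BF (fun k => k) e α ε t u w1| +
      |hh * (⟪regOp ε u, regOp ε w3⟫_ℂ).im| + |α * BF (fun _ => 1) e α ε t u w2| := by
    refine (abs_sub _ _).trans (add_le_add ((abs_sub _ _).trans ?_) le_rfl)
    rw [abs_mul, abs_two]
  refine tri.trans ?_
  set x := μ⁻¹ * nrg χ e α ε t u with hx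
  have hx0 : 0 ≤ x := by positivity
  set y1 := μ * nrg (deriv f) e α ε t w with hy1
  have hy10 : 0 ≤ y1 := by positivity
  set y2 := μ * nrg (fun y => y * deriv f y) e α ε t w with hy2
  have hy20 : 0 ≤ y2 := by positivity
  set z := hh * (‖u‖ * ‖w‖) with hz
  have hz0 : 0 ≤ z := by positivity
  have e5 : μ * (nrg (deriv f) e α ε t w + nrg (fun y => y * deriv f y) e α ε t w) = y1 + y2 := by
    rw [hy1, hy2]; ring
  rw [e5]
  have s1 : C1 * hh * (‖u‖ * (D1 * ‖w‖)) = C1 * D1 * z := by rw [hz]; ring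
  have s2 : C2 * hh * (‖u‖ * (D2 * ‖w‖)) = C2 * D2 * z := by rw [hz]; ring
  have s3 : hh * (D3 * (‖u‖ * ‖w‖)) = D3 * z := by rw [hz]; ring
  rw [s1] at b1
  rw [s2] at b2
  rw [s3] at b3
  have c1 : 0 ≤ C1 * D1 := by positivity
  have c2 : 0 ≤ C2 * D2 := by positivity
  have c3 : 0 ≤ (2 * C1 * D1 + C2 * D2 + D3) * (x + (y1 + y2)) := by positivity
  linarith

theorem norm_le_of_re_inner {X : L2} {η : ℝ} (hη : 0 ≤ η)
    (h : ∀ u : L2, ‖u‖ ≤ 1 → -η ≤ (⟪u, X⟫_ℂ).re) : ‖X‖ ≤ η := by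
  rcases eq_or_ne X 0 with rfl | hX
  · simpa
  have hp := norm_pos_iff.2 hX
  have h1 := h (((-‖X‖⁻¹ : ℝ) : ℂ) • X) (by
    rw [norm_smul, Complex.norm_real, norm_neg, Real.norm_of_nonneg (by positivity),
      inv_mul_cancel₀ hp.ne'])
  rw [inner_smul_left, Complex.conj_ofReal, Complex.re_ofReal_mul] at h1
  have h2 : (⟪X, X⟫_ℂ).re = ‖X‖ ^ 2 := inner_self_eq_norm_sq (𝕜 := ℂ) X
  rw [h2] at h1
  have h3 : ‖X‖⁻¹ * ‖X‖ ^ 2 = ‖X‖ := by field_simp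
  linarith

theorem tendsto_regOp (u : L2) : Tendsto (fun ε => regOp ε u) (𝓝[>] 0) (𝓝 u) := by
  have := tendsto_fourierMul (l := 𝓝[>] (0 : ℝ)) (q := fun ε ξ => (reg ε ξ : ℂ)) (p := fun _ => 1)
    (C := 1) (Eventually.of_forall fun ε => (isBdd_reg ε).1) measurable_const
    (Eventually.of_forall fun ε ξ => by
      rw [Complex.norm_real, Real.norm_of_nonneg (reg_pos _ _).le]
      exact reg_le_one _ _) (fun _ => by simp) (fun ξ => ?_) u
  · rwa [fourierMul_one] at this
  · have h1 : Tendsto (fun ε => reg ε ξ) (𝓝 0) (𝓝 (reg 0 ξ)) := by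
      have : Continuous fun ε => reg ε ξ := by
        unfold reg
        refine continuous_const.div (by fun_prop) fun ε => by positivity
      exact this.tendsto 0
    have h2 : reg 0 ξ = 1 := by simp [reg]
    rw [h2] at h1
    have := (Complex.continuous_ofReal.tendsto 1).comp (h1.mono_left (nhdsWithin_le_nhds (s := Ioi 0)))
    rw [Complex.ofReal_one] at this
    exact this

theorem deriv_ne_zero_support {f : ℝ → ℝ} {s₀ : ℝ} (hf : ∀ y, f y ≠ 0 → s₀ ≤ y) {y : ℝ}
    (hy : deriv f y ≠ 0) : s₀ ≤ y := by
  by_contra! h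
  refine hy ?_
  have : f =ᶠ[𝓝 y] fun _ => 0 := by
    filter_upwards [eventually_lt_nhds h] with z hz
    by_contra h1
    exact absurd (hf z h1) (not_le.2 hz)
  rw [this.deriv_eq, deriv_const]

theorem exists_plateau {f : ℝ → ℝ} (hf : StepLike f) {s s₀ : ℝ} (hs : s < s₀)
    (hfs : ∀ y, f y ≠ 0 → s₀ ≤ y) : ∃ χ : ℝ → ℝ, ContDiff ℝ ∞ χ ∧ HasCompactSupport χ ∧
      (∀ y, χ y * deriv f y = deriv f y) ∧ ∀ y, χ y ≠ 0 → (s + s₀) / 2 ≤ y := by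
  obtain ⟨R, hR⟩ : ∃ R, ∀ y, deriv f y ≠ 0 → y ≤ R := by
    obtain ⟨R, hR⟩ := hf.compact.isCompact.bddAbove
    exact ⟨R, fun y hy => hR (subset_tsupport _ hy)⟩
  obtain ⟨E, hE, E0, E1, -, -⟩ := exists_step (show (s + s₀) / 2 < s₀ by linarith)
  obtain ⟨E', hE', E0', E1', -, -⟩ := exists_step (show R < R + 1 by linarith)
  refine ⟨fun y => E y * (1 - E' y), hE.smooth.mul (contDiff_const.sub hE'.smooth), ?_,
    fun y => ?_, fun y hy => ?_⟩
  · refine HasCompactSupport.of_support_subset_isCompact (isCompact_Icc (a := (s + s₀) / 2) (b := R + 1))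
      fun y hy => ⟨?_, ?_⟩
    · by_contra! h
      exact hy (by simp [E0 y h.le])
    · by_contra! h
      exact hy (by simp [E1' y h.le])
  · rcases eq_or_ne (deriv f y) 0 with h | h
    · rw [h, mul_zero]
    · beta_reduce
      rw [E1 y (deriv_ne_zero_support hfs h), E0' y (hR y h)]
      ring
  · by_contra! h
    exact hy (by simp [E0 y h.le])

theorem tendsto_rpow_neg_tail {p : ℝ} (hp : 1 < p) (c : ℝ) :
    Tendsto (fun t : ℝ => c * (t ^ (1 - p) / (p - 1))) atTop (𝓝 0) := by
  have := tendsto_rpow_neg_atTop (show 0 < p - 1 by linarith)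
  have h2 := (this.div_const (p - 1)).const_mul c
  simp only [zero_div, mul_zero] at h2
  refine h2.congr fun t => ?_
  rw [neg_sub]

/-- Cook's method in weak form. The increment of `e^{-itΔ} f v` is tested against unit vectors `u`,
which turns it into the increment of the pairing with the free wave of `u`. The energy of the free
wave is bounded uniformly in `u`, the energy of `v` has small tails, and the weighted Cauchy–Schwarz
inequality combines the two. -/
theorem ExtSol.exists_limit {α s s₀ M C β T : ℝ} (hα : 1 / 2 < α) (hα1 : α < 1) (hs : 1 / 2 ≤ s)
    (hs₀ : s < s₀) (hβ : 1 < β) {v : ℝ → L2} (hv : ExtSol α s M C β T v) {f : ℝ → ℝ}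
    (hf : StepLike f) (hfs : ∀ y, f y ≠ 0 → s₀ ≤ y) {e : E3} (he : ‖e‖ = 1) :
    ∃ w, Tendsto (fun t => freeEvol (-t) (loc f e α t (v t))) atTop (𝓝 w) := by
  have hT := hv.one_le
  have hT0 : 0 < T := by linarith
  have hM0 : 0 ≤ M := (norm_nonneg _).trans (hv.bound T le_rfl)
  obtain ⟨χ, hχ, hχc, hχf, hχs⟩ := exists_plateau hf hs₀ hfs
  have hχS := StepLike.of_compact hχ hχc
  obtain ⟨Ku, hKu, HU⟩ := propagation_estimate (M := 1) (C := 0) hα hα1 hs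
    (show s < (s + s₀) / 2 by linarith) hβ hχ hχc hχs
  obtain ⟨K, hK, HK⟩ := exists_pairing_bound hf hχS hχf
  obtain ⟨D, hD0, hD⟩ := hf.bounded
  refine cauchySeq_tendsto_of_complete (Metric.cauchySeq_iff.2 fun η₀ hη₀ => ?_)
  obtain ⟨η, hη, hηη⟩ : ∃ η, 0 < η ∧ η < η₀ := ⟨η₀ / 2, by linarith, by linarith⟩
  -- First `μ` is taken large to make the merely bounded energy of the free wave contribute at most
  -- `η / 4`; then `δ` is taken small against `μ`, so that the two tails of `v` contribute `η / 8`
  -- each. The commutator error and the source account for `η / 4` each.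
  set μ : ℝ := 4 * K * Ku / η + 1 with hμ
  have hμ0 : 0 < μ := by positivity
  set δ : ℝ := η / (8 * (K + 1) * μ) with hδ
  have hδ0 : 0 < δ := by positivity
  obtain ⟨T₁, ε₁, hT₁, hε₁, hε₁1, H1⟩ := hv.exists_tail_small hα hα1 hs hs₀ hβ hf.deriv_contDiff
    hf.compact (fun y hy => deriv_ne_zero_support hfs hy) he hδ0
  obtain ⟨T₂, ε₂, hT₂, hε₂, hε₂1, H2⟩ := hv.exists_tail_small hα hα1 hs hs₀ hβ
    (hf.id_mul_deriv.smooth) (hf.compact.mul_left (f := fun y => y))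
    (fun y hy => deriv_ne_zero_support hfs (right_ne_zero_of_mul hy)) he hδ0
  obtain ⟨T₃, hT₃⟩ := eventually_atTop.1 (((tendsto_rpow_neg_tail (show 1 < 2 * α by linarith)
    (K * M)).eventually_lt_const (show 0 < η / 4 by linarith)).and
    ((tendsto_rpow_neg_tail hβ (D * C)).eventually_lt_const (show 0 < η / 4 by linarith)))
  set T₀ := max (max T₁ T₂) T₃ with hT₀
  have hTT₀ : T ≤ T₀ := hT₁.trans ((le_max_left _ _).trans (le_max_left _ _))
  have key : ∀ t₁ t₂, T₀ ≤ t₁ → t₁ ≤ t₂ → ‖freeEvol (-t₂) (loc f e α t₂ (v t₂)) -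
      freeEvol (-t₁) (loc f e α t₁ (v t₁))‖ ≤ η := by
    intro t₁ t₂ ht₁ ht₁₂
    have hTt₁ : T ≤ t₁ := hTT₀.trans ht₁
    have hTt₂ : T ≤ t₂ := hTt₁.trans ht₁₂
    refine norm_le_of_re_inner hη.le fun u hu => ?_
    have hU := fun s => extSol_freeEvol α s β hu
    set U : ℝ → L2 := fun t => freeEvol t u with hUdef
    set r : ℝ → ℝ → ℝ := fun ε t => (⟪rloc (fun _ => 1) e α ε U t, rloc f e α ε v t⟫_ℂ).re with hr
    have hlim : ∀ t, Tendsto (fun ε => r ε t) (𝓝[>] 0)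
        (𝓝 (⟪u, freeEvol (-t) (loc f e α t (v t))⟫_ℂ).re) := by
      intro t
      rw [← inner_freeEvol]
      refine (Complex.continuous_re.tendsto _).comp (Tendsto.inner ?_ (tendsto_regOp _))
      have := tendsto_regOp (freeEvol t u)
      simpa only [rloc, loc_one, hUdef] using this
    have hmain : ∀ᶠ ε in 𝓝[>] (0 : ℝ), -η ≤ r ε t₂ - r ε t₁ := by
      filter_upwards [Ioc_mem_nhdsGT (lt_min hε₁ hε₂)] with ε hε
      have hε0 : 0 < ε := hε.1
      have hεε₁ : ε ≤ ε₁ := hε.2.trans (min_le_left _ _)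
      have hεε₂ : ε ≤ ε₂ := hε.2.trans (min_le_right _ _)
      have hε1 : ε ≤ 1 := hεε₁.trans hε₁1
      have adm : ∀ t, T ≤ t → Adm e α ε t := fun t ht => ⟨he, hα, hα1, hε0, hε1, hT.trans ht⟩
      have hUc : ContinuousOn U (Ici T) := (continuous_freeEvol u).continuousOn
      have c1 := continuousOn_inv_mul_nrg hχS hT0 adm hUc
      have c2 := continuousOn_inv_mul_nrg hf.deriv hT0 adm hv.cont
      have c3 := continuousOn_inv_mul_nrg hf.id_mul_deriv hT0 adm hv.cont
      have c4 := continuousOn_rpow_Ici hT0 (-(2 * α))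
      have c5 := continuousOn_rpow_Ici hT0 (-β)
      have S1 : StepLike fun _ : ℝ => (1 : ℝ) := StepLike.const 1
      have hrc : ContinuousOn (r ε) (Ici T) := Complex.continuous_re.comp_continuousOn
        ((continuousOn_rloc S1 e α ε hT0 hUc).inner (continuousOn_rloc hf e α ε hT0 hv.cont))
      have I := integral_le_sub_of_approxDeriv (r := r ε)
        (r' := fun t => (⟪rlocDeriv (fun _ => 1) e α ε t (U t), rloc f e α ε v t⟫_ℂ).re +
          (⟪rloc (fun _ => 1) e α ε U t, rlocDeriv f e α ε t (v t)⟫_ℂ).re)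
        (b := fun t => D * C * t ^ (-β))
        (g := fun t => -(K * μ⁻¹) * (t⁻¹ * nrg χ e α ε t (U t)) -
          K * μ * (t⁻¹ * nrg (deriv f) e α ε t (v t)) -
          K * μ * (t⁻¹ * nrg (fun y => y * deriv f y) e α ε t (v t)) -
          K * M * t ^ (-(2 * α)) - D * C * t ^ (-β)) hrc
        (((((continuousOn_const.mul c1).sub (continuousOn_const.mul c2)).sub
          (continuousOn_const.mul c3)).sub (continuousOn_const.mul c4)).sub (continuousOn_const.mul c5))
        (fun t ht => ?_) (fun t ht => ?_) hTt₁ ht₁₂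
      · have i1 := c1.intervalIntegrable_Ici hTt₁ hTt₂
        have i2 := c2.intervalIntegrable_Ici hTt₁ hTt₂
        have i3 := c3.intervalIntegrable_Ici hTt₁ hTt₂
        have i4 := c4.intervalIntegrable_Ici hTt₁ hTt₂
        have i5 := c5.intervalIntegrable_Ici hTt₁ hTt₂
        rw [intervalIntegral.integral_sub ((((i1.const_mul _).sub (i2.const_mul _)).sub
            (i3.const_mul _)).sub (i4.const_mul _)) (i5.const_mul _),
          intervalIntegral.integral_sub (((i1.const_mul _).sub (i2.const_mul _)).sub
            (i3.const_mul _)) (i4.const_mul _),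
          intervalIntegral.integral_sub ((i1.const_mul _).sub (i2.const_mul _)) (i3.const_mul _),
          intervalIntegral.integral_sub (i1.const_mul _) (i2.const_mul _)] at I
        simp only [intervalIntegral.integral_const_mul] at I
        have h1t : 1 ≤ t₁ := hT.trans hTt₁
        have J1 := HU (hU s) he hε0 hε1 t₁ t₂ h1t ht₁₂
        have J2 := H1 ε hε0 hεε₁ t₁ t₂ (((le_max_left _ _).trans (le_max_left _ _)).trans ht₁) ht₁₂
        have J3 := H2 ε hε0 hεε₂ t₁ t₂ (((le_max_right _ _).trans (le_max_left _ _)).trans ht₁) ht₁₂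
        have J4 := integral_rpow_neg_le (show 1 < 2 * α by linarith) h1t ht₁₂
        have J5 := integral_rpow_neg_le hβ h1t ht₁₂
        obtain ⟨J6, J7⟩ := hT₃ t₁ ((le_max_right _ _).trans ht₁)
        have A1 : K * μ⁻¹ * Ku ≤ η / 4 := by
          rw [mul_right_comm, ← div_eq_mul_inv, div_le_iff₀ hμ0, hμ]
          have : η / 4 * (4 * K * Ku / η + 1) = K * Ku + η / 4 := by field_simp
          linarith
        have A2 : K * μ * δ ≤ η / 8 := by
          have e1 : (K + 1) * μ * δ = η / 8 := by
            rw [hδ]; field_simp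
          have e2 : K * μ * δ ≤ (K + 1) * μ * δ := by
            gcongr
            linarith
          linarith
        have B1 := mul_le_mul_of_nonneg_left J1 (show 0 ≤ K * μ⁻¹ by positivity)
        have B2 := mul_le_mul_of_nonneg_left J2 (show 0 ≤ K * μ by positivity)
        have B3 := mul_le_mul_of_nonneg_left J3 (show 0 ≤ K * μ by positivity)
        have B4 := mul_le_mul_of_nonneg_left J4 (show 0 ≤ K * M by positivity)
        have B5 := mul_le_mul_of_nonneg_left J5 (show 0 ≤ D * C from mul_nonneg hD0 hv.nonneg)
        linarith
      -- A free wave solves the equation on the whole space. Taking `s = -1` and `s₀ = 0` makes the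
      -- constant cutoff `1` admissible.
      · have a1 := (hU (-1)).approxDeriv (s₀ := 0) S1 (by norm_num) (fun y _ => abs_nonneg y)
          (D := 1) (fun y => by simp) (adm t ht) (hT.trans ht)
        have a2 := hv.approxDeriv hf hs₀ (fun y hy => (hfs y hy).trans (le_abs_self y)) hD (adm t ht) ht
        refine (a1.re_inner a2).mono ?_
        have : ‖rloc (fun _ => 1) e α ε U t‖ ≤ 1 := by
          refine (norm_regOp_le _ _).trans ?_
          rw [loc_one, hUdef, norm_freeEvol]
          exact hu
        have ht0 : 0 < t := hT0.trans_le ht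
        have hC := hv.nonneg
        have hb : 0 ≤ D * (C * t ^ (-β)) := by positivity
        have := mul_le_mul_of_nonneg_right this hb
        linarith
      · have ht0 : 0 < t := hT0.trans_le ht
        have hb := HK (adm t ht) (U t) (v t) hμ0
        have h2 := (abs_le.1 hb).1
        have e1 : rloc (fun _ => 1) e α ε U t = regOp ε (U t) := by rw [rloc, loc_one]
        rw [e1]
        change -_ ≤ t * ((⟪rlocDeriv (fun _ => 1) e α ε t (U t), rloc f e α ε v t⟫_ℂ).re + _) at h2
        set X := (⟪rlocDeriv (fun _ => 1) e α ε t (U t), rloc f e α ε v t⟫_ℂ).re +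
          (⟪regOp ε (U t), rlocDeriv f e α ε t (v t)⟫_ℂ).re with hX
        have h3 := mul_le_mul_of_nonneg_left h2 (inv_nonneg.2 ht0.le)
        rw [inv_mul_cancel_left₀ ht0.ne'] at h3
        have hpow : t⁻¹ * t ^ (1 - 2 * α) = t ^ (-(2 * α)) := by
          rw [← Real.rpow_neg_one, ← Real.rpow_add ht0]; ring_nf
        have h4 : ‖U t‖ * ‖v t‖ ≤ M := by
          rw [hUdef, norm_freeEvol]
          calc ‖u‖ * ‖v t‖ ≤ 1 * M := by
                gcongr
                exact hv.bound t ht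
            _ = M := one_mul M
        have h5 : K * t ^ (-(2 * α)) * (‖U t‖ * ‖v t‖) ≤ K * t ^ (-(2 * α)) * M := by gcongr
        have h6 : t⁻¹ * -(K * (μ⁻¹ * nrg χ e α ε t (U t) + μ * (nrg (deriv f) e α ε t (v t) +
            nrg (fun y => y * deriv f y) e α ε t (v t)) + t ^ (1 - 2 * α) * (‖U t‖ * ‖v t‖))) =
          -(K * μ⁻¹) * (t⁻¹ * nrg χ e α ε t (U t)) -
          K * μ * (t⁻¹ * nrg (deriv f) e α ε t (v t)) -
          K * μ * (t⁻¹ * nrg (fun y => y * deriv f y) e α ε t (v t)) -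
          K * t ^ (-(2 * α)) * (‖U t‖ * ‖v t‖) := by
          rw [← hpow]; ring
        rw [h6] at h3
        linarith
    -- The bound is uniform for small `ε`, so the regularization is removed only at the end, for
    -- fixed `u`, `t₁` and `t₂`.
    have := ge_of_tendsto ((hlim t₂).sub (hlim t₁)) hmain
    rwa [inner_sub_right, Complex.sub_re]
  refine ⟨T₀, fun m hm n hn => ?_⟩
  rw [dist_eq_norm]
  rcases le_total m n with h | h
  · rw [norm_sub_rev]
    exact (key m n hm h).trans_lt hηη
  · exact (key n m hn h).trans_lt hηη

theorem integral_inv_unbounded (c : ℝ) (hc : 0 < c) (K T : ℝ) (hT : 0 < T) :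
    ∃ t, T ≤ t ∧ K < ∫ τ in T..t, c * τ⁻¹ := by
  refine ⟨T * Real.exp (|K| / c + 1), ?_, ?_⟩
  · refine le_mul_of_one_le_right hT.le (Real.one_le_exp (by positivity))
  · rw [intervalIntegral.integral_const_mul, integral_inv_of_pos hT (by positivity),
      mul_div_cancel_left₀ _ hT.ne', Real.log_exp]
    have : c * (|K| / c + 1) = |K| + c := by field_simp
    rw [this]
    linarith [le_abs_self K]

/-- The limit of `e^{-itΔ} χ v` exists by Cook's method. Were it nonzero, the local energy would
eventually be bounded below, since it contains `1/8` times the regularized mass; then `∫ dt / t`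
would diverge against the propagation estimate. The choice `ε = 1` is enough, as the resolvent
commutes with the free group and has a nowhere vanishing symbol. -/
theorem ExtSol.tendsto_shell {α s s₀ M C β T : ℝ} (hα : 1 / 2 < α) (hα1 : α < 1) (hs : 1 / 2 ≤ s)
    (hs₀ : s < s₀) (hβ : 1 < β) {v : ℝ → L2} (hv : ExtSol α s M C β T v) {χ : ℝ → ℝ}
    (hχ : ContDiff ℝ ∞ χ) (hχc : HasCompactSupport χ) (hχs : ∀ y, χ y ≠ 0 → s₀ ≤ y) {e : E3}
    (he : ‖e‖ = 1) : Tendsto (fun t => loc χ e α t (v t)) atTop (𝓝 0) := by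
  have hS := StepLike.of_compact hχ hχc
  have hT := hv.one_le
  have hT0 : 0 < T := by linarith
  obtain ⟨w, hw⟩ := hv.exists_limit hα hα1 hs hs₀ hβ hS hχs he
  obtain ⟨K, hK, H⟩ := propagation_estimate (M := M) (C := C) hα hα1 hs hs₀ hβ hχ hχc hχs
  have hzero : regOp 1 w = 0 := by
    by_contra hne
    have hpos : 0 < ‖regOp 1 w‖ ^ 2 := by
      have := norm_pos_iff.2 hne
      positivity
    set c : ℝ := ‖regOp 1 w‖ ^ 2 / 16 with hc
    have hc0 : 0 < c := by positivity
    have h1 : Tendsto (fun t => ‖regOp 1 (freeEvol (-t) (loc χ e α t (v t)))‖ ^ 2) atTop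
        (𝓝 (‖regOp 1 w‖ ^ 2)) := ((((regOp 1).continuous.tendsto w).comp hw).norm).pow 2
    obtain ⟨T₁, hT₁⟩ := eventually_atTop.1 (h1.eventually_const_lt (show 8 * c < _ by rw [hc]; linarith))
    set T₂ := max T T₁ with hT₂
    have hT₂0 : 0 < T₂ := hT0.trans_le (le_max_left _ _)
    obtain ⟨t, ht, hlt⟩ := integral_inv_unbounded c hc0 K T₂ hT₂0
    have adm : ∀ t, T₂ ≤ t → Adm e α 1 t := fun t ht =>
      ⟨he, hα, hα1, one_pos, le_rfl, hT.trans ((le_max_left _ _).trans ht)⟩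
    have h2 := H hv he one_pos le_rfl T₂ t (le_max_left _ _) ht
    have cn := continuousOn_inv_mul_nrg hS hT₂0 adm (hv.cont.mono (Ici_subset_Ici.2 (le_max_left _ _)))
    have cc : ContinuousOn (fun τ : ℝ => c * τ⁻¹) (Ici T₂) := continuousOn_const.mul
      fun τ hτ => (continuousAt_inv₀ (hT₂0.trans_le hτ).ne').continuousWithinAt
    have h3 : ∫ τ in T₂..t, c * τ⁻¹ ≤ ∫ τ in T₂..t, τ⁻¹ * nrg χ e α 1 τ (v τ) := by
      refine intervalIntegral.integral_mono_on ht (cc.intervalIntegrable_Ici le_rfl ht)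
        (cn.intervalIntegrable_Ici le_rfl ht) fun τ hτ => ?_
      have hτ0 : 0 < τ := hT₂0.trans_le hτ.1
      rw [mul_comm]
      refine mul_le_mul_of_nonneg_left ?_ (inv_nonneg.2 hτ0.le)
      have h4 := (hT₁ τ ((le_max_right _ _).trans hτ.1)).le
      have h5 := BF_self_mono (adm τ hτ.1) ((BLipSym.const (1 / 8)).lipSym) lipSym_abs_add
        (fun k => by linarith [abs_nonneg k]) (loc χ e α τ (v τ))
      have h6 := BF_const_mul (adm τ hτ.1) ((BLipSym.const 1).lipSym) (1 / 8)
        (loc χ e α τ (v τ)) (loc χ e α τ (v τ))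
      simp only [mul_one] at h6
      rw [h6, ← inner_reg_symOp_reg (BLipSym.const 1), symOp_one] at h5
      have h7 : (⟪regOp 1 (loc χ e α τ (v τ)), regOp 1 (loc χ e α τ (v τ))⟫_ℂ).re =
        ‖regOp 1 (loc χ e α τ (v τ))‖ ^ 2 := inner_self_eq_norm_sq (𝕜 := ℂ) _
      have h8 : ‖regOp 1 (freeEvol (-τ) (loc χ e α τ (v τ)))‖ = ‖regOp 1 (loc χ e α τ (v τ))‖ := by
        rw [freeEvol_eq, regOp, fourierMul_comm (isBdd_reg 1) (isBdd_freeSymbol _), ← freeEvol_eq,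
          norm_freeEvol]
      rw [h8] at h4
      rw [h7] at h5
      change c ≤ BF _ e α 1 τ _ _
      linarith
    linarith
  have hw0 : w = 0 := by
    refine fourier_injective ?_
    have h2 := congrArg (fun z : L2 => (𝓕 z : L2)) hzero
    simp only [regOp, fourier_fourierMul] at h2
    have h0 : (𝓕 (0 : L2) : L2) = 0 := map_zero (Lp.fourierTransformₗᵢ E3 ℂ)
    rw [h0] at h2 ⊢
    ext1
    filter_upwards [mulOp_coe (isBdd_reg 1) (𝓕 w : L2), Lp.coeFn_zero ℂ 2 (volume : Measure E3)]
      with ξ h3 h4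
    rw [h2, h4] at h3
    rw [h4]
    have h5 : ((reg 1 ξ : ℝ) : ℂ) ≠ 0 := Complex.ofReal_ne_zero.2 (reg_pos 1 ξ).ne'
    simpa [h5] using h3.symm
  rw [tendsto_zero_iff_norm_tendsto_zero]
  rw [hw0] at hw
  have h := hw.norm
  rw [norm_zero] at h
  exact h.congr fun t => norm_freeEvol _ _

/-! ### Convergence of the channel state -/

/-- `1 - ∏ₑ (1 - f(⟪e, x⟫ / t^α))` over the directions `e` in a list, as an operator. -/
def netOp (f : ℝ → ℝ) (α t : ℝ) : List E3 → L2 → L2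
  | [], _ => 0
  | e :: l, w => netOp f α t l w + loc f e α t (w - netOp f α t l w)

/-- The multiplier of `netOp`. -/
def netCut (f : ℝ → ℝ) (R : ℝ) : List E3 → E3 → ℝ
  | [], _ => 0
  | e :: l, x => netCut f R l x + f (inner ℝ e x / R) * (1 - netCut f R l x)

theorem netCut_eq_one {f : ℝ → ℝ} {R : ℝ} {l : List E3} {x : E3} {e : E3} (he : e ∈ l)
    (h : f (inner ℝ e x / R) = 1) : netCut f R l x = 1 := by
  induction l with
  | nil => simp at he
  | cons a l ih =>
    rw [netCut]
    rcases List.mem_cons.1 he with rfl | h'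
    · rw [h]; ring
    · rw [ih h']; ring

theorem netCut_eq_zero {f : ℝ → ℝ} {R : ℝ} {l : List E3} {x : E3}
    (h : ∀ e ∈ l, f (inner ℝ e x / R) = 0) : netCut f R l x = 0 := by
  induction l with
  | nil => rfl
  | cons a l ih =>
    rw [netCut, ih fun e he => h e (List.mem_cons_of_mem _ he), h a List.mem_cons_self]
    ring

theorem netCut_mem {f : ℝ → ℝ} (h0 : ∀ y, 0 ≤ f y) (h1 : ∀ y, f y ≤ 1) (R : ℝ) (l : List E3)
    (x : E3) : 0 ≤ netCut f R l x ∧ netCut f R l x ≤ 1 := by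
  induction l with
  | nil => simp [netCut]
  | cons a l ih =>
    rw [netCut]
    have a0 := h0 (inner ℝ a x / R)
    have a1 := h1 (inner ℝ a x / R)
    constructor <;> nlinarith [ih.1, ih.2]

theorem isBdd_netCut {f : ℝ → ℝ} (hf : StepLike f) (h0 : ∀ y, 0 ≤ f y) (h1 : ∀ y, f y ≤ 1) (R : ℝ)
    (l : List E3) : IsBdd fun x => (netCut f R l x : ℂ) := by
  refine IsBdd.of_continuous (C := 1) (Complex.continuous_ofReal.comp ?_) fun x => ?_
  · have hfc := hf.smooth.continuous
    induction l with
    | nil => exact continuous_const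
    | cons a l ih =>
      simp only [netCut]
      fun_prop
  · rw [Complex.norm_real, Real.norm_of_nonneg (netCut_mem h0 h1 R l x).1]
    exact (netCut_mem h0 h1 R l x).2

theorem netOp_eq {f : ℝ → ℝ} (hf : StepLike f) (h0 : ∀ y, 0 ≤ f y) (h1 : ∀ y, f y ≤ 1) (α t : ℝ)
    (l : List E3) (w : L2) : netOp f α t l w = mulOp (fun x => (netCut f (t ^ α) l x : ℂ)) w := by
  induction l with
  | nil => simp [netOp, netCut, mulOp_const]
  | cons a l ih =>
    have hb := isBdd_netCut hf h0 h1 (t ^ α) l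
    have hc := hf.isBdd a (t ^ α)
    rw [netOp, ih, loc]
    have : (fun x => (netCut f (t ^ α) (a :: l) x : ℂ)) = fun x => (netCut f (t ^ α) l x : ℂ) +
        cut a (t ^ α) f x * (1 - (netCut f (t ^ α) l x : ℂ)) := by
      funext x
      rw [netCut, cut]; push_cast; ring
    rw [this, mulOp_add hb (hc.mul ((IsBdd.const 1).sub hb)), mulOp_mul hc ((IsBdd.const 1).sub hb),
      mulOp_sub (IsBdd.const 1) hb, mulOp_const, one_smul]

/-- `v` solves the equation up to `O(t^{-β})`, `β > 1`, in every region `‖x‖ ≥ s t^α`, `s > 1/2`. -/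
def ExteriorSolution (α : ℝ) (v : ℝ → L2) : Prop :=
  ∀ s, 1 / 2 < s → ∃ M C β T, 1 < β ∧ ExtSol α s M C β T v

theorem ExteriorSolution.exists_limit {α : ℝ} (hα : 1 / 2 < α) (hα1 : α < 1) {v : ℝ → L2}
    (hv : ExteriorSolution α v) {f : ℝ → ℝ} (hf : StepLike f) {s₀ : ℝ} (hs₀ : 1 / 2 < s₀)
    (hfs : ∀ y, f y ≠ 0 → s₀ ≤ y) {e : E3} (he : ‖e‖ = 1) :
    ∃ w, Tendsto (fun t => freeEvol (-t) (loc f e α t (v t))) atTop (𝓝 w) := by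
  obtain ⟨M, C, β, T, hβ, h⟩ := hv ((1 / 2 + s₀) / 2) (by linarith)
  exact h.exists_limit hα hα1 (by linarith) (by linarith) hβ hf hfs he

theorem exists_limit_free {α : ℝ} (hα : 1 / 2 < α) (hα1 : α < 1) {f : ℝ → ℝ} (hf : StepLike f)
    {s₀ : ℝ} (hs₀ : 1 / 2 < s₀) (hfs : ∀ y, f y ≠ 0 → s₀ ≤ y) {e : E3} (he : ‖e‖ = 1) (u : L2) :
    ∃ w, Tendsto (fun t => freeEvol (-t) (loc f e α t (freeEvol t u))) atTop (𝓝 w) :=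
  (extSol_freeEvol α (1 / 2) 2 (le_refl ‖u‖)).exists_limit hα hα1 le_rfl hs₀ (by norm_num) hf hfs he

/-- By induction on the list. The new cutoff acts both on `v`, where the limit is known, and on the
previous net state. The latter is asymptotically a free wave, to which the existence of limits for
free waves applies. -/
theorem ExteriorSolution.exists_limit_net {α : ℝ} (hα : 1 / 2 < α) (hα1 : α < 1) {v : ℝ → L2}
    (hv : ExteriorSolution α v) {f : ℝ → ℝ} (hf : StepLike f) {s₀ : ℝ} (hs₀ : 1 / 2 < s₀)
    (hfs : ∀ y, f y ≠ 0 → s₀ ≤ y) (l : List E3) (hl : ∀ e ∈ l, ‖e‖ = 1) :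
    ∃ w, Tendsto (fun t => freeEvol (-t) (netOp f α t l (v t))) atTop (𝓝 w) := by
  induction l with
  | nil => exact ⟨0, tendsto_const_nhds.congr fun t => by simp [netOp, freeEvol_eq]⟩
  | cons e l ih =>
    obtain ⟨b, hb⟩ := ih fun e he => hl e (List.mem_cons_of_mem _ he)
    have he := hl e List.mem_cons_self
    obtain ⟨w, hw⟩ := hv.exists_limit hα hα1 hf hs₀ hfs he
    obtain ⟨z, hz⟩ := exists_limit_free hα hα1 hf hs₀ hfs he b
    obtain ⟨D, hD0, hD⟩ := hf.bounded
    refine ⟨b + (w - z), ?_⟩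
    have h1 : Tendsto (fun t => freeEvol (-t) (loc f e α t (netOp f α t l (v t)))) atTop (𝓝 z) := by
      -- The operators `e^{-itΔ} f e^{itΔ}` are uniformly bounded and converge at the vector `b`, so
      -- they may be applied to a family tending to `b`.
      have := tendsto_clm_apply (l := atTop) (A := fun t : ℝ => fourierMul (freeSymbol (-t)) ∘L
        mulOp (cut e (t ^ α) f) ∘L fourierMul (freeSymbol t)) (B := D) (u₀ := b) (y₀ := z)
        (u := fun t => freeEvol (-t) (netOp f α t l (v t))) (Eventually.of_forall fun t x => ?_) ?_ hb
      · refine this.congr fun t => ?_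
        simp only [ContinuousLinearMap.comp_apply]
        rw [← freeEvol_eq, ← freeEvol_eq, freeEvol_add, add_neg_cancel, freeEvol_zero]
        rfl
      · simp only [ContinuousLinearMap.comp_apply]
        rw [← freeEvol_eq, ← freeEvol_eq, norm_freeEvol]
        refine (norm_loc_le hf hD _).trans ?_
        rw [norm_freeEvol]
      · refine hz.congr fun t => ?_
        simp only [ContinuousLinearMap.comp_apply]
        rw [← freeEvol_eq, ← freeEvol_eq]
        rfl
    refine (hb.add (hw.sub h1)).congr fun t => ?_
    rw [netOp, freeEvol_add_map, ← freeEvol_sub_map]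
    congr 2
    exact (map_sub (mulOp (cut e (t ^ α) f)) _ _).symm

/-! ### From finitely many half-spaces to the radial cutoff. -/

theorem exists_net {l : ℝ} (hl : l < 1) : ∃ L : List E3, (∀ e ∈ L, ‖e‖ = 1) ∧
    ∀ x : E3, x ≠ 0 → ∃ e ∈ L, l * ‖x‖ ≤ inner ℝ e x := by
  have hc : IsCompact (Metric.sphere (0 : E3) 1) := isCompact_sphere 0 1
  obtain ⟨t, ht, hcov⟩ := hc.elim_nhds_subcover (fun e => {x : E3 | l < inner ℝ e x}) (fun e he => by
    have h1 : IsOpen {x : E3 | l < inner ℝ e x} := isOpen_lt continuous_const (by fun_prop)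
    refine h1.mem_nhds ?_
    rw [mem_sphere_zero_iff_norm] at he
    simpa [he] using hl)
  refine ⟨t.toList, fun e he => ?_, fun x hx => ?_⟩
  · simpa using ht e (Finset.mem_toList.1 he)
  · have hp := norm_pos_iff.2 hx
    have h2 : ‖x‖⁻¹ • x ∈ Metric.sphere (0 : E3) 1 := by
      rw [mem_sphere_zero_iff_norm, norm_smul, norm_inv, norm_norm, inv_mul_cancel₀ hp.ne']
    obtain ⟨e, he, h3⟩ := mem_iUnion₂.1 (hcov h2)
    refine ⟨e, Finset.mem_toList.2 he, ?_⟩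
    change l < inner ℝ e (‖x‖⁻¹ • x) at h3
    rw [inner_smul_right, lt_inv_mul_iff₀ hp] at h3
    linarith

theorem SmoothCharFun.mem_Icc (F : SmoothCharFun) (l : ℝ) : 0 ≤ F l ∧ F l ≤ 1 := by
  have h0 := (F.eq_zero (1 / 2) le_rfl).ge
  constructor
  · rcases le_total l (1 / 2) with h | h
    · exact (F.eq_zero l h).ge
    · exact h0.trans (F.monotone h)
  · rcases le_total l 1 with h | h
    · exact (F.monotone h).trans (F.eq_one 1 le_rfl).le
    · exact (F.eq_one l h).le

theorem mulOp_sum {ι : Type*} (s : List ι) (q : ι → E3 → ℂ) (hq : ∀ i ∈ s, IsBdd (q i)) (w : L2) :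
    IsBdd (fun x => (s.map fun i => q i x).sum) ∧
      mulOp (fun x => (s.map fun i => q i x).sum) w = (s.map fun i => mulOp (q i) w).sum := by
  induction s with
  | nil => simpa [mulOp_const] using IsBdd.const 0
  | cons a s ih =>
    obtain ⟨h1, h2⟩ := ih fun i hi => hq i (List.mem_cons_of_mem _ hi)
    have h3 := hq a List.mem_cons_self
    simp only [List.map_cons, List.sum_cons]
    exact ⟨h3.add h1, by rw [mulOp_add h3 h1, h2]⟩

theorem norm_mulOp_mono {p q : E3 → ℂ} (hp : IsBdd p) (hq : IsBdd q) (h : ∀ x, ‖p x‖ ≤ ‖q x‖)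
    (w : L2) : ‖mulOp p w‖ ≤ ‖mulOp q w‖ := by
  refine Lp.norm_le_norm_of_ae_le ?_
  filter_upwards [mulOp_coe hp w, mulOp_coe hq w] with x h1 h2
  rw [h1, h2, norm_mul, norm_mul]
  exact mul_le_mul_of_nonneg_right (h x) (norm_nonneg _)

theorem tendsto_list_sum_zero {ι : Type*} (s : List ι) (g : ι → ℝ → L2)
    (h : ∀ i ∈ s, Tendsto (g i) atTop (𝓝 0)) :
    Tendsto (fun t => (s.map fun i => g i t).sum) atTop (𝓝 0) := by
  induction s with
  | nil => simp
  | cons a s ih =>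
    have := (h a List.mem_cons_self).add (ih fun i hi => h i (List.mem_cons_of_mem _ hi))
    simpa using this

/-- Multiplication by `F(‖x‖ / R)`. -/
def radCut (F : SmoothCharFun) (R : ℝ) (x : E3) : ℂ := (F (‖x‖ / R) : ℂ)

theorem isBdd_radCut (F : SmoothCharFun) (R : ℝ) : IsBdd (radCut F R) := by
  refine IsBdd.of_continuous (C := 1) (Complex.continuous_ofReal.comp
    (F.smooth.continuous.comp (continuous_norm.div_const R))) fun x => ?_
  rw [radCut, Complex.norm_real, Real.norm_of_nonneg (F.mem_Icc _).1]
  exact (F.mem_Icc _).2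

/-- The radial cutoff and a cutoff built from finitely many half-spaces differ by at most `δ` plus a
sum of shell cutoffs. The shells carry no mass asymptotically, and the state of the half-space
cutoff converges, hence the radial one is Cauchy. -/
theorem ExteriorSolution.exists_limit_radCut {α : ℝ} (hα : 1 / 2 < α) (hα1 : α < 1) {v : ℝ → L2}
    (hv : ExteriorSolution α v) (F : SmoothCharFun) :
    ∃ w, Tendsto (fun t => freeEvol (-t) (mulOp (radCut F (t ^ α)) (v t))) atTop (𝓝 w) := by
  obtain ⟨M, _, _, T, _, hM⟩ := hv 1 (by norm_num)
  have hM0 : 0 ≤ M := (norm_nonneg _).trans (hM.bound T le_rfl)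
  refine cauchySeq_tendsto_of_complete (Metric.cauchySeq_iff'.2 fun η hη => ?_)
  set δ : ℝ := η / (8 * (M + 1)) with hδ
  have hδ0 : 0 < δ := by positivity
  -- Half-space cutoffs are available only beyond some `s₀ > 1/2`, while `F` may start right at
  -- `1/2`. By continuity `F` is at most `δ` up to some `a > 1/2`, and this part is simply paid for.
  obtain ⟨a, ha, ha1, haF⟩ : ∃ a, 1 / 2 < a ∧ a < 1 ∧ F a ≤ δ := by
    have h1 : Tendsto F (𝓝 (1 / 2)) (𝓝 0) := by
      have := F.smooth.continuous.tendsto (1 / 2)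
      rwa [F.eq_zero _ le_rfl] at this
    have h2 : ∀ᶠ a in 𝓝[>] (1 / 2 : ℝ), F a < δ :=
      (h1.eventually_lt_const hδ0).filter_mono nhdsWithin_le_nhds
    obtain ⟨a, h3, h4⟩ := (h2.and (Ioo_mem_nhdsGT (show (1 / 2 : ℝ) < 1 by norm_num))).exists
    exact ⟨a, h4.1, h4.2, h3.le⟩
  set s₀ : ℝ := (1 / 2 + a) / 2 with hs₀
  have hs₀a : s₀ < a := by rw [hs₀]; linarith
  have hs₀2 : 1 / 2 < s₀ := by rw [hs₀]; linarith
  -- The net must be fine enough that every point with `‖x‖ > aR` has a direction in which it lies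
  -- beyond `(s₀ + a)/2`, where `χ` is already one. Also `l > 1/2`, so a point with `‖x‖ > 2R` has a
  -- direction in which `f = 1`, and both cutoffs are one there.
  set l : ℝ := ((s₀ + a) / 2) / a with hl
  have hl1 : l < 1 := by rw [hl, div_lt_one (by linarith)]; linarith
  have hla : l * a = (s₀ + a) / 2 := by rw [hl]; field_simp
  have hl0 : 1 / 2 < l := by
    rw [hl, lt_div_iff₀ (by linarith)]; nlinarith
  obtain ⟨L, hL1, hL⟩ := exists_net hl1
  obtain ⟨f, hf, f0, f1, fn, fl⟩ := exists_step (show a < 1 from ha1)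
  have hfs : ∀ y, f y ≠ 0 → a ≤ y := fun y hy => by
    by_contra! h
    exact hy (f0 y h.le)
  obtain ⟨E, hE, E0, E1, En, El⟩ := exists_step (show s₀ < (s₀ + a) / 2 by linarith)
  obtain ⟨E', hE', E0', E1', En', El'⟩ := exists_step (show (2 : ℝ) < 3 by norm_num)
  set χ : ℝ → ℝ := fun y => E y * (1 - E' y) with hχ
  have hχc : HasCompactSupport χ := by
    refine HasCompactSupport.of_support_subset_isCompact (isCompact_Icc (a := s₀) (b := 3))
      fun y hy => ⟨?_, ?_⟩
    · by_contra! h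
      exact hy (by simp [hχ, E0 y h.le])
    · by_contra! h
      exact hy (by simp [hχ, E1' y h.le])
  have hχs : ContDiff ℝ ∞ χ := hE.smooth.mul (contDiff_const.sub hE'.smooth)
  have hχ0 : ∀ y, 0 ≤ χ y := fun y => mul_nonneg (En y) (by linarith [El' y])
  have hχS := StepLike.of_compact hχs hχc
  have hχsupp : ∀ y, χ y ≠ 0 → s₀ ≤ y := fun y hy => by
    by_contra! h
    exact hy (by simp [hχ, E0 y h.le])
  obtain ⟨w, hw⟩ := hv.exists_limit_net hα hα1 hf ha hfs L hL1
  have hshell : Tendsto (fun t => (L.map fun e => loc χ e α t (v t)).sum) atTop (𝓝 0) := by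
    refine tendsto_list_sum_zero L (fun e t => loc χ e α t (v t)) fun e he => ?_
    obtain ⟨M', C, β, T', hβ, h⟩ := hv ((1 / 2 + s₀) / 2) (by linarith)
    exact h.tendsto_shell hα hα1 (by linarith) (by linarith) hβ hχs hχc hχsupp (hL1 e he)
  -- the difference of the two cutoffs lives in a shell
  have hdiff : ∀ R : ℝ, 0 < R → ∀ x, ‖radCut F R x - (netCut f R L x : ℂ)‖ ≤
      ‖((δ : ℝ) : ℂ) + (L.map fun e => cut e R χ x).sum‖ := by
    intro R hR x
    have hsum : (L.map fun e => cut e R χ x).sum =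
        (((L.map fun e => χ (inner ℝ e x / R)).sum : ℝ) : ℂ) := by
      rw [← Complex.ofRealHom_eq_coe, map_list_sum, List.map_map]
      rfl
    have hsum0 : 0 ≤ (L.map fun e => χ (inner ℝ e x / R)).sum :=
      List.sum_nonneg fun z hz => by
        obtain ⟨e, -, rfl⟩ := List.mem_map.1 hz
        exact hχ0 _
    rw [hsum, radCut, ← Complex.ofReal_sub, ← Complex.ofReal_add, Complex.norm_real,
      Complex.norm_real, Real.norm_of_nonneg (add_nonneg hδ0.le hsum0), Real.norm_eq_abs]
    have hF := F.mem_Icc (‖x‖ / R)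
    have hN := netCut_mem fn fl R L x
    have hin : ∀ e ∈ L, inner ℝ e x / R ≤ ‖x‖ / R := fun e he => by
      refine div_le_div_of_nonneg_right ((real_inner_le_norm e x).trans ?_) hR.le
      rw [hL1 e he, one_mul]
    rcases le_or_gt (‖x‖ / R) a with hxa | hxa
    · rw [netCut_eq_zero fun e he => f0 _ ((hin e he).trans hxa), sub_zero, abs_of_nonneg hF.1]
      have := F.monotone hxa
      linarith
    have hx0 : x ≠ 0 := by
      rintro rfl
      rw [norm_zero, zero_div] at hxa
      linarith
    obtain ⟨e, he, hex⟩ := hL x hx0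
    have hex' : l * (‖x‖ / R) ≤ inner ℝ e x / R := by
      rw [← mul_div_assoc]
      exact div_le_div_of_nonneg_right hex hR.le
    rcases le_or_gt (‖x‖ / R) 2 with hx2 | hx2
    · have h1 : (s₀ + a) / 2 ≤ inner ℝ e x / R := by
        rw [← hla]
        exact (mul_le_mul_of_nonneg_left hxa.le (by linarith)).trans hex'
      have h2 : χ (inner ℝ e x / R) = 1 := by
        simp [hχ, E1 _ h1, E0' _ ((hin e he).trans hx2)]
      have h3 : χ (inner ℝ e x / R) ≤ (L.map fun e => χ (inner ℝ e x / R)).sum :=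
        List.single_le_sum (fun z hz => by
          obtain ⟨e, -, rfl⟩ := List.mem_map.1 hz
          exact hχ0 _) _ (List.mem_map.2 ⟨e, he, rfl⟩)
      rw [h2] at h3
      rw [abs_le]
      constructor <;> linarith [hF.1, hF.2, hN.1, hN.2]
    · have h1 : 1 ≤ inner ℝ e x / R := by
        refine le_trans ?_ hex'
        nlinarith
      rw [netCut_eq_one he (f1 _ h1), F.eq_one _ (by linarith), sub_self, abs_zero]
      linarith
  have hbound : ∀ᶠ t in atTop, ‖freeEvol (-t) (mulOp (radCut F (t ^ α)) (v t)) -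
      freeEvol (-t) (netOp f α t L (v t))‖ ≤ η / 4 := by
    have h1 := (tendsto_zero_iff_norm_tendsto_zero.1 hshell).eventually_lt_const
      (show 0 < η / 8 by linarith)
    filter_upwards [h1, eventually_ge_atTop T] with t ht hTt
    have ht0 : 0 < t := by linarith [hM.one_le]
    have hR : 0 < t ^ α := Real.rpow_pos_of_pos ht0 α
    have hb1 := isBdd_radCut F (t ^ α)
    have hb2 := isBdd_netCut hf fn fl (t ^ α) L
    obtain ⟨hb3, hs3⟩ := mulOp_sum L (fun e => cut e (t ^ α) χ) (fun e _ => hχS.isBdd e _) (v t)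
    rw [← freeEvol_sub_map, norm_freeEvol, netOp_eq hf fn fl, ← mulOp_sub hb1 hb2]
    refine (norm_mulOp_mono (hb1.sub hb2) ((IsBdd.const _).add hb3) (hdiff _ hR) _).trans ?_
    rw [mulOp_add (IsBdd.const _) hb3, mulOp_const, hs3]
    refine (norm_add_le _ _).trans ?_
    rw [norm_smul, Complex.norm_real, Real.norm_of_nonneg hδ0.le]
    have h2 : δ * ‖v t‖ ≤ η / 8 := by
      have h3 := hM.bound t hTt
      calc δ * ‖v t‖ ≤ δ * (M + 1) := by gcongr; linarith
        _ = η / 8 := by rw [hδ]; field_simp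
    have h4 : ‖(L.map fun e => mulOp (cut e (t ^ α) χ) (v t)).sum‖ < η / 8 := ht
    linarith
  obtain ⟨T₁, hT₁⟩ := eventually_atTop.1 (hbound.and (hw.eventually (Metric.ball_mem_nhds w
    (show 0 < η / 4 by linarith))))
  refine ⟨T₁, fun t ht => ?_⟩
  obtain ⟨a1, a2⟩ := hT₁ t ht
  obtain ⟨b1, b2⟩ := hT₁ T₁ le_rfl
  rw [← dist_eq_norm] at a1 b1
  change dist _ w < _ at a2
  change dist _ w < _ at b2
  have c1 := dist_triangle (freeEvol (-t) (mulOp (radCut F (t ^ α)) (v t)))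
    (freeEvol (-t) (netOp f α t L (v t))) w
  have c2 := dist_triangle (freeEvol (-T₁) (mulOp (radCut F (T₁ ^ α)) (v T₁)))
    (freeEvol (-T₁) (netOp f α T₁ L (v T₁))) w
  have c3 := dist_triangle_right (freeEvol (-t) (mulOp (radCut F (t ^ α)) (v t)))
    (freeEvol (-T₁) (mulOp (radCut F (T₁ ^ α)) (v T₁))) w
  linarith

/-! ### The smoothed norm -/

theorem SmoothedNorm.inner_nonneg (ρ : SmoothedNorm) {s : ℝ} (hs : 1 ≤ s) :
    0 ≤ ∫ u in (1 : ℝ)..s, ρ.bump u :=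
  intervalIntegral.integral_nonneg hs fun u _ => ρ.nonneg u

theorem SmoothedNorm.bump_eq_zero (ρ : SmoothedNorm) {u : ℝ} (h : u ∉ Ioo (1 : ℝ) 2) :
    ρ.bump u = 0 := by
  rw [← ρ.support_eq] at h
  exact Function.notMem_support.1 h

theorem SmoothedNorm.continuous_primitive (ρ : SmoothedNorm) :
    Continuous fun s : ℝ => ∫ u in (1 : ℝ)..s, ρ.bump u :=
  intervalIntegral.continuous_primitive
    (fun a b => ρ.smooth.continuous.intervalIntegrable a b) 1

theorem SmoothedNorm.profile_of_two_le (ρ : SmoothedNorm) {r : ℝ} (hr : 2 ≤ r) :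
    ρ.profile r = r := by
  have hi : ∀ a b, IntervalIntegrable (fun s : ℝ => ∫ u in (1 : ℝ)..s, ρ.bump u) volume a b :=
    fun a b => ρ.continuous_primitive.intervalIntegrable a b
  have h1 : ∀ s ∈ uIcc 2 r, ∫ u in (1 : ℝ)..s, ρ.bump u = 1 := by
    intro s hs
    rw [uIcc_of_le hr] at hs
    rw [← intervalIntegral.integral_add_adjacent_intervals (b := 2)
      (ρ.smooth.continuous.intervalIntegrable _ _) (ρ.smooth.continuous.intervalIntegrable _ _),
      ρ.integral_eq]
    have : ∫ u in (2 : ℝ)..s, ρ.bump u = ∫ u in (2 : ℝ)..s, 0 :=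
      intervalIntegral.integral_congr fun u hu => ρ.bump_eq_zero fun h => by
        rw [uIcc_of_le hs.1] at hu
        exact absurd h.2 (not_lt.2 hu.1)
    rw [this]; simp
  rw [SmoothedNorm.profile, ← intervalIntegral.integral_add_adjacent_intervals (hi 1 2) (hi 2 r),
    intervalIntegral.integral_congr h1, intervalIntegral.integral_const, smul_eq_mul]
  ring

theorem SmoothedNorm.profile_le_two (ρ : SmoothedNorm) {r : ℝ} (hr : r ≤ 2) : ρ.profile r ≤ 2 := by
  have hi : ∀ a b, IntervalIntegrable (fun s : ℝ => ∫ u in (1 : ℝ)..s, ρ.bump u) volume a b :=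
    fun a b => ρ.continuous_primitive.intervalIntegrable a b
  have h1 : ∫ s in r..2, (∫ u in (1 : ℝ)..s, ρ.bump u) ≥ 0 := by
    refine intervalIntegral.integral_nonneg hr fun s _ => ?_
    rcases le_total 1 s with h | h
    · exact ρ.inner_nonneg h
    · have : ∫ u in (1 : ℝ)..s, ρ.bump u = ∫ u in (1 : ℝ)..s, 0 :=
        intervalIntegral.integral_congr fun u hu => ρ.bump_eq_zero fun h' => by
          rw [uIcc_of_ge h] at hu
          exact absurd h'.1 (not_lt.2 hu.2)
      rw [this]; simp
  have h2 := intervalIntegral.integral_add_adjacent_intervals (hi 1 r) (hi r 2)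
  rw [SmoothedNorm.profile]
  linarith

/-- The smoothed norm differs from `‖x‖` only for `‖x‖ < 2`. Both arguments of `F` are then at most
`2 / 4 = 1/2`, where `F` vanishes. -/
theorem cutoff_eq_radCut (F : SmoothCharFun) (ρ : SmoothedNorm) {α t : ℝ} (ht : 4 ≤ t ^ α) :
    cutoff F ρ α t = radCut F (t ^ α) := by
  funext x
  rw [cutoff, radCut, SmoothedNorm.japanese]
  have hR : 0 < t ^ α := by linarith
  rcases le_total 2 ‖x‖ with h | h
  · rw [ρ.profile_of_two_le h]
  · rw [F.eq_zero, F.eq_zero]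
    · rw [div_le_iff₀ hR]; linarith
    · rw [div_le_iff₀ hR]; linarith [ρ.profile_le_two h]

theorem channelState_eq (F : SmoothCharFun) (ρ : SmoothedNorm) (α : ℝ) (φ : ℝ → L2) (t : ℝ) :
    channelState F ρ α φ t = freeEvol (-t) (mulOp (cutoff F ρ α t) (φ t)) := by
  rw [channelState, mulOp_apply (memLp_cutoff F ρ α t)]

theorem eventually_channelState_eq (F : SmoothCharFun) (ρ : SmoothedNorm) {α : ℝ} (hα : 0 < α)
    (φ : ℝ → L2) : ∀ᶠ t in atTop,
      channelState F ρ α φ t = freeEvol (-t) (mulOp (radCut F (t ^ α)) (φ t)) := by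
  filter_upwards [(tendsto_rpow_atTop hα).eventually_ge_atTop 4] with t ht
  rw [channelState_eq, cutoff_eq_radCut F ρ ht]

/-! ### Weak derivatives -/

/-- `g` is the derivative of `f` in the direction `e`. -/
def HasGrad (e : E3) (f g : L2) : Prop :=
  ((𝓕 g : L2) : E3 → ℂ) =ᵐ[volume]
    fun ξ => Complex.I * ((2 * Real.pi * inner ℝ e ξ : ℝ) : ℂ) * (𝓕 f : L2) ξ

/-- Multiplying by the positive symbol of the resolvent turns the unbounded relation into an
equality of bounded operators. Closedness of the derivative and its commutation with the free group
become immediate. -/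
theorem hasGrad_iff_reg {e : E3} {f g : L2} {ε : ℝ} (hε : 0 < ε) :
    HasGrad e f g ↔ regOp ε g =
      Complex.I • fourierMul (fun ξ => ((2 * Real.pi * inner ℝ e ξ * reg ε ξ : ℝ) : ℂ)) f := by
  have hi := isBdd_inner_mul_reg hε e
  have key : regOp ε g =
      Complex.I • fourierMul (fun ξ => ((2 * Real.pi * inner ℝ e ξ * reg ε ξ : ℝ) : ℂ)) f ↔
      mulOp (fun ξ => (reg ε ξ : ℂ)) (𝓕 g : L2) =
      mulOp (fun ξ => Complex.I * ((2 * Real.pi * inner ℝ e ξ * reg ε ξ : ℝ) : ℂ)) (𝓕 f : L2) := by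
    rw [← fourierMul_const_mul _ hi, regOp, ← fourier_fourierMul, ← fourier_fourierMul]
    exact ⟨fun h => congrArg (fun z : L2 => (𝓕 z : L2)) h, fun h => fourier_injective h⟩
  rw [key, HasGrad, Lp.ext_iff]
  have h1 := mulOp_coe (isBdd_reg ε) (𝓕 g : L2)
  have h2 := mulOp_coe ((IsBdd.const Complex.I).mul hi) (𝓕 f : L2)
  constructor
  · intro h
    filter_upwards [h, h1, h2] with ξ h3 h4 h5
    rw [h4, h5, h3]
    push_cast; ring
  · intro h
    filter_upwards [h, h1, h2] with ξ h3 h4 h5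
    rw [h4, h5] at h3
    have h6 : ((reg ε ξ : ℝ) : ℂ) ≠ 0 := Complex.ofReal_ne_zero.2 (reg_pos ε ξ).ne'
    refine mul_left_cancel₀ h6 ?_
    rw [h3]
    push_cast; ring

theorem hasGrad_schwartz (e : E3) (y : 𝓢(E3, ℂ)) :
    HasGrad e (y.toLp 2 volume) ((∂_{e} y).toLp 2 volume) := by
  rw [HasGrad, SchwartzMap.toLp_fourier_eq, SchwartzMap.toLp_fourier_eq]
  filter_upwards [(𝓕 (∂_{e} y)).coeFn_toLp 2 volume, (𝓕 y).coeFn_toLp 2 volume] with ξ h1 h2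
  have hi : (fun ξ : E3 => (inner ℝ ξ e : ℝ)).HasTemperateGrowth := by fun_prop
  rw [h1, h2, SchwartzMap.fourier_lineDerivOp_eq, _root_.smul_apply,
    SchwartzMap.smulLeftCLM_apply_apply hi, real_inner_comm]
  simp only [Complex.real_smul, smul_eq_mul]
  push_cast; ring

theorem HasGrad.of_tendsto {ι : Type*} {l : Filter ι} [l.NeBot] {e : E3} {f g : ι → L2} {f₀ g₀ : L2}
    (h : ∀ᶠ i in l, HasGrad e (f i) (g i)) (hf : Tendsto f l (𝓝 f₀)) (hg : Tendsto g l (𝓝 g₀)) :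
    HasGrad e f₀ g₀ := by
  rw [hasGrad_iff_reg one_pos]
  refine tendsto_nhds_unique (((regOp 1).continuous.tendsto g₀).comp hg) ?_
  have h1 := ((Complex.I • fourierMul (fun ξ => ((2 * Real.pi * inner ℝ e ξ * reg 1 ξ : ℝ) : ℂ)) :
    L2 →L[ℂ] L2).continuous.tendsto f₀).comp hf
  refine h1.congr' ?_
  filter_upwards [h] with i hi
  exact ((hasGrad_iff_reg one_pos).1 hi).symm

theorem HasGrad.sub {e : E3} {f g f' g' : L2} (h : HasGrad e f g) (h' : HasGrad e f' g') :
    HasGrad e (f - f') (g - g') := by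
  rw [hasGrad_iff_reg one_pos] at h h' ⊢
  rw [map_sub, h, h', map_sub, smul_sub]

theorem HasGrad.freeEvol {e : E3} {f g : L2} (h : HasGrad e f g) (t : ℝ) :
    HasGrad e (freeEvol t f) (freeEvol t g) := by
  rw [hasGrad_iff_reg one_pos] at h ⊢
  rw [freeEvol_eq, freeEvol_eq, regOp, fourierMul_comm (isBdd_reg 1) (isBdd_freeSymbol t),
    fourierMul_comm (isBdd_inner_mul_reg one_pos e) (isBdd_freeSymbol t)]
  rw [regOp] at h
  rw [h, map_smul]

/-- Schwartz functions are dense in the graph of `∂_e`. After applying the resolvent both components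
depend continuously on `f` in `L²`, so Schwartz approximations of `f` suffice; then `ε → 0`. -/
theorem HasGrad.induction {e : E3} {P : L2 → L2 → Prop}
    (hS : ∀ y : 𝓢(E3, ℂ), P (y.toLp 2 volume) ((∂_{e} y).toLp 2 volume))
    (hc : ∀ (f g : ℕ → L2) (f₀ g₀ : L2), (∀ n, P (f n) (g n)) → Tendsto f atTop (𝓝 f₀) →
      Tendsto g atTop (𝓝 g₀) → P f₀ g₀) {f g : L2} (h : HasGrad e f g) : P f g := by
  have hd : DenseRange (SchwartzMap.toLpCLM ℂ (E := E3) ℂ 2 volume) :=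
    SchwartzMap.denseRange_toLpCLM ENNReal.ofNat_ne_top
  have hseq : ∃ ζ : ℕ → 𝓢(E3, ℂ), Tendsto (fun n => ((ζ n).toLp 2 volume : L2)) atTop (𝓝 f) := by
    obtain ⟨u, hu, hlim⟩ := mem_closure_iff_seq_limit.1 (hd.closure_range ▸ mem_univ f)
    choose ζ hζ using hu
    exact ⟨ζ, hlim.congr fun n => (hζ n).symm⟩
  obtain ⟨ζ, hζ⟩ := hseq
  have h1 : ∀ ε : ℝ, 0 < ε → P (regOp ε f) (regOp ε g) := by
    intro ε hε
    choose y hy0 hy1 hy2 using fun n => exists_schwartz_reg hε (ζ n)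
    refine hc _ _ _ _ (fun n => hS (y n)) ?_ ?_
    · simp_rw [hy0]
      exact ((regOp ε).continuous.tendsto f).comp hζ
    · simp_rw [hy2]
      rw [(hasGrad_iff_reg hε).1 h]
      exact ((Complex.I • fourierMul (fun ξ => ((2 * Real.pi * inner ℝ e ξ * reg ε ξ : ℝ) : ℂ)) :
        L2 →L[ℂ] L2).continuous.tendsto f).comp hζ
  have h2 : Tendsto (fun n : ℕ => 1 / ((n : ℝ) + 1)) atTop (𝓝[>] 0) :=
    tendsto_nhdsWithin_iff.2 ⟨tendsto_one_div_add_atTop_nhds_zero_nat,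
      Eventually.of_forall fun n => by
        rw [mem_Ioi]; positivity⟩
  exact hc _ _ _ _ (fun n => h1 (1 / ((n : ℝ) + 1)) (by positivity)) ((tendsto_regOp f).comp h2)
    ((tendsto_regOp g).comp h2)

theorem HasGrad.inner_eq {e : E3} {f g : L2} (h : HasGrad e f g) (η : 𝓢(E3, ℂ)) :
    ⟪((∂_{e} η).toLp 2 volume : L2), f⟫_ℂ = -⟪(η.toLp 2 volume : L2), g⟫_ℂ := by
  have hη := hasGrad_schwartz e η
  rw [← Lp.inner_fourier_eq, ← Lp.inner_fourier_eq (η.toLp 2 volume : L2), L2_inner_def, L2_inner_def,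
    ← integral_neg]
  refine integral_congr_ae ?_
  filter_upwards [hη, h] with ξ h1 h2
  rw [h1, h2, map_mul, map_mul, Complex.conj_I, Complex.conj_ofReal]
  ring

theorem HasGrad.mul {e : E3} {q : E3 → ℂ} (hq : q.HasTemperateGrowth) (hb : IsBdd q)
    (hb' : IsBdd fun x => fderiv ℝ q x e) {f g : L2} (h : HasGrad e f g) :
    HasGrad e (mulOp q f) (mulOp q g + mulOp (fun x => fderiv ℝ q x e) f) := by
  refine HasGrad.induction (P := fun f g => HasGrad e (mulOp q f)
    (mulOp q g + mulOp (fun x => fderiv ℝ q x e) f)) (fun y => ?_) (fun f g f₀ g₀ hP hf hg => ?_) h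
  · have h1 := hasGrad_schwartz e (SchwartzMap.smulLeftCLM ℂ q y)
    rw [toLp_smulLeftCLM hq hb] at h1
    convert h1 using 1
    ext1
    filter_upwards [Lp.coeFn_add (mulOp q ((∂_{e} y).toLp 2 volume))
        (mulOp (fun x => fderiv ℝ q x e) (y.toLp 2 volume)), mulOp_coe hb ((∂_{e} y).toLp 2 volume),
      mulOp_coe hb' (y.toLp 2 volume), y.coeFn_toLp 2 volume, (∂_{e} y).coeFn_toLp 2 volume,
      (∂_{e} (SchwartzMap.smulLeftCLM ℂ q y)).coeFn_toLp 2 volume] with x a1 a2 a3 a4 a5 a6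
    rw [a1, Pi.add_apply, a2, a3, a4, a5, a6, SchwartzMap.lineDerivOp_apply_eq_fderiv,
      SchwartzMap.lineDerivOp_apply_eq_fderiv, SchwartzMap.smulLeftCLM_apply hq]
    have h2 := ((hq.1.differentiable (by simp) x).hasFDerivAt.smul (y.hasFDerivAt x)).fderiv
    change _ = fderiv ℝ (q • ⇑y) x e
    rw [h2]
    simp
  · exact HasGrad.of_tendsto (Eventually.of_forall hP) (((mulOp q).continuous.tendsto f₀).comp hf)
      ((((mulOp q).continuous.tendsto g₀).comp hg).add
        (((mulOp fun x => fderiv ℝ q x e).continuous.tendsto f₀).comp hf))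

/-! ### The Sobolev norm -/

theorem enorm_le_h1Norm (f : L2) : ‖f‖ₑ ≤ h1Norm f := by
  have h1 : ‖f‖ = ‖(𝓕 f : L2)‖ := (Lp.norm_fourier_eq f).symm
  rw [enorm_eq_iff_norm_eq.2 h1, Lp.enorm_def, h1Norm]
  refine eLpNorm_mono fun ξ => ?_
  rw [norm_mul, Complex.norm_real, Real.norm_of_nonneg (Real.sqrt_nonneg _)]
  refine le_mul_of_one_le_left (norm_nonneg _) ?_
  rw [Real.one_le_sqrt]
  linarith [sq_nonneg (2 * Real.pi * ‖ξ‖)]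

theorem norm_grad_symbol_le {e : E3} (he : ‖e‖ = 1) (ξ : E3) (z : ℂ) :
    ‖Complex.I * ((2 * Real.pi * inner ℝ e ξ : ℝ) : ℂ) * z‖ ≤
      ‖(Real.sqrt (1 + (2 * Real.pi * ‖ξ‖) ^ 2) : ℂ) * z‖ := by
  rw [norm_mul, norm_mul, norm_mul, Complex.norm_I, one_mul, Complex.norm_real, Complex.norm_real]
  refine mul_le_mul_of_nonneg_right ?_ (norm_nonneg _)
  rw [Real.norm_eq_abs, Real.norm_of_nonneg (Real.sqrt_nonneg _)]
  refine Real.abs_le_sqrt ?_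
  have h1 := abs_real_inner_le_norm e ξ
  rw [he, one_mul] at h1
  have h2 : (inner ℝ e ξ) ^ 2 ≤ ‖ξ‖ ^ 2 := sq_le_sq' (by linarith [(abs_le.1 h1).1]) (abs_le.1 h1).2
  have h3 := mul_le_mul_of_nonneg_left h2 (sq_nonneg (2 * Real.pi))
  nlinarith

theorem HasGrad.enorm_le {e : E3} (he : ‖e‖ = 1) {f g : L2} (h : HasGrad e f g) :
    ‖g‖ₑ ≤ h1Norm f := by
  have h1 : ‖g‖ = ‖(𝓕 g : L2)‖ := (Lp.norm_fourier_eq g).symm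
  rw [enorm_eq_iff_norm_eq.2 h1, Lp.enorm_def, h1Norm]
  refine eLpNorm_mono_ae ?_
  filter_upwards [h] with ξ hξ
  rw [hξ]
  exact norm_grad_symbol_le he ξ _

theorem exists_hasGrad {e : E3} (he : ‖e‖ = 1) {f : L2} (h : h1Norm f < ⊤) : ∃ g, HasGrad e f g := by
  have hm : AEStronglyMeasurable (fun ξ : E3 => Complex.I * ((2 * Real.pi * inner ℝ e ξ : ℝ) : ℂ) *
      (𝓕 f : L2) ξ) volume := by
    refine AEStronglyMeasurable.mul (Continuous.aestronglyMeasurable (by fun_prop)) ?_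
    exact Lp.aestronglyMeasurable _
  have hml : MemLp (fun ξ : E3 => Complex.I * ((2 * Real.pi * inner ℝ e ξ : ℝ) : ℂ) *
      (𝓕 f : L2) ξ) 2 volume :=
    ⟨hm, (eLpNorm_mono fun ξ => norm_grad_symbol_le he ξ _).trans_lt h⟩
  refine ⟨(𝓕⁻ (hml.toLp _) : L2), ?_⟩
  rw [HasGrad, FourierTransform.fourier_fourierInv_eq]
  exact hml.coeFn_toLp

/-- The standard basis vectors. -/
def bvec (i : Fin 3) : E3 := EuclideanSpace.single i 1

theorem norm_bvec (i : Fin 3) : ‖bvec i‖ = 1 := by simp [bvec]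

theorem h1Norm_le {f : L2} {g : Fin 3 → L2} (h : ∀ i, HasGrad (bvec i) f (g i)) :
    h1Norm f ≤ ‖f‖ₑ + ∑ i, ‖g i‖ₑ := by
  have e0 : ‖f‖ₑ = eLpNorm (fun ξ => ‖(𝓕 f : L2) ξ‖) 2 volume := by
    rw [enorm_eq_iff_norm_eq.2 (Lp.norm_fourier_eq f).symm, Lp.enorm_def, eLpNorm_norm]
  have e1 : ∀ i, ‖g i‖ₑ = eLpNorm (fun ξ => ‖(𝓕 (g i) : L2) ξ‖) 2 volume := fun i => by
    rw [enorm_eq_iff_norm_eq.2 (Lp.norm_fourier_eq (g i)).symm, Lp.enorm_def, eLpNorm_norm]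
  have m : ∀ z : L2, AEStronglyMeasurable (fun ξ => ‖z ξ‖) volume := fun z =>
    (Lp.aestronglyMeasurable z).norm
  rw [e0]
  simp_rw [e1]
  refine le_trans ?_ (add_le_add le_rfl (eLpNorm_sum_le (fun i _ => m _) one_le_two))
  refine le_trans ?_ (eLpNorm_add_le (m _) (Finset.aestronglyMeasurable_sum _ fun i _ => m _) one_le_two)
  refine eLpNorm_mono_ae ?_
  filter_upwards [h 0, h 1, h 2] with ξ h0 h1 h2
  simp only [Pi.add_apply, Fin.sum_univ_three, h0, h1, h2, norm_mul, Complex.norm_I,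
    one_mul, Complex.norm_real]
  have hin : ∀ i, inner ℝ (bvec i) ξ = ξ i := fun i => by
    simp [bvec, EuclideanSpace.inner_single_left]
  simp only [hin, Real.norm_eq_abs, abs_two, abs_of_pos Real.pi_pos]
  rw [abs_of_nonneg (Real.sqrt_nonneg _)]
  have hn : ‖ξ‖ ^ 2 = ξ 0 ^ 2 + ξ 1 ^ 2 + ξ 2 ^ 2 := by
    rw [EuclideanSpace.real_norm_sq_eq, Fin.sum_univ_three]
  set z := ‖(𝓕 f : L2) ξ‖ with hz
  have hz0 : 0 ≤ z := norm_nonneg _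
  have hs : Real.sqrt (1 + (2 * Real.pi * ‖ξ‖) ^ 2) ≤
      1 + (2 * Real.pi * |ξ 0| + 2 * Real.pi * |ξ 1| + 2 * Real.pi * |ξ 2|) := by
    refine Real.sqrt_le_iff.2 ⟨by positivity, ?_⟩
    have e2 : (2 * Real.pi * ‖ξ‖) ^ 2 = (2 * Real.pi * |ξ 0|) ^ 2 + (2 * Real.pi * |ξ 1|) ^ 2 +
        (2 * Real.pi * |ξ 2|) ^ 2 := by
      simp only [mul_pow, sq_abs, hn]; ring
    rw [e2]
    have p0 : 0 ≤ 2 * Real.pi * |ξ 0| := by positivity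
    have p1 : 0 ≤ 2 * Real.pi * |ξ 1| := by positivity
    have p2 : 0 ≤ 2 * Real.pi * |ξ 2| := by positivity
    nlinarith [mul_nonneg p0 p1, mul_nonneg p0 p2, mul_nonneg p1 p2]
  refine (mul_le_mul_of_nonneg_right hs hz0).trans (le_trans (le_of_eq ?_) (le_abs_self _))
  ring

/-- Lower semicontinuity: Fatou's lemma for the Fourier transforms along an almost everywhere
convergent subsequence. -/
theorem h1Norm_le_of_tendsto {f : ℕ → L2} {f₀ : L2} {K : ℝ≥0∞} (hf : Tendsto f atTop (𝓝 f₀))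
    (h : ∀ n, h1Norm (f n) ≤ K) : h1Norm f₀ ≤ K := by
  have h1 : Tendsto (fun n => (𝓕 (f n) : L2)) atTop (𝓝 (𝓕 f₀ : L2)) :=
    ((Lp.fourierTransformₗᵢ E3 ℂ).continuous.tendsto f₀).comp hf
  obtain ⟨ns, -, hns⟩ := (tendstoInMeasure_of_tendsto_Lp h1).exists_seq_tendsto_ae
  unfold h1Norm
  refine (Lp.eLpNorm_lim_le_liminf_eLpNorm (f := fun n (ξ : E3) =>
    (Real.sqrt (1 + (2 * Real.pi * ‖ξ‖) ^ 2) : ℂ) * (𝓕 (f (ns n)) : L2) ξ) (fun n => ?_) _ ?_).trans ?_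
  · refine AEStronglyMeasurable.mul (Continuous.aestronglyMeasurable (by fun_prop)) ?_
    exact Lp.aestronglyMeasurable _
  · filter_upwards [hns] with ξ hξ
    exact hξ.const_mul _
  · refine liminf_le_of_le (by isBoundedDefault) fun b hb => ?_
    obtain ⟨n, hn⟩ := hb.exists
    exact hn.trans (h (ns n))

/-! ### Radial cutoffs -/

theorem contDiff_radCut (F : SmoothCharFun) {R : ℝ} (hR : 0 < R) : ContDiff ℝ ∞ (radCut F R) := by
  refine Complex.ofRealCLM.contDiff.comp (contDiff_iff_contDiffAt.2 fun x => ?_)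
  rcases eq_or_ne x 0 with rfl | hx
  · have : (fun x : E3 => F (‖x‖ / R)) =ᶠ[𝓝 0] fun _ => 0 := by
      filter_upwards [Metric.ball_mem_nhds (0 : E3) (half_pos hR)] with x hx
      rw [mem_ball_zero_iff] at hx
      refine F.eq_zero _ ?_
      rw [div_le_iff₀ hR]; linarith
    exact contDiffAt_const.congr_of_eventuallyEq this
  · exact F.smooth.contDiffAt.comp x ((contDiffAt_norm ℝ hx).div_const R)

theorem hasCompactSupport_one_sub_radCut (F : SmoothCharFun) {R : ℝ} (hR : 0 < R) :
    HasCompactSupport fun x => 1 - radCut F R x := by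
  refine HasCompactSupport.of_support_subset_isCompact (isCompact_closedBall (0 : E3) R) fun x hx => ?_
  rw [mem_closedBall_zero_iff]
  by_contra! h
  refine hx ?_
  change 1 - radCut F R x = 0
  rw [radCut, F.eq_one _ (by rw [le_div_iff₀ hR]; linarith)]
  simp

theorem hasTemperateGrowth_radCut (F : SmoothCharFun) {R : ℝ} (hR : 0 < R) :
    (radCut F R).HasTemperateGrowth := by
  have h1 := (hasCompactSupport_one_sub_radCut F hR).hasTemperateGrowth
    (contDiff_const.sub (contDiff_radCut F hR))
  have h2 := (Function.HasTemperateGrowth.const (1 : ℂ) (E := E3)).sub h1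
  refine (funext fun x => ?_ : radCut F R = _) ▸ h2
  simp

theorem exists_fderiv_radCut_bound (F : SmoothCharFun) : ∃ K : ℝ, 0 ≤ K ∧ ∀ {R : ℝ}, 0 < R →
    ∀ {e : E3}, ‖e‖ = 1 → (IsBdd fun x => fderiv ℝ (radCut F R) x e) ∧
      ∀ x, ‖fderiv ℝ (radCut F R) x e‖ ≤ K / R := by
  have hc1 : Continuous (fderiv ℝ (radCut F 1)) := (contDiff_radCut F one_pos).continuous_fderiv (by simp)
  have hcs : HasCompactSupport (fderiv ℝ (radCut F 1)) := by
    have := (hasCompactSupport_one_sub_radCut F one_pos).fderiv (𝕜 := ℝ)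
    have h2 : fderiv ℝ (fun x => 1 - radCut F 1 x) = -fderiv ℝ (radCut F 1) := by
      funext x
      rw [fderiv_const_sub, Pi.neg_apply]
    rw [h2] at this
    simpa using this.neg
  obtain ⟨K, hK⟩ := hcs.exists_bound_of_continuous hc1
  refine ⟨K, (norm_nonneg _).trans (hK 0), fun {R} hR {e} he => ?_⟩
  have hform : ∀ x, fderiv ℝ (radCut F R) x e = R⁻¹ • fderiv ℝ (radCut F 1) (R⁻¹ • x) e := by
    intro x
    have h1 : radCut F R = fun x => radCut F 1 (R⁻¹ • x) := by
      funext x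
      rw [radCut, radCut, norm_smul, Real.norm_of_nonneg (by positivity), div_one, div_eq_inv_mul]
    rw [h1, fderiv_comp_smul]
    rfl
  have hb : ∀ x, ‖fderiv ℝ (radCut F R) x e‖ ≤ K / R := fun x => by
    rw [hform, norm_smul, norm_inv, Real.norm_of_nonneg hR.le, div_eq_inv_mul]
    refine mul_le_mul_of_nonneg_left ?_ (by positivity)
    refine ((fderiv ℝ (radCut F 1) (R⁻¹ • x)).le_opNorm e).trans ?_
    rw [he, mul_one]
    exact hK _
  refine ⟨IsBdd.of_continuous ?_ hb, hb⟩
  exact ((contDiff_radCut F hR).continuous_fderiv (by simp)).clm_apply continuous_const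

/-! ### The weak chain rule -/

/-- The derivative of `‖x‖` in the direction `e`. -/
def normDeriv (e x : E3) : ℝ := fderiv ℝ (fun x : E3 => ‖x‖) x e

theorem abs_normDeriv_le {e : E3} (he : ‖e‖ = 1) (x : E3) : |normDeriv e x| ≤ 1 := by
  have h1 : ‖fderiv ℝ (fun x : E3 => ‖x‖) x‖ ≤ ((1 : NNReal) : ℝ) :=
    norm_fderiv_le_of_lipschitz ℝ lipschitzWith_one_norm
  have h2 := (fderiv ℝ (fun x : E3 => ‖x‖) x).le_opNorm e
  rw [he, mul_one] at h2
  exact h2.trans (by simpa using h1)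

theorem measurable_normDeriv (e : E3) : Measurable (normDeriv e) :=
  measurable_fderiv_apply_const ℝ _ e

section Chain

variable {K : ℂ × ℝ → ℂ}

theorem aestronglyMeasurable_chain_deriv (hK : ContDiff ℝ 1 K) (e : E3) {f g : E3 → ℂ}
    (hf : AEStronglyMeasurable f volume) (hg : AEStronglyMeasurable g volume) :
    AEStronglyMeasurable (fun x => fderiv ℝ K (f x, ‖x‖) (g x, normDeriv e x)) volume := by
  have h1 : Continuous fun p : (ℂ × ℝ) × (ℂ × ℝ) => fderiv ℝ K p.1 p.2 :=
    ((hK.continuous_fderiv (by simp)).comp continuous_fst).clm_apply continuous_snd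
  exact h1.comp_aestronglyMeasurable ((hf.prodMk continuous_norm.aestronglyMeasurable).prodMk
    (hg.prodMk (measurable_normDeriv e).aestronglyMeasurable))

theorem norm_chain_deriv_le {B : ℝ} (hB : ∀ p, ‖fderiv ℝ K p‖ ≤ B) {e : E3} (he : ‖e‖ = 1) (p : ℂ × ℝ)
    (w : ℂ) (x : E3) : ‖fderiv ℝ K p (w, normDeriv e x)‖ ≤ B * (‖w‖ + 1) := by
  refine ((fderiv ℝ K p).le_opNorm _).trans ?_
  refine mul_le_mul (hB p) ?_ (norm_nonneg _) ((norm_nonneg _).trans (hB p))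
  rw [Prod.norm_def]
  refine max_le (by linarith [norm_nonneg w]) ?_
  have := abs_normDeriv_le he x
  rw [Real.norm_eq_abs]
  linarith [norm_nonneg w]

theorem integrable_coe_mul_schwartz (g : L2) (η : 𝓢(E3, ℂ)) :
    Integrable (fun x => ‖g x‖ * ‖η x‖) volume := by
  refine (integrable_norm_mul g (η.toLp 2 volume)).congr ?_
  filter_upwards [η.coeFn_toLp 2 volume] with x hx
  rw [hx]

theorem integral_coe_mul_schwartz_le (g : L2) (η : 𝓢(E3, ℂ)) :
    ∫ x, ‖g x‖ * ‖η x‖ ≤ ‖g‖ * ‖(η.toLp 2 volume : L2)‖ := by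
  refine le_trans (le_of_eq ?_) (integral_norm_mul_le g (η.toLp 2 volume))
  refine integral_congr_ae ?_
  filter_upwards [η.coeFn_toLp 2 volume] with x hx
  rw [hx]

/-- Vanishing of `K` for small radii hides the point `x = 0`, where `‖x‖` is not differentiable.
There both sides of the chain rule are zero. -/
theorem integral_chain_schwartz (hK : ContDiff ℝ 1 K) {B : ℝ} (hB : ∀ p, ‖K p‖ ≤ B)
    (hB' : ∀ p, ‖fderiv ℝ K p‖ ≤ B) {ρ : ℝ} (hρ : 0 < ρ) (h0 : ∀ z r, r < ρ → K (z, r) = 0)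
    {e : E3} (he : ‖e‖ = 1) (y η : 𝓢(E3, ℂ)) :
    ∫ x, K (y x, ‖x‖) * (∂_{e} η) x =
      -∫ x, fderiv ℝ K (y x, ‖x‖) ((∂_{e} y) x, normDeriv e x) * η x := by
  have hKd : Differentiable ℝ K := hK.differentiable (by simp)
  have hkc : Continuous fun x => K (y x, ‖x‖) := hK.continuous.comp (y.continuous.prodMk continuous_norm)
  have hline : ∀ x, HasLineDerivAt ℝ (fun x => K (y x, ‖x‖))
      (fderiv ℝ K (y x, ‖x‖) ((∂_{e} y) x, normDeriv e x)) x e := by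
    intro x
    rcases eq_or_ne x 0 with rfl | hx
    · have h1 : (fun x => K (y x, ‖x‖)) =ᶠ[𝓝 0] fun _ => 0 := by
        filter_upwards [Metric.ball_mem_nhds (0 : E3) hρ] with x hx
        exact h0 _ _ (mem_ball_zero_iff.1 hx)
      have h2 : K =ᶠ[𝓝 (y 0, ‖(0 : E3)‖)] fun _ => 0 := by
        have : {p : ℂ × ℝ | p.2 < ρ} ∈ 𝓝 (y 0, ‖(0 : E3)‖) :=
          (isOpen_lt continuous_snd continuous_const).mem_nhds (by simpa using hρ)
        filter_upwards [this] with p hp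
        exact h0 p.1 p.2 hp
      rw [h2.fderiv_eq, fderiv_fun_const]
      have h3 := (hasFDerivAt_const (0 : ℂ) (0 : E3) (𝕜 := ℝ)).congr_of_eventuallyEq h1
      simpa using h3.hasLineDerivAt e
    · have h1 : DifferentiableAt ℝ (fun x : E3 => ‖x‖) x := (contDiffAt_norm ℝ hx (n := 1)).differentiableAt
        (by simp)
      exact ((hKd _).hasFDerivAt.comp x ((y.hasFDerivAt x).prodMk h1.hasFDerivAt)).hasLineDerivAt e
  have hmeas := aestronglyMeasurable_chain_deriv hK e (f := y) (g := fun x => (∂_{e} y) x)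
    y.continuous.aestronglyMeasurable (∂_{e} y).continuous.aestronglyMeasurable
  refine integral_bilinear_hasLineDerivAt_right_eq_neg_left_of_integrable
    (B := ContinuousLinearMap.mul ℝ ℂ) (v := e) ?_ ?_ ?_ (fun x _ => hline x)
    (fun x _ => (η.hasFDerivAt x).hasLineDerivAt e)
  · have hb : Integrable (fun x => B * ((SchwartzMap.seminorm ℝ 0 0 (∂_{e} y)) + 1) * ‖η x‖) volume :=
      (η.integrable (μ := volume)).norm.const_mul _
    refine hb.mono' (hmeas.mul η.continuous.aestronglyMeasurable) (Eventually.of_forall fun x => ?_)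
    rw [ContinuousLinearMap.mul_apply', norm_mul]
    refine mul_le_mul_of_nonneg_right ((norm_chain_deriv_le hB' he _ _ _).trans ?_) (norm_nonneg _)
    refine mul_le_mul_of_nonneg_left ?_ ((norm_nonneg _).trans (hB 0))
    have := SchwartzMap.norm_le_seminorm ℝ (∂_{e} y) x
    linarith
  · refine ((∂_{e} η).integrable (μ := volume)).norm.const_mul B |>.mono'
      (hkc.aestronglyMeasurable.mul (∂_{e} η).continuous.aestronglyMeasurable)
      (Eventually.of_forall fun x => ?_)
    refine (norm_mul_le _ _).trans ?_
    exact mul_le_mul_of_nonneg_right (hB _) (norm_nonneg _)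
  · refine (η.integrable (μ := volume)).norm.const_mul B |>.mono'
      (hkc.aestronglyMeasurable.mul η.continuous.aestronglyMeasurable)
      (Eventually.of_forall fun x => ?_)
    refine (norm_mul_le _ _).trans ?_
    exact mul_le_mul_of_nonneg_right (hB _) (norm_nonneg _)

/-- The Schwartz case passes to the limit because the derivative of `K` is bounded and continuous.
The limit is taken along an almost everywhere convergent subsequence of `f`. -/
theorem HasGrad.integral_chain (hK : ContDiff ℝ 1 K) {B : ℝ} (hB : ∀ p, ‖K p‖ ≤ B)
    (hB' : ∀ p, ‖fderiv ℝ K p‖ ≤ B) {ρ : ℝ} (hρ : 0 < ρ) (h0 : ∀ z r, r < ρ → K (z, r) = 0)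
    {e : E3} (he : ‖e‖ = 1) {f g : L2} (h : HasGrad e f g) (η : 𝓢(E3, ℂ)) :
    ∫ x, K (f x, ‖x‖) * (∂_{e} η) x =
      -∫ x, fderiv ℝ K (f x, ‖x‖) (g x, normDeriv e x) * η x := by
  have hB0 : 0 ≤ B := (norm_nonneg _).trans (hB 0)
  have hDc : Continuous (fderiv ℝ K) := hK.continuous_fderiv (by simp)
  refine HasGrad.induction (P := fun f g => ∫ x, K (f x, ‖x‖) * (∂_{e} η) x =
    -∫ x, fderiv ℝ K (f x, ‖x‖) (g x, normDeriv e x) * η x) (fun y => ?_) ?_ h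
  · have := integral_chain_schwartz hK hB hB' hρ h0 he y η
    have a1 : ∫ x, K ((y.toLp 2 volume : L2) x, ‖x‖) * (∂_{e} η) x =
        ∫ x, K (y x, ‖x‖) * (∂_{e} η) x := by
      refine integral_congr_ae ?_
      filter_upwards [y.coeFn_toLp 2 volume] with x hx
      rw [hx]
    have a2 : ∫ x, fderiv ℝ K ((y.toLp 2 volume : L2) x, ‖x‖)
          (((∂_{e} y).toLp 2 volume : L2) x, normDeriv e x) * η x =
        ∫ x, fderiv ℝ K (y x, ‖x‖) ((∂_{e} y) x, normDeriv e x) * η x := by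
      refine integral_congr_ae ?_
      filter_upwards [y.coeFn_toLp 2 volume, (∂_{e} y).coeFn_toLp 2 volume] with x hx hx'
      rw [hx, hx']
    rw [a1, a2, this]
  · intro f g f₀ g₀ hP hf hg
    obtain ⟨ns, hns, hae⟩ := (tendstoInMeasure_of_tendsto_Lp hf).exists_seq_tendsto_ae
    have mf : ∀ f : L2, AEStronglyMeasurable f volume := fun f => Lp.aestronglyMeasurable f
    have L : Tendsto (fun k => ∫ x, K (f (ns k) x, ‖x‖) * (∂_{e} η) x) atTop
        (𝓝 (∫ x, K (f₀ x, ‖x‖) * (∂_{e} η) x)) := by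
      refine tendsto_integral_of_dominated_convergence (fun x => B * ‖(∂_{e} η) x‖) (fun k => ?_)
        (((∂_{e} η).integrable (μ := volume)).norm.const_mul B) (fun k => Eventually.of_forall fun x => ?_) ?_
      · exact (hK.continuous.comp_aestronglyMeasurable
          ((mf _).prodMk continuous_norm.aestronglyMeasurable)).mul
          (∂_{e} η).continuous.aestronglyMeasurable
      · rw [norm_mul]
        exact mul_le_mul_of_nonneg_right (hB _) (norm_nonneg _)
      · filter_upwards [hae] with x hx
        exact ((hK.continuous.tendsto _).comp (hx.prodMk_nhds tendsto_const_nhds)).mul_const _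
    have hbound : ∀ g : L2, Integrable (fun x => B * (‖g x‖ + 1) * ‖η x‖) volume := fun g => by
      have := ((integrable_coe_mul_schwartz g η).add ((η.integrable (μ := volume)).norm)).const_mul B
      refine this.congr (Eventually.of_forall fun x => ?_)
      simp only [Pi.add_apply]; ring
    have hmeas : ∀ f g : L2, AEStronglyMeasurable
        (fun x => fderiv ℝ K (f x, ‖x‖) (g x, normDeriv e x) * η x) volume := fun f g =>
      (aestronglyMeasurable_chain_deriv hK e (mf f) (mf g)).mul η.continuous.aestronglyMeasurable
    have hle : ∀ (f g : L2) x, ‖fderiv ℝ K (f x, ‖x‖) (g x, normDeriv e x) * η x‖ ≤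
        B * (‖g x‖ + 1) * ‖η x‖ := fun f g x => by
      rw [norm_mul]
      exact mul_le_mul_of_nonneg_right (norm_chain_deriv_le hB' he _ _ _) (norm_nonneg _)
    have hint : ∀ f g : L2, Integrable
        (fun x => fderiv ℝ K (f x, ‖x‖) (g x, normDeriv e x) * η x) volume := fun f g =>
      (hbound g).mono' (hmeas f g) (Eventually.of_forall (hle f g))
    have R1 : Tendsto (fun k => ∫ x, fderiv ℝ K (f (ns k) x, ‖x‖) (g₀ x, normDeriv e x) * η x) atTop
        (𝓝 (∫ x, fderiv ℝ K (f₀ x, ‖x‖) (g₀ x, normDeriv e x) * η x)) := by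
      refine tendsto_integral_of_dominated_convergence (fun x => B * (‖g₀ x‖ + 1) * ‖η x‖)
        (fun k => hmeas _ _) (hbound g₀) (fun k => Eventually.of_forall (hle _ _)) ?_
      filter_upwards [hae] with x hx
      have h1 : Tendsto (fun k => fderiv ℝ K (f (ns k) x, ‖x‖)) atTop
          (𝓝 (fderiv ℝ K (f₀ x, ‖x‖))) :=
        (hDc.tendsto _).comp (hx.prodMk_nhds (tendsto_const_nhds (x := ‖x‖)))
      exact (((ContinuousLinearMap.apply ℝ ℂ (g₀ x, normDeriv e x)).continuous.tendsto _).comp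
        h1).mul_const _
    -- The two arguments are treated separately: `g` is replaced by its limit using only `L²`
    -- convergence and the bound on the derivative, after which the dependence on `f` is handled by
    -- dominated convergence.
    have R2 : Tendsto (fun k => (∫ x, fderiv ℝ K (f (ns k) x, ‖x‖) (g (ns k) x, normDeriv e x) * η x) -
        ∫ x, fderiv ℝ K (f (ns k) x, ‖x‖) (g₀ x, normDeriv e x) * η x) atTop (𝓝 0) := by
      have h1 : Tendsto (fun k => B * (‖g (ns k) - g₀‖ * ‖(η.toLp 2 volume : L2)‖)) atTop (𝓝 0) := by
        have h2 := (tendsto_iff_norm_sub_tendsto_zero.1 (hg.comp hns.tendsto_atTop))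
        have h3 := (h2.mul_const ‖(η.toLp 2 volume : L2)‖).const_mul B
        rwa [zero_mul, mul_zero] at h3
      refine squeeze_zero_norm (fun k => ?_) h1
      rw [← integral_sub (hint _ _) (hint _ _)]
      have h4 : ∫ x, B * (‖(g (ns k) - g₀ : L2) x‖ * ‖η x‖) ≤
          B * (‖g (ns k) - g₀‖ * ‖(η.toLp 2 volume : L2)‖) := by
        rw [integral_const_mul]
        exact mul_le_mul_of_nonneg_left (integral_coe_mul_schwartz_le _ η) hB0
      refine le_trans (norm_integral_le_of_norm_le
        ((integrable_coe_mul_schwartz (g (ns k) - g₀) η).const_mul B) ?_) h4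
      filter_upwards [Lp.coeFn_sub (g (ns k)) g₀] with x hx
      rw [← sub_mul, ← map_sub, Prod.mk_sub_mk, sub_self, hx, Pi.sub_apply, norm_mul, ← mul_assoc]
      refine mul_le_mul_of_nonneg_right ?_ (norm_nonneg _)
      refine ((fderiv ℝ K _).le_opNorm _).trans ?_
      refine mul_le_mul (hB' _) ?_ (norm_nonneg _) hB0
      rw [Prod.norm_def, norm_zero]
      exact max_le le_rfl (norm_nonneg _)
    have R3 := R2.add R1
    simp only [sub_add_cancel, zero_add] at R3
    refine tendsto_nhds_unique L ?_
    simp_rw [hP]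
    exact R3.neg

end Chain

/-! ### Truncated nonlinearities -/

/-- The nonlinearity `κ(r) λ(|z|) N(|z|, r) z`. -/
def truncNL (N : ℝ × ℝ → ℂ) (κ l : ℝ → ℝ) (p : ℂ × ℝ) : ℂ :=
  ((κ p.2 : ℝ) : ℂ) * (((l ‖p.1‖ : ℝ) : ℂ) * N (‖p.1‖, p.2) * p.1)

section Trunc

variable {N : ℝ × ℝ → ℂ} {κ l : ℝ → ℝ} {ρ₀ ρ₁ : ℝ}

theorem truncNL_eventually_zero {b : ℝ} (hb : 0 < b) (hl : ∀ y ≤ b, l y = 0) (r : ℝ) :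
    truncNL N κ l =ᶠ[𝓝 ((0 : ℂ), r)] fun _ => 0 := by
  have : {p : ℂ × ℝ | ‖p.1‖ < b} ∈ 𝓝 ((0 : ℂ), r) :=
    (isOpen_lt (continuous_fst.norm) continuous_const).mem_nhds (by simpa using hb)
  filter_upwards [this] with p hp
  rw [truncNL, hl _ (le_of_lt hp)]
  simp

/-- Differentiability of `N` is known only for positive modulus and radius beyond `ρ₀`; the
truncations vanish near the two places where it could fail, `z = 0` and small `r`. -/
theorem contDiff_truncNL (hN : ContDiffOn ℝ 1 N (Ioi 0 ×ˢ Ioi ρ₀)) (hρ : ρ₀ < ρ₁)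
    (hκ : ContDiff ℝ ∞ κ) (hκ0 : ∀ r ≤ ρ₁, κ r = 0) (hl : ContDiff ℝ ∞ l) {b : ℝ} (hb : 0 < b)
    (hl0 : ∀ y ≤ b, l y = 0) : ContDiff ℝ 1 (truncNL N κ l) := by
  refine contDiff_iff_contDiffAt.2 fun ⟨z, r⟩ => ?_
  rcases eq_or_ne z 0 with rfl | hz
  · exact contDiffAt_const.congr_of_eventuallyEq (truncNL_eventually_zero hb hl0 r)
  rcases lt_or_ge r ρ₁ with hr | hr
  · have : {p : ℂ × ℝ | p.2 < ρ₁} ∈ 𝓝 (z, r) :=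
      (isOpen_lt continuous_snd continuous_const).mem_nhds hr
    refine contDiffAt_const (c := (0 : ℂ)) |>.congr_of_eventuallyEq ?_
    filter_upwards [this] with p hp
    rw [truncNL, hκ0 _ (le_of_lt hp)]
    simp
  have h1 : ContDiffAt ℝ 1 (fun p : ℂ × ℝ => ‖p.1‖) (z, r) :=
    ContDiffAt.norm ℝ contDiffAt_fst hz
  have h2 : ContDiffAt ℝ 1 N (‖z‖, r) := hN.contDiffAt ((isOpen_Ioi.prod isOpen_Ioi).mem_nhds
    ⟨norm_pos_iff.2 hz, hρ.trans_le hr⟩)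
  have h3 : ContDiffAt ℝ 1 (fun p : ℂ × ℝ => N (‖p.1‖, p.2)) (z, r) :=
    ContDiffAt.comp (f := fun p : ℂ × ℝ => (‖p.1‖, p.2)) (z, r) h2 (h1.prodMk contDiffAt_snd)
  have hκ1 : ContDiff ℝ 1 κ := hκ.of_le (by exact_mod_cast le_top)
  have hl1 : ContDiff ℝ 1 l := hl.of_le (by exact_mod_cast le_top)
  have h4 : ContDiffAt ℝ 1 (fun p : ℂ × ℝ => ((κ p.2 : ℝ) : ℂ)) (z, r) :=
    Complex.ofRealCLM.contDiff.contDiffAt.comp (z, r) (hκ1.contDiffAt.comp (z, r) contDiffAt_snd)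
  have h5 : ContDiffAt ℝ 1 (fun p : ℂ × ℝ => ((l ‖p.1‖ : ℝ) : ℂ)) (z, r) :=
    Complex.ofRealCLM.contDiff.contDiffAt.comp (z, r) (hl1.contDiffAt.comp (z, r) h1)
  exact h4.mul ((h5.mul h3).mul contDiffAt_fst)

theorem hasCompactSupport_truncNL {R B : ℝ} (hκ0 : ∀ r ≤ ρ₁, κ r = 0) (hκR : ∀ r, R ≤ r → κ r = 0)
    (hlB : ∀ y, B ≤ y → l y = 0) : HasCompactSupport (truncNL N κ l) := by
  refine HasCompactSupport.of_support_subset_isCompact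
    ((isCompact_closedBall (0 : ℂ) B).prod (isCompact_Icc (a := ρ₁) (b := R))) fun p hp => ?_
  refine ⟨?_, ?_, ?_⟩
  · rw [mem_closedBall_zero_iff]
    by_contra! h
    exact hp (by rw [truncNL, hlB _ h.le]; simp)
  · by_contra! h
    exact hp (by rw [truncNL, hκ0 _ h.le]; simp)
  · by_contra! h
    exact hp (by rw [truncNL, hκR _ h.le]; simp)

/-- The truncation enters only through `|l| ≤ 1` and `|y l'(y)| ≤ D`, both insensitive to scale. The
modulus derivative of `N` appears multiplied by `|z|`, which is precisely the quantity controlled by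
the regularity hypothesis. -/
theorem norm_fderiv_truncNL_le (hN : ContDiffOn ℝ 1 N (Ioi 0 ×ˢ Ioi ρ₀)) (hρ : ρ₀ < ρ₁)
    (hκ : ContDiff ℝ ∞ κ) (hκ0 : ∀ r ≤ ρ₁, κ r = 0) (hl : ContDiff ℝ ∞ l) {b : ℝ} (hb : 0 < b)
    (hl0 : ∀ y ≤ b, l y = 0) (hl1 : ∀ y, |l y| ≤ 1) {D : ℝ} (hD : ∀ y, |y * deriv l y| ≤ D)
    {z : ℂ} {r : ℝ} (hr : ρ₀ < r) (hκ1 : κ =ᶠ[𝓝 r] fun _ => 1) (w : ℂ) {s : ℝ} (hs : |s| ≤ 1)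
    {a c : ℝ} (ha : ‖N (‖z‖, r)‖ ≤ a)
    (hc : ‖z‖ * ‖deriv (fun s => N (s, r)) ‖z‖‖ + ‖deriv (fun r => N (‖z‖, r)) r‖ ≤ c) :
    ‖fderiv ℝ (truncNL N κ l) (z, r) (w, s)‖ ≤ ((D + 1) * a + c) * ‖w‖ + c * ‖z‖ := by
  have hD0 : 0 ≤ D := (abs_nonneg _).trans (hD 0)
  have ha0 : 0 ≤ a := (norm_nonneg _).trans ha
  have hc0 : 0 ≤ c := le_trans (by positivity) hc
  rcases eq_or_ne z 0 with rfl | hz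
  · rw [(truncNL_eventually_zero hb hl0 r).fderiv_eq]
    have h0 : fderiv ℝ (fun _ : ℂ × ℝ => (0 : ℂ)) (0, r) (w, s) = 0 := by simp
    rw [h0, norm_zero]
    positivity
  have hz0 : 0 < ‖z‖ := norm_pos_iff.2 hz
  have hKd : DifferentiableAt ℝ (truncNL N κ l) (z, r) :=
    (contDiff_truncNL hN hρ hκ hκ0 hl hb hl0).differentiable (by simp) _
  have hNd : DifferentiableAt ℝ N (‖z‖, r) := (hN.contDiffAt ((isOpen_Ioi.prod isOpen_Ioi).mem_nhds
    (show (‖z‖, r) ∈ Ioi 0 ×ˢ Ioi ρ₀ from ⟨hz0, hr⟩))).differentiableAt (by simp)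
  set n1 := deriv (fun s => N (s, r)) ‖z‖ with hn1
  set n2 := deriv (fun r => N (‖z‖, r)) r with hn2
  have hκr : κ r = 1 := hκ1.self_of_nhds
  have dN1 : HasDerivAt (fun s => N (s, r)) n1 ‖z‖ := by
    have : DifferentiableAt ℝ (fun s => N (s, r)) ‖z‖ :=
      DifferentiableAt.comp (g := N) (f := fun s => (s, r)) ‖z‖ hNd (by fun_prop)
    exact this.hasDerivAt
  have dN2 : HasDerivAt (fun r => N (‖z‖, r)) n2 r := by
    have : DifferentiableAt ℝ (fun r => N (‖z‖, r)) r :=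
      DifferentiableAt.comp (g := N) (f := fun r => (‖z‖, r)) r hNd (by fun_prop)
    exact this.hasDerivAt
  -- the derivative in `r`
  have e2 : fderiv ℝ (truncNL N κ l) (z, r) (0, 1) = ((l ‖z‖ : ℝ) : ℂ) * n2 * z := by
    have h1 : HasDerivAt (fun r' : ℝ => (z, r')) ((0 : ℂ), (1 : ℝ)) r :=
      (hasDerivAt_const r z).prodMk (hasDerivAt_id r)
    have h2 := hKd.hasFDerivAt.comp_hasDerivAt (f := fun r' : ℝ => (z, r')) r h1
    have h3 : HasDerivAt (fun r' => ((l ‖z‖ : ℝ) : ℂ) * N (‖z‖, r') * z) (((l ‖z‖ : ℝ) : ℂ) * n2 * z) r :=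
      (dN2.const_mul _).mul_const z
    refine h2.unique (h3.congr_of_eventuallyEq ?_)
    filter_upwards [hκ1] with r' hr'
    simp only [Function.comp, truncNL, hr', Complex.ofReal_one, one_mul]
  -- the derivative in `z`
  set P : ℂ →L[ℝ] ℝ := fderiv ℝ (fun z : ℂ => ‖z‖) z with hP
  have e1 : fderiv ℝ (truncNL N κ l) (z, r) (w, 0) =
      (((l ‖z‖ : ℝ) : ℂ) * N (‖z‖, r)) * w +
        (P w : ℂ) * (((deriv l ‖z‖ : ℝ) : ℂ) * N (‖z‖, r) + ((l ‖z‖ : ℝ) : ℂ) * n1) * z := by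
    have h1 : HasFDerivAt (fun z' : ℂ => (z', r)) (ContinuousLinearMap.inl ℝ ℂ ℝ) z := by
      have := (hasFDerivAt_id (𝕜 := ℝ) z).prodMk (hasFDerivAt_const r z)
      exact this
    have h2 := hKd.hasFDerivAt.comp (f := fun z' : ℂ => (z', r)) z h1
    have h3 : HasDerivAt (fun s => ((l s : ℝ) : ℂ) * N (s, r))
        (((deriv l ‖z‖ : ℝ) : ℂ) * N (‖z‖, r) + ((l ‖z‖ : ℝ) : ℂ) * n1) ‖z‖ :=
      ((hl.differentiable (by simp) _).hasDerivAt.ofReal_comp).mul dN1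
    have h4 : HasFDerivAt (fun z : ℂ => ‖z‖) P z :=
      ((contDiffAt_norm ℝ hz (n := 1)).differentiableAt (by simp)).hasFDerivAt
    have h5 := h3.hasFDerivAt.comp z h4
    have h6 := h5.mul (hasFDerivAt_id (𝕜 := ℝ) z)
    have h6' : (truncNL N κ l ∘ fun z' : ℂ => (z', r)) =
        (fun s : ℝ => ((l s : ℝ) : ℂ) * N (s, r)) ∘ norm * id := by
      funext z'
      simp only [Function.comp, truncNL, hκr, Complex.ofReal_one, one_mul, Pi.mul_apply, id]
    rw [← h6'] at h6
    have h7 := h2.unique h6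
    have h8 := congrArg (fun T : ℂ →L[ℝ] ℂ => T w) h7
    simp only [ContinuousLinearMap.comp_apply, ContinuousLinearMap.inl_apply] at h8
    rw [h8]
    simp
    ring
  have split : fderiv ℝ (truncNL N κ l) (z, r) (w, s) =
      fderiv ℝ (truncNL N κ l) (z, r) (w, 0) + (s : ℂ) * fderiv ℝ (truncNL N κ l) (z, r) (0, 1) := by
    rw [← Complex.real_smul, ← map_smul, ← map_add]
    simp
  have hPw : |P w| ≤ ‖w‖ := by
    have h1 : ‖P‖ ≤ ((1 : NNReal) : ℝ) := norm_fderiv_le_of_lipschitz ℝ lipschitzWith_one_norm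
    have h2 := P.le_opNorm w
    rw [NNReal.coe_one] at h1
    exact h2.trans (mul_le_of_le_one_left (norm_nonneg _) h1)
  have q1 : ‖(((l ‖z‖ : ℝ) : ℂ) * N (‖z‖, r)) * w‖ ≤ a * ‖w‖ := by
    rw [norm_mul, norm_mul, Complex.norm_real, Real.norm_eq_abs]
    refine mul_le_mul_of_nonneg_right ?_ (norm_nonneg _)
    calc |l ‖z‖| * ‖N (‖z‖, r)‖ ≤ 1 * a := by
          gcongr
          exact hl1 _
      _ = a := one_mul a
  have q2 : ‖(P w : ℂ) * (((deriv l ‖z‖ : ℝ) : ℂ) * N (‖z‖, r) + ((l ‖z‖ : ℝ) : ℂ) * n1) * z‖ ≤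
      ‖w‖ * (D * a + ‖z‖ * ‖n1‖) := by
    have h1 := hD ‖z‖
    rw [abs_mul, abs_norm] at h1
    have h2 : ‖((deriv l ‖z‖ : ℝ) : ℂ) * N (‖z‖, r) + ((l ‖z‖ : ℝ) : ℂ) * n1‖ * ‖z‖ ≤
        D * a + ‖z‖ * ‖n1‖ := by
      have h3 : ‖((deriv l ‖z‖ : ℝ) : ℂ) * N (‖z‖, r) + ((l ‖z‖ : ℝ) : ℂ) * n1‖ ≤
          |deriv l ‖z‖| * ‖N (‖z‖, r)‖ + |l ‖z‖| * ‖n1‖ := by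
        refine (norm_add_le _ _).trans (le_of_eq ?_)
        rw [norm_mul, norm_mul, Complex.norm_real, Complex.norm_real, Real.norm_eq_abs, Real.norm_eq_abs]
      calc _ ≤ (|deriv l ‖z‖| * ‖N (‖z‖, r)‖ + |l ‖z‖| * ‖n1‖) * ‖z‖ := by gcongr
        _ = (‖z‖ * |deriv l ‖z‖|) * ‖N (‖z‖, r)‖ + |l ‖z‖| * (‖z‖ * ‖n1‖) := by ring
        _ ≤ D * a + 1 * (‖z‖ * ‖n1‖) := by
          gcongr
          exact hl1 _
        _ = _ := by ring
    rw [norm_mul, norm_mul, Complex.norm_real, Real.norm_eq_abs, mul_assoc]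
    gcongr
  have q3 : ‖(s : ℂ) * (((l ‖z‖ : ℝ) : ℂ) * n2 * z)‖ ≤ ‖n2‖ * ‖z‖ := by
    rw [norm_mul, norm_mul, norm_mul, Complex.norm_real, Complex.norm_real, Real.norm_eq_abs,
      Real.norm_eq_abs]
    calc |s| * (|l ‖z‖| * ‖n2‖ * ‖z‖) ≤ 1 * (1 * ‖n2‖ * ‖z‖) := by
          gcongr
          exact hl1 _
      _ = _ := by ring
  rw [split, e1, e2]
  refine (norm_add_le _ _).trans ?_
  have q4 := norm_add_le ((((l ‖z‖ : ℝ) : ℂ) * N (‖z‖, r)) * w)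
    ((P w : ℂ) * (((deriv l ‖z‖ : ℝ) : ℂ) * N (‖z‖, r) + ((l ‖z‖ : ℝ) : ℂ) * n1) * z)
  have p1 : ‖z‖ * ‖n1‖ ≤ c := by linarith [norm_nonneg n2]
  have p2 : ‖n2‖ ≤ c := by linarith [mul_nonneg hz0.le (norm_nonneg n1)]
  have p3 := mul_le_mul_of_nonneg_left p1 (norm_nonneg w)
  have p4 := mul_le_mul_of_nonneg_right p2 hz0.le
  nlinarith

end Trunc

/-! ### The gradient of the nonlinearity in the weak sense -/

/-- One step is rescaled to cut near zero and near infinity. Since `y E'(y)` keeps its supremum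
under dilation, the bound `D` does not depend on `n`. -/
theorem exists_truncations : ∃ D : ℝ, 0 ≤ D ∧ ∃ l : ℕ → ℝ → ℝ, ∀ n, ContDiff ℝ ∞ (l n) ∧
    (∀ y ≤ 1 / ((n : ℝ) + 1), l n y = 0) ∧ (∀ y, 2 * ((n : ℝ) + 1) ≤ y → l n y = 0) ∧
    (∀ y, 2 / ((n : ℝ) + 1) ≤ y → y ≤ (n : ℝ) + 1 → l n y = 1) ∧ (∀ y, |l n y| ≤ 1) ∧
    ∀ y, |y * deriv (l n) y| ≤ D := by
  obtain ⟨E, hE, hE0, hE1, hEp, hEl⟩ := exists_step one_lt_two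
  obtain ⟨D, hD0, hD⟩ := hE.id_mul_deriv.bounded
  have hEd : Differentiable ℝ E := hE.smooth.differentiable (by simp)
  refine ⟨D + D, by positivity, fun n y => E (((n : ℝ) + 1) * y) * (1 - E (y / ((n : ℝ) + 1))),
    fun n => ?_⟩
  have hn : 0 < (n : ℝ) + 1 := by positivity
  have hs := hE.smooth
  refine ⟨?_, fun y hy => ?_, fun y hy => ?_, fun y hy hy' => ?_, fun y => ?_, fun y => ?_⟩
  · exact (hs.comp (contDiff_const.mul contDiff_id)).mul
      (contDiff_const.sub (hs.comp (contDiff_id.div_const _)))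
  · dsimp only
    rw [hE0 (((n : ℝ) + 1) * y) (by rw [le_div_iff₀ hn] at hy; linarith), zero_mul]
  · dsimp only
    rw [hE1 (y / ((n : ℝ) + 1)) (by rw [le_div_iff₀ hn]; exact hy), sub_self, mul_zero]
  · dsimp only
    rw [hE1 (((n : ℝ) + 1) * y) (by rw [div_le_iff₀ hn] at hy; linarith),
      hE0 (y / ((n : ℝ) + 1)) (by rw [div_le_one hn]; exact hy')]
    simp
  · rw [abs_mul, abs_of_nonneg (hEp _), abs_of_nonneg (by linarith [hEl (y / ((n : ℝ) + 1))])]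
    exact mul_le_one₀ (hEl _) (by linarith [hEl (y / ((n : ℝ) + 1))])
      (by linarith [hEp (y / ((n : ℝ) + 1))])
  · have h1 : HasDerivAt (fun y => E (((n : ℝ) + 1) * y))
        (deriv E (((n : ℝ) + 1) * y) * ((n : ℝ) + 1)) y := by
      have := (hasDerivAt_id y).const_mul ((n : ℝ) + 1)
      rw [mul_one] at this
      exact (hEd _).hasDerivAt.comp y this
    have h2 : HasDerivAt (fun y => 1 - E (y / ((n : ℝ) + 1)))
        (-(deriv E (y / ((n : ℝ) + 1)) * (1 / ((n : ℝ) + 1)))) y := by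
      have := (hasDerivAt_id y).div_const ((n : ℝ) + 1)
      exact ((hEd _).hasDerivAt.comp y this).const_sub 1
    have h3 := (h1.mul h2).deriv
    rw [show (fun y => E (((n : ℝ) + 1) * y)) * (fun y => 1 - E (y / ((n : ℝ) + 1))) =
      fun y => E (((n : ℝ) + 1) * y) * (1 - E (y / ((n : ℝ) + 1))) from rfl] at h3
    dsimp only
    rw [h3]
    have e : y * (deriv E (((n : ℝ) + 1) * y) * ((n : ℝ) + 1) * (1 - E (y / ((n : ℝ) + 1))) +
        E (((n : ℝ) + 1) * y) * -(deriv E (y / ((n : ℝ) + 1)) * (1 / ((n : ℝ) + 1)))) =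
      (((n : ℝ) + 1) * y * deriv E (((n : ℝ) + 1) * y)) * (1 - E (y / ((n : ℝ) + 1))) +
        -(E (((n : ℝ) + 1) * y) * (y / ((n : ℝ) + 1) * deriv E (y / ((n : ℝ) + 1)))) := by ring
    rw [e]
    refine (abs_add_le _ _).trans (add_le_add ?_ ?_)
    · rw [abs_mul]
      refine (mul_le_of_le_one_right (abs_nonneg _) ?_).trans (hD _)
      rw [abs_of_nonneg (by linarith [hEl (y / ((n : ℝ) + 1))])]
      linarith [hEp (y / ((n : ℝ) + 1))]
    · rw [abs_neg, abs_mul]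
      refine (mul_le_of_le_one_left (abs_nonneg _) ?_).trans (hD _)
      rw [abs_of_nonneg (hEp _)]
      exact hEl _

/-- A weak bound for the derivative of `N(|f|, |x|) f` in the exterior region. The chain rule is
applied to truncations, whose derivative bounds are uniform, and the truncation is removed on the
side where no derivative of `N` appears. -/
theorem exists_norm_integral_nonlinearity_le : ∃ D : ℝ, 0 ≤ D ∧ ∀ {N : ℝ × ℝ → ℂ} {ρ₀ σ a b : ℝ},
    0 ≤ ρ₀ → ρ₀ < σ → 0 ≤ a → 0 ≤ b → ContDiffOn ℝ 1 N (Ioi 0 ×ˢ Ioi ρ₀) →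
    ∀ {e : E3}, ‖e‖ = 1 → ∀ {f g : L2}, HasGrad e f g →
    (∀ᵐ x, σ ≤ ‖x‖ → ‖N (‖f x‖, ‖x‖)‖ ≤ a ∧
      ‖f x‖ * ‖deriv (fun s => N (s, ‖x‖)) ‖f x‖‖ + ‖deriv (fun r => N (‖f x‖, r)) ‖x‖‖ ≤ b) →
    ∀ η : 𝓢(E3, ℂ), HasCompactSupport η → (∀ x, η x ≠ 0 → σ ≤ ‖x‖) →
    ‖∫ x, N (‖f x‖, ‖x‖) * f x * (∂_{e} η) x‖ ≤
      (((D + 1) * a + b) * ‖g‖ + b * ‖f‖) * ‖(η.toLp 2 volume : L2)‖ := by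
  obtain ⟨D, hD0, l, hl⟩ := exists_truncations
  refine ⟨D, hD0, fun {N ρ₀ σ a b} hρ0 hρσ ha hb hN {e} he {f g} hfg hae η hηc hησ => ?_⟩
  choose hls hl0 hlB hl1 hlle hlD using hl
  obtain ⟨R, hR⟩ : ∃ R : ℝ, ∀ x ∈ tsupport η, ‖x‖ ≤ R := by
    obtain ⟨R, hR⟩ := hηc.isCompact.isBounded.subset_closedBall 0
    exact ⟨R, fun x hx => mem_closedBall_zero_iff.1 (hR hx)⟩
  have hσ : ∀ x ∈ tsupport η, σ ≤ ‖x‖ := fun x hx =>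
    closure_minimal (s := Function.support η) (t := {x : E3 | σ ≤ ‖x‖}) (fun x hx => hησ x hx)
      (isClosed_le continuous_const continuous_norm) hx
  -- The radial truncation rises between `ρ₁` and `ρ₂`, strictly inside the region of smoothness and
  -- strictly below the support of `η`. It is therefore locally constant there and contributes no
  -- derivative.
  obtain ⟨ρ₂, h02, h2σ⟩ := exists_between hρσ
  obtain ⟨ρ₁, h01, h12⟩ := exists_between h02
  obtain ⟨E₁, hE₁, hE₁0, hE₁1, -, -⟩ := exists_step h12
  obtain ⟨E₂, hE₂, hE₂0, hE₂1, -, -⟩ := exists_step (lt_add_one (R + 1))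
  set κ : ℝ → ℝ := fun r => E₁ r * (1 - E₂ r) with hκ
  have hκs : ContDiff ℝ ∞ κ := hE₁.smooth.mul (contDiff_const.sub hE₂.smooth)
  have hκ0 : ∀ r ≤ ρ₁, κ r = 0 := fun r hr => by simp only [hκ, hE₁0 r hr, zero_mul]
  have hκR : ∀ r, R + 1 + 1 ≤ r → κ r = 0 := fun r hr => by
    simp only [hκ, hE₂1 r hr, sub_self, mul_zero]
  have hκ1 : ∀ x ∈ tsupport η, κ =ᶠ[𝓝 ‖x‖] fun _ => 1 := fun x hx => by
    filter_upwards [lt_mem_nhds (h2σ.trans_le (hσ x hx)),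
      gt_mem_nhds ((hR x hx).trans_lt (lt_add_one R))] with r h1 h2
    simp only [hκ, hE₁1 r h1.le, hE₂0 r h2.le, sub_zero, mul_one]
  have hsup : ∀ x, (∂_{e} η) x ≠ 0 → x ∈ tsupport η := fun x hx => by
    by_contra h
    apply hx
    rw [SchwartzMap.lineDerivOp_apply_eq_fderiv]
    have : fderiv ℝ η x = 0 := image_eq_zero_of_notMem_tsupport
      (fun h' => h (tsupport_fderiv_subset ℝ h'))
    rw [this]; rfl
  have hpos : ∀ n : ℕ, 0 < 1 / ((n : ℝ) + 1) := fun n => by positivity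
  have hK : ∀ n, ContDiff ℝ 1 (truncNL N κ (l n)) := fun n =>
    contDiff_truncNL hN h01 hκs hκ0 (hls n) (hpos n) (hl0 n)
  have hKc : ∀ n, HasCompactSupport (truncNL N κ (l n)) := fun n =>
    hasCompactSupport_truncNL hκ0 hκR (hlB n)
  have hmf : AEStronglyMeasurable f volume := Lp.aestronglyMeasurable f
  have main : ∀ n, ‖∫ x, truncNL N κ (l n) (f x, ‖x‖) * (∂_{e} η) x‖ ≤
      (((D + 1) * a + b) * ‖g‖ + b * ‖f‖) * ‖(η.toLp 2 volume : L2)‖ := by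
    intro n
    obtain ⟨B₁, hB₁⟩ := (hKc n).exists_bound_of_continuous (hK n).continuous
    obtain ⟨B₂, hB₂⟩ := ((hKc n).fderiv ℝ).exists_bound_of_continuous
      ((hK n).continuous_fderiv (by simp))
    rw [hfg.integral_chain (hK n) (B := max B₁ B₂) (fun p => (hB₁ p).trans (le_max_left _ _))
      (fun p => (hB₂ p).trans (le_max_right _ _)) (hρ0.trans_lt h01)
      (fun z r hr => by rw [truncNL, hκ0 _ hr.le]; simp) he, norm_neg]
    have hint := ((integrable_coe_mul_schwartz g η).const_mul ((D + 1) * a + b)).add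
      ((integrable_coe_mul_schwartz f η).const_mul b)
    refine (norm_integral_le_of_norm_le hint ?_).trans ?_
    · filter_upwards [hae] with x hx
      by_cases h : η x = 0
      · rw [h, mul_zero, norm_zero]
        simp only [Pi.add_apply, h, norm_zero, mul_zero, add_zero, le_refl]
      · have hx' : x ∈ tsupport η := subset_tsupport _ h
        obtain ⟨h1, h2⟩ := hx (hσ x hx')
        have := norm_fderiv_truncNL_le hN h01 hκs hκ0 (hls n) (hpos n) (hl0 n) (hlle n) (hlD n)
          (hρσ.trans_le (hσ x hx')) (hκ1 x hx') (g x) (abs_normDeriv_le he x) h1 h2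
        rw [norm_mul]
        refine (mul_le_mul_of_nonneg_right this (norm_nonneg _)).trans (le_of_eq ?_)
        simp only [Pi.add_apply]; ring
    · simp only [Pi.add_apply]
      rw [integral_add ((integrable_coe_mul_schwartz g η).const_mul _)
        ((integrable_coe_mul_schwartz f η).const_mul _), integral_const_mul, integral_const_mul]
      have i1 := mul_le_mul_of_nonneg_left (integral_coe_mul_schwartz_le g η)
        (show 0 ≤ (D + 1) * a + b by positivity)
      have i2 := mul_le_mul_of_nonneg_left (integral_coe_mul_schwartz_le f η) hb
      linarith
  refine le_of_tendsto' (x := atTop) (Tendsto.norm ?_) main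
  refine tendsto_integral_of_dominated_convergence (fun x => a * (‖f x‖ * ‖(∂_{e} η) x‖))
    (fun n => ?_) ((integrable_coe_mul_schwartz f (∂_{e} η)).const_mul a) (fun n => ?_) ?_
  · exact ((hK n).continuous.comp_aestronglyMeasurable
      (hmf.prodMk continuous_norm.aestronglyMeasurable)).mul
      (∂_{e} η).continuous.aestronglyMeasurable
  · filter_upwards [hae] with x hx
    by_cases h : (∂_{e} η) x = 0
    · rw [h, mul_zero, norm_zero, mul_zero, mul_zero]
    · have hx' := hsup x h
      obtain ⟨h1, -⟩ := hx (hσ x hx')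
      rw [truncNL, (hκ1 x hx').self_of_nhds, Complex.ofReal_one, one_mul, norm_mul, norm_mul, norm_mul,
        Complex.norm_real, Real.norm_eq_abs, mul_assoc]
      refine mul_le_mul_of_nonneg_right ?_ (by positivity)
      calc |l n ‖f x‖| * ‖N (‖f x‖, ‖x‖)‖ ≤ 1 * a :=
            mul_le_mul (hlle n _) h1 (norm_nonneg _) zero_le_one
        _ = a := one_mul a
  · refine Eventually.of_forall fun x => ?_
    by_cases h : (∂_{e} η) x = 0
    · simp only [h, mul_zero]; exact tendsto_const_nhds
    rcases eq_or_ne (f x) 0 with hf | hf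
    · simp only [truncNL, hf, mul_zero, zero_mul]; exact tendsto_const_nhds
    have hf' : 0 < ‖f x‖ := norm_pos_iff.2 hf
    have hx' := hsup x h
    refine tendsto_const_nhds.congr' ?_
    obtain ⟨n₁, hn₁⟩ := exists_nat_ge ‖f x‖
    obtain ⟨n₂, hn₂⟩ := exists_nat_ge (2 / ‖f x‖)
    filter_upwards [eventually_ge_atTop (max n₁ n₂)] with n hn
    have q1 : (n₁ : ℝ) ≤ n := by exact_mod_cast (le_max_left _ _).trans hn
    have q2 : (n₂ : ℝ) ≤ n := by exact_mod_cast (le_max_right _ _).trans hn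
    rw [truncNL, (hκ1 x hx').self_of_nhds, Complex.ofReal_one, one_mul]
    simp only
    rw [hl1 n ‖f x‖ ?_ (by linarith), Complex.ofReal_one, one_mul]
    rw [div_le_iff₀ (by positivity), mul_comm, ← div_le_iff₀ hf']
    linarith

/-! ### Test functions -/

/-- The decay hypotheses hold for every characteristic function; one that reaches the value one
already at `b` converts them into plain bounds on `‖x‖ ≥ b t^α`, for each `b > 1/2`. -/
theorem exists_smoothCharFun {b : ℝ} (hb : 1 / 2 < b) (hb1 : b ≤ 1) :
    ∃ G : SmoothCharFun, ∀ y, b ≤ y → G y = 1 := by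
  have h0 : 0 < b - 1 / 2 := sub_pos.2 hb
  have h1 : ∀ y, b ≤ y → Real.smoothTransition ((y - 1 / 2) / (b - 1 / 2)) = 1 := fun y hy =>
    Real.smoothTransition.one_of_one_le (by rw [one_le_div h0]; linarith)
  exact ⟨⟨fun y => Real.smoothTransition ((y - 1 / 2) / (b - 1 / 2)),
    Real.smoothTransition.contDiff.comp ((contDiff_id.sub contDiff_const).div_const _),
    fun x y h => Real.smoothTransition.monotone (by gcongr),
    fun y hy => Real.smoothTransition.zero_of_nonpos
      (div_nonpos_of_nonpos_of_nonneg (by linarith) h0.le), fun y hy => h1 y (hb1.trans hy)⟩, h1⟩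

theorem inner_toLp (η : 𝓢(E3, ℂ)) (f : L2) :
    ⟪(η.toLp 2 volume : L2), f⟫_ℂ = ∫ x, f x * conj (η x) := by
  rw [L2_inner_def]
  refine integral_congr_ae ?_
  filter_upwards [η.coeFn_toLp 2 volume] with x hx
  rw [hx, mul_comm]

/-- The complex conjugate of a Schwartz function. -/
def conjS (η : 𝓢(E3, ℂ)) : 𝓢(E3, ℂ) :=
  SchwartzMap.postcompCLM (𝕜 := ℝ) (Complex.conjCLE : ℂ →L[ℝ] ℂ) η

theorem conjS_apply (η : 𝓢(E3, ℂ)) (x : E3) : conjS η x = conj (η x) := rfl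

theorem laplacian_conj (η : 𝓢(E3, ℂ)) (x : E3) :
    Laplacian.laplacian (fun x => conj (η x)) x = conj ((Δ η) x) := by
  rw [SchwartzMap.laplacian_apply]
  exact ((η.smooth 2).contDiffAt).laplacian_CLM_comp_left (l := (Complex.conjCLE : ℂ →L[ℝ] ℂ))

theorem lineDeriv_conjS (e : E3) (η : 𝓢(E3, ℂ)) (x : E3) :
    (∂_{e} (conjS η)) x = conj ((∂_{e} η) x) := by
  rw [SchwartzMap.lineDerivOp_apply_eq_fderiv, SchwartzMap.lineDerivOp_apply_eq_fderiv]
  have h : HasFDerivAt (conjS η) ((Complex.conjCLE : ℂ →L[ℝ] ℂ) ∘L fderiv ℝ η x) x :=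
    (Complex.conjCLE : ℂ →L[ℝ] ℂ).hasFDerivAt.comp x η.differentiableAt.hasFDerivAt
  rw [h.fderiv]
  rfl

theorem norm_toLp_conjS (η : 𝓢(E3, ℂ)) :
    ‖((conjS η).toLp 2 volume : L2)‖ = ‖(η.toLp 2 volume : L2)‖ := by
  rw [Lp.norm_def, Lp.norm_def]
  congr 1
  refine eLpNorm_congr_norm_ae ?_
  filter_upwards [η.coeFn_toLp 2 volume, (conjS η).coeFn_toLp 2 volume] with x h1 h2
  rw [h1, h2, conjS_apply, RCLike.norm_conj]

theorem lineDeriv_comm (a e : E3) (η : 𝓢(E3, ℂ)) : ∂_{a} (∂_{e} η) = ∂_{e} (∂_{a} η) := by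
  have h0 : ∀ a : E3, (fun ξ : E3 => inner ℝ ξ a).HasTemperateGrowth := fun a => by fun_prop
  have h1 : ∀ a : E3, (fun ξ : E3 => ((inner ℝ ξ a : ℝ) : ℂ)).HasTemperateGrowth := fun a =>
    (Function.Complex.hasTemperateGrowth_ofReal).comp (h0 a)
  have h2 : ∀ (a : E3) (y : 𝓢(E3, ℂ)), ∂_{a} y = (2 * Real.pi * Complex.I) •
      SchwartzMap.fourierMultiplierCLM ℂ (fun ξ : E3 => ((inner ℝ ξ a : ℝ) : ℂ)) y := fun a y => by
    rw [SchwartzMap.lineDeriv_eq_fourierMultiplierCLM, ← SchwartzMap.fourierMultiplierCLM_ofReal ℂ (h0 a)]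
    rfl
  rw [h2 a, h2 e, h2 e, h2 a, map_smul, map_smul,
    SchwartzMap.fourierMultiplierCLM_fourierMultiplierCLM_apply (h1 a) (h1 e),
    SchwartzMap.fourierMultiplierCLM_fourierMultiplierCLM_apply (h1 e) (h1 a),
    mul_comm (fun ξ : E3 => ((inner ℝ ξ a : ℝ) : ℂ))]

theorem laplacian_lineDeriv (e : E3) (η : 𝓢(E3, ℂ)) : Δ (∂_{e} η) = ∂_{e} (Δ η) := by
  set b := stdOrthonormalBasis ℝ E3
  rw [SchwartzMap.laplacian_eq_sum b, SchwartzMap.laplacian_eq_sum b, LineDeriv.lineDerivOp_sum]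
  refine Finset.sum_congr rfl fun i _ => ?_
  rw [lineDeriv_comm (b i) e, lineDeriv_comm (b i) e]

/-- Cutting off a test function at infinity. -/
theorem tendsto_toLp_cut {γ : ℝ → ℝ} (hγ : StepLike γ) (h1 : γ 0 = 1) {e : E3} (he : ‖e‖ = 1)
    (y : 𝓢(E3, ℂ)) :
    Tendsto (fun n : ℕ => ((SchwartzMap.smulLeftCLM ℂ (cut e (n + 1) γ) y).toLp 2 volume : L2)) atTop
      (𝓝 (y.toLp 2 volume)) ∧
    Tendsto (fun n : ℕ => ((Δ (SchwartzMap.smulLeftCLM ℂ (cut e (n + 1) γ) y)).toLp 2 volume : L2))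
      atTop (𝓝 ((Δ y).toLp 2 volume)) := by
  have key : ∀ f : L2, Tendsto (fun n : ℕ => mulOp (cut e (n + 1) γ) f) atTop (𝓝 f) := fun f => by
    obtain ⟨C, -, hC⟩ := hγ.bounded
    have hb : ∀ R x, ‖cut e R γ x‖ ≤ C := fun R x => by rw [cut, Complex.norm_real]; exact hC _
    have h2 := tendsto_mulOp (l := atTop) (q := fun n : ℕ => cut e (n + 1) γ) (p := fun _ => 1) (C := C)
      (Eventually.of_forall fun n => (hγ.isBdd e _).1) measurable_const
      (Eventually.of_forall fun n x => hb _ x) (fun x => ?_) (fun x => ?_) f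
    · rwa [mulOp_const, one_smul] at h2
    · have := hC 0
      rw [h1] at this
      simpa using this
    · have h3 : Tendsto (fun n : ℕ => inner ℝ e x / ((n : ℝ) + 1)) atTop (𝓝 0) := by
        have := tendsto_one_div_add_atTop_nhds_zero_nat (𝕜 := ℝ).const_mul (inner ℝ e x)
        simpa [div_eq_mul_inv] using this
      have h4 := (hγ.smooth.continuous.tendsto 0).comp h3
      rw [h1] at h4
      have h5 := (Complex.continuous_ofReal.tendsto 1).comp h4
      rwa [Complex.ofReal_one] at h5
  have small : ∀ {Q : ℝ → ℝ}, StepLike Q → ∀ (c : ℕ → ℝ), Tendsto c atTop (𝓝 0) → ∀ f : L2,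
      Tendsto (fun n : ℕ => ((c n : ℝ) : ℂ) • mulOp (cut e (n + 1) Q) f) atTop (𝓝 0) := by
    intro Q hQ c hc f
    obtain ⟨C, -, hC⟩ := hQ.norm_cut_le
    have h2 : Tendsto (fun n => |c n| * (C * ‖f‖)) atTop (𝓝 0) := by
      have := hc.abs.mul_const (C * ‖f‖)
      rwa [abs_zero, zero_mul] at this
    refine squeeze_zero_norm (fun n => ?_) h2
    rw [norm_smul, Complex.norm_real, Real.norm_eq_abs]
    exact mul_le_mul_of_nonneg_left (hC _ _ _) (abs_nonneg _)
  refine ⟨?_, ?_⟩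
  · simp_rw [toLp_smulLeftCLM (hγ.hasTemperateGrowth_cut _ _) (hγ.isBdd _ _)]
    exact key _
  · simp_rw [laplacian_smulLeftCLM_cut hγ he, SchwartzMap.toLp_add', SchwartzMap.toLp_smul',
      toLp_smulLeftCLM (hγ.hasTemperateGrowth_cut _ _) (hγ.isBdd _ _),
      toLp_smulLeftCLM (hγ.deriv.hasTemperateGrowth_cut _ _) (hγ.deriv.isBdd _ _),
      toLp_smulLeftCLM (hγ.deriv.deriv.hasTemperateGrowth_cut _ _) (hγ.deriv.deriv.isBdd _ _)]
    have c0 : Tendsto (fun n : ℕ => 1 / ((n : ℝ) + 1)) atTop (𝓝 0) :=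
      tendsto_one_div_add_atTop_nhds_zero_nat
    have c1 : Tendsto (fun n : ℕ => 2 / ((n : ℝ) + 1)) atTop (𝓝 0) := by
      have := c0.const_mul 2
      simpa [div_eq_mul_inv] using this
    have c2 : Tendsto (fun n : ℕ => 1 / ((n : ℝ) + 1) ^ 2) atTop (𝓝 0) := by
      have := c0.mul c0
      simpa [div_eq_mul_inv, sq] using this
    have := (key ((Δ y).toLp 2 volume)).add ((small hγ.deriv _ c1 ((∂_{e} y).toLp 2 volume)).add
      (small hγ.deriv.deriv _ c2 (y.toLp 2 volume)))
    rwa [add_zero, add_zero] at this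

theorem abs_le_of_cut_ne_zero {γ : ℝ → ℝ} {A : ℝ} (hγ : ∀ y, γ y ≠ 0 → |y| < A) {e : E3} {R : ℝ}
    (hR : 0 < R) {x : E3} (h : cut e R γ x ≠ 0) : |inner ℝ e x| ≤ A * R := by
  have h1 := hγ (inner ℝ e x / R) (fun h' => h (by rw [cut, h', Complex.ofReal_zero]))
  rw [abs_div, abs_of_pos hR, div_lt_iff₀ hR] at h1
  exact h1.le

/-- A property of test functions which is stable under limits of `(η, Δη)` in `L²` only needs to be
checked for test functions of compact support. -/
theorem schwartz_induction {P : 𝓢(E3, ℂ) → Prop} {S : Set E3}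
    (hc : ∀ (η : ℕ → 𝓢(E3, ℂ)) (y : 𝓢(E3, ℂ)), (∀ n, P (η n)) →
      Tendsto (fun n => ((η n).toLp 2 volume : L2)) atTop (𝓝 (y.toLp 2 volume)) →
      Tendsto (fun n => ((Δ (η n)).toLp 2 volume : L2)) atTop (𝓝 ((Δ y).toLp 2 volume)) → P y)
    (hP : ∀ η : 𝓢(E3, ℂ), HasCompactSupport η → (∀ x, η x ≠ 0 → x ∈ S) → P η) (η : 𝓢(E3, ℂ))
    (hη : ∀ x, η x ≠ 0 → x ∈ S) : P η := by
  obtain ⟨γ, hγ, hγc, hγs, hγ1⟩ := exists_bump (show (-1 : ℝ) < 1 by norm_num)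
  rw [show ((-1 : ℝ) + 1) / 2 = 0 by norm_num] at hγ1
  have hS : StepLike γ := StepLike.of_compact hγ hγc
  have hγ' : ∀ y, γ y ≠ 0 → |y| < 1 := fun y hy => abs_lt.2 (hγs y hy)
  have happ : ∀ (e : E3) (R : ℝ) (y : 𝓢(E3, ℂ)) x,
      SchwartzMap.smulLeftCLM ℂ (cut e R γ) y x = cut e R γ x * y x := fun e R y x => by
    rw [SchwartzMap.smulLeftCLM_apply_apply (hS.hasTemperateGrowth_cut e R), smul_eq_mul]
  have step : ∀ e : E3, ‖e‖ = 1 → ∀ y : 𝓢(E3, ℂ),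
      (∀ n : ℕ, P (SchwartzMap.smulLeftCLM ℂ (cut e (n + 1) γ) y)) → P y := fun e he y h =>
    hc _ y h (tendsto_toLp_cut hS hγ1 he y).1 (tendsto_toLp_cut hS hγ1 he y).2
  -- One slab cutoff for each coordinate direction: the product of the three has bounded support,
  -- and each limit is of the one-directional kind already treated.
  refine step (bvec 0) (norm_bvec 0) _ fun n₀ => step (bvec 1) (norm_bvec 1) _ fun n₁ =>
    step (bvec 2) (norm_bvec 2) _ fun n₂ => hP _ ?_ fun x hx => ?_
  · set B : ℝ := ((n₀ : ℝ) + 1) + (n₁ + 1) + (n₂ + 1) with hB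
    refine HasCompactSupport.of_support_subset_isCompact (isCompact_closedBall (0 : E3) (3 * B))
      fun x hx => ?_
    rw [Function.mem_support, happ, happ, happ] at hx
    have hi : ∀ i, inner ℝ (bvec i) x = x i := fun i => by
      simp [bvec, EuclideanSpace.inner_single_left]
    have a2 := abs_le_of_cut_ne_zero hγ' (by positivity) (left_ne_zero_of_mul hx)
    have a1 := abs_le_of_cut_ne_zero hγ' (by positivity) (left_ne_zero_of_mul (right_ne_zero_of_mul hx))
    have a0 := abs_le_of_cut_ne_zero hγ' (by positivity)
      (left_ne_zero_of_mul (right_ne_zero_of_mul (right_ne_zero_of_mul hx)))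
    rw [hi, one_mul] at a0 a1 a2
    have b0 : (0 : ℝ) ≤ n₀ := by positivity
    have b1 : (0 : ℝ) ≤ n₁ := by positivity
    have b2 : (0 : ℝ) ≤ n₂ := by positivity
    have c0 : |x 0| ≤ B := by linarith
    have c1 : |x 1| ≤ B := by linarith
    have c2 : |x 2| ≤ B := by linarith
    have hBp : 0 ≤ B := by positivity
    rw [mem_closedBall_zero_iff, EuclideanSpace.norm_eq, Real.sqrt_le_left (by positivity),
      Fin.sum_univ_three]
    simp only [Real.norm_eq_abs]
    nlinarith [abs_nonneg (x 0), abs_nonneg (x 1), abs_nonneg (x 2)]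
  · rw [happ, happ, happ] at hx
    exact hη x (right_ne_zero_of_mul (right_ne_zero_of_mul (right_ne_zero_of_mul hx)))

/-! ### The solution and its gradient as exterior solutions -/

theorem norm_le_of_enorm_le {f : L2} {M : ℝ} (hM : 0 ≤ M) (h : ‖f‖ₑ ≤ ENNReal.ofReal M) : ‖f‖ ≤ M := by
  rwa [← ofReal_norm, ENNReal.ofReal_le_ofReal_iff hM] at h

theorem le_of_tendsto_test {d I : L2} {K : ℝ} {y d' : ℕ → L2} {y₀ d₀ : L2}
    (h : ∀ n, ‖⟪y n, d⟫_ℂ - Complex.I * ⟪d' n, I⟫_ℂ‖ ≤ K * ‖y n‖)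
    (h1 : Tendsto y atTop (𝓝 y₀)) (h2 : Tendsto d' atTop (𝓝 d₀)) :
    ‖⟪y₀, d⟫_ℂ - Complex.I * ⟪d₀, I⟫_ℂ‖ ≤ K * ‖y₀‖ :=
  le_of_tendsto_of_tendsto' ((h1.inner tendsto_const_nhds).sub
    ((h2.inner tendsto_const_nhds).const_mul _)).norm (h1.norm.const_mul K) h

/-- It suffices to test the equation of an exterior solution against compactly supported functions. -/
theorem exterior_eqn_of_hasCompactSupport {v : ℝ → L2} {t t' : ℝ} (htt : t ≤ t')
    (hv : ContinuousOn v (Icc t t')) {S : Set E3} {K : ℝ}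
    (h : ∀ η : 𝓢(E3, ℂ), HasCompactSupport η → (∀ x, η x ≠ 0 → x ∈ S) →
      ‖⟪(η.toLp 2 volume : L2), v t' - v t⟫_ℂ -
        Complex.I * ∫ τ in t..t', ⟪((Δ η).toLp 2 volume : L2), v τ⟫_ℂ‖ ≤
        K * ‖(η.toLp 2 volume : L2)‖) (η : 𝓢(E3, ℂ)) (hη : ∀ x, η x ≠ 0 → x ∈ S) :
    ‖⟪(η.toLp 2 volume : L2), v t' - v t⟫_ℂ -
      Complex.I * ∫ τ in t..t', ⟪((Δ η).toLp 2 volume : L2), v τ⟫_ℂ‖ ≤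
      K * ‖(η.toLp 2 volume : L2)‖ := by
  have hi : IntervalIntegrable v volume t t' := by
    refine ContinuousOn.intervalIntegrable ?_
    rwa [uIcc_of_le htt]
  obtain ⟨J, hJ⟩ : ∃ J : L2, ∀ u : L2, ∫ τ in t..t', ⟪u, v τ⟫_ℂ = ⟪u, J⟫_ℂ := by
    refine ⟨∫ τ in t..t', v τ, fun u => ?_⟩
    rw [intervalIntegral.integral_of_le htt, intervalIntegral.integral_of_le htt]
    exact integral_inner hi.1 u
  have main : ∀ Q : 𝓢(E3, ℂ) → Prop, (∀ η, Q η ↔ ‖⟪(η.toLp 2 volume : L2), v t' - v t⟫_ℂ -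
      Complex.I * ⟪((Δ η).toLp 2 volume : L2), J⟫_ℂ‖ ≤ K * ‖(η.toLp 2 volume : L2)‖) → Q η := by
    intro Q hQ
    refine schwartz_induction (P := Q) (S := S) (fun η y hP h1 h2 => ?_) (fun η hc hs => ?_) η hη
    · exact (hQ y).2 (le_of_tendsto_test (fun n => (hQ (η n)).1 (hP n)) h1 h2)
    · rw [hQ, ← hJ]
      exact h η hc hs
  rw [hJ]
  exact main _ fun _ => Iff.rfl

section Solution

variable {N : ℝ → ℝ → ℝ → ℂ} {φ₀ : L2} {φ : ℝ → L2}

theorem IsGlobalRadialSolution.continuousOn (hφ : IsGlobalRadialSolution N φ₀ φ) :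
    ContinuousOn φ (Ici 0) := fun t ht => by
  rw [ContinuousWithinAt, tendsto_iff_edist_tendsto_0]
  refine tendsto_of_tendsto_of_tendsto_of_le_of_le tendsto_const_nhds (hφ.continuous t ht)
    (fun _ => bot_le) fun s => ?_
  rw [edist_eq_enorm_sub]
  exact enorm_le_h1Norm _

theorem IsGlobalRadialSolution.eqn (hφ : IsGlobalRadialSolution N φ₀ φ) {η : 𝓢(E3, ℂ)}
    (hη : HasCompactSupport η) {t t' : ℝ} (ht : 0 ≤ t) (ht' : 0 ≤ t') :
    ⟪(η.toLp 2 volume : L2), φ t' - φ t⟫_ℂ -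
      Complex.I * ∫ τ in t..t', ⟪((Δ η).toLp 2 volume : L2), φ τ⟫_ℂ =
      -(Complex.I * ∫ τ in t..t', ∫ x, interaction N φ τ x * conj (η x)) := by
  have hs : ContDiff ℝ ∞ fun x => conj (η x) := (conjS η).smooth ⊤
  have hc : HasCompactSupport fun x => conj (η x) := hη.comp_left (g := conj) (map_zero _)
  have hint := hφ.integrable _ hs hc
  have heq := hφ.equation _ hs hc
  simp_rw [laplacian_conj, ← inner_toLp] at heq
  have hLi : ∀ t, 0 ≤ t → IntervalIntegrable (fun τ => ⟪((Δ η).toLp 2 volume : L2), φ τ⟫_ℂ)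
      volume 0 t := fun t ht => by
    refine ContinuousOn.intervalIntegrable ?_
    rw [uIcc_of_le ht]
    exact continuousOn_const.inner (hφ.continuousOn.mono fun x hx => hx.1)
  have h1 := heq t ht
  have h2 := heq t' ht'
  rw [← intervalIntegral.integral_interval_sub_left (hLi t' ht') (hLi t ht),
    ← intervalIntegral.integral_interval_sub_left (hint t' ht') (hint t ht), inner_sub_right]
  linear_combination h2 - h1

theorem IsGlobalRadialSolution.norm_le {M : ℝ} (hM : 0 ≤ M)
    (hb : ∀ t, 0 ≤ t → h1Norm (φ t) ≤ ENNReal.ofReal M) {t : ℝ} (ht : 0 ≤ t) : ‖φ t‖ ≤ M :=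
  norm_le_of_enorm_le hM ((enorm_le_h1Norm _).trans (hb t ht))

theorem GlobalH1Bound.exists_nonneg (h : GlobalH1Bound φ) :
    ∃ M : ℝ, 0 ≤ M ∧ ∀ t, 0 ≤ t → h1Norm (φ t) ≤ ENNReal.ofReal M := by
  obtain ⟨M, hM⟩ := h
  exact ⟨max M 0, le_max_right _ _, fun t ht =>
    (hM t ht).trans (ENNReal.ofReal_le_ofReal (le_max_left _ _))⟩

theorem exterior_le {α s b t t' : ℝ} (hα : 0 < α) (hs : 1 / 2 < s) (hb : b ≤ s) {x : E3} (ht : 1 ≤ t)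
    (htt : t ≤ t') (hx : s * t' ^ α ≤ ‖x‖) : b * t ^ α ≤ ‖x‖ := by
  have h1 : t ^ α ≤ t' ^ α := Real.rpow_le_rpow (by linarith) htt hα.le
  have h2 : 0 ≤ t ^ α := Real.rpow_nonneg (by linarith) _
  calc b * t ^ α ≤ s * t ^ α := mul_le_mul_of_nonneg_right hb h2
    _ ≤ s * t' ^ α := mul_le_mul_of_nonneg_left h1 (by linarith)
    _ ≤ ‖x‖ := hx

theorem ExteriorDecay.exists_bound {α : ℝ} (h : ExteriorDecay N φ α) {b : ℝ} (hb : 1 / 2 < b) (hb1 : b ≤ 1) :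
    ∃ β C T : ℝ, 1 < β ∧ 0 ≤ C ∧ 1 ≤ T ∧ ∀ t, T ≤ t → ∀ᵐ x : E3, b * t ^ α ≤ ‖x‖ →
      ‖N ‖φ t x‖ ‖x‖ t‖ ≤ C * t ^ (-β) := by
  obtain ⟨G, hG⟩ := exists_smoothCharFun hb hb1
  obtain ⟨β, hβ, C, T, hT, H⟩ := h G
  refine ⟨β, max C 0, T, hβ, le_max_right _ _, hT, fun t ht => ?_⟩
  have ht0 : 0 < t := by linarith
  filter_upwards [H t ht] with x hx hxb
  rw [hG _ (by rwa [le_div_iff₀ (Real.rpow_pos_of_pos ht0 α)]), abs_one, one_mul] at hx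
  exact hx.trans (mul_le_mul_of_nonneg_right (le_max_left _ _) (Real.rpow_nonneg ht0.le _))

theorem ExteriorRegularity.exists_bound {α : ℝ} (h : ExteriorRegularity N φ α) {b : ℝ} (hb : 1 / 2 < b)
    (hb1 : b ≤ 1) : ∃ β C T : ℝ, 1 < β ∧ 0 ≤ C ∧ 1 ≤ T ∧ ∀ t, T ≤ t → ∀ᵐ x : E3, b * t ^ α ≤ ‖x‖ →
      ‖φ t x‖ * ‖deriv (fun s => N s ‖x‖ t) ‖φ t x‖‖ + ‖deriv (fun r => N ‖φ t x‖ r t) ‖x‖‖ ≤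
        C * t ^ (-β) := by
  obtain ⟨G, hG⟩ := exists_smoothCharFun hb hb1
  obtain ⟨β, hβ, C, T, hT, H⟩ := h.2 G
  refine ⟨β, max C 0, T, hβ, le_max_right _ _, hT, fun t ht => ?_⟩
  have ht0 : 0 < t := by linarith
  filter_upwards [H t ht] with x hx hxb
  rw [hG _ (by rwa [le_div_iff₀ (Real.rpow_pos_of_pos ht0 α)]), abs_one, one_mul] at hx
  exact hx.trans (mul_le_mul_of_nonneg_right (le_max_left _ _) (Real.rpow_nonneg ht0.le _))

/-- On the support of an admissible test function the interaction is `O(τ^{-β})` pointwise for all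
`τ` in `[t, t']`, so the source is bounded in `L²` by this decay times the norm of the solution. -/
theorem exteriorSolution_self {α : ℝ} (hα : 0 < α) (hφ : IsGlobalRadialSolution N φ₀ φ)
    (hbound : GlobalH1Bound φ) (hdecay : ExteriorDecay N φ α) : ExteriorSolution α φ := by
  intro s hs
  obtain ⟨M, hM0, hM⟩ := hbound.exists_nonneg
  obtain ⟨β, C, T, hβ, hC, hT, H⟩ := hdecay.exists_bound (lt_min hs (by norm_num : (1 : ℝ) / 2 < 1))
    (min_le_right s 1)
  refine ⟨M, C * M, β, T, hβ, hT, by positivity,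
    hφ.continuousOn.mono fun t ht => (by linarith : (0 : ℝ) ≤ T).trans ht, fun t ht =>
    IsGlobalRadialSolution.norm_le hM0 hM (by linarith), fun t t' ht htt η hη => ?_⟩
  refine exterior_eqn_of_hasCompactSupport htt (S := {x | s * t' ^ α ≤ ‖x‖})
    (hφ.continuousOn.mono fun z hz => (by linarith : (0 : ℝ) ≤ t).trans hz.1) (fun η hηc hη => ?_) η hη
  rw [hφ.eqn hηc (by linarith) (by linarith), norm_neg, norm_mul, Complex.norm_I, one_mul]
  have key : ∀ τ ∈ uIoc t t', ‖∫ x, interaction N φ τ x * conj (η x)‖ ≤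
      C * M * t ^ (-β) * ‖(η.toLp 2 volume : L2)‖ := by
    intro τ hτ
    rw [uIoc_of_le htt] at hτ
    have hτ0 : 0 < τ := by linarith [hτ.1]
    have hp : τ ^ (-β) ≤ t ^ (-β) :=
      Real.rpow_le_rpow_of_nonpos (by linarith) hτ.1.le (by linarith)
    have hp0 : 0 ≤ τ ^ (-β) := Real.rpow_nonneg hτ0.le _
    refine (norm_integral_le_of_norm_le ((integrable_coe_mul_schwartz (φ τ) η).const_mul (C * τ ^ (-β)))
      ?_).trans ?_
    · filter_upwards [H τ (by linarith [hτ.1])] with x hx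
      rw [interaction, norm_mul, norm_mul, RCLike.norm_conj]
      by_cases h : η x = 0
      · rw [h, norm_zero, mul_zero, mul_zero, mul_zero]
      · have := hx (exterior_le hα hs (min_le_left _ _) (by linarith [hτ.1]) hτ.2 (hη x h))
        rw [mul_assoc]
        exact mul_le_mul_of_nonneg_right this (by positivity)
    · rw [integral_const_mul]
      have h1 := integral_coe_mul_schwartz_le (φ τ) η
      have h2 : ‖φ τ‖ ≤ M := IsGlobalRadialSolution.norm_le hM0 hM hτ0.le
      calc C * τ ^ (-β) * ∫ x, ‖φ τ x‖ * ‖η x‖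
          ≤ C * t ^ (-β) * (M * ‖(η.toLp 2 volume : L2)‖) := by
            refine mul_le_mul (mul_le_mul_of_nonneg_left hp hC) (h1.trans ?_)
              (integral_nonneg fun x => by positivity)
              (mul_nonneg hC (Real.rpow_nonneg (by linarith) _))
            exact mul_le_mul_of_nonneg_right h2 (norm_nonneg _)
        _ = _ := by ring
  refine (intervalIntegral.norm_integral_le_of_norm_le_const key).trans (le_of_eq ?_)
  rw [abs_of_nonneg (by linarith)]
  ring

/-- The equation is tested with `∂_e η` and the derivative is moved back onto the solution. What
remains is the interaction paired with `∂_e η`, and the weak chain rule bounds it by the `L²` norm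
of `η` itself. -/
theorem exteriorSolution_grad {α : ℝ} (hα : 0 < α) (hφ : IsGlobalRadialSolution N φ₀ φ)
    (hbound : GlobalH1Bound φ) (hdecay : ExteriorDecay N φ α) (hreg : ExteriorRegularity N φ α)
    {e : E3} (he : ‖e‖ = 1) {ψ : ℝ → L2} (hψ : ∀ t, 0 ≤ t → HasGrad e (φ t) (ψ t)) :
    ExteriorSolution α ψ := by
  intro s hs
  obtain ⟨M, hM0, hM⟩ := hbound.exists_nonneg
  have hb : 1 / 2 < min s 1 := lt_min hs (by norm_num)
  obtain ⟨β₁, C₁, T₁, hβ₁, hC₁, hT₁, H₁⟩ := hdecay.exists_bound hb (min_le_right s 1)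
  obtain ⟨β₂, C₂, T₂, hβ₂, hC₂, hT₂, H₂⟩ := hreg.exists_bound hb (min_le_right s 1)
  obtain ⟨T₃, hT₃, H₃⟩ := hreg.1
  obtain ⟨D, hD, HD⟩ := exists_norm_integral_nonlinearity_le
  set β := min β₁ β₂
  have hβ : 1 < β := lt_min hβ₁ hβ₂
  set T := max T₁ (max T₂ T₃)
  have hT : 1 ≤ T := hT₁.trans (le_max_left _ _)
  have hψc : ContinuousOn ψ (Ici 0) := fun t ht => by
    rw [ContinuousWithinAt, tendsto_iff_edist_tendsto_0]
    refine tendsto_of_tendsto_of_tendsto_of_le_of_le' tendsto_const_nhds (hφ.continuous t ht)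
      (Eventually.of_forall fun _ => bot_le) ?_
    filter_upwards [self_mem_nhdsWithin] with s hs
    rw [edist_eq_enorm_sub]
    exact ((hψ s hs).sub (hψ t ht)).enorm_le he
  have hψM : ∀ t, 0 ≤ t → ‖ψ t‖ ≤ M := fun t ht =>
    norm_le_of_enorm_le hM0 (((hψ t ht).enorm_le he).trans (hM t ht))
  refine ⟨M, ((D + 1) * C₁ + 2 * C₂) * M, β, T, hβ, hT, by positivity,
    hψc.mono fun t ht => (by linarith : (0 : ℝ) ≤ T).trans ht, fun t ht => hψM t (by linarith),
    fun t t' ht htt η hη => ?_⟩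
  refine exterior_eqn_of_hasCompactSupport htt (S := {x | s * t' ^ α ≤ ‖x‖})
    (hψc.mono fun z hz => (by linarith : (0 : ℝ) ≤ t).trans hz.1) (fun η hηc hη => ?_) η hη
  have hηc' : HasCompactSupport (fun x => (∂_{e} η : 𝓢(E3, ℂ)) x) := by
    have := (hηc.fderiv (𝕜 := ℝ)).comp_left (g := fun L : E3 →L[ℝ] ℂ => L e) rfl
    refine this.mono' fun x hx => subset_tsupport _ ?_
    rwa [Function.mem_support, SchwartzMap.lineDerivOp_apply_eq_fderiv] at hx
  have hconj : HasCompactSupport (conjS η) := hηc.comp_left (g := conj) (map_zero _)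
  have heq := hφ.eqn (η := ∂_{e} η) hηc' (t := t) (t' := t') (by linarith) (by linarith)
  have e1 : ⟪((∂_{e} η).toLp 2 volume : L2), φ t' - φ t⟫_ℂ = -⟪(η.toLp 2 volume : L2), ψ t' - ψ t⟫_ℂ :=
    ((hψ t' (by linarith)).sub (hψ t (by linarith))).inner_eq η
  have e2 : ∫ τ in t..t', ⟪((Δ (∂_{e} η)).toLp 2 volume : L2), φ τ⟫_ℂ =
      -∫ τ in t..t', ⟪((Δ η).toLp 2 volume : L2), ψ τ⟫_ℂ := by
    rw [← intervalIntegral.integral_neg]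
    refine intervalIntegral.integral_congr fun τ hτ => ?_
    rw [uIcc_of_le htt] at hτ
    simp only [laplacian_lineDeriv]
    exact (hψ τ (by linarith [hτ.1])).inner_eq (Δ η)
  rw [e1, e2] at heq
  have e3 : ⟪(η.toLp 2 volume : L2), ψ t' - ψ t⟫_ℂ -
      Complex.I * ∫ τ in t..t', ⟪((Δ η).toLp 2 volume : L2), ψ τ⟫_ℂ =
      Complex.I * ∫ τ in t..t', ∫ x, interaction N φ τ x * conj ((∂_{e} η) x) := by
    linear_combination -heq
  rw [e3, norm_mul, Complex.norm_I, one_mul]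
  have key : ∀ τ ∈ uIoc t t', ‖∫ x, interaction N φ τ x * conj ((∂_{e} η) x)‖ ≤
      ((D + 1) * C₁ + 2 * C₂) * M * t ^ (-β) * ‖(η.toLp 2 volume : L2)‖ := by
    intro τ hτ
    rw [uIoc_of_le htt] at hτ
    have hτ1 : 1 ≤ τ := by linarith [hτ.1]
    have hτT : T ≤ τ := by linarith [hτ.1]
    have hp : ∀ β', β ≤ β' → τ ^ (-β') ≤ t ^ (-β) := fun β' h =>
      (Real.rpow_le_rpow_of_exponent_le hτ1 (neg_le_neg h)).trans
        (Real.rpow_le_rpow_of_nonpos (by linarith) hτ.1.le (by linarith))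
    have hτα : 0 < τ ^ α := Real.rpow_pos_of_pos (by linarith) _
    have ht0 : 0 ≤ t ^ (-β) := Real.rpow_nonneg (by linarith) _
    have hae : ∀ᵐ x, min s 1 * τ ^ α ≤ ‖x‖ → ‖N ‖φ τ x‖ ‖x‖ τ‖ ≤ C₁ * t ^ (-β) ∧
        ‖φ τ x‖ * ‖deriv (fun s => N s ‖x‖ τ) ‖φ τ x‖‖ + ‖deriv (fun r => N ‖φ τ x‖ r τ) ‖x‖‖ ≤
          C₂ * t ^ (-β) := by
      filter_upwards [H₁ τ ((le_max_left _ _).trans hτT),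
        H₂ τ (((le_max_left _ _).trans (le_max_right _ _)).trans hτT)] with x h1 h2 hx
      exact ⟨(h1 hx).trans (mul_le_mul_of_nonneg_left (hp _ (min_le_left _ _)) hC₁),
        (h2 hx).trans (mul_le_mul_of_nonneg_left (hp _ (min_le_right _ _)) hC₂)⟩
    have hlt : τ ^ α / 2 < min s 1 * τ ^ α := by
      have := mul_lt_mul_of_pos_right hb hτα
      linarith
    have := HD (N := fun p => N p.1 p.2 τ) (half_pos hτα).le hlt (by positivity) (by positivity)
      (H₃ τ (((le_max_right _ _).trans (le_max_right _ _)).trans hτT)) he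
      (hψ τ (by linarith)) hae (conjS η) hconj (fun x hx => exterior_le hα hs (min_le_left _ _) hτ1 hτ.2
        (hη x fun h => hx (by rw [conjS_apply, h, map_zero])))
    simp_rw [lineDeriv_conjS, norm_toLp_conjS] at this
    refine this.trans ?_
    have g1 := hψM τ (by linarith)
    have g2 : ‖φ τ‖ ≤ M := IsGlobalRadialSolution.norm_le hM0 hM (by linarith)
    calc _ ≤ (((D + 1) * (C₁ * t ^ (-β)) + C₂ * t ^ (-β)) * M + C₂ * t ^ (-β) * M) *
          ‖(η.toLp 2 volume : L2)‖ := by gcongr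
      _ = _ := by ring
  refine (intervalIntegral.norm_integral_le_of_norm_le_const key).trans (le_of_eq ?_)
  rw [abs_of_nonneg (by linarith)]
  ring

end Solution

/-! ### The channel wave operator -/

/-- The gradient of the channel state in the direction `e`. -/
def channelGrad (F : SmoothCharFun) (α : ℝ) (e : E3) (φ ψ : ℝ → L2) (t : ℝ) : L2 :=
  freeEvol (-t) (mulOp (radCut F (t ^ α)) (ψ t) +
    mulOp (fun x => fderiv ℝ (radCut F (t ^ α)) x e) (φ t))

theorem hasGrad_channelGrad (F : SmoothCharFun) {α : ℝ} {e : E3} (he : ‖e‖ = 1) {φ ψ : ℝ → L2} {t : ℝ}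
    (ht : 0 < t) (h : HasGrad e (φ t) (ψ t)) :
    HasGrad e (freeEvol (-t) (mulOp (radCut F (t ^ α)) (φ t))) (channelGrad F α e φ ψ t) := by
  obtain ⟨K, -, hK⟩ := exists_fderiv_radCut_bound F
  have hp := Real.rpow_pos_of_pos ht α
  exact (h.mul (hasTemperateGrowth_radCut F hp) (isBdd_radCut F _) (hK hp he).1).freeEvol _

theorem norm_radCut_le (F : SmoothCharFun) (R : ℝ) (x : E3) : ‖radCut F R x‖ ≤ 1 := by
  rw [radCut, Complex.norm_real, Real.norm_of_nonneg (F.mem_Icc _).1]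
  exact (F.mem_Icc _).2

theorem exists_norm_channelGrad_le (F : SmoothCharFun) : ∃ K : ℝ, 0 ≤ K ∧ ∀ {α : ℝ}, 0 < α →
    ∀ {e : E3}, ‖e‖ = 1 → ∀ {φ ψ : ℝ → L2} {M t : ℝ}, 1 ≤ t → ‖φ t‖ ≤ M → ‖ψ t‖ ≤ M →
    ‖channelGrad F α e φ ψ t‖ ≤ (1 + K) * M := by
  obtain ⟨K, hK0, hK⟩ := exists_fderiv_radCut_bound F
  refine ⟨K, hK0, fun {α} hα {e} he {φ ψ M t} ht h1 h2 => ?_⟩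
  have hp : 1 ≤ t ^ α := Real.one_le_rpow ht hα.le
  rw [channelGrad, norm_freeEvol]
  refine (norm_add_le _ _).trans ?_
  have g1 := norm_mulOp_le (isBdd_radCut F (t ^ α)) (norm_radCut_le F _) (ψ t)
  have g2 := norm_mulOp_le (hK (by linarith : 0 < t ^ α) he).1 (hK (by linarith : 0 < t ^ α) he).2 (φ t)
  have g3 : K / t ^ α * ‖φ t‖ ≤ K * M :=
    mul_le_mul (div_le_self hK0 hp) h1 (norm_nonneg _) hK0
  linarith

/-- The derivative may fall on the cutoff, which costs `O(t^{-α})` and vanishes in the limit, or on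
the solution, where the convergence theorem for exterior solutions applies to `ψ`. -/
theorem ExteriorSolution.exists_limit_channelGrad {α : ℝ} (hα : 1 / 2 < α) (hα1 : α < 1)
    (F : SmoothCharFun) {e : E3} (he : ‖e‖ = 1) {φ ψ : ℝ → L2} {M : ℝ} (hφ : ∀ t, 0 ≤ t → ‖φ t‖ ≤ M)
    (hψ : ExteriorSolution α ψ) : ∃ w, Tendsto (channelGrad F α e φ ψ) atTop (𝓝 w) := by
  obtain ⟨w, hw⟩ := hψ.exists_limit_radCut hα hα1 F
  obtain ⟨K, hK0, hK⟩ := exists_fderiv_radCut_bound F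
  refine ⟨w, ?_⟩
  have h1 : Tendsto (fun t => freeEvol (-t) (mulOp (fun x => fderiv ℝ (radCut F (t ^ α)) x e) (φ t)))
      atTop (𝓝 0) := by
    have h2 : Tendsto (fun t : ℝ => K * M * (t ^ α)⁻¹) atTop (𝓝 0) := by
      have := ((tendsto_rpow_atTop (by linarith : 0 < α)).inv_tendsto_atTop).const_mul (K * M)
      rwa [mul_zero] at this
    refine squeeze_zero_norm' ?_ h2
    filter_upwards [eventually_gt_atTop 0] with t ht
    have hp := Real.rpow_pos_of_pos ht α
    rw [norm_freeEvol]
    refine (norm_mulOp_le (hK hp he).1 (hK hp he).2 (φ t)).trans ?_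
    calc K / t ^ α * ‖φ t‖ ≤ K / t ^ α * M :=
          mul_le_mul_of_nonneg_left (hφ t ht.le) (by positivity)
      _ = _ := by rw [div_eq_mul_inv]; ring
  have h3 := hw.add h1
  rw [add_zero] at h3
  refine h3.congr fun t => ?_
  rw [channelGrad, freeEvol_add_map]

end

theorem mainTheorem2 (α₀ : ℝ) (hα₀ : α₀ ∈ Set.Ioo (1 / 2 : ℝ) 1)
    (F : SmoothCharFun) (ρ : SmoothedNorm) (N : ℝ → ℝ → ℝ → ℂ) (φ₀ : L2) (φ : ℝ → L2)
    (hφ₀ : IsAdmissibleDatum φ₀) (hφ : IsGlobalRadialSolution N φ₀ φ)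
    (hbound : GlobalH1Bound φ) (hdecay : ExteriorDecay N φ α₀) :
    ∃ Ω : L2, h1Norm Ω < ⊤ ∧
      Tendsto (fun t => channelState F ρ α₀ φ t) atTop (𝓝 Ω) ∧
      (ExteriorRegularity N φ α₀ →
        Tendsto (fun t => h1Norm (channelState F ρ α₀ φ t - Ω)) atTop (𝓝 0)) := by
  obtain ⟨hα, hα1⟩ := hα₀
  have hα0 : 0 < α₀ := by linarith
  obtain ⟨M, hM0, hM⟩ := hbound.exists_nonneg
  have hφM : ∀ t, 0 ≤ t → ‖φ t‖ ≤ M := fun t ht => IsGlobalRadialSolution.norm_le hM0 hM ht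
  obtain ⟨Ω, hΩ⟩ := (exteriorSolution_self hα0 hφ hbound hdecay).exists_limit_radCut hα hα1 F
  have hcs := eventually_channelState_eq F ρ hα0 φ
  have hlim : Tendsto (fun t => channelState F ρ α₀ φ t) atTop (𝓝 Ω) :=
    hΩ.congr' (hcs.mono fun t ht => ht.symm)
  -- The value `0` at negative times is a dummy that makes the choice of `ψ` total in `t`.
  have hgrad : ∀ (i : Fin 3) (t : ℝ), ∃ g, 0 ≤ t → HasGrad (bvec i) (φ t) g := fun i t => by
    by_cases ht : 0 ≤ t
    · obtain ⟨g, hg⟩ := exists_hasGrad (norm_bvec i) (hφ.memH1 t ht)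
      exact ⟨g, fun _ => hg⟩
    · exact ⟨0, fun h => absurd h ht⟩
  choose ψ hψ using hgrad
  have hψM : ∀ i t, 0 ≤ t → ‖ψ i t‖ ≤ M := fun i t ht =>
    norm_le_of_enorm_le hM0 (((hψ i t ht).enorm_le (norm_bvec i)).trans (hM t ht))
  have hG : ∀ i, ∀ᶠ t in atTop,
      HasGrad (bvec i) (channelState F ρ α₀ φ t) (channelGrad F α₀ (bvec i) φ (ψ i) t) := fun i => by
    filter_upwards [hcs, eventually_gt_atTop 0] with t h1 h2
    rw [h1]
    exact hasGrad_channelGrad F (norm_bvec i) h2 (hψ i t h2.le)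
  obtain ⟨K, hK0, hK⟩ := exists_norm_channelGrad_le F
  have hbd : ∀ᶠ t in atTop, h1Norm (channelState F ρ α₀ φ t) ≤
      ENNReal.ofReal M + ∑ _i : Fin 3, ENNReal.ofReal ((1 + K) * M) := by
    filter_upwards [hcs, eventually_ge_atTop 1, eventually_all.2 hG] with t h1 h2 h3
    refine (h1Norm_le h3).trans (add_le_add ?_ (Finset.sum_le_sum fun i _ => ?_))
    · rw [h1, ← ofReal_norm, norm_freeEvol]
      refine ENNReal.ofReal_le_ofReal ((norm_mulOp_le (isBdd_radCut F _) (norm_radCut_le F _) _).trans ?_)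
      rw [one_mul]
      exact hφM t (by linarith)
    · rw [← ofReal_norm]
      exact ENNReal.ofReal_le_ofReal
        (hK hα0 (norm_bvec i) h2 (hφM t (by linarith)) (hψM i t (by linarith)))
  refine ⟨Ω, ?_, hlim, fun hreg => ?_⟩
  -- The bound in `H¹` uses no regularity of the interaction, so the limit lies in `H¹` even without
  -- convergence of the gradients.
  · obtain ⟨T, hT⟩ := eventually_atTop.1 hbd
    refine (h1Norm_le_of_tendsto (f := fun n : ℕ => channelState F ρ α₀ φ (T + n))
      (hlim.comp (tendsto_atTop_add_const_left _ T tendsto_natCast_atTop_atTop))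
      fun n => hT _ (le_add_of_nonneg_right n.cast_nonneg)).trans_lt ?_
    exact ENNReal.add_lt_top.2 ⟨ENNReal.ofReal_lt_top,
      ENNReal.sum_lt_top.2 fun _ _ => ENNReal.ofReal_lt_top⟩
  -- The gradients of the channel states converge in `L²`, and closedness of `∂_e` identifies their
  -- limits with the gradient of `Ω`. The norm of the difference is then controlled by finitely many
  -- `L²` norms tending to zero.
  · have hw : ∀ i, ∃ w, Tendsto (channelGrad F α₀ (bvec i) φ (ψ i)) atTop (𝓝 w) := fun i =>
      (exteriorSolution_grad hα0 hφ hbound hdecay hreg (norm_bvec i)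
        (hψ i)).exists_limit_channelGrad hα hα1 F (norm_bvec i) hφM
    choose w hw using hw
    have hΩw : ∀ i, HasGrad (bvec i) Ω (w i) := fun i => HasGrad.of_tendsto (hG i) hlim (hw i)
    have hz : ∀ {u : ℝ → L2} {u₀ : L2}, Tendsto u atTop (𝓝 u₀) →
        Tendsto (fun t => ‖u t - u₀‖ₑ) atTop (𝓝 0) := fun h => by
      simp_rw [← edist_eq_enorm_sub]
      exact tendsto_iff_edist_tendsto_0.1 h
    have hsum : Tendsto (fun t => ‖channelState F ρ α₀ φ t - Ω‖ₑ +
        ∑ i, ‖channelGrad F α₀ (bvec i) φ (ψ i) t - w i‖ₑ) atTop (𝓝 0) := by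
      have := (hz hlim).add (tendsto_finsetSum Finset.univ fun i _ => hz (hw i))
      simpa using this
    refine tendsto_of_tendsto_of_tendsto_of_le_of_le' tendsto_const_nhds hsum
      (Eventually.of_forall fun _ => bot_le) ?_
    filter_upwards [eventually_all.2 hG] with t ht
    exact h1Norm_le fun i => (ht i).sub (hΩw i)
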